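/- **Conventions.** All categories are small and $\mathbb C$-linear. A $*$-structure is an antilinear involutive contravariant functor $f\mapsto f^*$ which is the identity on objects. A *C\*-category* is a category with a $*$-structure such that every $f^*f$ is of the form $g^*g$ with $g$ an endomorphism and such that $\|f\|^2=\sup\{|\lambda| : f^*f-\lambda\,\mathrm{id}\text{ is not invertible}\}$ defines complete norms on the morphism spaces which are submultiplicative and satisfy $\|f^*f\|=\|f\|^2$. A *unitary tensor category* $\mathcal C$ is a rigid monoidal C\*-category with zero object, finite direct sums and split projections, whose tensor product is a bilinear $*$-functor and whose associator and unitors are unitary. **Centrally cyclic bimodules.** A *$\mathcal C$-bimodule C\*-category* is a C\*-category $\mathcal M$ with zero object, finite direct sums and split projections, with a left action $U\triangleright X$ and a right action $X\triangleleft U$ of $\mathcal C$ by bilinear $*$-functors, and with coherent natural unitary associativity, unit and middle associativity isomorphisms, the last ones being $(U\triangleright X)\triangleleft V\simeq U\triangleright(X\triangleleft V)$. It is *centrally cyclic* if it is equipped with an object $m$ such that every object of $\mathcal M$ is a subobject of some $m\triangleleft U$ (that is, admits an isometry into it), and with unitary isomorphisms $\alpha_U\colon m\triangleleft U\simeq U\triangleright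 m$, natural in $U\in\mathcal C$ and coherent with respect to the tensor product and the unit of $\mathcal C$. Morphisms $(\mathcal M,m,\alpha)\to(\mathcal M',m',\alpha')$ are linear $*$-functors $F\colon\mathcal M\to\mathcal M'$ together with unitary $\mathcal C$-bimodule structure isomorphisms $U\triangleright F(X)\simeq F(U\triangleright X)$, $F(X)\triangleleft U\simeq F(X\triangleleft U)$ and a unitary $F(m)\simeq m'$ intertwining $\alpha$ and $\alpha'$; two such are identified if they are related by a unitary natural isomorphism compatible with all these data. **Yetter–Drinfeld C\*-algebras.** Let $\mathrm{Vect}(\mathcal C)$ be the category of linear functors $\mathcal C^{\mathrm{op}}\to\mathrm{Vect}$ with Day convolution as tensor product; $\mathcal C$ embeds in it by the Yoneda embedding. For an algebra $A\in\mathrm{Vect}(\mathcal C)$, a *$*$-algebra structure* $j$ on $A$ consists of antilinear maps $j\colon A(U)\to A(V)$ for each dual $V$ of $U$ with given duality morphisms $\eta\colon 1\to U\otimes V$, $\varepsilon\colon V\otimes U\to1$, which are natural, unital, antimultiplicative ($j(a\cdot b)=j(b)\cdot j(a)$) and involutive (the map for $(U,V,\eta,\varepsilon)$ followed by the map for $(V,U,\varepsilon^*,\eta^*)$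 is the identity). The *corresponding* $*$-structure on the category of free left $A$-modules $A\otimes V$ ($V\in\mathcal C$) is the one for which $(f\otimes Y)^*=f^*\otimes Y$ for $A$-linear $f$ and $Y\in\mathcal C$, $(A\otimes g)^*=A\otimes g^*$ for morphisms $g$ of $\mathcal C$, and $\widehat{j(a)}=(A\otimes\eta^*)\circ(\hat a^*\otimes V)$ for $a\in A(U)$, where $\hat a\colon A\otimes U\to A$ is the $A$-linear map determined by $a$. A *Yetter–Drinfeld C\*-algebra in $\mathcal C$* is an algebra $(A,\mu,\sigma)$ in the Drinfeld center $\mathcal Z(\mathrm{Vect}(\mathcal C))$ with a $*$-algebra structure $j$ such that the corresponding $*$-structure on free $A$-modules exists and makes them a C\*-category, and such that the half-braiding $\sigma_U\colon A\otimes U\simeq U\otimes A$ is unitary. The latter means that, when $U\otimes(A\otimes V)$ is identified with $A\otimes U\otimes V$ by means of $\sigma_U$, one has $(U\otimes f)^*=U\otimes f^*$ for all $U\in\mathcal C$ and all $A$-linear maps $f\colon A\otimes V\to A\otimes W$. Morphisms are morphisms of algebras in $\mathcal Z(\mathrm{Vect}(\mathcal C))$ that commute with the maps $j$. **Theorem.**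 Let $\mathcal C$ be a unitary tensor category. Then the category of centrally cyclic $\mathcal C$-bimodule C\*-categories is equivalent to the category of Yetter–Drinfeld C\*-algebras in $\mathcal C$. -/

import Mathlib

set_option linter.unusedSectionVars false

open CategoryTheory MonoidalCategory Opposite
open scoped TensorProduct DirectSum ComplexConjugate

universe u v

/-! ### Linear presheaves -/

section Presheaves

variable (C : Type u) [SmallCategory C] [Preadditive C] [Linear ℂ C]

/-- A presheaf of complex vector spaces is linear if it acts linearly on morphism spaces. -/
def isLinearPresheaf : ObjectProperty (Cᵒᵖ ⥤ ModuleCat.{u} ℂ) := fun F =>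
  ∀ ⦃X Y : C⦄ (f g : X ⟶ Y) (c : ℂ),
    F.map (f + g).op = F.map f.op + F.map g.op ∧ F.map (c • f).op = c • F.map f.op

/-- `Vect(C)`: linear functors `Cᵒᵖ ⥤ Vect` and natural transformations. -/
abbrev VectC := (isLinearPresheaf C).FullSubcategory

variable {C}

namespace VectC

/-- The vector space `F(X)`. -/
abbrev ev (F : VectC C) (X : C) : Type u := F.obj.obj (op X)

/-- The restriction `F(f) : F(Y) → F(X)` along `f : X ⟶ Y`, linear in `f`. -/
noncomputable def resL (F : VectC C) (X Y : C) : (X ⟶ Y) →ₗ[ℂ] F.ev Y →ₗ[ℂ] F.ev X where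
  toFun f := (F.obj.map f.op).hom
  map_add' f g := by rw [(F.property f g 0).1]; rfl
  map_smul' c f := by rw [(F.property f f c).2]; rfl

/-- The restriction `F(f) : F(Y) → F(X)` along `f : X ⟶ Y`. -/
noncomputable abbrev res (F : VectC C) {X Y : C} (f : X ⟶ Y) : F.ev Y →ₗ[ℂ] F.ev X := F.resL X Y f

theorem res_def (F : VectC C) {X Y : C} (f : X ⟶ Y) : F.res f = (F.obj.map f.op).hom := rfl

@[simp] theorem res_id (F : VectC C) {X : C} (a : F.ev X) : F.res (𝟙 X) a = a := by
  simp [res_def]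

theorem res_comp (F : VectC C) {X Y Z : C} (f : X ⟶ Y) (g : Y ⟶ Z) (a : F.ev Z) :
    F.res (f ≫ g) a = F.res f (F.res g a) := by
  simp [res_def]

/-- The component at `X` of a morphism of presheaves. -/
noncomputable def app {F G : VectC C} (φ : F ⟶ G) (X : C) : F.ev X →ₗ[ℂ] G.ev X :=
  (φ.hom.app (op X)).hom

theorem app_res {F G : VectC C} (φ : F ⟶ G) {X Y : C} (f : X ⟶ Y) (a : F.ev Y) :
    app φ X (F.res f a) = G.res f (app φ Y a) :=
  congrArg (fun t => t.hom a) (φ.hom.naturality f.op)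

@[simp] theorem app_id (F : VectC C) {X : C} (a : F.ev X) : app (𝟙 F) X a = a := rfl

@[simp] theorem app_comp {F G H : VectC C} (φ : F ⟶ G) (ψ : G ⟶ H) {X : C} (a : F.ev X) :
    app (φ ≫ ψ) X a = app ψ X (app φ X a) := rfl

@[simp] theorem app_add {F G : VectC C} (φ ψ : F ⟶ G) {X : C} (a : F.ev X) :
    app (φ + ψ) X a = app φ X a + app ψ X a := rfl

@[simp] theorem app_smul {F G : VectC C} (c : ℂ) (φ : F ⟶ G) {X : C} (a : F.ev X) :
    app (c • φ) X a = c • app φ X a := rfl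

theorem ext_app {F G : VectC C} {φ ψ : F ⟶ G} (h : ∀ X (a : F.ev X), app φ X a = app ψ X a) :
    φ = ψ := by
  apply ObjectProperty.hom_ext
  apply NatTrans.ext
  funext X
  apply ModuleCat.hom_ext
  apply LinearMap.ext
  intro a
  exact h X.unop a

/-- A morphism of presheaves from its components. -/
def homMk {F G : VectC C} (t : ∀ X, F.ev X →ₗ[ℂ] G.ev X)
    (nat : ∀ {X Y : C} (f : X ⟶ Y) (a : F.ev Y), t X (F.res f a) = G.res f (t Y a)) : F ⟶ G :=
  ObjectProperty.homMk
    { app := fun X => ModuleCat.ofHom (t X.unop)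
      naturality := fun X Y f => by
        apply ModuleCat.hom_ext
        apply LinearMap.ext
        intro a
        exact nat f.unop a }

@[simp] theorem app_homMk {F G : VectC C} (t : ∀ X, F.ev X →ₗ[ℂ] G.ev X)
    (nat : ∀ {X Y : C} (f : X ⟶ Y) (a : F.ev Y), t X (F.res f a) = G.res f (t Y a)) (X : C)
    (a : F.ev X) : app (homMk t nat) X a = t X a := rfl

/-- A linear presheaf from its values and restriction maps. -/
def mk' (o : C → Type u) [∀ X, AddCommGroup (o X)] [∀ X, Module ℂ (o X)]
    (m : ∀ X Y : C, (X ⟶ Y) →ₗ[ℂ] o Y →ₗ[ℂ] o X)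
    (m_id : ∀ (X : C) (a : o X), m X X (𝟙 X) a = a)
    (m_comp : ∀ {X Y Z : C} (f : X ⟶ Y) (g : Y ⟶ Z) (a : o Z),
      m X Z (f ≫ g) a = m X Y f (m Y Z g a)) : VectC C where
  obj :=
    { obj := fun X => ModuleCat.of ℂ (o X.unop)
      map := fun {X Y} f => ModuleCat.ofHom (m Y.unop X.unop f.unop)
      map_id := fun X => by
        apply ModuleCat.hom_ext
        apply LinearMap.ext
        exact m_id X.unop
      map_comp := fun f g => by
        apply ModuleCat.hom_ext
        apply LinearMap.ext
        exact m_comp g.unop f.unop }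
  property := fun X Y f g c => by
    constructor
    · apply ModuleCat.hom_ext
      exact (m X Y).map_add f g
    · apply ModuleCat.hom_ext
      exact (m X Y).map_smul c f

/-- The representable presheaf `C(-, U)`. -/
noncomputable def yo (U : C) : VectC C where
  obj := (linearYoneda ℂ C).obj U
  property := fun X Y f g c => by
    constructor
    · apply ModuleCat.hom_ext
      apply LinearMap.ext
      intro k
      exact Preadditive.add_comp _ _ _ f g k
    · apply ModuleCat.hom_ext
      apply LinearMap.ext
      intro k
      exact Linear.smul_comp _ _ _ c f k

theorem yo_ev (U X : C) : (yo U).ev X = (X ⟶ U) := rfl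

theorem yo_res {U X Y : C} (f : X ⟶ Y) (k : Y ⟶ U) : (yo U).res f k = f ≫ k := rfl

/-- The morphism `C(-, U) ⟶ C(-, V)` given by composition with `g : U ⟶ V`. -/
noncomputable def yoMap {U V : C} (g : U ⟶ V) : yo U ⟶ yo V :=
  ObjectProperty.homMk ((linearYoneda ℂ C).map g)

theorem app_yoMap {U V X : C} (g : U ⟶ V) (k : X ⟶ U) :
    app (yoMap g) X k = (k ≫ g : X ⟶ V) := rfl

/-- The morphism `C(-, U) ⟶ F` given by an element of `F(U)`. -/
noncomputable def yoDesc {F : VectC C} {U : C} (a : F.ev U) : yo U ⟶ F :=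
  homMk (fun X => (F.resL X U).flip a) (fun f k => F.res_comp f k a)

theorem app_yoDesc {F : VectC C} {U X : C} (a : F.ev U) (k : X ⟶ U) :
    app (yoDesc a) X k = F.res k a := rfl

end VectC

end Presheaves


/-! ### Day convolution -/

section Day

variable {C : Type u} [SmallCategory C] [Preadditive C] [Linear ℂ C] [MonoidalCategory C]
  [MonoidalPreadditive C] [MonoidalLinear ℂ C]

namespace VectC

/-- The sum of all `C(X, U ⊗ V) ⊗ F(U) ⊗ G(V)`. -/
abbrev DaySum (F G : VectC C) (X : C) : Type u :=
  ⨁ p : C × C, (X ⟶ p.1 ⊗ p.2) ⊗[ℂ] (F.ev p.1 ⊗[ℂ] G.ev p.2)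

open scoped Classical in
/-- The element `f ⊗ a ⊗ b` of `DaySum`. -/
noncomputable def daySumMk (F G : VectC C) (X U V : C) :
    (X ⟶ U ⊗ V) →ₗ[ℂ] F.ev U →ₗ[ℂ] G.ev V →ₗ[ℂ] DaySum F G X :=
  LinearMap.mk₂ ℂ
    (fun f a => (DirectSum.lof ℂ (C × C)
        (fun p => (X ⟶ p.1 ⊗ p.2) ⊗[ℂ] (F.ev p.1 ⊗[ℂ] G.ev p.2)) (U, V)).comp
      ((TensorProduct.mk ℂ (X ⟶ U ⊗ V) (F.ev U ⊗[ℂ] G.ev V) f).comp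
        (TensorProduct.mk ℂ (F.ev U) (G.ev V) a)))
    (fun f f' a => by ext b; simp)
    (fun c f a => by
      apply LinearMap.ext
      intro b
      exact map_smul (DirectSum.lof ℂ (C × C)
        (fun p => (X ⟶ p.1 ⊗ p.2) ⊗[ℂ] (F.ev p.1 ⊗[ℂ] G.ev p.2)) (U, V)) c (f ⊗ₜ[ℂ] (a ⊗ₜ[ℂ] b)))
    (fun f a a' => by ext b; simp [TensorProduct.tmul_add])
    (fun c f a => by
      apply LinearMap.ext
      intro b
      have h : f ⊗ₜ[ℂ] ((c • a) ⊗ₜ[ℂ] b) = c • (f ⊗ₜ[ℂ] (a ⊗ₜ[ℂ] b)) := by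
        rw [← TensorProduct.smul_tmul', TensorProduct.tmul_smul]
      exact (congrArg _ h).trans (map_smul (DirectSum.lof ℂ (C × C)
        (fun p => (X ⟶ p.1 ⊗ p.2) ⊗[ℂ] (F.ev p.1 ⊗[ℂ] G.ev p.2)) (U, V)) c (f ⊗ₜ[ℂ] (a ⊗ₜ[ℂ] b))))

/-- The relations of the coend over `(U, V)`. -/
def dayRel (F G : VectC C) (X : C) : Submodule ℂ (DaySum F G X) :=
  Submodule.span ℂ
    {t | ∃ (U U' V V' : C) (f : X ⟶ U ⊗ V) (g : U ⟶ U') (h : V ⟶ V') (a : F.ev U') (b : G.ev V'),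
      t = daySumMk F G X U' V' (f ≫ (g ⊗ₘ h)) a b - daySumMk F G X U V f (F.res g a) (G.res h b)}

/-- The value at `X` of the Day convolution of `F` and `G`, the coend
`∫^{U, V} C(X, U ⊗ V) ⊗ F(U) ⊗ G(V)`. -/
def DayObj (F G : VectC C) (X : C) : Type u := DaySum F G X ⧸ dayRel F G X

noncomputable instance (F G : VectC C) (X : C) : AddCommGroup (DayObj F G X) :=
  inferInstanceAs (AddCommGroup (DaySum F G X ⧸ dayRel F G X))

noncomputable instance (F G : VectC C) (X : C) : Module ℂ (DayObj F G X) :=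
  inferInstanceAs (Module ℂ (DaySum F G X ⧸ dayRel F G X))

/-- The quotient map to the coend. -/
noncomputable def dayQ (F G : VectC C) (X : C) : DaySum F G X →ₗ[ℂ] DayObj F G X :=
  (dayRel F G X).mkQ

/-- The class of `f ⊗ a ⊗ b` in the coend. -/
noncomputable def dayMk (F G : VectC C) (X U V : C) :
    (X ⟶ U ⊗ V) →ₗ[ℂ] F.ev U →ₗ[ℂ] G.ev V →ₗ[ℂ] DayObj F G X :=
  LinearMap.mk₂ ℂ
    (fun f a => (dayQ F G X).comp (daySumMk F G X U V f a))
    (fun f f' a => by ext b; simp)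
    (fun c f a => by ext b; simp)
    (fun f a a' => by ext b; simp)
    (fun c f a => by ext b; simp)

theorem dayMk_rel (F G : VectC C) {X U U' V V' : C} (f : X ⟶ U ⊗ V) (g : U ⟶ U') (h : V ⟶ V')
    (a : F.ev U') (b : G.ev V') :
    dayMk F G X U' V' (f ≫ (g ⊗ₘ h)) a b = dayMk F G X U V f (F.res g a) (G.res h b) := by
  rw [← sub_eq_zero]
  have : daySumMk F G X U' V' (f ≫ (g ⊗ₘ h)) a b - daySumMk F G X U V f (F.res g a) (G.res h b)
      ∈ dayRel F G X := Submodule.subset_span ⟨U, U', V, V', f, g, h, a, b, rfl⟩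
  exact (Submodule.Quotient.mk_eq_zero _).mpr this

open scoped Classical in
/-- Linear maps out of the coend. -/
noncomputable def dayLift {F G : VectC C} {X : C} {N : Type u} [AddCommGroup N] [Module ℂ N]
    (ψ : ∀ U V : C, (X ⟶ U ⊗ V) →ₗ[ℂ] F.ev U →ₗ[ℂ] G.ev V →ₗ[ℂ] N)
    (hψ : ∀ {U U' V V' : C} (f : X ⟶ U ⊗ V) (g : U ⟶ U') (h : V ⟶ V') (a : F.ev U') (b : G.ev V'),
      ψ U' V' (f ≫ (g ⊗ₘ h)) a b = ψ U V f (F.res g a) (G.res h b)) :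
    DayObj F G X →ₗ[ℂ] N :=
  (dayRel F G X).liftQ
    (DirectSum.toModule ℂ (C × C) N fun p =>
      TensorProduct.lift
        { toFun := fun f => TensorProduct.lift (ψ p.1 p.2 f)
          map_add' := fun f f' => by apply TensorProduct.ext'; intro a b; simp
          map_smul' := fun c f => by apply TensorProduct.ext'; intro a b; simp })
    (by
      apply Submodule.span_le.mpr
      rintro t ⟨U, U', V, V', f, g, h, a, b, rfl⟩
      rw [SetLike.mem_coe, LinearMap.mem_ker, map_sub, sub_eq_zero]
      refine (DirectSum.toModule_lof (M := fun p : C × C =>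
        (X ⟶ p.1 ⊗ p.2) ⊗[ℂ] (F.ev p.1 ⊗[ℂ] G.ev p.2)) ℂ (U', V')
        ((f ≫ (g ⊗ₘ h)) ⊗ₜ[ℂ] (a ⊗ₜ[ℂ] b))).trans ?_
      refine Eq.trans ?_
        (DirectSum.toModule_lof (M := fun p : C × C =>
          (X ⟶ p.1 ⊗ p.2) ⊗[ℂ] (F.ev p.1 ⊗[ℂ] G.ev p.2)) ℂ (U, V)
          (f ⊗ₜ[ℂ] (F.res g a ⊗ₜ[ℂ] G.res h b))).symm
      simpa using hψ f g h a b)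

open scoped Classical in
theorem dayLift_mk {F G : VectC C} {X : C} {N : Type u} [AddCommGroup N] [Module ℂ N]
    (ψ : ∀ U V : C, (X ⟶ U ⊗ V) →ₗ[ℂ] F.ev U →ₗ[ℂ] G.ev V →ₗ[ℂ] N)
    (hψ : ∀ {U U' V V' : C} (f : X ⟶ U ⊗ V) (g : U ⟶ U') (h : V ⟶ V') (a : F.ev U') (b : G.ev V'),
      ψ U' V' (f ≫ (g ⊗ₘ h)) a b = ψ U V f (F.res g a) (G.res h b))
    {U V : C} (f : X ⟶ U ⊗ V) (a : F.ev U) (b : G.ev V) :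
    dayLift ψ hψ (dayMk F G X U V f a b) = ψ U V f a b := by
  have h : dayLift ψ hψ (dayMk F G X U V f a b) =
      DirectSum.toModule ℂ (C × C) N (fun p =>
        TensorProduct.lift
          { toFun := fun f => TensorProduct.lift (ψ p.1 p.2 f)
            map_add' := fun f f' => by apply TensorProduct.ext'; intro a b; simp
            map_smul' := fun c f => by apply TensorProduct.ext'; intro a b; simp })
        (daySumMk F G X U V f a b) := rfl
  rw [h]
  refine (DirectSum.toModule_lof (M := fun p : C × C =>
    (X ⟶ p.1 ⊗ p.2) ⊗[ℂ] (F.ev p.1 ⊗[ℂ] G.ev p.2)) ℂ (U, V) (f ⊗ₜ[ℂ] (a ⊗ₜ[ℂ] b))).trans ?_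
  simp

theorem dayObj_induction {F G : VectC C} {X : C} {P : DayObj F G X → Prop}
    (mk : ∀ (U V : C) (f : X ⟶ U ⊗ V) (a : F.ev U) (b : G.ev V), P (dayMk F G X U V f a b))
    (zero : P 0) (add : ∀ s t, P s → P t → P (s + t)) (t : DayObj F G X) : P t := by
  classical
  obtain ⟨t, rfl⟩ :=
    (Submodule.mkQ_surjective (dayRel F G X) : Function.Surjective (dayQ F G X)) t
  induction t using DirectSum.induction_on with
  | zero => rw [map_zero]; exact zero
  | add s t hs ht => rw [map_add]; exact add _ _ hs ht
  | of p t =>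
    change P (dayQ F G X (DirectSum.lof ℂ (C × C)
        (fun p => (X ⟶ p.1 ⊗ p.2) ⊗[ℂ] (F.ev p.1 ⊗[ℂ] G.ev p.2)) p t))
    induction t using TensorProduct.induction_on with
    | zero => rw [map_zero, map_zero]; exact zero
    | add s t hs ht => rw [map_add, map_add]; exact add _ _ hs ht
    | tmul f t =>
      induction t using TensorProduct.induction_on with
      | zero => rw [TensorProduct.tmul_zero, map_zero, map_zero]; exact zero
      | add s t hs ht => rw [TensorProduct.tmul_add, map_add, map_add]; exact add _ _ hs ht
      | tmul a b => exact mk p.1 p.2 f a b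

/-- Restriction of elements of the coend along `k : X ⟶ Y`. -/
noncomputable def dayRes (F G : VectC C) (X Y : C) :
    (X ⟶ Y) →ₗ[ℂ] DayObj F G Y →ₗ[ℂ] DayObj F G X where
  toFun k := dayLift
    (fun U V => (dayMk F G X U V).comp (Linear.leftComp ℂ (U ⊗ V) k))
    (fun f g h a b => by
      simp only [LinearMap.comp_apply, Linear.leftComp_apply]
      rw [← Category.assoc, dayMk_rel])
  map_add' k k' := by
    apply LinearMap.ext
    intro t
    induction t using dayObj_induction with
    | zero => simp
    | add s t hs ht => simp only [map_add, hs, ht]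
    | mk U V f a b => simp [dayLift_mk]
  map_smul' c k := by
    apply LinearMap.ext
    intro t
    induction t using dayObj_induction with
    | zero => simp
    | add s t hs ht => simp only [map_add, hs, ht]
    | mk U V f a b => simp [dayLift_mk]

theorem dayRes_mk (F G : VectC C) {X Y U V : C} (k : X ⟶ Y) (f : Y ⟶ U ⊗ V) (a : F.ev U)
    (b : G.ev V) : dayRes F G X Y k (dayMk F G Y U V f a b) = dayMk F G X U V (k ≫ f) a b :=
  dayLift_mk (fun U V => (dayMk F G X U V).comp (Linear.leftComp ℂ (U ⊗ V) k))
    (fun f g h a b => by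
      simp only [LinearMap.comp_apply, Linear.leftComp_apply]
      rw [← Category.assoc, dayMk_rel]) f a b

/-- The Day convolution of two linear presheaves. -/
noncomputable def day (F G : VectC C) : VectC C :=
  mk' (DayObj F G) (dayRes F G)
    (fun X t => by
      induction t using dayObj_induction with
      | zero => simp
      | add s t hs ht => simp only [map_add, hs, ht]
      | mk U V f a b => simp [dayRes_mk])
    (fun k l t => by
      induction t using dayObj_induction with
      | zero => simp
      | add s t hs ht => simp only [map_add, hs, ht]
      | mk U V f a b => simp [dayRes_mk])

/-- The defining description of the values of `day F G`. -/
noncomputable def dayEv (F G : VectC C) (X : C) : DayObj F G X ≃ₗ[ℂ] (day F G).ev X :=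
  LinearEquiv.refl ℂ (DayObj F G X)

theorem res_dayEv {F G : VectC C} {X Y : C} (k : X ⟶ Y) (t : DayObj F G Y) :
    (day F G).res k (dayEv F G Y t) = dayEv F G X (dayRes F G X Y k t) := rfl

/-- The element of `(F ⊗ G)(X)` given by `f : X ⟶ U ⊗ V`, `a ∈ F(U)` and `b ∈ G(V)`. -/
noncomputable def pureT (F G : VectC C) (X U V : C) :
    (X ⟶ U ⊗ V) →ₗ[ℂ] F.ev U →ₗ[ℂ] G.ev V →ₗ[ℂ] (day F G).ev X :=
  LinearMap.mk₂ ℂ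
    (fun f a => (dayEv F G X).toLinearMap.comp (dayMk F G X U V f a))
    (fun f f' a => by apply LinearMap.ext; intro b; simp)
    (fun c f a => by apply LinearMap.ext; intro b; simp)
    (fun f a a' => by apply LinearMap.ext; intro b; simp)
    (fun c f a => by apply LinearMap.ext; intro b; simp)

theorem pureT_def (F G : VectC C) (X U V : C) (f : X ⟶ U ⊗ V) (a : F.ev U) (b : G.ev V) :
    pureT F G X U V f a b = dayEv F G X (dayMk F G X U V f a b) := rfl

theorem pureT_rel {F G : VectC C} {X U U' V V' : C} (f : X ⟶ U ⊗ V) (g : U ⟶ U') (h : V ⟶ V')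
    (a : F.ev U') (b : G.ev V') :
    pureT F G X U V f (F.res g a) (G.res h b) = pureT F G X U' V' (f ≫ (g ⊗ₘ h)) a b := by
  rw [pureT_def, pureT_def, dayMk_rel]

theorem pureT_res_left {F G : VectC C} {X U U' V : C} (f : X ⟶ U ⊗ V) (g : U ⟶ U')
    (a : F.ev U') (b : G.ev V) :
    pureT F G X U V f (F.res g a) b = pureT F G X U' V (f ≫ g ▷ V) a b := by
  simpa using pureT_rel f g (𝟙 V) a b

theorem pureT_res_right {F G : VectC C} {X U V V' : C} (f : X ⟶ U ⊗ V) (h : V ⟶ V')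
    (a : F.ev U) (b : G.ev V') :
    pureT F G X U V f a (G.res h b) = pureT F G X U V' (f ≫ U ◁ h) a b := by
  simpa using pureT_rel f (𝟙 U) h a b

theorem res_pureT {F G : VectC C} {X Y U V : C} (k : X ⟶ Y) (f : Y ⟶ U ⊗ V)
    (a : F.ev U) (b : G.ev V) :
    (day F G).res k (pureT F G Y U V f a b) = pureT F G X U V (k ≫ f) a b := by
  rw [pureT_def, res_dayEv, dayRes_mk, pureT_def]

theorem day_induction {F G : VectC C} {X : C} {P : (day F G).ev X → Prop}
    (mk : ∀ (U V : C) (f : X ⟶ U ⊗ V) (a : F.ev U) (b : G.ev V), P (pureT F G X U V f a b))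
    (zero : P 0) (add : ∀ s t, P s → P t → P (s + t)) (t : (day F G).ev X) : P t := by
  obtain ⟨t, rfl⟩ := (dayEv F G X).surjective t
  induction t using dayObj_induction with
  | zero => rw [map_zero]; exact zero
  | add s t hs ht => rw [map_add]; exact add _ _ hs ht
  | mk U V f a b => exact mk U V f a b

/-- The trilinear family underlying `desc`. -/
noncomputable def descFam {F G H : VectC C}
    (φ : ∀ U V : C, F.ev U →ₗ[ℂ] G.ev V →ₗ[ℂ] H.ev (U ⊗ V)) (X U V : C) :
    (X ⟶ U ⊗ V) →ₗ[ℂ] F.ev U →ₗ[ℂ] G.ev V →ₗ[ℂ] H.ev X where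
  toFun f := (φ U V).compr₂ (H.res f)
  map_add' f f' := by
    apply LinearMap.ext₂; intro a b
    simp only [LinearMap.compr₂_apply, LinearMap.add_apply, map_add]
  map_smul' c f := by
    apply LinearMap.ext₂; intro a b
    simp only [LinearMap.compr₂_apply, LinearMap.smul_apply, map_smul, RingHom.id_apply]

theorem descFam_apply {F G H : VectC C}
    (φ : ∀ U V : C, F.ev U →ₗ[ℂ] G.ev V →ₗ[ℂ] H.ev (U ⊗ V)) (X U V : C) (f : X ⟶ U ⊗ V)
    (a : F.ev U) (b : G.ev V) : descFam φ X U V f a b = H.res f (φ U V a b) := rfl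

theorem descFam_rel {F G H : VectC C}
    (φ : ∀ U V : C, F.ev U →ₗ[ℂ] G.ev V →ₗ[ℂ] H.ev (U ⊗ V))
    (hφ : ∀ {U U' V V' : C} (g : U ⟶ U') (h : V ⟶ V') (a : F.ev U') (b : G.ev V'),
      φ U V (F.res g a) (G.res h b) = H.res (g ⊗ₘ h) (φ U' V' a b)) (X : C)
    {U U' V V' : C} (f : X ⟶ U ⊗ V) (g : U ⟶ U') (h : V ⟶ V') (a : F.ev U') (b : G.ev V') :
    descFam φ X U' V' (f ≫ (g ⊗ₘ h)) a b = descFam φ X U V f (F.res g a) (G.res h b) := by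
  rw [descFam_apply, descFam_apply, hφ, res_comp]

/-- The components of `desc`. -/
noncomputable def descAux {F G H : VectC C}
    (φ : ∀ U V : C, F.ev U →ₗ[ℂ] G.ev V →ₗ[ℂ] H.ev (U ⊗ V))
    (hφ : ∀ {U U' V V' : C} (g : U ⟶ U') (h : V ⟶ V') (a : F.ev U') (b : G.ev V'),
      φ U V (F.res g a) (G.res h b) = H.res (g ⊗ₘ h) (φ U' V' a b)) (X : C) :
    (day F G).ev X →ₗ[ℂ] H.ev X :=
  (dayLift (descFam φ X) (descFam_rel φ hφ X)).comp (dayEv F G X).symm.toLinearMap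

theorem descAux_pureT {F G H : VectC C}
    (φ : ∀ U V : C, F.ev U →ₗ[ℂ] G.ev V →ₗ[ℂ] H.ev (U ⊗ V))
    (hφ : ∀ {U U' V V' : C} (g : U ⟶ U') (h : V ⟶ V') (a : F.ev U') (b : G.ev V'),
      φ U V (F.res g a) (G.res h b) = H.res (g ⊗ₘ h) (φ U' V' a b))
    {X U V : C} (f : X ⟶ U ⊗ V) (a : F.ev U) (b : G.ev V) :
    descAux φ hφ X (pureT F G X U V f a b) = H.res f (φ U V a b) := by
  rw [descAux, LinearMap.comp_apply, pureT_def, LinearEquiv.coe_coe, LinearEquiv.symm_apply_apply]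
  exact dayLift_mk (descFam φ X) (descFam_rel φ hφ X) f a b

/-- Morphisms out of `F ⊗ G` are natural families of bilinear maps `F(U) × G(V) → H(U ⊗ V)`. -/
noncomputable def desc {F G H : VectC C}
    (φ : ∀ U V : C, F.ev U →ₗ[ℂ] G.ev V →ₗ[ℂ] H.ev (U ⊗ V))
    (hφ : ∀ {U U' V V' : C} (g : U ⟶ U') (h : V ⟶ V') (a : F.ev U') (b : G.ev V'),
      φ U V (F.res g a) (G.res h b) = H.res (g ⊗ₘ h) (φ U' V' a b)) : day F G ⟶ H :=
  homMk (descAux φ hφ)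
    (fun {X Y} k t => by
      induction t using day_induction with
      | zero => simp only [map_zero]
      | add s t hs ht => simp only [map_add, hs, ht]
      | mk U V f a b => rw [res_pureT, descAux_pureT, descAux_pureT, res_comp])

theorem desc_pureT {F G H : VectC C}
    (φ : ∀ U V : C, F.ev U →ₗ[ℂ] G.ev V →ₗ[ℂ] H.ev (U ⊗ V))
    (hφ : ∀ {U U' V V' : C} (g : U ⟶ U') (h : V ⟶ V') (a : F.ev U') (b : G.ev V'),
      φ U V (F.res g a) (G.res h b) = H.res (g ⊗ₘ h) (φ U' V' a b))
    {X U V : C} (f : X ⟶ U ⊗ V) (a : F.ev U) (b : G.ev V) :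
    app (desc φ hφ) X (pureT F G X U V f a b) = H.res f (φ U V a b) :=
  descAux_pureT φ hφ f a b

theorem day_ext {F G H : VectC C} {φ ψ : day F G ⟶ H}
    (h : ∀ (X U V : C) (f : X ⟶ U ⊗ V) (a : F.ev U) (b : G.ev V),
      app φ X (pureT F G X U V f a b) = app ψ X (pureT F G X U V f a b)) : φ = ψ := by
  apply ext_app
  intro X t
  induction t using day_induction with
  | zero => simp only [map_zero]
  | add s t hs ht => simp only [map_add, hs, ht]
  | mk U V f a b => exact h X U V f a b

end VectC

end Day

/-! ### The monoidal structure on `Vect(C)` -/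

section Monoidal

variable {C : Type u} [SmallCategory C] [Preadditive C] [Linear ℂ C] [MonoidalCategory C]
  [MonoidalPreadditive C] [MonoidalLinear ℂ C]

namespace VectC

/-- The bilinear maps underlying `dayMap`. -/
noncomputable def dayMapFam {F F' G G' : VectC C} (s : F ⟶ F') (t : G ⟶ G') (U V : C) :
    F.ev U →ₗ[ℂ] G.ev V →ₗ[ℂ] (day F' G').ev (U ⊗ V) :=
  (pureT F' G' (U ⊗ V) U V (𝟙 _)).compl₁₂ (app s U) (app t V)

theorem dayMapFam_nat {F F' G G' : VectC C} (s : F ⟶ F') (t : G ⟶ G') {U U' V V' : C}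
    (g : U ⟶ U') (h : V ⟶ V') (a : F.ev U') (b : G.ev V') :
    dayMapFam s t U V (F.res g a) (G.res h b) =
      (day F' G').res (g ⊗ₘ h) (dayMapFam s t U' V' a b) := by
  simp only [dayMapFam, LinearMap.compl₁₂_apply, app_res]
  rw [pureT_rel, res_pureT, Category.id_comp, Category.comp_id]

/-- The Day convolution of two morphisms. -/
noncomputable def dayMap {F F' G G' : VectC C} (s : F ⟶ F') (t : G ⟶ G') : day F G ⟶ day F' G' :=
  desc (dayMapFam s t) (dayMapFam_nat s t)

theorem dayMap_pureT {F F' G G' : VectC C} (s : F ⟶ F') (t : G ⟶ G') {X U V : C} (f : X ⟶ U ⊗ V)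
    (a : F.ev U) (b : G.ev V) :
    app (dayMap s t) X (pureT F G X U V f a b) = pureT F' G' X U V f (app s U a) (app t V b) := by
  refine (desc_pureT _ (dayMapFam_nat s t) f a b).trans ?_
  rw [dayMapFam, LinearMap.compl₁₂_apply, res_pureT, Category.comp_id]

section LeftNested

variable {F G H T : VectC C}
  (ψ : ∀ U V Z : C, F.ev U →ₗ[ℂ] G.ev V →ₗ[ℂ] H.ev Z →ₗ[ℂ] T.ev ((U ⊗ V) ⊗ Z))
  (hψ : ∀ {U U' V V' Z Z' : C} (f : U ⟶ U') (g : V ⟶ V') (h : Z ⟶ Z') (a : F.ev U') (b : G.ev V')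
    (c : H.ev Z'), ψ U V Z (F.res f a) (G.res g b) (H.res h c) =
      T.res ((f ⊗ₘ g) ⊗ₘ h) (ψ U' V' Z' a b c))

/-- The family of maps underlying `descLAux`. -/
noncomputable def descLFam (W Z U V : C) :
    (W ⟶ U ⊗ V) →ₗ[ℂ] F.ev U →ₗ[ℂ] G.ev V →ₗ[ℂ] H.ev Z →ₗ[ℂ] T.ev (W ⊗ Z) where
  toFun f := (ψ U V Z).compr₂ (LinearMap.llcomp ℂ _ _ _ (T.res (f ▷ Z)))
  map_add' f f' := by
    apply LinearMap.ext₂; intro a b; apply LinearMap.ext; intro c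
    simp only [LinearMap.compr₂_apply, LinearMap.add_apply, LinearMap.llcomp_apply,
      MonoidalPreadditive.add_whiskerRight, map_add]
  map_smul' k f := by
    apply LinearMap.ext₂; intro a b; apply LinearMap.ext; intro c
    simp only [LinearMap.compr₂_apply, LinearMap.smul_apply, LinearMap.llcomp_apply,
      MonoidalLinear.smul_whiskerRight, map_smul, RingHom.id_apply]

theorem descLFam_apply (W Z U V : C) (f : W ⟶ U ⊗ V) (a : F.ev U) (b : G.ev V) (c : H.ev Z) :
    descLFam ψ W Z U V f a b c = T.res (f ▷ Z) (ψ U V Z a b c) := rfl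

theorem descLFam_rel
    (hψ : ∀ {U U' V V' Z Z' : C} (f : U ⟶ U') (g : V ⟶ V') (h : Z ⟶ Z') (a : F.ev U')
      (b : G.ev V') (c : H.ev Z'), ψ U V Z (F.res f a) (G.res g b) (H.res h c) =
        T.res ((f ⊗ₘ g) ⊗ₘ h) (ψ U' V' Z' a b c)) (W Z : C) {U U' V V' : C} (f : W ⟶ U ⊗ V) (g : U ⟶ U') (h : V ⟶ V')
    (a : F.ev U') (b : G.ev V') :
    descLFam ψ W Z U' V' (f ≫ (g ⊗ₘ h)) a b = descLFam ψ W Z U V f (F.res g a) (G.res h b) := by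
  apply LinearMap.ext
  intro c
  have := hψ g h (𝟙 Z) a b c
  rw [res_id] at this
  rw [descLFam_apply, descLFam_apply, this, comp_whiskerRight, res_comp, tensorHom_id]

/-- For fixed `W`, `Z`, the bilinear map `(F ⊗ G)(W) × H(Z) → T(W ⊗ Z)` induced by `ψ`. -/
noncomputable def descLAux (W Z : C) : (day F G).ev W →ₗ[ℂ] H.ev Z →ₗ[ℂ] T.ev (W ⊗ Z) :=
  (dayLift (descLFam ψ W Z) (descLFam_rel ψ hψ W Z)).comp (dayEv F G W).symm.toLinearMap

theorem descLAux_pureT {W Z U V : C} (f : W ⟶ U ⊗ V) (a : F.ev U) (b : G.ev V) (c : H.ev Z) :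
    descLAux ψ hψ W Z (pureT F G W U V f a b) c = T.res (f ▷ Z) (ψ U V Z a b c) := by
  rw [descLAux, LinearMap.comp_apply, pureT_def, LinearEquiv.coe_coe, LinearEquiv.symm_apply_apply]
  exact congrArg (fun t => t c) (dayLift_mk (descLFam ψ W Z) (descLFam_rel ψ hψ W Z) f a b)

theorem descLAux_nat {W W' Z Z' : C} (g : W ⟶ W') (h : Z ⟶ Z') (t : (day F G).ev W')
    (c : H.ev Z') : descLAux ψ hψ W Z ((day F G).res g t) (H.res h c) =
      T.res (g ⊗ₘ h) (descLAux ψ hψ W' Z' t c) := by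
  induction t using day_induction with
  | zero => simp only [map_zero, LinearMap.zero_apply]
  | add s t hs ht => simp only [map_add, LinearMap.add_apply, hs, ht]
  | mk U V f a b =>
    have := hψ (𝟙 U) (𝟙 V) h a b c
    rw [res_id, res_id] at this
    rw [res_pureT, descLAux_pureT, descLAux_pureT, this, ← res_comp, ← res_comp]
    congr 2
    rw [id_tensorHom_id, id_tensorHom, comp_whiskerRight, Category.assoc,
      MonoidalCategory.tensorHom_def g h, Category.assoc, whisker_exchange]

/-- Morphisms out of `(F ⊗ G) ⊗ H` from natural families of trilinear maps. -/
noncomputable def descL : day (day F G) H ⟶ T :=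
  desc (descLAux ψ hψ) (descLAux_nat ψ hψ)

theorem descL_pureT {X W Z U V : C} (k : X ⟶ W ⊗ Z) (f : W ⟶ U ⊗ V) (a : F.ev U) (b : G.ev V)
    (c : H.ev Z) :
    app (descL ψ hψ) X (pureT (day F G) H X W Z k (pureT F G W U V f a b) c) =
      T.res (k ≫ f ▷ Z) (ψ U V Z a b c) := by
  refine (desc_pureT _ (descLAux_nat ψ hψ) k _ c).trans ?_
  rw [descLAux_pureT, res_comp]

end LeftNested

section RightNested

variable {F G H T : VectC C}
  (ψ : ∀ U V Z : C, G.ev V →ₗ[ℂ] H.ev Z →ₗ[ℂ] F.ev U →ₗ[ℂ] T.ev (U ⊗ (V ⊗ Z)))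
  (hψ : ∀ {U U' V V' Z Z' : C} (f : U ⟶ U') (g : V ⟶ V') (h : Z ⟶ Z') (a : F.ev U') (b : G.ev V')
    (c : H.ev Z'), ψ U V Z (G.res g b) (H.res h c) (F.res f a) =
      T.res (f ⊗ₘ (g ⊗ₘ h)) (ψ U' V' Z' b c a))

/-- The family of maps underlying `descRAux`. -/
noncomputable def descRFam (U W V Z : C) :
    (W ⟶ V ⊗ Z) →ₗ[ℂ] G.ev V →ₗ[ℂ] H.ev Z →ₗ[ℂ] F.ev U →ₗ[ℂ] T.ev (U ⊗ W) where
  toFun f := (ψ U V Z).compr₂ (LinearMap.llcomp ℂ _ _ _ (T.res (U ◁ f)))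
  map_add' f f' := by
    apply LinearMap.ext₂; intro a b; apply LinearMap.ext; intro c
    simp only [LinearMap.compr₂_apply, LinearMap.add_apply, LinearMap.llcomp_apply,
      MonoidalPreadditive.whiskerLeft_add, map_add]
  map_smul' k f := by
    apply LinearMap.ext₂; intro a b; apply LinearMap.ext; intro c
    simp only [LinearMap.compr₂_apply, LinearMap.smul_apply, LinearMap.llcomp_apply,
      MonoidalLinear.whiskerLeft_smul, map_smul, RingHom.id_apply]

theorem descRFam_apply (U W V Z : C) (f : W ⟶ V ⊗ Z) (a : F.ev U) (b : G.ev V) (c : H.ev Z) :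
    descRFam ψ U W V Z f b c a = T.res (U ◁ f) (ψ U V Z b c a) := rfl

theorem descRFam_rel
    (hψ : ∀ {U U' V V' Z Z' : C} (f : U ⟶ U') (g : V ⟶ V') (h : Z ⟶ Z') (a : F.ev U')
      (b : G.ev V') (c : H.ev Z'), ψ U V Z (G.res g b) (H.res h c) (F.res f a) =
        T.res (f ⊗ₘ (g ⊗ₘ h)) (ψ U' V' Z' b c a)) (U W : C) {V V' Z Z' : C} (f : W ⟶ V ⊗ Z) (g : V ⟶ V') (h : Z ⟶ Z')
    (b : G.ev V') (c : H.ev Z') :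
    descRFam ψ U W V' Z' (f ≫ (g ⊗ₘ h)) b c = descRFam ψ U W V Z f (G.res g b) (H.res h c) := by
  apply LinearMap.ext
  intro a
  have := hψ (𝟙 U) g h a b c
  rw [res_id] at this
  rw [descRFam_apply, descRFam_apply, this, MonoidalCategory.whiskerLeft_comp, res_comp,
    id_tensorHom]

/-- For fixed `U`, `W`, the bilinear map `F(U) × (G ⊗ H)(W) → T(U ⊗ W)` induced by `ψ`. -/
noncomputable def descRAux (U W : C) : F.ev U →ₗ[ℂ] (day G H).ev W →ₗ[ℂ] T.ev (U ⊗ W) :=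
  ((dayLift (descRFam ψ U W) (descRFam_rel ψ hψ U W)).comp (dayEv G H W).symm.toLinearMap).flip

theorem descRAux_pureT {U W V Z : C} (f : W ⟶ V ⊗ Z) (a : F.ev U) (b : G.ev V) (c : H.ev Z) :
    descRAux ψ hψ U W a (pureT G H W V Z f b c) = T.res (U ◁ f) (ψ U V Z b c a) := by
  rw [descRAux, LinearMap.flip_apply, LinearMap.comp_apply, pureT_def, LinearEquiv.coe_coe,
    LinearEquiv.symm_apply_apply]
  exact congrArg (fun t => t a) (dayLift_mk (descRFam ψ U W) (descRFam_rel ψ hψ U W) f b c)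

theorem descRAux_nat {U U' W W' : C} (g : U ⟶ U') (h : W ⟶ W') (a : F.ev U')
    (t : (day G H).ev W') : descRAux ψ hψ U W (F.res g a) ((day G H).res h t) =
      T.res (g ⊗ₘ h) (descRAux ψ hψ U' W' a t) := by
  induction t using day_induction with
  | zero => simp only [map_zero]
  | add s t hs ht => simp only [map_add, hs, ht]
  | mk V Z f b c =>
    have := hψ g (𝟙 V) (𝟙 Z) a b c
    rw [res_id, res_id] at this
    rw [res_pureT, descRAux_pureT, descRAux_pureT, this, ← res_comp, ← res_comp]
    congr 2
    simp [MonoidalCategory.tensorHom_def', ← whisker_exchange]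

/-- Morphisms out of `F ⊗ (G ⊗ H)` from natural families of trilinear maps. -/
noncomputable def descR : day F (day G H) ⟶ T :=
  desc (descRAux ψ hψ) (descRAux_nat ψ hψ)

theorem descR_pureT {X U W V Z : C} (k : X ⟶ U ⊗ W) (f : W ⟶ V ⊗ Z) (a : F.ev U) (b : G.ev V)
    (c : H.ev Z) :
    app (descR ψ hψ) X (pureT F (day G H) X U W k a (pureT G H W V Z f b c)) =
      T.res (k ≫ U ◁ f) (ψ U V Z b c a) := by
  refine (desc_pureT _ (descRAux_nat ψ hψ) k a _).trans ?_
  rw [descRAux_pureT, res_comp]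

end RightNested

/-- `(a, b, c) ↦ a ⊗ (b ⊗ c)`. -/
noncomputable def assocFam (F G H : VectC C) (U V Z : C) :
    F.ev U →ₗ[ℂ] G.ev V →ₗ[ℂ] H.ev Z →ₗ[ℂ] (day F (day G H)).ev ((U ⊗ V) ⊗ Z) :=
  LinearMap.mk₂ ℂ
    (fun a b => (pureT F (day G H) _ U (V ⊗ Z) (α_ U V Z).hom a).comp
      (pureT G H (V ⊗ Z) V Z (𝟙 _) b))
    (fun a a' b => by apply LinearMap.ext; intro c; simp)
    (fun k a b => by apply LinearMap.ext; intro c; simp)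
    (fun a b b' => by apply LinearMap.ext; intro c; simp)
    (fun k a b => by apply LinearMap.ext; intro c; simp)

theorem assocFam_apply (F G H : VectC C) {U V Z : C} (a : F.ev U) (b : G.ev V) (c : H.ev Z) :
    assocFam F G H U V Z a b c =
      pureT F (day G H) _ U (V ⊗ Z) (α_ U V Z).hom a (pureT G H (V ⊗ Z) V Z (𝟙 _) b c) := rfl

theorem assocFam_nat (F G H : VectC C) {U U' V V' Z Z' : C} (f : U ⟶ U') (g : V ⟶ V') (h : Z ⟶ Z')
    (a : F.ev U') (b : G.ev V') (c : H.ev Z') :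
    assocFam F G H U V Z (F.res f a) (G.res g b) (H.res h c) =
      (day F (day G H)).res ((f ⊗ₘ g) ⊗ₘ h) (assocFam F G H U' V' Z' a b c) := by
  rw [assocFam_apply, assocFam_apply, pureT_rel, res_pureT, Category.id_comp,
    ← Category.comp_id (g ⊗ₘ h), ← res_pureT, pureT_rel]
  congr 3
  simp

/-- `(b, c, a) ↦ (a ⊗ b) ⊗ c`. -/
noncomputable def assocInvFam (F G H : VectC C) (U V Z : C) :
    G.ev V →ₗ[ℂ] H.ev Z →ₗ[ℂ] F.ev U →ₗ[ℂ] (day (day F G) H).ev (U ⊗ (V ⊗ Z)) :=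
  LinearMap.mk₂ ℂ
    (fun b c => ((pureT (day F G) H _ (U ⊗ V) Z (α_ U V Z).inv).flip c).comp
      ((pureT F G (U ⊗ V) U V (𝟙 _)).flip b))
    (fun a a' b => by apply LinearMap.ext; intro c; simp)
    (fun k a b => by apply LinearMap.ext; intro c; simp)
    (fun a b b' => by apply LinearMap.ext; intro c; simp)
    (fun k a b => by apply LinearMap.ext; intro c; simp)

theorem assocInvFam_apply (F G H : VectC C) {U V Z : C} (a : F.ev U) (b : G.ev V) (c : H.ev Z) :
    assocInvFam F G H U V Z b c a =
      pureT (day F G) H _ (U ⊗ V) Z (α_ U V Z).inv (pureT F G (U ⊗ V) U V (𝟙 _) a b) c := rfl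

theorem assocInvFam_nat (F G H : VectC C) {U U' V V' Z Z' : C} (f : U ⟶ U') (g : V ⟶ V')
    (h : Z ⟶ Z') (a : F.ev U') (b : G.ev V') (c : H.ev Z') :
    assocInvFam F G H U V Z (G.res g b) (H.res h c) (F.res f a) =
      (day (day F G) H).res (f ⊗ₘ (g ⊗ₘ h)) (assocInvFam F G H U' V' Z' b c a) := by
  rw [assocInvFam_apply, assocInvFam_apply, pureT_rel, res_pureT, Category.id_comp,
    ← Category.comp_id (f ⊗ₘ g), ← res_pureT, pureT_rel]
  congr 3
  simp

/-- `(F ⊗ G) ⊗ H ⟶ F ⊗ (G ⊗ H)`. -/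
noncomputable def assocHom (F G H : VectC C) : day (day F G) H ⟶ day F (day G H) :=
  descL (assocFam F G H) (assocFam_nat F G H)

theorem assocHom_pureT {F G H : VectC C} {X W Z U V : C} (k : X ⟶ W ⊗ Z) (f : W ⟶ U ⊗ V)
    (a : F.ev U) (b : G.ev V) (c : H.ev Z) :
    app (assocHom F G H) X (pureT (day F G) H X W Z k (pureT F G W U V f a b) c) =
      pureT F (day G H) X U (V ⊗ Z) (k ≫ f ▷ Z ≫ (α_ U V Z).hom) a
        (pureT G H (V ⊗ Z) V Z (𝟙 _) b c) := by
  rw [assocHom, descL_pureT, assocFam_apply, res_pureT, Category.assoc]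

/-- `F ⊗ (G ⊗ H) ⟶ (F ⊗ G) ⊗ H`. -/
noncomputable def assocInv (F G H : VectC C) : day F (day G H) ⟶ day (day F G) H :=
  descR (assocInvFam F G H) (assocInvFam_nat F G H)

theorem assocInv_pureT {F G H : VectC C} {X U W V Z : C} (k : X ⟶ U ⊗ W) (f : W ⟶ V ⊗ Z)
    (a : F.ev U) (b : G.ev V) (c : H.ev Z) :
    app (assocInv F G H) X (pureT F (day G H) X U W k a (pureT G H W V Z f b c)) =
      pureT (day F G) H X (U ⊗ V) Z (k ≫ U ◁ f ≫ (α_ U V Z).inv)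
        (pureT F G (U ⊗ V) U V (𝟙 _) a b) c := by
  rw [assocInv, descR_pureT, assocInvFam_apply, res_pureT, Category.assoc]

theorem pureT_left {F G H : VectC C} {X W Z U V : C} (k : X ⟶ W ⊗ Z) (f : W ⟶ U ⊗ V)
    (a : F.ev U) (b : G.ev V) (c : H.ev Z) :
    pureT (day F G) H X W Z k (pureT F G W U V f a b) c =
      pureT (day F G) H X (U ⊗ V) Z (k ≫ f ▷ Z) (pureT F G (U ⊗ V) U V (𝟙 _) a b) c := by
  rw [← pureT_res_left, res_pureT, Category.comp_id]

theorem pureT_right {F G H : VectC C} {X U W V Z : C} (k : X ⟶ U ⊗ W) (f : W ⟶ V ⊗ Z)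
    (a : F.ev U) (b : G.ev V) (c : H.ev Z) :
    pureT F (day G H) X U W k a (pureT G H W V Z f b c) =
      pureT F (day G H) X U (V ⊗ Z) (k ≫ U ◁ f) a (pureT G H (V ⊗ Z) V Z (𝟙 _) b c) := by
  rw [← pureT_res_right, res_pureT, Category.comp_id]

theorem day_extL {F G H T : VectC C} {φ ψ : day (day F G) H ⟶ T}
    (h : ∀ (X W Z U V : C) (k : X ⟶ W ⊗ Z) (f : W ⟶ U ⊗ V) (a : F.ev U) (b : G.ev V) (c : H.ev Z),
      app φ X (pureT (day F G) H X W Z k (pureT F G W U V f a b) c) =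
        app ψ X (pureT (day F G) H X W Z k (pureT F G W U V f a b) c)) : φ = ψ := by
  apply day_ext
  intro X W Z k t c
  induction t using day_induction with
  | zero => simp only [map_zero, LinearMap.zero_apply]
  | add s t hs ht => simp only [map_add, LinearMap.add_apply, hs, ht]
  | mk U V f a b => exact h X W Z U V k f a b c

theorem day_extR {F G H T : VectC C} {φ ψ : day F (day G H) ⟶ T}
    (h : ∀ (X U W V Z : C) (k : X ⟶ U ⊗ W) (f : W ⟶ V ⊗ Z) (a : F.ev U) (b : G.ev V) (c : H.ev Z),
      app φ X (pureT F (day G H) X U W k a (pureT G H W V Z f b c)) =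
        app ψ X (pureT F (day G H) X U W k a (pureT G H W V Z f b c))) : φ = ψ := by
  apply day_ext
  intro X U W k a t
  induction t using day_induction with
  | zero => simp only [map_zero]
  | add s t hs ht => simp only [map_add, hs, ht]
  | mk V Z f b c => exact h X U W V Z k f a b c

/-- The associator of the Day convolution. -/
noncomputable def dayAssoc (F G H : VectC C) : day (day F G) H ≅ day F (day G H) where
  hom := assocHom F G H
  inv := assocInv F G H
  hom_inv_id := by
    apply day_extL
    intro X W Z U V k f a b c
    rw [app_comp, assocHom_pureT, assocInv_pureT, app_id, pureT_left k f]
    congr 3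
    simp
  inv_hom_id := by
    apply day_extR
    intro X U W V Z k f a b c
    rw [app_comp, assocInv_pureT, assocHom_pureT, app_id, pureT_right k f]
    congr 3
    simp

/-- The bilinear map `(k, b) ↦ F(λ ∘ (k ⊗ V)) b`. -/
noncomputable def leftUnitFam (F : VectC C) (U V : C) :
    (U ⟶ 𝟙_ C) →ₗ[ℂ] F.ev V →ₗ[ℂ] F.ev (U ⊗ V) where
  toFun k := F.res (k ▷ V ≫ (λ_ V).hom)
  map_add' k k' := by
    rw [MonoidalPreadditive.add_whiskerRight, Preadditive.add_comp]
    exact map_add (F.resL _ _) _ _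
  map_smul' c k := by
    rw [MonoidalLinear.smul_whiskerRight, Linear.smul_comp]
    exact map_smul (F.resL _ _) _ _

theorem leftUnitFam_nat (F : VectC C) {U U' V V' : C} (g : U ⟶ U') (h : V ⟶ V')
    (k : (yo (𝟙_ C)).ev U') (b : F.ev V') :
    leftUnitFam F U V ((yo (𝟙_ C)).res g k) (F.res h b) =
      F.res (g ⊗ₘ h) (leftUnitFam F U' V' k b) := by
  revert k
  change ∀ k : U' ⟶ 𝟙_ C, F.res ((g ≫ k) ▷ V ≫ (λ_ V).hom) (F.res h b) =
    F.res (g ⊗ₘ h) (F.res (k ▷ V' ≫ (λ_ V').hom) b)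
  intro k
  rw [← res_comp, ← res_comp]
  congr 2
  simp [MonoidalCategory.tensorHom_def, whisker_exchange_assoc]

/-- `C(-, 𝟙) ⊗ F ⟶ F`. -/
noncomputable def leftUnitHom (F : VectC C) : day (yo (𝟙_ C)) F ⟶ F :=
  desc (leftUnitFam F) (leftUnitFam_nat F)

theorem leftUnitHom_pureT {F : VectC C} {X U V : C} (f : X ⟶ U ⊗ V) (k : U ⟶ 𝟙_ C) (b : F.ev V) :
    app (leftUnitHom F) X (pureT (yo (𝟙_ C)) F X U V f k b) =
      F.res (f ≫ k ▷ V ≫ (λ_ V).hom) b :=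
  (desc_pureT (F := yo (𝟙_ C)) (leftUnitFam F) (leftUnitFam_nat F) f k b).trans
    (F.res_comp f (k ▷ V ≫ (λ_ V).hom) b).symm

/-- The bilinear map `(a, k) ↦ F(ρ ∘ (U ⊗ k)) a`. -/
noncomputable def rightUnitFam (F : VectC C) (U V : C) :
    F.ev U →ₗ[ℂ] (V ⟶ 𝟙_ C) →ₗ[ℂ] F.ev (U ⊗ V) :=
  LinearMap.flip
    { toFun := fun k => F.res (U ◁ k ≫ (ρ_ U).hom)
      map_add' := fun k k' => by
        rw [MonoidalPreadditive.whiskerLeft_add, Preadditive.add_comp]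
        exact map_add (F.resL _ _) _ _
      map_smul' := fun c k => by
        rw [MonoidalLinear.whiskerLeft_smul, Linear.smul_comp]
        exact map_smul (F.resL _ _) _ _ }

theorem rightUnitFam_nat (F : VectC C) {U U' V V' : C} (g : U ⟶ U') (h : V ⟶ V')
    (a : F.ev U') (k : (yo (𝟙_ C)).ev V') :
    rightUnitFam F U V (F.res g a) ((yo (𝟙_ C)).res h k) =
      F.res (g ⊗ₘ h) (rightUnitFam F U' V' a k) := by
  revert k
  change ∀ k : V' ⟶ 𝟙_ C, F.res (U ◁ (h ≫ k) ≫ (ρ_ U).hom) (F.res g a) =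
    F.res (g ⊗ₘ h) (F.res (U' ◁ k ≫ (ρ_ U').hom) a)
  intro k
  rw [← res_comp, ← res_comp]
  congr 2
  simp [MonoidalCategory.tensorHom_def', ← whisker_exchange_assoc]

/-- `F ⊗ C(-, 𝟙) ⟶ F`. -/
noncomputable def rightUnitHom (F : VectC C) : day F (yo (𝟙_ C)) ⟶ F :=
  desc (rightUnitFam F) (rightUnitFam_nat F)

theorem rightUnitHom_pureT {F : VectC C} {X U V : C} (f : X ⟶ U ⊗ V) (a : F.ev U) (k : V ⟶ 𝟙_ C) :
    app (rightUnitHom F) X (pureT F (yo (𝟙_ C)) X U V f a k) =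
      F.res (f ≫ U ◁ k ≫ (ρ_ U).hom) a :=
  (desc_pureT (G := yo (𝟙_ C)) (rightUnitFam F) (rightUnitFam_nat F) f a k).trans
    (F.res_comp f (U ◁ k ≫ (ρ_ U).hom) a).symm

/-- An element of a representable presheaf. -/
abbrev yoElt {X U : C} (k : X ⟶ U) : (yo U).ev X := k

theorem yoElt_eq {X U : C} (k : X ⟶ U) : yoElt k = (yo U).res k (yoElt (𝟙 U)) :=
  (Category.comp_id k).symm

theorem pureT_yo_left {F : VectC C} {X U V W : C} (f : X ⟶ U ⊗ V) (k : U ⟶ W) (b : F.ev V) :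
    pureT (yo W) F X U V f k b = pureT (yo W) F X W V (f ≫ k ▷ V) (yoElt (𝟙 W)) b :=
  (congrArg (fun z => pureT (yo W) F X U V f z b) (yoElt_eq k)).trans
    (pureT_res_left (F := yo W) f k (yoElt (𝟙 W)) b)

theorem pureT_yo_right {F : VectC C} {X U V W : C} (f : X ⟶ U ⊗ V) (a : F.ev U) (k : V ⟶ W) :
    pureT F (yo W) X U V f a k = pureT F (yo W) X U W (f ≫ U ◁ k) a (yoElt (𝟙 W)) :=
  (congrArg (fun z => pureT F (yo W) X U V f a z) (yoElt_eq k)).trans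
    (pureT_res_right (G := yo W) f k a (yoElt (𝟙 W)))

/-- The left unitor of the Day convolution. -/
noncomputable def dayLeftUnitor (F : VectC C) : day (yo (𝟙_ C)) F ≅ F where
  hom := leftUnitHom F
  inv := homMk
    (fun X => pureT (yo (𝟙_ C)) F X (𝟙_ C) X (λ_ X).inv (yoElt (𝟙 (𝟙_ C))))
    (fun {X Y} f b => by
      rw [pureT_res_right, res_pureT, leftUnitor_inv_naturality])
  hom_inv_id := by
    apply day_ext
    intro X U V f k b
    rw [app_comp, leftUnitHom_pureT f k b, app_homMk, app_id, pureT_res_right]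
    refine Eq.trans ?_ (pureT_yo_left f k b).symm
    congr 3
    rw [← leftUnitor_inv_naturality]
    simp
  inv_hom_id := by
    apply ext_app
    intro X b
    rw [app_comp, app_homMk, leftUnitHom_pureT]
    simp

/-- The right unitor of the Day convolution. -/
noncomputable def dayRightUnitor (F : VectC C) : day F (yo (𝟙_ C)) ≅ F where
  hom := rightUnitHom F
  inv := homMk
    (fun X => (pureT F (yo (𝟙_ C)) X X (𝟙_ C) (ρ_ X).inv).flip (yoElt (𝟙 (𝟙_ C))))
    (fun {X Y} f b => by
      rw [LinearMap.flip_apply, LinearMap.flip_apply, pureT_res_left, res_pureT,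
        rightUnitor_inv_naturality])
  hom_inv_id := by
    apply day_ext
    intro X U V f a k
    rw [app_comp, rightUnitHom_pureT f a k, app_homMk, app_id, LinearMap.flip_apply, pureT_res_left]
    refine Eq.trans ?_ (pureT_yo_right f a k).symm
    congr 3
    rw [← rightUnitor_inv_naturality]
    simp
  inv_hom_id := by
    apply ext_app
    intro X b
    rw [app_comp, app_homMk, LinearMap.flip_apply, rightUnitHom_pureT]
    simp

noncomputable instance : MonoidalCategoryStruct (VectC C) where
  tensorObj := day
  tensorUnit := yo (𝟙_ C)
  tensorHom := dayMap
  whiskerLeft F _ _ t := dayMap (𝟙 F) t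
  whiskerRight s G := dayMap s (𝟙 G)
  associator := dayAssoc
  leftUnitor := dayLeftUnitor
  rightUnitor := dayRightUnitor

end VectC

end Monoidal

/-! ### Coherence -/

section Coherence

variable {C : Type u} [SmallCategory C] [Preadditive C] [Linear ℂ C] [MonoidalCategory C]
  [MonoidalPreadditive C] [MonoidalLinear ℂ C]

namespace VectC

theorem dayMap_id (F G : VectC C) : dayMap (𝟙 F) (𝟙 G) = 𝟙 (day F G) := by
  apply day_ext
  intro X U V f a b
  rw [dayMap_pureT]; rfl

theorem dayMap_comp {F F' F'' G G' G'' : VectC C} (s : F ⟶ F') (s' : F' ⟶ F'') (t : G ⟶ G')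
    (t' : G' ⟶ G'') : dayMap s t ≫ dayMap s' t' = dayMap (s ≫ s') (t ≫ t') := by
  apply day_ext
  intro X U V f a b
  rw [app_comp, dayMap_pureT, dayMap_pureT, dayMap_pureT, app_comp, app_comp]

theorem dayAssoc_naturality {F F' G G' H H' : VectC C} (s : F ⟶ F') (t : G ⟶ G') (r : H ⟶ H') :
    dayMap (dayMap s t) r ≫ assocHom F' G' H' = assocHom F G H ≫ dayMap s (dayMap t r) := by
  apply day_extL
  intro X W Z U V k f a b c
  rw [app_comp, app_comp, assocHom_pureT, dayMap_pureT, dayMap_pureT, dayMap_pureT, dayMap_pureT,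
    assocHom_pureT]

theorem dayLeftUnitor_naturality {F F' : VectC C} (s : F ⟶ F') :
    dayMap (𝟙 (yo (𝟙_ C))) s ≫ leftUnitHom F' = leftUnitHom F ≫ s := by
  apply day_ext
  intro X U V f k b
  rw [app_comp, app_comp, dayMap_pureT, leftUnitHom_pureT f k b, app_res]
  exact leftUnitHom_pureT f k _

theorem dayRightUnitor_naturality {F F' : VectC C} (s : F ⟶ F') :
    dayMap s (𝟙 (yo (𝟙_ C))) ≫ rightUnitHom F' = rightUnitHom F ≫ s := by
  apply day_ext
  intro X U V f a k
  rw [app_comp, app_comp, dayMap_pureT, rightUnitHom_pureT f a k, app_res]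
  exact rightUnitHom_pureT f _ k

theorem day_triangle (F G : VectC C) :
    assocHom F (yo (𝟙_ C)) G ≫ dayMap (𝟙 F) (leftUnitHom G) =
      dayMap (rightUnitHom F) (𝟙 G) := by
  apply day_extL
  intro X W Z U V k f a x b
  rw [app_comp, assocHom_pureT, dayMap_pureT, dayMap_pureT, leftUnitHom_pureT _ x b,
    rightUnitHom_pureT _ a x, app_id, app_id, pureT_res_right, pureT_res_left]
  congr 3
  have e : ∀ x : V ⟶ 𝟙_ C, (k ≫ f ▷ Z ≫ (α_ U V Z).hom) ≫ U ◁ (𝟙 (V ⊗ Z) ≫ x ▷ Z ≫ (λ_ Z).hom) =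
      k ≫ (f ≫ U ◁ x ≫ (ρ_ U).hom) ▷ Z := by
    intro x
    simp only [comp_whiskerRight, MonoidalCategory.whiskerLeft_comp, Category.assoc,
      MonoidalCategory.whiskerLeft_id, Category.id_comp]
    rw [← MonoidalCategory.triangle, associator_naturality_middle_assoc]
  exact e x

theorem day_pentagon (F G H K : VectC C) :
    dayMap (assocHom F G H) (𝟙 K) ≫ assocHom F (day G H) K ≫ dayMap (𝟙 F) (assocHom G H K) =
      assocHom (day F G) H K ≫ assocHom F G (day H K) := by
  apply day_extL
  intro X W Z U V k f t c d
  induction t using day_induction with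
  | zero => simp only [map_zero, LinearMap.zero_apply]
  | add s t hs ht => simp only [map_add, LinearMap.add_apply, hs, ht]
  | mk U' V' f' a b =>
    simp only [app_comp]
    rw [dayMap_pureT, assocHom_pureT, assocHom_pureT, dayMap_pureT, assocHom_pureT, assocHom_pureT,
      assocHom_pureT, pureT_right, app_id, app_id, pureT_right (F := G)]
    congr 3
    simp

noncomputable instance : MonoidalCategory (VectC C) :=
  MonoidalCategory.ofTensorHom
    (id_tensorHom_id := dayMap_id)
    (id_tensorHom := fun _ _ _ _ => rfl)
    (tensorHom_id := fun _ _ => rfl)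
    (tensorHom_comp_tensorHom := fun s t s' t' => dayMap_comp s s' t t')
    (associator_naturality := fun s t r => dayAssoc_naturality s t r)
    (leftUnitor_naturality := fun s => dayLeftUnitor_naturality s)
    (rightUnitor_naturality := fun s => dayRightUnitor_naturality s)
    (pentagon := day_pentagon)
    (triangle := day_triangle)

theorem tensor_eq (F G : VectC C) : F ⊗ G = day F G := rfl

theorem app_tensorHom_pureT {F F' G G' : VectC C} (s : F ⟶ F') (t : G ⟶ G') {X U V : C}
    (f : X ⟶ U ⊗ V) (a : F.ev U) (b : G.ev V) :
    app (s ⊗ₘ t) X (pureT F G X U V f a b) = pureT F' G' X U V f (app s U a) (app t V b) :=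
  dayMap_pureT s t f a b

theorem app_whiskerLeft_pureT (F : VectC C) {G G' : VectC C} (t : G ⟶ G') {X U V : C}
    (f : X ⟶ U ⊗ V) (a : F.ev U) (b : G.ev V) :
    app (F ◁ t) X (pureT F G X U V f a b) = pureT F G' X U V f a (app t V b) :=
  dayMap_pureT (𝟙 F) t f a b

theorem app_whiskerRight_pureT {F F' : VectC C} (s : F ⟶ F') (G : VectC C) {X U V : C}
    (f : X ⟶ U ⊗ V) (a : F.ev U) (b : G.ev V) :
    app (s ▷ G) X (pureT F G X U V f a b) = pureT F' G X U V f (app s U a) b :=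
  dayMap_pureT s (𝟙 G) f a b

theorem app_associator_hom_pureT {F G H : VectC C} {X W Z U V : C} (k : X ⟶ W ⊗ Z)
    (f : W ⟶ U ⊗ V) (a : F.ev U) (b : G.ev V) (c : H.ev Z) :
    app (α_ F G H).hom X (pureT (day F G) H X W Z k (pureT F G W U V f a b) c) =
      pureT F (day G H) X U (V ⊗ Z) (k ≫ f ▷ Z ≫ (α_ U V Z).hom) a
        (pureT G H (V ⊗ Z) V Z (𝟙 _) b c) :=
  assocHom_pureT k f a b c

theorem app_associator_inv_pureT {F G H : VectC C} {X U W V Z : C} (k : X ⟶ U ⊗ W)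
    (f : W ⟶ V ⊗ Z) (a : F.ev U) (b : G.ev V) (c : H.ev Z) :
    app (α_ F G H).inv X (pureT F (day G H) X U W k a (pureT G H W V Z f b c)) =
      pureT (day F G) H X (U ⊗ V) Z (k ≫ U ◁ f ≫ (α_ U V Z).inv)
        (pureT F G (U ⊗ V) U V (𝟙 _) a b) c :=
  assocInv_pureT k f a b c

instance : MonoidalPreadditive (VectC C) where
  whiskerLeft_zero {F G G'} := day_ext fun X U V f a b =>
    (app_whiskerLeft_pureT F 0 f a b).trans (map_zero (pureT F G' X U V f a))
  zero_whiskerRight {F G G'} := day_ext fun X U V f a b =>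
    (app_whiskerRight_pureT 0 F f a b).trans
      (LinearMap.congr_fun (map_zero (pureT G' F X U V f)) b)
  whiskerLeft_add {F G G'} s t := day_ext fun X U V f a b => by
    rw [app_add]
    refine (app_whiskerLeft_pureT F (s + t) f a b).trans ?_
    rw [app_add, map_add]
    exact congrArg₂ _ (app_whiskerLeft_pureT F s f a b).symm
      (app_whiskerLeft_pureT F t f a b).symm
  add_whiskerRight {F G G'} s t := day_ext fun X U V f a b => by
    rw [app_add]
    refine (app_whiskerRight_pureT (s + t) F f a b).trans ?_
    rw [app_add, map_add, LinearMap.add_apply]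
    exact congrArg₂ _ (app_whiskerRight_pureT s F f a b).symm
      (app_whiskerRight_pureT t F f a b).symm

instance : MonoidalLinear ℂ (VectC C) where
  whiskerLeft_smul F {G G'} c s := day_ext fun X U V f a b => by
    rw [app_smul]
    refine (app_whiskerLeft_pureT F (c • s) f a b).trans ?_
    rw [app_smul, map_smul]
    exact congrArg _ (app_whiskerLeft_pureT F s f a b).symm
  smul_whiskerRight c {G G'} s F := day_ext fun X U V f a b => by
    rw [app_smul]
    refine (app_whiskerRight_pureT (c • s) F f a b).trans ?_
    rw [app_smul, map_smul, LinearMap.smul_apply]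
    exact congrArg _ (app_whiskerRight_pureT s F f a b).symm

end VectC

end Coherence

/-! ### Representable presheaves and tensor products -/

section YonedaTensor

variable {C : Type u} [SmallCategory C] [Preadditive C] [Linear ℂ C] [MonoidalCategory C]
  [MonoidalPreadditive C] [MonoidalLinear ℂ C]

namespace VectC

/-- The bilinear map `(f, g) ↦ f ⊗ g`. -/
noncomputable def yoTensorFam (V W U U' : C) :
    (U ⟶ V) →ₗ[ℂ] (U' ⟶ W) →ₗ[ℂ] (U ⊗ U' ⟶ V ⊗ W) :=
  LinearMap.mk₂ ℂ (fun f g => f ⊗ₘ g)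
    (fun f f' g => by simp [MonoidalCategory.tensorHom_def])
    (fun c f g => by simp [MonoidalCategory.tensorHom_def])
    (fun f g g' => by simp [MonoidalCategory.tensorHom_def])
    (fun c f g => by simp [MonoidalCategory.tensorHom_def])

theorem yoTensorFam_nat (V W : C) {U₁ U₂ U₁' U₂' : C} (g : U₁ ⟶ U₂) (h : U₁' ⟶ U₂')
    (a : (yo V).ev U₂) (b : (yo W).ev U₂') :
    (yoTensorFam V W U₁ U₁' ((yo V).res g a) ((yo W).res h b) : (yo (V ⊗ W)).ev (U₁ ⊗ U₁')) =
      (yo (V ⊗ W)).res (g ⊗ₘ h) (yoTensorFam V W U₂ U₂' a b) := by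
  revert a b
  change ∀ (a : U₂ ⟶ V) (b : U₂' ⟶ W), (g ≫ a) ⊗ₘ (h ≫ b) = (g ⊗ₘ h) ≫ (a ⊗ₘ b)
  intro a b
  rw [tensorHom_comp_tensorHom]

/-- `C(-, V) ⊗ C(-, W) ⟶ C(-, V ⊗ W)`, sending `f ⊗ g` to the tensor product of `f` and `g`. -/
noncomputable def yoTensorHom (V W : C) : yo V ⊗ yo W ⟶ yo (V ⊗ W) :=
  desc (F := yo V) (G := yo W) (H := yo (V ⊗ W)) (yoTensorFam V W) (yoTensorFam_nat V W)

theorem yoTensorHom_pureT {V W X U U' : C} (f : X ⟶ U ⊗ U') (a : U ⟶ V) (b : U' ⟶ W) :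
    app (yoTensorHom V W) X (pureT (yo V) (yo W) X U U' f a b) = f ≫ (a ⊗ₘ b) :=
  desc_pureT (F := yo V) (G := yo W) (H := yo (V ⊗ W)) (yoTensorFam V W) (yoTensorFam_nat V W)
    f a b

/-- The Yoneda embedding is monoidal: `C(-, V) ⊗ C(-, W) ≅ C(-, V ⊗ W)`. -/
noncomputable def yoTensor (V W : C) : yo V ⊗ yo W ≅ yo (V ⊗ W) where
  hom := yoTensorHom V W
  inv := yoDesc (F := day (yo V) (yo W))
    (pureT (yo V) (yo W) (V ⊗ W) V W (𝟙 _) (yoElt (𝟙 V)) (yoElt (𝟙 W)))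
  hom_inv_id := by
    apply day_ext
    intro X U U' f a b
    have e : app (yoTensorHom V W) X (pureT (yo V) (yo W) X U U' f a b) =
        (f ≫ (yoElt a ⊗ₘ yoElt b) : X ⟶ V ⊗ W) := yoTensorHom_pureT f a b
    rw [app_comp, e]
    refine (app_yoDesc _ _).trans ((res_pureT _ _ _ _).trans ?_)
    refine Eq.trans ?_ ((pureT_yo_left f a b).trans (pureT_yo_right _ _ b)).symm
    congr 3
    rw [Category.comp_id, Category.assoc]
    exact congrArg (f ≫ ·) (MonoidalCategory.tensorHom_def (yoElt a) (yoElt b))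
  inv_hom_id := by
    apply ext_app
    intro X k
    rw [app_comp, app_id]
    refine (congrArg (app (yoTensorHom V W) X) (res_pureT (F := yo V) (G := yo W) k _ _ _)).trans ?_
    refine (yoTensorHom_pureT _ _ _).trans ?_
    rw [id_tensorHom_id, Category.comp_id]
    exact Category.comp_id (obj := C) _

end VectC

end YonedaTensor

/-! ### Modules over an algebra in the center -/

section CenterAlgebra

variable {D : Type*} [Category D] [MonoidalCategory D]

/-- The algebra in `D` underlying an algebra in the Drinfeld center of `D`. -/
instance centerMonObj (A : Mon (Center D)) : MonObj A.X.1 where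
  one := A.mon.one.f
  mul := A.mon.mul.f
  one_mul := congrArg Center.Hom.f A.mon.one_mul
  mul_one := congrArg Center.Hom.f A.mon.mul_one
  mul_assoc := congrArg Center.Hom.f A.mon.mul_assoc

/-- The left action of an algebra `A` on the free module `A ⊗ X`. -/
def freeAct (A : D) [MonObj A] (X : D) : A ⊗ (A ⊗ X) ⟶ A ⊗ X :=
  (α_ A A X).inv ≫ MonObj.mul ▷ X

theorem whiskerLeft_freeAct (A : D) [MonObj A] {X Y : D} (f : X ⟶ Y) :
    A ◁ A ◁ f ≫ freeAct A Y = freeAct A X ≫ A ◁ f := by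
  simp only [freeAct, Category.assoc]
  rw [associator_inv_naturality_right_assoc, whisker_exchange]

theorem whiskerLeft_associator_freeAct (A : D) [MonObj A] (X Y : D) :
    A ◁ (α_ A X Y).hom ≫ freeAct A (X ⊗ Y) =
      (α_ A (A ⊗ X) Y).inv ≫ freeAct A X ▷ Y ≫ (α_ A X Y).hom := by
  simp only [freeAct, comp_whiskerRight, Category.assoc]
  monoidal

theorem whiskerLeft_mul_freeAct (A : D) [MonObj A] :
    A ◁ ((MonObj.mul (X := A)) ≫ (ρ_ A).inv) ≫ freeAct A (𝟙_ D) =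
      freeAct A A ≫ MonObj.mul ≫ (ρ_ A).inv := by
  simp only [freeAct, Category.assoc]
  rw [MonObj.mul_assoc_assoc, Iso.inv_hom_id_assoc, MonoidalCategory.whiskerLeft_comp,
    Category.assoc]
  congr 1
  rw [rightUnitor_inv_naturality]
  monoidal

theorem mul_whiskerRight_comm (A : Mon (Center D)) (U : D) :
    (MonObj.mul (X := A.X.1)) ▷ U ≫ (A.X.2.β U).hom =
      (α_ A.X.1 A.X.1 U).hom ≫ A.X.1 ◁ (A.X.2.β U).hom ≫ (α_ A.X.1 U A.X.1).inv ≫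
        (A.X.2.β U).hom ▷ A.X.1 ≫ (α_ U A.X.1 A.X.1).hom ≫ U ◁ (MonObj.mul (X := A.X.1)) := by
  refine (A.mon.mul.comm U).trans ?_
  have e : ∀ m : U ⊗ (A.X.1 ⊗ A.X.1) ⟶ U ⊗ A.X.1,
      ((Center.tensorObj A.X A.X).2.β U).hom ≫ m =
        (α_ A.X.1 A.X.1 U).hom ≫ A.X.1 ◁ (A.X.2.β U).hom ≫ (α_ A.X.1 U A.X.1).inv ≫
          (A.X.2.β U).hom ▷ A.X.1 ≫ (α_ U A.X.1 A.X.1).hom ≫ m := by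
    intro m
    change ((α_ A.X.1 A.X.1 U).hom ≫ A.X.1 ◁ (A.X.2.β U).hom ≫ (α_ A.X.1 U A.X.1).inv ≫
      (A.X.2.β U).hom ▷ A.X.1 ≫ (α_ U A.X.1 A.X.1).hom) ≫ m = _
    simp only [Category.assoc]
  exact e _

/-- The half-braiding induces `A ⊗ (U ⊗ X) ≅ U ⊗ (A ⊗ X)`. -/
def braidPast (A : Center D) (U X : D) : A.1 ⊗ (U ⊗ X) ≅ U ⊗ (A.1 ⊗ X) :=
  (α_ A.1 U X).symm ≪≫ whiskerRightIso (A.2.β U) X ≪≫ α_ U A.1 X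

theorem braidPast_naturality (A : Center D) (U : D) {X Y : D} (f : X ⟶ Y) :
    A.1 ◁ U ◁ f ≫ (braidPast A U Y).hom = (braidPast A U X).hom ≫ U ◁ A.1 ◁ f := by
  simp only [braidPast, Iso.trans_hom, Iso.symm_hom, whiskerRightIso_hom, Category.assoc]
  rw [associator_inv_naturality_right_assoc, whisker_exchange_assoc, associator_naturality_right]

theorem freeAct_braidPast (A : Mon (Center D)) (U X : D) :
    freeAct A.X.1 (U ⊗ X) ≫ (braidPast A.X U X).hom =
      A.X.1 ◁ (braidPast A.X U X).hom ≫ (braidPast A.X U (A.X.1 ⊗ X)).hom ≫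
        U ◁ freeAct A.X.1 X := by
  have h := mul_whiskerRight_comm A U
  simp only [braidPast, Iso.trans_hom, Iso.symm_hom, whiskerRightIso_hom, Category.assoc, freeAct]
  rw [associator_inv_naturality_left_assoc, ← comp_whiskerRight_assoc, h]
  monoidal

end CenterAlgebra

/-! ### Free modules -/

section FreeModules

variable {C : Type u} [SmallCategory C] [Preadditive C] [Linear ℂ C] [MonoidalCategory C]
  [MonoidalPreadditive C] [MonoidalLinear ℂ C]

open VectC

/-- The space of `A`-linear maps `A ⊗ X ⟶ A ⊗ Y`. -/
noncomputable def freeHom (A : VectC C) [MonObj A] (X Y : VectC C) :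
    Submodule ℂ (A ⊗ X ⟶ A ⊗ Y) where
  carrier := {f | A ◁ f ≫ freeAct A Y = freeAct A X ≫ f}
  add_mem' {f g} hf hg := by
    simp only [Set.mem_ofPred_eq] at hf hg ⊢
    rw [MonoidalPreadditive.whiskerLeft_add, Preadditive.add_comp, Preadditive.comp_add, hf, hg]
  zero_mem' := by simp
  smul_mem' c f hf := by
    simp only [Set.mem_ofPred_eq] at hf ⊢
    rw [MonoidalLinear.whiskerLeft_smul, Linear.smul_comp, Linear.comp_smul, hf]

theorem mem_freeHom {A : VectC C} [MonObj A] {X Y : VectC C} {f : A ⊗ X ⟶ A ⊗ Y} :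
    f ∈ freeHom A X Y ↔ A ◁ f ≫ freeAct A Y = freeAct A X ≫ f := Iff.rfl

/-- The category of free left `A`-modules `A ⊗ V`, `V ∈ C`, and `A`-linear maps.
The object `V` stands for the module `A ⊗ C(-, V)`. -/
@[ext]
structure FreeMod (A : VectC C) where
  /-- The object `V` of `C` generating `A ⊗ V`. -/
  gen : C

namespace FreeMod

variable (A : VectC C) [MonObj A]

noncomputable instance : Category (FreeMod A) where
  Hom V W := freeHom A (yo V.gen) (yo W.gen)
  id V := ⟨𝟙 _, by simp [mem_freeHom]⟩
  comp f g := ⟨f.1 ≫ g.1, by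
    have hf := mem_freeHom.mp f.2
    have hg := mem_freeHom.mp g.2
    rw [mem_freeHom, MonoidalCategory.whiskerLeft_comp, Category.assoc, hg, reassoc_of% hf]⟩

variable {A}

/-- The `A`-linear map `A ⊗ V ⟶ A ⊗ W` of presheaves underlying a morphism. -/
noncomputable def map {V W : FreeMod A} (f : V ⟶ W) : A ⊗ yo V.gen ⟶ A ⊗ yo W.gen := f.1

theorem map_mem {V W : FreeMod A} (f : V ⟶ W) :
    A ◁ map f ≫ freeAct A (yo W.gen) = freeAct A (yo V.gen) ≫ map f := f.2

/-- A morphism of free modules from an `A`-linear map of presheaves. -/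
noncomputable def mkHom {V W : FreeMod A} (f : A ⊗ yo V.gen ⟶ A ⊗ yo W.gen)
    (h : A ◁ f ≫ freeAct A (yo W.gen) = freeAct A (yo V.gen) ≫ f) : V ⟶ W := ⟨f, h⟩

@[simp] theorem map_mkHom {V W : FreeMod A} (f : A ⊗ yo V.gen ⟶ A ⊗ yo W.gen)
    (h : A ◁ f ≫ freeAct A (yo W.gen) = freeAct A (yo V.gen) ≫ f) : map (mkHom f h) = f := rfl

@[ext]
theorem hom_ext {V W : FreeMod A} {f g : V ⟶ W} (h : map f = map g) : f = g := Subtype.ext h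

@[simp] theorem map_id (V : FreeMod A) : map (𝟙 V) = 𝟙 _ := rfl

@[simp] theorem map_comp {V W Z : FreeMod A} (f : V ⟶ W) (g : W ⟶ Z) :
    map (f ≫ g) = map f ≫ map g := rfl

noncomputable instance : Preadditive (FreeMod A) where
  homGroup V W := inferInstanceAs (AddCommGroup (freeHom A (yo V.gen) (yo W.gen)))
  add_comp _ _ _ _ _ _ := hom_ext (Preadditive.add_comp ..)
  comp_add _ _ _ _ _ _ := hom_ext (Preadditive.comp_add ..)

noncomputable instance : Linear ℂ (FreeMod A) where
  homModule V W := inferInstanceAs (Module ℂ (freeHom A (yo V.gen) (yo W.gen)))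
  smul_comp _ _ _ _ _ _ := hom_ext (Linear.smul_comp ..)
  comp_smul _ _ _ _ _ _ := hom_ext (Linear.comp_smul ..)

variable (A) in
/-- The free module `A ⊗ V`. -/
abbrev of (V : C) : FreeMod A := ⟨V⟩

/-- The free morphism `A ⊗ g`. -/
noncomputable def freeMap {V W : C} (g : V ⟶ W) : of A V ⟶ of A W :=
  mkHom (A ◁ yoMap g) (whiskerLeft_freeAct A (yoMap g))

/-- `(A ⊗ V) ⊗ Y ≅ A ⊗ (V ⊗ Y)`. -/
noncomputable def reassocIso (A : VectC C) (V Y : C) : (A ⊗ yo V) ⊗ yo Y ≅ A ⊗ yo (V ⊗ Y) :=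
  α_ A (yo V) (yo Y) ≪≫ whiskerLeftIso A (yoTensor V Y)

theorem freeAct_reassocIso (V Y : C) :
    A ◁ (reassocIso A V Y).hom ≫ freeAct A (yo (V ⊗ Y)) =
      (α_ A (A ⊗ yo V) (yo Y)).inv ≫ freeAct A (yo V) ▷ yo Y ≫ (reassocIso A V Y).hom := by
  simp only [reassocIso, Iso.trans_hom, whiskerLeftIso_hom, MonoidalCategory.whiskerLeft_comp,
    Category.assoc, whiskerLeft_freeAct]
  rw [← Category.assoc, whiskerLeft_associator_freeAct, Category.assoc, Category.assoc]

theorem freeAct_reassocIso_inv (V Y : C) :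
    A ◁ (reassocIso A V Y).inv ≫ (α_ A (A ⊗ yo V) (yo Y)).inv ≫ freeAct A (yo V) ▷ yo Y =
      freeAct A (yo (V ⊗ Y)) ≫ (reassocIso A V Y).inv := by
  rw [Iso.eq_comp_inv, Category.assoc, Category.assoc, ← freeAct_reassocIso, ← Category.assoc,
    ← MonoidalCategory.whiskerLeft_comp, Iso.inv_hom_id, MonoidalCategory.whiskerLeft_id,
    Category.id_comp]

theorem rightWh_mem {V W : C} {f : A ⊗ yo V ⟶ A ⊗ yo W}
    (hf : A ◁ f ≫ freeAct A (yo W) = freeAct A (yo V) ≫ f) (Y : C) :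
    A ◁ ((reassocIso A V Y).inv ≫ f ▷ yo Y ≫ (reassocIso A W Y).hom) ≫ freeAct A (yo (W ⊗ Y)) =
      freeAct A (yo (V ⊗ Y)) ≫ (reassocIso A V Y).inv ≫ f ▷ yo Y ≫ (reassocIso A W Y).hom := by
  have h : A ◁ f ▷ yo Y ≫ (α_ A (A ⊗ yo W) (yo Y)).inv ≫ freeAct A (yo W) ▷ yo Y =
      (α_ A (A ⊗ yo V) (yo Y)).inv ≫ freeAct A (yo V) ▷ yo Y ≫ f ▷ yo Y := by
    rw [associator_inv_naturality_middle_assoc, ← comp_whiskerRight, hf, comp_whiskerRight]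
  rw [MonoidalCategory.whiskerLeft_comp, MonoidalCategory.whiskerLeft_comp, Category.assoc,
    Category.assoc, freeAct_reassocIso, reassoc_of% h, ← reassoc_of% (freeAct_reassocIso_inv V Y)]

/-- The right action of `Y` on morphisms of free modules, `f ↦ f ⊗ Y`. -/
noncomputable def rightWh {V W : C} (f : of A V ⟶ of A W) (Y : C) :
    of A (V ⊗ Y) ⟶ of A (W ⊗ Y) :=
  mkHom ((reassocIso A V Y).inv ≫ map f ▷ yo Y ≫ (reassocIso A W Y).hom)
    (rightWh_mem (map_mem f) Y)

/-- The morphism `A ⊗ U ⟶ A`, `x ⊗ u ↦ x · a(u)`, of free modules given by `a ∈ A(U)`. -/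
noncomputable def hat {U : C} (a : A.ev U) : of A U ⟶ of A (𝟙_ C) :=
  mkHom (A ◁ yoDesc a ≫ MonObj.mul ≫ (ρ_ A).inv) (by
    have h := whiskerLeft_mul_freeAct A
    rw [MonoidalCategory.whiskerLeft_comp, Category.assoc]
    refine (congrArg _ h).trans ?_
    rw [← Category.assoc, whiskerLeft_freeAct, Category.assoc])

end FreeMod

namespace FreeMod

variable {A : Mon (Center (VectC C))}

/-- `U ⊗ (A ⊗ V) ≅ A ⊗ (U ⊗ V)`, by means of the half-braiding of `A` with `C(-, U)`. -/
noncomputable def centralIso (A : Mon (Center (VectC C))) (U V : C) :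
    yo U ⊗ (A.X.1 ⊗ yo V) ≅ A.X.1 ⊗ yo (U ⊗ V) :=
  (braidPast A.X (yo U) (yo V)).symm ≪≫ whiskerLeftIso A.X.1 (yoTensor U V)

theorem freeAct_centralIso (U V : C) :
    A.X.1 ◁ (centralIso A U V).hom ≫ freeAct A.X.1 (yo (U ⊗ V)) =
      (braidPast A.X (yo U) (A.X.1 ⊗ yo V)).hom ≫ yo U ◁ freeAct A.X.1 (yo V) ≫
        (centralIso A U V).hom := by
  have h := freeAct_braidPast A (yo U) (yo V)
  rw [← Iso.eq_comp_inv, Category.assoc, Category.assoc] at h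
  simp only [centralIso, Iso.trans_hom, Iso.symm_hom, whiskerLeftIso_hom,
    MonoidalCategory.whiskerLeft_comp, Category.assoc, whiskerLeft_freeAct]
  rw [reassoc_of% h, ← MonoidalCategory.whiskerLeft_comp_assoc, Iso.inv_hom_id,
    MonoidalCategory.whiskerLeft_id, Category.id_comp]

theorem freeAct_centralIso_inv (U V : C) :
    A.X.1 ◁ (centralIso A U V).inv ≫ (braidPast A.X (yo U) (A.X.1 ⊗ yo V)).hom ≫
        yo U ◁ freeAct A.X.1 (yo V) =
      freeAct A.X.1 (yo (U ⊗ V)) ≫ (centralIso A U V).inv := by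
  rw [Iso.eq_comp_inv, Category.assoc, Category.assoc, ← freeAct_centralIso, ← Category.assoc,
    ← MonoidalCategory.whiskerLeft_comp, Iso.inv_hom_id, MonoidalCategory.whiskerLeft_id,
    Category.id_comp]

theorem leftWh_mem (U : C) {V W : C} {f : A.X.1 ⊗ yo V ⟶ A.X.1 ⊗ yo W}
    (hf : A.X.1 ◁ f ≫ freeAct A.X.1 (yo W) = freeAct A.X.1 (yo V) ≫ f) :
    A.X.1 ◁ ((centralIso A U V).inv ≫ yo U ◁ f ≫ (centralIso A U W).hom) ≫
        freeAct A.X.1 (yo (U ⊗ W)) =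
      freeAct A.X.1 (yo (U ⊗ V)) ≫ (centralIso A U V).inv ≫ yo U ◁ f ≫
        (centralIso A U W).hom := by
  have h : A.X.1 ◁ yo U ◁ f ≫ (braidPast A.X (yo U) (A.X.1 ⊗ yo W)).hom ≫
      yo U ◁ freeAct A.X.1 (yo W) = (braidPast A.X (yo U) (A.X.1 ⊗ yo V)).hom ≫
        yo U ◁ freeAct A.X.1 (yo V) ≫ yo U ◁ f := by
    rw [← Category.assoc, braidPast_naturality, Category.assoc,
      ← MonoidalCategory.whiskerLeft_comp, hf, MonoidalCategory.whiskerLeft_comp]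
  rw [MonoidalCategory.whiskerLeft_comp, MonoidalCategory.whiskerLeft_comp, Category.assoc,
    Category.assoc, freeAct_centralIso, reassoc_of% h,
    ← reassoc_of% (freeAct_centralIso_inv (A := A) U V)]

/-- The left action of `U` on morphisms of free modules: `U ⊗ f`, conjugated by the isomorphisms
`U ⊗ (A ⊗ V) ≅ A ⊗ (U ⊗ V)` given by the half-braiding. -/
noncomputable def leftWh (U : C) {V W : C} (f : of A.X.1 V ⟶ of A.X.1 W) :
    of A.X.1 (U ⊗ V) ⟶ of A.X.1 (U ⊗ W) :=
  mkHom ((centralIso A U V).inv ≫ yo U ◁ map f ≫ (centralIso A U W).hom)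
    (leftWh_mem U (map_mem f))

end FreeMod

end FreeModules

/-! ### C*-categories -/

section CStar

/-- A `*`-structure on a complex linear category: an antilinear, involutive, contravariant
functor which is the identity on objects. -/
class DaggerCategory (M : Type*) [Category M] [Preadditive M] [Linear ℂ M] where
  /-- The adjoint of a morphism. -/
  dag {X Y : M} : (X ⟶ Y) → (Y ⟶ X)
  dag_dag {X Y : M} (f : X ⟶ Y) : dag (dag f) = f
  dag_comp {X Y Z : M} (f : X ⟶ Y) (g : Y ⟶ Z) : dag (f ≫ g) = dag g ≫ dag f
  dag_add {X Y : M} (f g : X ⟶ Y) : dag (f + g) = dag f + dag g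
  dag_smul {X Y : M} (c : ℂ) (f : X ⟶ Y) : dag (c • f) = conj c • dag f

open DaggerCategory

attribute [simp] dag_dag

variable {M : Type*} [Category M] [Preadditive M] [Linear ℂ M] [DaggerCategory M]

@[simp] theorem dag_id (X : M) : dag (𝟙 X) = 𝟙 X := by
  have h : dag (𝟙 X ≫ dag (𝟙 X)) = 𝟙 X ≫ dag (𝟙 X) := by rw [dag_comp, dag_dag, Category.id_comp]
  rwa [Category.id_comp, dag_dag, eq_comm] at h

/-- `f* f = 1`. -/
def IsIsometry {X Y : M} (f : X ⟶ Y) : Prop := f ≫ dag f = 𝟙 X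

/-- `f* f = 1` and `f f* = 1`. -/
def IsUnitary {X Y : M} (f : X ⟶ Y) : Prop := f ≫ dag f = 𝟙 X ∧ dag f ≫ f = 𝟙 Y

theorem IsUnitary.id (X : M) : IsUnitary (𝟙 X) := by simp [IsUnitary]

theorem IsUnitary.comp {X Y Z : M} {f : X ⟶ Y} {g : Y ⟶ Z} (hf : IsUnitary f)
    (hg : IsUnitary g) : IsUnitary (f ≫ g) := by
  constructor
  · rw [dag_comp, Category.assoc, reassoc_of% hg.1, hf.1]
  · rw [dag_comp, Category.assoc, reassoc_of% hf.2, hg.2]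

theorem IsUnitary.dag_eq_inv {X Y : M} {e : X ≅ Y} (h : IsUnitary e.hom) :
    dag e.hom = e.inv := by
  rw [← Category.id_comp (dag e.hom), ← e.inv_hom_id, Category.assoc, h.1, Category.comp_id]

theorem IsUnitary.inv {X Y : M} {e : X ≅ Y} (h : IsUnitary e.hom) : IsUnitary e.inv := by
  rw [← h.dag_eq_inv]
  exact ⟨by rw [dag_dag, h.2], by rw [dag_dag, h.1]⟩

/-- The C*-norm: `‖f‖² = sup {|c| : f* f - c is not invertible}`. -/
noncomputable def cnorm {X Y : M} (f : X ⟶ Y) : ℝ :=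
  Real.sqrt (spectralRadius ℂ (A := End X) (f ≫ dag f)).toReal

variable (M) in
/-- A `*`-category is a C*-category if every `f* f` is of the form `g* g` with `g` an endomorphism,
and if `cnorm` is a well-defined complete norm on all morphism spaces, submultiplicative and
satisfying the C*-identity. -/
class IsCStarCategory : Prop where
  exists_sq {X Y : M} (f : X ⟶ Y) : ∃ g : X ⟶ X, f ≫ dag f = g ≫ dag g
  spectralRadius_ne_top {X Y : M} (f : X ⟶ Y) : spectralRadius ℂ (A := End X) (f ≫ dag f) ≠ ⊤
  cnorm_add {X Y : M} (f g : X ⟶ Y) : cnorm (f + g) ≤ cnorm f + cnorm g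
  cnorm_smul {X Y : M} (c : ℂ) (f : X ⟶ Y) : cnorm (c • f) = ‖c‖ * cnorm f
  eq_zero_of_cnorm {X Y : M} (f : X ⟶ Y) : cnorm f = 0 → f = 0
  complete {X Y : M} (f : ℕ → (X ⟶ Y)) :
    (∀ ε > 0, ∃ N, ∀ m ≥ N, ∀ n ≥ N, cnorm (f m - f n) < ε) →
      ∃ g : X ⟶ Y, ∀ ε > 0, ∃ N, ∀ n ≥ N, cnorm (f n - g) < ε
  cnorm_comp {X Y Z : M} (f : X ⟶ Y) (g : Y ⟶ Z) : cnorm (f ≫ g) ≤ cnorm f * cnorm g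
  cnorm_star {X Y : M} (f : X ⟶ Y) : cnorm (f ≫ dag f) = cnorm f ^ 2

variable (M) in
/-- A `*`-category is finitely additive and Karoubi complete if it has a zero object, orthogonal
direct sums of pairs of objects, and if every projection `p = p* = p²` is of the form `v v*`
with `v` an isometry. -/
class IsKaroubiAdditive : Prop where
  exists_zero : ∃ Z : M, 𝟙 Z = 0
  exists_sum (X Y : M) : ∃ (S : M) (i : X ⟶ S) (j : Y ⟶ S), IsIsometry i ∧ IsIsometry j ∧
    i ≫ dag j = 0 ∧ dag i ≫ i + dag j ≫ j = 𝟙 S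
  exists_split {X : M} (p : X ⟶ X) : p ≫ p = p → dag p = p →
    ∃ (Y : M) (v : Y ⟶ X), IsIsometry v ∧ dag v ≫ v = p

end CStar

/-! ### Unitary tensor categories -/

section UTC

open DaggerCategory

variable (C : Type u) [SmallCategory C] [Preadditive C] [Linear ℂ C] [DaggerCategory C]
  [MonoidalCategory C] [MonoidalPreadditive C] [MonoidalLinear ℂ C]

/-- A unitary tensor category: a rigid C*-tensor category with direct sums and subobjects. -/
class IsUnitaryTensorCategory : Prop extends IsCStarCategory C, IsKaroubiAdditive C where
  dag_tensor {U V U' V' : C} (f : U ⟶ V) (g : U' ⟶ V') : dag (f ⊗ₘ g) = dag f ⊗ₘ dag g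
  associator_unitary (U V W : C) : IsUnitary (α_ U V W).hom
  leftUnitor_unitary (U : C) : IsUnitary (λ_ U).hom
  rightUnitor_unitary (U : C) : IsUnitary (ρ_ U).hom
  exists_right_dual (U : C) : ∃ V : C, Nonempty (ExactPairing U V)
  exists_left_dual (U : C) : ∃ V : C, Nonempty (ExactPairing V U)

namespace IsUnitaryTensorCategory

variable {C} [IsUnitaryTensorCategory C]

theorem dag_whiskerLeft (U : C) {V W : C} (f : V ⟶ W) : dag (U ◁ f) = U ◁ dag f := by
  rw [← id_tensorHom, dag_tensor, dag_id, id_tensorHom]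

theorem dag_whiskerRight {V W : C} (f : V ⟶ W) (U : C) : dag (f ▷ U) = dag f ▷ U := by
  rw [← tensorHom_id, dag_tensor, dag_id, tensorHom_id]

theorem dag_associator_hom (U V W : C) : dag (α_ U V W).hom = (α_ U V W).inv :=
  (associator_unitary U V W).dag_eq_inv

theorem dag_associator_inv (U V W : C) : dag (α_ U V W).inv = (α_ U V W).hom := by
  rw [← dag_associator_hom, dag_dag]

theorem dag_leftUnitor_hom (U : C) : dag (λ_ U).hom = (λ_ U).inv :=
  (leftUnitor_unitary U).dag_eq_inv

theorem dag_leftUnitor_inv (U : C) : dag (λ_ U).inv = (λ_ U).hom := by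
  rw [← dag_leftUnitor_hom, dag_dag]

theorem dag_rightUnitor_hom (U : C) : dag (ρ_ U).hom = (ρ_ U).inv :=
  (rightUnitor_unitary U).dag_eq_inv

theorem dag_rightUnitor_inv (U : C) : dag (ρ_ U).inv = (ρ_ U).hom := by
  rw [← dag_rightUnitor_hom, dag_dag]

/-- The adjoint of a duality pairing: if `V` is dual to `U` through `η : 1 ⟶ U ⊗ V` and
`ε : V ⊗ U ⟶ 1`, then `U` is dual to `V` through `ε*` and `η*`. -/
@[reducible]
def dagPairing {U V : C} (p : ExactPairing U V) : ExactPairing V U where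
  coevaluation' := dag (ε_ U V)
  evaluation' := dag (η_ U V)
  coevaluation_evaluation' := by
    have h := congrArg dag (ExactPairing.evaluation_coevaluation U V)
    simp only [dag_comp, dag_whiskerLeft, dag_whiskerRight, dag_associator_hom,
      dag_leftUnitor_hom, dag_rightUnitor_inv, Category.assoc] at h
    exact h
  evaluation_coevaluation' := by
    have h := congrArg dag (ExactPairing.coevaluation_evaluation U V)
    simp only [dag_comp, dag_whiskerLeft, dag_whiskerRight, dag_associator_inv,
      dag_leftUnitor_inv, dag_rightUnitor_hom, Category.assoc] at h
    exact h

end IsUnitaryTensorCategory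

end UTC

/-! ### Bimodule categories -/

section Bimodules

open DaggerCategory
open scoped MonoidalLeftAction MonoidalRightAction

variable (C : Type u) [SmallCategory C] [Preadditive C] [Linear ℂ C] [DaggerCategory C]
  [MonoidalCategory C] [MonoidalPreadditive C] [MonoidalLinear ℂ C]

/-- A `C`-bimodule category: a left and a right action of `C` on `M` commuting up to coherent
isomorphisms `(U ▷ X) ◁ V ≅ U ▷ (X ◁ V)`. -/
class BimoduleCategory (M : Type u) [SmallCategory M] [MonoidalLeftAction C M]
    [MonoidalRightAction C M] where
  /-- The isomorphism `(U ▷ X) ◁ V ≅ U ▷ (X ◁ V)`. -/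
  mid (U : C) (X : M) (V : C) : (U ⊙ₗ X) ⊙ᵣ V ≅ U ⊙ₗ (X ⊙ᵣ V)
  mid_naturality_left {U U' : C} (f : U ⟶ U') (X : M) (V : C) :
    (f ⊵ₗ X) ⊵ᵣ V ≫ (mid U' X V).hom = (mid U X V).hom ≫ f ⊵ₗ (X ⊙ᵣ V)
  mid_naturality_middle (U : C) {X X' : M} (f : X ⟶ X') (V : C) :
    (U ⊴ₗ f) ⊵ᵣ V ≫ (mid U X' V).hom = (mid U X V).hom ≫ U ⊴ₗ (f ⊵ᵣ V)
  mid_naturality_right (U : C) (X : M) {V V' : C} (f : V ⟶ V') :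
    (U ⊙ₗ X) ⊴ᵣ f ≫ (mid U X V').hom = (mid U X V).hom ≫ U ⊴ₗ (X ⊴ᵣ f)
  mid_tensor_left (U U' : C) (X : M) (V : C) :
    (αₗ U U' X).hom ⊵ᵣ V ≫ (mid U (U' ⊙ₗ X) V).hom ≫ U ⊴ₗ (mid U' X V).hom =
      (mid (U ⊗ U') X V).hom ≫ (αₗ U U' (X ⊙ᵣ V)).hom
  mid_tensor_right (U : C) (X : M) (V V' : C) :
    (mid U X (V ⊗ V')).hom ≫ U ⊴ₗ (αᵣ X V V').hom =
      (αᵣ (U ⊙ₗ X) V V').hom ≫ (mid U X V).hom ⊵ᵣ V' ≫ (mid U (X ⊙ᵣ V) V').hom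
  mid_unit_left (X : M) (V : C) :
    (mid (𝟙_ C) X V).hom ≫ (λₗ (X ⊙ᵣ V)).hom = (λₗ X).hom ⊵ᵣ V
  mid_unit_right (U : C) (X : M) :
    (mid U X (𝟙_ C)).hom ≫ U ⊴ₗ (ρᵣ X).hom = (ρᵣ (U ⊙ₗ X)).hom

open BimoduleCategory

/-- A `C`-bimodule C*-category: `M` is a Karoubi complete, finitely additive C*-category, the two
actions are bilinear and `*`-preserving, and all structure isomorphisms are unitary. -/
class IsCStarBimodule (M : Type u) [SmallCategory M] [Preadditive M] [Linear ℂ M]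
    [DaggerCategory M] [MonoidalLeftAction C M] [MonoidalRightAction C M]
    [BimoduleCategory C M] : Prop extends IsCStarCategory M, IsKaroubiAdditive M where
  add_left {U V : C} (f g : U ⟶ V) (X : M) : (f + g) ⊵ₗ X = f ⊵ₗ X + g ⊵ₗ X
  smul_left {U V : C} (c : ℂ) (f : U ⟶ V) (X : M) : (c • f) ⊵ₗ X = c • (f ⊵ₗ X)
  left_add (U : C) {X Y : M} (f g : X ⟶ Y) : U ⊴ₗ (f + g) = U ⊴ₗ f + U ⊴ₗ g
  left_smul (U : C) {X Y : M} (c : ℂ) (f : X ⟶ Y) : U ⊴ₗ (c • f) = c • (U ⊴ₗ f)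
  right_add (X : M) {U V : C} (f g : U ⟶ V) : X ⊴ᵣ (f + g) = X ⊴ᵣ f + X ⊴ᵣ g
  right_smul (X : M) {U V : C} (c : ℂ) (f : U ⟶ V) : X ⊴ᵣ (c • f) = c • (X ⊴ᵣ f)
  add_right {X Y : M} (f g : X ⟶ Y) (U : C) : (f + g) ⊵ᵣ U = f ⊵ᵣ U + g ⊵ᵣ U
  smul_right {X Y : M} (c : ℂ) (f : X ⟶ Y) (U : C) : (c • f) ⊵ᵣ U = c • (f ⊵ᵣ U)
  dag_left {U V : C} (f : U ⟶ V) (X : M) : dag (f ⊵ₗ X) = dag f ⊵ₗ X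
  left_dag (U : C) {X Y : M} (f : X ⟶ Y) : dag (U ⊴ₗ f) = U ⊴ₗ dag f
  right_dag (X : M) {U V : C} (f : U ⟶ V) : dag (X ⊴ᵣ f) = X ⊴ᵣ dag f
  dag_right {X Y : M} (f : X ⟶ Y) (U : C) : dag (f ⊵ᵣ U) = dag f ⊵ᵣ U
  leftAssoc_unitary (U V : C) (X : M) : IsUnitary (αₗ U V X).hom
  leftUnit_unitary (X : M) : IsUnitary (λₗ[C] X).hom
  rightAssoc_unitary (X : M) (U V : C) : IsUnitary (αᵣ X U V).hom
  rightUnit_unitary (X : M) : IsUnitary (ρᵣ[C] X).hom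
  mid_unitary (U : C) (X : M) (V : C) : IsUnitary (mid U X V).hom

/-- A centrally cyclic `C`-bimodule C*-category: a `C`-bimodule C*-category with an object `m`,
generating under the right action, and coherent natural unitaries `m ◁ U ≅ U ▷ m`. -/
structure CentrallyCyclicBimodule where
  /-- The underlying category. -/
  carrier : Type u
  [category : SmallCategory carrier]
  [preadditive : Preadditive carrier]
  [linear : Linear ℂ carrier]
  [dagger : DaggerCategory carrier]
  [leftAction : MonoidalLeftAction C carrier]
  [rightAction : MonoidalRightAction C carrier]
  [bimodule : BimoduleCategory C carrier]
  [isCStar : IsCStarBimodule C carrier]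
  /-- The distinguished object `m`. -/
  pt : carrier
  /-- Every object is a subobject of some `m ◁ U`. -/
  cyclic (X : carrier) : ∃ (U : C) (v : X ⟶ pt ⊙ᵣ U), IsIsometry v
  /-- The isomorphism `m ◁ U ≅ U ▷ m`. -/
  central (U : C) : pt ⊙ᵣ U ≅ U ⊙ₗ pt
  central_unitary (U : C) : IsUnitary (central U).hom
  central_naturality {U V : C} (f : U ⟶ V) :
    pt ⊴ᵣ f ≫ (central V).hom = (central U).hom ≫ f ⊵ₗ pt
  central_tensor (U V : C) :
    (central (U ⊗ V)).hom = (αᵣ pt U V).hom ≫ (central U).hom ⊵ᵣ V ≫ (mid U pt V).hom ≫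
      U ⊴ₗ (central V).hom ≫ (αₗ U V pt).inv
  central_unit : (central (𝟙_ C)).hom = (ρᵣ pt).hom ≫ (λₗ pt).inv

attribute [instance] CentrallyCyclicBimodule.category CentrallyCyclicBimodule.preadditive
  CentrallyCyclicBimodule.linear CentrallyCyclicBimodule.dagger CentrallyCyclicBimodule.leftAction
  CentrallyCyclicBimodule.rightAction CentrallyCyclicBimodule.bimodule
  CentrallyCyclicBimodule.isCStar

namespace CentrallyCyclicBimodule

variable {C}

/-- A functor of centrally cyclic bimodule C*-categories: a linear `*`-functor `F` with natural
unitaries `U ▷ F(X) ⟶ F(U ▷ X)` and `F(X) ◁ U ⟶ F(X ◁ U)` making it a functor of bimodule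
categories, and with a unitary `F(m) ≅ m` compatible with the central structures. -/
structure PointedFunctor (S T : CentrallyCyclicBimodule C) where
  /-- The underlying functor. -/
  F : S.carrier ⥤ T.carrier
  map_add {X Y : S.carrier} (f g : X ⟶ Y) : F.map (f + g) = F.map f + F.map g
  map_smul {X Y : S.carrier} (c : ℂ) (f : X ⟶ Y) : F.map (c • f) = c • F.map f
  map_dag {X Y : S.carrier} (f : X ⟶ Y) : F.map (dag f) = dag (F.map f)
  /-- Compatibility with the left action. -/
  l (U : C) (X : S.carrier) : U ⊙ₗ F.obj X ⟶ F.obj (U ⊙ₗ X)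
  l_unitary (U : C) (X : S.carrier) : IsUnitary (l U X)
  l_naturality_left {U V : C} (f : U ⟶ V) (X : S.carrier) :
    f ⊵ₗ F.obj X ≫ l V X = l U X ≫ F.map (f ⊵ₗ X)
  l_naturality_right (U : C) {X Y : S.carrier} (f : X ⟶ Y) :
    U ⊴ₗ F.map f ≫ l U Y = l U X ≫ F.map (U ⊴ₗ f)
  l_assoc (U V : C) (X : S.carrier) :
    l (U ⊗ V) X ≫ F.map (αₗ U V X).hom = (αₗ U V (F.obj X)).hom ≫ U ⊴ₗ l V X ≫ l U (V ⊙ₗ X)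
  l_unit (X : S.carrier) : l (𝟙_ C) X ≫ F.map (λₗ X).hom = (λₗ (F.obj X)).hom
  /-- Compatibility with the right action. -/
  r (X : S.carrier) (U : C) : F.obj X ⊙ᵣ U ⟶ F.obj (X ⊙ᵣ U)
  r_unitary (X : S.carrier) (U : C) : IsUnitary (r X U)
  r_naturality_left {X Y : S.carrier} (f : X ⟶ Y) (U : C) :
    F.map f ⊵ᵣ U ≫ r Y U = r X U ≫ F.map (f ⊵ᵣ U)
  r_naturality_right (X : S.carrier) {U V : C} (f : U ⟶ V) :
    F.obj X ⊴ᵣ f ≫ r X V = r X U ≫ F.map (X ⊴ᵣ f)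
  r_assoc (X : S.carrier) (U V : C) :
    r X (U ⊗ V) ≫ F.map (αᵣ X U V).hom = (αᵣ (F.obj X) U V).hom ≫ r X U ⊵ᵣ V ≫ r (X ⊙ᵣ U) V
  r_unit (X : S.carrier) : r X (𝟙_ C) ≫ F.map (ρᵣ X).hom = (ρᵣ (F.obj X)).hom
  l_r (U : C) (X : S.carrier) (V : C) :
    l U X ⊵ᵣ V ≫ r (U ⊙ₗ X) V ≫ F.map (mid U X V).hom =
      (mid U (F.obj X) V).hom ≫ U ⊴ₗ r X V ≫ l U (X ⊙ᵣ V)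
  /-- Compatibility with the distinguished objects. -/
  u : F.obj S.pt ≅ T.pt
  u_unitary : IsUnitary u.hom
  u_central (U : C) :
    u.hom ⊵ᵣ U ≫ (T.central U).hom ≫ U ⊴ₗ u.inv ≫ l U S.pt =
      r S.pt U ≫ F.map (S.central U).hom

namespace PointedFunctor

theorem map_unitary {S T : CentrallyCyclicBimodule C} (P : PointedFunctor S T) {X Y : S.carrier}
    {f : X ⟶ Y} (h : IsUnitary f) : IsUnitary (P.F.map f) :=
  ⟨by rw [← P.map_dag, ← P.F.map_comp, h.1, P.F.map_id],
    by rw [← P.map_dag, ← P.F.map_comp, h.2, P.F.map_id]⟩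

/-- The identity functor. -/
def id (S : CentrallyCyclicBimodule C) : PointedFunctor S S where
  F := 𝟭 _
  map_add _ _ := rfl
  map_smul _ _ := rfl
  map_dag _ := rfl
  l U X := 𝟙 _
  l_unitary _ _ := IsUnitary.id _
  l_naturality_left f X := by simp
  l_naturality_right U _ _ f := by simp
  l_assoc U V X := by simp
  l_unit X := by simp
  r X U := 𝟙 _
  r_unitary _ _ := IsUnitary.id _
  r_naturality_left f X := by simp
  r_naturality_right U _ _ f := by simp
  r_assoc U V X := by simp
  r_unit X := by simp
  l_r U X V := by simp
  u := Iso.refl _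
  u_unitary := IsUnitary.id _
  u_central U := by simp

/-- Composition of functors of centrally cyclic bimodule C*-categories. -/
def comp {S T R : CentrallyCyclicBimodule C} (P : PointedFunctor S T) (Q : PointedFunctor T R) :
    PointedFunctor S R where
  F := P.F ⋙ Q.F
  map_add f g := by simp [P.map_add, Q.map_add]
  map_smul c f := by simp [P.map_smul, Q.map_smul]
  map_dag f := by simp [P.map_dag, Q.map_dag]
  l U X := Q.l U (P.F.obj X) ≫ Q.F.map (P.l U X)
  l_unitary U X := (Q.l_unitary U _).comp (Q.map_unitary (P.l_unitary U X))
  l_naturality_left f X := by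
    simp only [CategoryTheory.Functor.comp_obj, CategoryTheory.Functor.comp_map, Category.assoc]
    rw [reassoc_of% (@Q.l_naturality_left), ← Q.F.map_comp, P.l_naturality_left, Q.F.map_comp]
  l_naturality_right U _ _ f := by
    simp only [CategoryTheory.Functor.comp_obj, CategoryTheory.Functor.comp_map, Category.assoc]
    rw [reassoc_of% (@Q.l_naturality_right), ← Q.F.map_comp, P.l_naturality_right, Q.F.map_comp]
  l_assoc U V X := by
    simp only [CategoryTheory.Functor.comp_obj, CategoryTheory.Functor.comp_map, Category.assoc]
    rw [← Q.F.map_comp, P.l_assoc, Q.F.map_comp, Q.F.map_comp, reassoc_of% (@Q.l_assoc),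
      ← reassoc_of% (@Q.l_naturality_right), MonoidalLeftAction.actionHomRight_comp_assoc]
  l_unit X := by
    simp only [CategoryTheory.Functor.comp_obj, CategoryTheory.Functor.comp_map, Category.assoc]
    rw [← Q.F.map_comp, P.l_unit, Q.l_unit]
  r X U := Q.r (P.F.obj X) U ≫ Q.F.map (P.r X U)
  r_unitary X U := (Q.r_unitary _ U).comp (Q.map_unitary (P.r_unitary X U))
  r_naturality_left f U := by
    simp only [CategoryTheory.Functor.comp_obj, CategoryTheory.Functor.comp_map, Category.assoc]
    rw [reassoc_of% (@Q.r_naturality_left), ← Q.F.map_comp, P.r_naturality_left, Q.F.map_comp]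
  r_naturality_right X _ _ f := by
    simp only [CategoryTheory.Functor.comp_obj, CategoryTheory.Functor.comp_map, Category.assoc]
    rw [reassoc_of% (@Q.r_naturality_right), ← Q.F.map_comp, P.r_naturality_right, Q.F.map_comp]
  r_assoc X U V := by
    simp only [CategoryTheory.Functor.comp_obj, CategoryTheory.Functor.comp_map, Category.assoc]
    rw [← Q.F.map_comp, P.r_assoc, Q.F.map_comp, Q.F.map_comp, reassoc_of% (@Q.r_assoc),
      ← reassoc_of% (@Q.r_naturality_left), MonoidalRightAction.comp_actionHomLeft_assoc]
  r_unit X := by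
    simp only [CategoryTheory.Functor.comp_obj, CategoryTheory.Functor.comp_map, Category.assoc]
    rw [← Q.F.map_comp, P.r_unit, Q.r_unit]
  l_r U X V := by
    simp only [CategoryTheory.Functor.comp_obj, CategoryTheory.Functor.comp_map, Category.assoc]
    rw [MonoidalRightAction.comp_actionHomLeft_assoc, reassoc_of% (@Q.r_naturality_left),
      ← Q.F.map_comp, ← Q.F.map_comp, P.l_r, Q.F.map_comp, Q.F.map_comp, reassoc_of% (@Q.l_r),
      ← reassoc_of% (@Q.l_naturality_right), MonoidalLeftAction.actionHomRight_comp_assoc]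
  u := Q.F.mapIso P.u ≪≫ Q.u
  u_unitary := (Q.map_unitary P.u_unitary).comp Q.u_unitary
  u_central U := by
    simp only [CategoryTheory.Functor.comp_obj, CategoryTheory.Functor.comp_map, Category.assoc, Iso.trans_hom, Iso.trans_inv,
      Functor.mapIso_hom, Functor.mapIso_inv]
    rw [MonoidalRightAction.comp_actionHomLeft_assoc,
      MonoidalLeftAction.actionHomRight_comp_assoc, reassoc_of% (@Q.l_naturality_right),
      reassoc_of% (@Q.u_central), reassoc_of% (@Q.r_naturality_left), ← Q.F.map_comp, ← Q.F.map_comp,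
      ← Q.F.map_comp, P.u_central, Q.F.map_comp]

/-- Two functors are equivalent if they are unitarily isomorphic, compatibly with all the
structure. -/
def Equivalent {S T : CentrallyCyclicBimodule C} (P Q : PointedFunctor S T) : Prop :=
  ∃ η : P.F ≅ Q.F, (∀ X, IsUnitary (η.hom.app X)) ∧
    (∀ (U : C) (X : S.carrier), P.l U X ≫ η.hom.app (U ⊙ₗ X) = U ⊴ₗ η.hom.app X ≫ Q.l U X) ∧
    (∀ (X : S.carrier) (U : C), P.r X U ≫ η.hom.app (X ⊙ᵣ U) = η.hom.app X ⊵ᵣ U ≫ Q.r X U) ∧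
    η.hom.app S.pt ≫ Q.u.hom = P.u.hom

theorem Equivalent.refl {S T : CentrallyCyclicBimodule C} (P : PointedFunctor S T) :
    Equivalent P P :=
  ⟨Iso.refl _, fun X => IsUnitary.id _, by simp, by simp, by simp⟩

theorem Equivalent.symm {S T : CentrallyCyclicBimodule C} {P Q : PointedFunctor S T}
    (h : Equivalent P Q) : Equivalent Q P := by
  obtain ⟨η, h1, h2, h3, h4⟩ := h
  refine ⟨η.symm, fun X => (h1 X).inv (e := η.app X), fun U X => ?_, fun X U => ?_, ?_⟩
  · have h := h2 U X
    simp only [Iso.symm_hom]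
    rw [← cancel_mono (η.hom.app (U ⊙ₗ X)), Category.assoc, Category.assoc, h,
      ← MonoidalLeftAction.actionHomRight_comp_assoc]
    simp
  · have h := h3 X U
    simp only [Iso.symm_hom]
    rw [← cancel_mono (η.hom.app (X ⊙ᵣ U)), Category.assoc, Category.assoc, h,
      ← MonoidalRightAction.comp_actionHomLeft_assoc]
    simp
  · rw [← h4]
    simp

theorem Equivalent.trans {S T : CentrallyCyclicBimodule C} {P Q R : PointedFunctor S T}
    (h : Equivalent P Q) (k : Equivalent Q R) : Equivalent P R := by
  obtain ⟨η, h1, h2, h3, h4⟩ := h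
  obtain ⟨θ, k1, k2, k3, k4⟩ := k
  refine ⟨η ≪≫ θ, fun X => (h1 X).comp (k1 X), fun U X => ?_, fun X U => ?_, ?_⟩
  · simp only [Iso.trans_hom, NatTrans.comp_app]
    rw [← Category.assoc, h2, Category.assoc, k2, MonoidalLeftAction.actionHomRight_comp_assoc]
  · simp only [Iso.trans_hom, NatTrans.comp_app]
    rw [← Category.assoc, h3, Category.assoc, k3, MonoidalRightAction.comp_actionHomLeft_assoc]
  · simp only [Iso.trans_hom, NatTrans.comp_app]
    rw [Category.assoc, k4, h4]

theorem Equivalent.comp {S T R : CentrallyCyclicBimodule C} {P P' : PointedFunctor S T}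
    {Q Q' : PointedFunctor T R} (h : Equivalent P P') (k : Equivalent Q Q') :
    Equivalent (P.comp Q) (P'.comp Q') := by
  obtain ⟨η, h1, h2, h3, h4⟩ := h
  obtain ⟨θ, k1, k2, k3, k4⟩ := k
  refine ⟨NatIso.hcomp η θ, fun X => ?_, fun U X => ?_, fun X U => ?_, ?_⟩
  · simp only [NatIso.hcomp_hom, NatTrans.hcomp_app]
    exact (k1 _).comp (Q'.map_unitary (h1 X))
  · simp only [NatIso.hcomp_hom, NatTrans.hcomp_app, PointedFunctor.comp, Category.assoc]
    rw [NatTrans.naturality_assoc, ← Q'.F.map_comp, h2, Q'.F.map_comp, ← Category.assoc, k2,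
      Category.assoc, ← reassoc_of% (@Q'.l_naturality_right),
      MonoidalLeftAction.actionHomRight_comp_assoc]
  · simp only [NatIso.hcomp_hom, NatTrans.hcomp_app, PointedFunctor.comp, Category.assoc]
    rw [NatTrans.naturality_assoc, ← Q'.F.map_comp, h3, Q'.F.map_comp, ← Category.assoc, k3,
      Category.assoc, ← reassoc_of% (@Q'.r_naturality_left), MonoidalRightAction.comp_actionHomLeft_assoc]
  · simp only [NatIso.hcomp_hom, NatTrans.hcomp_app, PointedFunctor.comp, Category.assoc,
      Iso.trans_hom, Functor.mapIso_hom]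
    rw [← Q'.F.map_comp_assoc, h4, ← NatTrans.naturality_assoc, k4]

/-- Functors up to equivalence. -/
def setoid (S T : CentrallyCyclicBimodule C) : Setoid (PointedFunctor S T) where
  r := Equivalent
  iseqv := ⟨Equivalent.refl, Equivalent.symm, Equivalent.trans⟩

end PointedFunctor

/-- The category of centrally cyclic `C`-bimodule C*-categories: morphisms are functors
preserving the structure, up to equivalence. -/
instance : Category (CentrallyCyclicBimodule C) where
  Hom S T := Quotient (PointedFunctor.setoid S T)
  id S := Quotient.mk _ (PointedFunctor.id S)
  comp f g := Quotient.map₂ PointedFunctor.comp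
    (fun _ _ h _ _ k => PointedFunctor.Equivalent.comp h k) f g
  id_comp f := by
    induction f using Quotient.inductionOn with
    | _ P =>
      refine Quotient.sound ⟨P.F.leftUnitor, fun X => ?_, fun U X => ?_, fun X U => ?_, ?_⟩
      · exact IsUnitary.id _
      all_goals simp [PointedFunctor.comp, PointedFunctor.id]
  comp_id f := by
    induction f using Quotient.inductionOn with
    | _ P =>
      refine Quotient.sound ⟨P.F.rightUnitor, fun X => ?_, fun U X => ?_, fun X U => ?_, ?_⟩
      · exact IsUnitary.id _
      all_goals simp [PointedFunctor.comp, PointedFunctor.id]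
  assoc f g h := by
    induction f using Quotient.inductionOn with
    | _ P =>
      induction g using Quotient.inductionOn with
      | _ Q =>
        induction h using Quotient.inductionOn with
        | _ R =>
          refine Quotient.sound ⟨Functor.associator P.F Q.F R.F, fun X => ?_, fun U X => ?_,
            fun X U => ?_, ?_⟩
          · exact IsUnitary.id _
          all_goals simp [PointedFunctor.comp]

end CentrallyCyclicBimodule

end Bimodules

/-! ### Yetter-Drinfeld C*-algebras -/

section YetterDrinfeld

open DaggerCategory VectC

variable {C : Type u} [SmallCategory C] [Preadditive C] [Linear ℂ C] [DaggerCategory C]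
  [MonoidalCategory C] [MonoidalPreadditive C] [MonoidalLinear ℂ C] [IsUnitaryTensorCategory C]

/-- The product `A(U) × A(V) → A(U ⊗ V)` of an algebra `A` in `Vect(C)`. -/
noncomputable def algMul (A : VectC C) [MonObj A] {U V : C} (a : A.ev U) (b : A.ev V) :
    A.ev (U ⊗ V) :=
  app (MonObj.mul (X := A)) (U ⊗ V) (pureT A A (U ⊗ V) U V (𝟙 _) a b)

/-- The unit in `A(1)` of an algebra `A` in `Vect(C)`. -/
noncomputable def algOne (A : VectC C) [MonObj A] : A.ev (𝟙_ C) :=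
  app (MonObj.one (X := A)) (𝟙_ C) (yoElt (𝟙 (𝟙_ C)))

/-- A `*`-algebra structure on an algebra `A` in `Vect(C)`: antilinear maps `A(U) → A(V)`, for
every dual `V` of `U` (with given duality morphisms `η : 1 ⟶ U ⊗ V` and `ε : V ⊗ U ⟶ 1`), natural,
involutive, antimultiplicative and unital. -/
structure StarAlgStructure (A : VectC C) [MonObj A] where
  /-- The involution `A(U) → A(V)`. -/
  star {U V : C} (p : ExactPairing U V) : A.ev U → A.ev V
  star_add {U V : C} (p : ExactPairing U V) (a b : A.ev U) :
    star p (a + b) = star p a + star p b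
  star_smul {U V : C} (p : ExactPairing U V) (c : ℂ) (a : A.ev U) :
    star p (c • a) = conj c • star p a
  star_res {U V U' V' : C} (p : ExactPairing U V) (p' : ExactPairing U' V') (g : U ⟶ U')
    (h : V ⟶ V') (w : η_ U V ≫ g ▷ V = η_ U' V' ≫ U' ◁ dag h) (a : A.ev U') :
    star p (A.res g a) = A.res h (star p' a)
  star_star {U V : C} (p : ExactPairing U V) (a : A.ev U) :
    star (IsUnitaryTensorCategory.dagPairing p) (star p a) = a
  star_mul {U V U' V' : C} (p : ExactPairing U V) (p' : ExactPairing U' V') (a : A.ev U)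
    (b : A.ev U') :
    star (ExactPairing.tensor : ExactPairing (U ⊗ U') (V' ⊗ V)) (algMul A a b) =
      algMul A (star p' b) (star p a)
  star_one : star (exactPairingUnit : ExactPairing (𝟙_ C) (𝟙_ C)) (algOne A) = algOne A

/-- A `*`-structure on the category of free `A`-modules is the one corresponding to a `*`-algebra
structure on `A` if the right action of `C` and the functor `V ↦ A ⊗ V` are `*`-preserving, and if
for `a ∈ A(U)`, viewed as a morphism `A ⊗ U ⟶ A`, the morphism `A ⊗ V ⟶ A` given by the
involution of `a` is `A ⊗ V ⟶ A ⊗ U ⊗ V ⟶ A`, where the first map is `a* ⊗ V` and the second one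
is `A ⊗ η*`. -/
structure IsCorrespondingDagger {A : VectC C} [MonObj A] (j : StarAlgStructure A)
    [DaggerCategory (FreeMod A)] : Prop where
  dag_rightWh {V W : C} (f : FreeMod.of A V ⟶ FreeMod.of A W) (Y : C) :
    dag (FreeMod.rightWh f Y) = FreeMod.rightWh (dag f) Y
  dag_freeMap {V W : C} (g : V ⟶ W) :
    dag (FreeMod.freeMap (A := A) g) = FreeMod.freeMap (dag g)
  hat_star {U V : C} (p : ExactPairing U V) (a : A.ev U) :
    FreeMod.hat (j.star p a) =
      FreeMod.freeMap (λ_ V).inv ≫ FreeMod.rightWh (dag (FreeMod.hat a)) V ≫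
        FreeMod.freeMap (dag (η_ U V))

/-- The half-braiding of an algebra `A` in the center of `Vect(C)` is unitary with respect to a
`*`-structure on the category of free `A`-modules. The components of the half-braiding identify
`U ⊗ A ⊗ V` with `A ⊗ U ⊗ V`, and they are unitary when the `*`-structure of `A ⊗ U ⊗ V` agrees with
that of `U ⊗ A ⊗ V`, that is, when `(U ⊗ f)* = U ⊗ f*` under these identifications. -/
def IsUnitaryHalfBraiding (A : Mon (Center (VectC C))) [DaggerCategory (FreeMod A.X.1)] : Prop :=
  ∀ (U : C) {V W : C} (f : FreeMod.of A.X.1 V ⟶ FreeMod.of A.X.1 W),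
    dag (FreeMod.leftWh U f) = FreeMod.leftWh U (dag f)

variable (C) in
/-- A Yetter-Drinfeld C*-algebra: an algebra in the Drinfeld center of `Vect(C)` with a
`*`-algebra structure such that, for the corresponding `*`-structure, the free modules form a
C*-category and the half-braiding is unitary. -/
structure YetterDrinfeldAlgebra where
  /-- The underlying algebra in the Drinfeld center. -/
  alg : Mon (Center (VectC C))
  /-- The `*`-algebra structure. -/
  star : StarAlgStructure alg.X.1
  isCStar : ∃ _ : DaggerCategory (FreeMod alg.X.1), IsCorrespondingDagger star ∧
    IsCStarCategory (FreeMod alg.X.1) ∧ IsUnitaryHalfBraiding alg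

namespace YetterDrinfeldAlgebra

/-- Morphisms of Yetter-Drinfeld C*-algebras: morphisms of algebras in the center which preserve
the involution. -/
@[ext]
structure Hom (A B : YetterDrinfeldAlgebra C) where
  /-- The underlying morphism of algebras in the Drinfeld center. -/
  hom : A.alg ⟶ B.alg
  map_star {U V : C} (p : ExactPairing U V) (a : A.alg.X.1.ev U) :
    app hom.hom.f V (A.star.star p a) = B.star.star p (app hom.hom.f U a)

noncomputable instance : Category (YetterDrinfeldAlgebra C) where
  Hom := Hom
  id A := ⟨𝟙 _, fun p a => rfl⟩
  comp f g := ⟨f.hom ≫ g.hom, fun p a => by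
    have hf := f.map_star p a
    have hg := g.map_star p (app f.hom.hom.f _ a)
    refine Eq.trans ?_ hg
    exact congrArg (app g.hom.hom.f _) hf⟩
  id_comp f := Hom.ext (Category.id_comp f.hom)
  comp_id f := Hom.ext (Category.comp_id f.hom)
  assoc f g h := Hom.ext (Category.assoc f.hom g.hom h.hom)

end YetterDrinfeldAlgebra

end YetterDrinfeld

/-!
Both categories are equivalent to a third one, the category `FreeCStarBimod C` of *C\*-categories of
free bimodules*. Such an object is a C\*-category `P` with a functor `J : C ⥤ P` and with two
commuting `*`-preserving actions `f ↦ f ⊗ W` and `f ↦ W ⊗ f` of `C` on the morphisms between the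
objects `J X`, both extending the tensor product of `C`. A centrally cyclic bimodule category
`(M, m, α)` gives rise to one by `J U = m ◁ U`, the left action being carried over along the unitary
`m ◁ (W ⊗ X) ≅ W ▷ (m ◁ X)` built from `α`. A Yetter-Drinfeld C\*-algebra `A` gives rise to one by
`J U = A ⊗ U`, the left action being carried over along the half-braiding.

*Bimodule categories* (`CentrallyCyclicBimodule.toFree`). Since every object embeds isometrically in
some `m ◁ U`, a bimodule category is determined by its free bimodules. To extend a functor `Φ` of
free bimodules, an object `X` embedded in `m ◁ U` is sent to an object split off `m' ◁ U` by the
image of the projection onto `X`. A `Frame` records such a pair of embeddings, and `Frame.tr` the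
resulting map on morphisms. In the coordinates given by frames all structure isomorphisms of both
bimodule categories are images of morphisms of `C`, which `Φ` preserves; hence `Frame.tr` carries
the structure isomorphisms of one category to those of the other (`Frame.rightAssoc`,
`Frame.middle`, `Frame.central` and so on). This gives fullness (`extension`) and, as every functor
inducing `Φ` provides frames of its own, faithfulness up to unitary isomorphism
(`equivalent_of_freeHom_eq`). Every C\*-category of free bimodules is hit because its completion by
ranges of projections (`SubFree`) is again a bimodule category (`SubFree.cyclicBimodule`,
`FreeCStarBimod.toFreeIso`).

*Algebras* (`FreeCStarBimod.toYD`). The presheaf `U ↦ P(J U, J 1)` is an algebra, the product of `a`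
and `b` being `a ⊗ V` followed by `b`. As `C` is rigid, every morphism `J X ⟶ J Y` is of the form
`(a ⊗ Y) ∘ J k` for an element `a` of the algebra (`FreeBimod.exists_normal`), and the left action
`a ↦ W ⊗ a` on elements amounts to a half-braiding (`FreeBimod.braidHom`). A morphism of algebras
therefore extends to all of `P` by acting on `a`, and it preserves the left action exactly when it
is compatible with the half-braidings (`FreeBimod.psi_braid`, `FreeBimod.ext_L`). Conversely an
algebra is the algebra of its free modules by `A(U) ≅ Hom_A(A ⊗ U, A)` (`FreeMod.hatCenterIso`).
The `*`-structure of `P` and the involution of the algebra determine each other by bending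
(`FreeCStarBimod.starElt`, `FreeCStarBimod.dag_eq_starElt`).

The C\*-axioms pass from one category to another by `CornerEmbedding.isCStarCategory`: a
`*`-category whose morphism spaces are corners `p Hom(X, Y) q` in a C\*-category is a C\*-category.
This covers both free modules over the algebra of `P`, with trivial projections, and `SubFree`.
-/

/-! ### Categories of free bimodules -/

section FreeBimodules

variable (C : Type u) [SmallCategory C] [Preadditive C] [Linear ℂ C] [MonoidalCategory C]
  [MonoidalPreadditive C] [MonoidalLinear ℂ C]

/-- A linear category `P` with a linear functor `J` from `C` whose image carries two commuting
actions of `C`, both extending the tensor product of `C`. This is what remains of a bimodule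
category with a central object `m` when only the objects `J U = m ◁ U` are kept: their objects
are acted on by tensoring in `C`, so that only the actions `f ↦ f ⊗ W` and `f ↦ W ⊗ f` on
morphisms are additional data. -/
structure FreeBimod where
  /-- The underlying category. -/
  carrier : Type u
  [category : SmallCategory carrier]
  [preadditive : Preadditive carrier]
  [linear : Linear ℂ carrier]
  /-- The functor `U ↦ m ◁ U`. -/
  J : C ⥤ carrier
  J_add {X Y : C} (f g : X ⟶ Y) : J.map (f + g) = J.map f + J.map g
  J_smul {X Y : C} (c : ℂ) (f : X ⟶ Y) : J.map (c • f) = c • J.map f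
  /-- The right action `f ↦ f ⊗ W`. -/
  R (W : C) {X Y : C} : (J.obj X ⟶ J.obj Y) → (J.obj (X ⊗ W) ⟶ J.obj (Y ⊗ W))
  R_add (W : C) {X Y : C} (f g : J.obj X ⟶ J.obj Y) : R W (f + g) = R W f + R W g
  R_smul (W : C) {X Y : C} (c : ℂ) (f : J.obj X ⟶ J.obj Y) : R W (c • f) = c • R W f
  R_comp (W : C) {X Y Z : C} (f : J.obj X ⟶ J.obj Y) (g : J.obj Y ⟶ J.obj Z) :
    R W (f ≫ g) = R W f ≫ R W g
  R_map (W : C) {X Y : C} (f : X ⟶ Y) : R W (J.map f) = J.map (f ▷ W)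
  R_exchange {W W' : C} (g : W ⟶ W') {X Y : C} (f : J.obj X ⟶ J.obj Y) :
    R W f ≫ J.map (Y ◁ g) = J.map (X ◁ g) ≫ R W' f
  R_tensor (W W' : C) {X Y : C} (f : J.obj X ⟶ J.obj Y) :
    R (W ⊗ W') f ≫ J.map (α_ Y W W').inv = J.map (α_ X W W').inv ≫ R W' (R W f)
  R_unit {X Y : C} (f : J.obj X ⟶ J.obj Y) :
    R (𝟙_ C) f ≫ J.map (ρ_ Y).hom = J.map (ρ_ X).hom ≫ f
  /-- The left action `f ↦ W ⊗ f`. -/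
  L (W : C) {X Y : C} : (J.obj X ⟶ J.obj Y) → (J.obj (W ⊗ X) ⟶ J.obj (W ⊗ Y))
  L_add (W : C) {X Y : C} (f g : J.obj X ⟶ J.obj Y) : L W (f + g) = L W f + L W g
  L_smul (W : C) {X Y : C} (c : ℂ) (f : J.obj X ⟶ J.obj Y) : L W (c • f) = c • L W f
  L_comp (W : C) {X Y Z : C} (f : J.obj X ⟶ J.obj Y) (g : J.obj Y ⟶ J.obj Z) :
    L W (f ≫ g) = L W f ≫ L W g
  L_map (W : C) {X Y : C} (f : X ⟶ Y) : L W (J.map f) = J.map (W ◁ f)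
  L_exchange {W W' : C} (g : W ⟶ W') {X Y : C} (f : J.obj X ⟶ J.obj Y) :
    L W f ≫ J.map (g ▷ Y) = J.map (g ▷ X) ≫ L W' f
  L_tensor (W W' : C) {X Y : C} (f : J.obj X ⟶ J.obj Y) :
    L (W ⊗ W') f ≫ J.map (α_ W W' Y).hom = J.map (α_ W W' X).hom ≫ L W (L W' f)
  L_unit {X Y : C} (f : J.obj X ⟶ J.obj Y) :
    L (𝟙_ C) f ≫ J.map (λ_ Y).hom = J.map (λ_ X).hom ≫ f
  R_L (W V : C) {X Y : C} (f : J.obj X ⟶ J.obj Y) :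
    R V (L W f) ≫ J.map (α_ W Y V).hom = J.map (α_ W X V).hom ≫ L W (R V f)

attribute [instance] FreeBimod.category FreeBimod.preadditive FreeBimod.linear

end FreeBimodules

namespace FreeBimod

variable {C : Type u} [SmallCategory C] [Preadditive C] [Linear ℂ C] [MonoidalCategory C]
  [MonoidalPreadditive C] [MonoidalLinear ℂ C]

/-- Functors between categories of free bimodules that commute with the functors from `C` and with
both actions. Only the morphisms between objects coming from `C` matter. -/
@[ext]
structure Hom (P Q : FreeBimod C) where
  /-- The action on morphisms. -/
  map {X Y : C} : (P.J.obj X ⟶ P.J.obj Y) → (Q.J.obj X ⟶ Q.J.obj Y)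
  map_add {X Y : C} (f g : P.J.obj X ⟶ P.J.obj Y) : map (f + g) = map f + map g
  map_smul {X Y : C} (c : ℂ) (f : P.J.obj X ⟶ P.J.obj Y) : map (c • f) = c • map f
  map_comp {X Y Z : C} (f : P.J.obj X ⟶ P.J.obj Y) (g : P.J.obj Y ⟶ P.J.obj Z) :
    map (f ≫ g) = map f ≫ map g
  map_J {X Y : C} (f : X ⟶ Y) : map (P.J.map f) = Q.J.map f
  map_R (W : C) {X Y : C} (f : P.J.obj X ⟶ P.J.obj Y) : map (P.R W f) = Q.R W (map f)
  map_L (W : C) {X Y : C} (f : P.J.obj X ⟶ P.J.obj Y) : map (P.L W f) = Q.L W (map f)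

attribute [simp] Hom.map_add Hom.map_smul Hom.map_comp Hom.map_J Hom.map_R Hom.map_L

@[simp] theorem Hom.map_id {P Q : FreeBimod C} (Φ : Hom P Q) (X : C) :
    Φ.map (𝟙 (P.J.obj X)) = 𝟙 (Q.J.obj X) := by
  rw [← P.J.map_id, Φ.map_J, Q.J.map_id]

/-- The identity. -/
def Hom.id (P : FreeBimod C) : Hom P P where
  map f := f
  map_add _ _ := rfl
  map_smul _ _ := rfl
  map_comp _ _ := rfl
  map_J _ := rfl
  map_R _ _ _ _ := rfl
  map_L _ _ _ _ := rfl

/-- Composition. -/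
def Hom.comp {P Q S : FreeBimod C} (Φ : Hom P Q) (Ψ : Hom Q S) : Hom P S where
  map f := Ψ.map (Φ.map f)
  map_add _ _ := by simp
  map_smul _ _ := by simp
  map_comp _ _ := by simp
  map_J _ := by simp
  map_R _ _ _ _ := by simp
  map_L _ _ _ _ := by simp

instance : Category (FreeBimod C) where
  Hom := Hom
  id := Hom.id
  comp := Hom.comp

variable (P : FreeBimod C)

theorem R_comp_assoc (W : C) {X Y Z : C} (f : P.J.obj X ⟶ P.J.obj Y) (g : P.J.obj Y ⟶ P.J.obj Z)
    {T : P.carrier} (h : P.J.obj (Z ⊗ W) ⟶ T) : P.R W (f ≫ g) ≫ h = P.R W f ≫ P.R W g ≫ h := by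
  rw [P.R_comp, Category.assoc]

theorem J_map_comp {X Y Z : C} (f : X ⟶ Y) (g : Y ⟶ Z) {T : P.carrier} (h : P.J.obj Z ⟶ T) :
    P.J.map f ≫ P.J.map g ≫ h = P.J.map (f ≫ g) ≫ h := by
  rw [P.J.map_comp, Category.assoc]

theorem R_exchange_assoc {W W' : C} (g : W ⟶ W') {X Y : C} (f : P.J.obj X ⟶ P.J.obj Y)
    {T : P.carrier} (h : P.J.obj (Y ⊗ W') ⟶ T) :
    P.R W f ≫ P.J.map (Y ◁ g) ≫ h = P.J.map (X ◁ g) ≫ P.R W' f ≫ h := by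
  rw [← Category.assoc, P.R_exchange, Category.assoc]

theorem L_exchange_assoc {W W' : C} (g : W ⟶ W') {X Y : C} (f : P.J.obj X ⟶ P.J.obj Y)
    {T : P.carrier} (h : P.J.obj (W' ⊗ Y) ⟶ T) :
    P.L W f ≫ P.J.map (g ▷ Y) ≫ h = P.J.map (g ▷ X) ≫ P.L W' f ≫ h := by
  rw [← Category.assoc, P.L_exchange, Category.assoc]

theorem R_id (W X : C) : P.R W (𝟙 (P.J.obj X)) = 𝟙 _ := by
  rw [← P.J.map_id, P.R_map, id_whiskerRight, P.J.map_id]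

theorem L_id (W X : C) : P.L W (𝟙 (P.J.obj X)) = 𝟙 _ := by
  rw [← P.J.map_id, P.L_map, MonoidalCategory.whiskerLeft_id, P.J.map_id]

theorem R_tensor' (W W' : C) {X Y : C} (f : P.J.obj X ⟶ P.J.obj Y) :
    P.R W' (P.R W f) ≫ P.J.map (α_ Y W W').hom = P.J.map (α_ X W W').hom ≫ P.R (W ⊗ W') f := by
  rw [← cancel_mono (P.J.map (α_ Y W W').inv), Category.assoc, Category.assoc, P.R_tensor,
    ← P.J.map_comp, J_map_comp]
  simp

theorem L_tensor' (W W' : C) {X Y : C} (f : P.J.obj X ⟶ P.J.obj Y) :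
    P.L W (P.L W' f) ≫ P.J.map (α_ W W' Y).inv = P.J.map (α_ W W' X).inv ≫ P.L (W ⊗ W') f := by
  rw [← cancel_mono (P.J.map (α_ W W' Y).hom), Category.assoc, Category.assoc, P.L_tensor,
    ← P.J.map_comp, J_map_comp]
  simp

/-- The two actions commute, in the form with the inverse associators. -/
theorem L_R (W V : C) {X Y : C} (f : P.J.obj X ⟶ P.J.obj Y) :
    P.L W (P.R V f) ≫ P.J.map (α_ W Y V).inv = P.J.map (α_ W X V).inv ≫ P.R V (P.L W f) := by
  rw [← cancel_mono (P.J.map (α_ W Y V).hom), Category.assoc, Category.assoc, P.R_L,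
    ← P.J.map_comp, J_map_comp]
  simp

theorem R_unit' {X Y : C} (f : P.J.obj X ⟶ P.J.obj Y) :
    f ≫ P.J.map (ρ_ Y).inv = P.J.map (ρ_ X).inv ≫ P.R (𝟙_ C) f := by
  rw [← cancel_mono (P.J.map (ρ_ Y).hom), Category.assoc, Category.assoc, P.R_unit,
    ← P.J.map_comp, J_map_comp]
  simp

theorem L_unit' {X Y : C} (f : P.J.obj X ⟶ P.J.obj Y) :
    f ≫ P.J.map (λ_ Y).inv = P.J.map (λ_ X).inv ≫ P.L (𝟙_ C) f := by
  rw [← cancel_mono (P.J.map (λ_ Y).hom), Category.assoc, Category.assoc, P.L_unit,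
    ← P.J.map_comp, J_map_comp]
  simp

end FreeBimod

/-! ### Tensoring with dual objects -/

section Duals

variable {C : Type u} [SmallCategory C] [Preadditive C] [Linear ℂ C] [MonoidalCategory C]
  [MonoidalPreadditive C] [MonoidalLinear ℂ C]

/-- The unit `X ⟶ V ⊗ (W ⊗ X)` of the adjunction between tensoring by dual objects on the left. -/
def etaL (V W : C) [ExactPairing V W] (X : C) : X ⟶ V ⊗ (W ⊗ X) :=
  (λ_ X).inv ≫ η_ V W ▷ X ≫ (α_ V W X).hom

/-- The counit `W ⊗ (V ⊗ X) ⟶ X`. -/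
def epsL (V W : C) [ExactPairing V W] (X : C) : W ⊗ (V ⊗ X) ⟶ X :=
  (α_ W V X).inv ≫ ε_ V W ▷ X ≫ (λ_ X).hom

/-- The unit `X ⟶ (X ⊗ V) ⊗ W` of the adjunction between tensoring by dual objects on the right. -/
def etaR (V W : C) [ExactPairing V W] (X : C) : X ⟶ (X ⊗ V) ⊗ W :=
  (ρ_ X).inv ≫ X ◁ η_ V W ≫ (α_ X V W).inv

/-- The counit `(X ⊗ W) ⊗ V ⟶ X`. -/
def epsR (V W : C) [ExactPairing V W] (X : C) : (X ⊗ W) ⊗ V ⟶ X :=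
  (α_ X W V).hom ≫ X ◁ ε_ V W ≫ (ρ_ X).hom

section

variable (V W : C) [ExactPairing V W]

theorem etaL_epsL (X : C) : etaL V W (V ⊗ X) ≫ V ◁ epsL V W X = 𝟙 _ := by
  calc _ = 𝟙 _ ⊗≫ (η_ V W ▷ V ≫ (α_ V W V).hom ≫ V ◁ ε_ V W) ▷ X ⊗≫ 𝟙 _ := by
        simp only [etaL, epsL]; monoidal
    _ = _ := by rw [ExactPairing.evaluation_coevaluation]; monoidal

theorem etaR_epsR (X : C) : etaR V W (X ⊗ W) ≫ epsR V W X ▷ W = 𝟙 _ := by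
  calc _ = 𝟙 _ ⊗≫ X ◁ (W ◁ η_ V W ≫ (α_ W V W).inv ≫ ε_ V W ▷ W) ⊗≫ 𝟙 _ := by
        simp only [etaR, epsR]; monoidal
    _ = _ := by rw [ExactPairing.coevaluation_evaluation]; monoidal

theorem etaL_naturality {X Y : C} (f : X ⟶ Y) : f ≫ etaL V W Y = etaL V W X ≫ V ◁ W ◁ f := by
  simp only [etaL]
  rw [leftUnitor_inv_naturality_assoc, whisker_exchange_assoc, associator_naturality_right]
  simp only [Category.assoc]

theorem etaR_naturality {X Y : C} (f : X ⟶ Y) : f ≫ etaR V W Y = etaR V W X ≫ (f ▷ V) ▷ W := by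
  simp only [etaR]
  rw [rightUnitor_inv_naturality_assoc, ← whisker_exchange_assoc, associator_inv_naturality_left]
  simp only [Category.assoc]

variable (P : FreeBimod C)

/-- The unit of duality is natural for morphisms of `P`, not only for those of `C`. -/
theorem FreeBimod.L_L_eta {X Y : C} (f : P.J.obj X ⟶ P.J.obj Y) :
    P.J.map (etaL V W X) ≫ P.L V (P.L W f) = f ≫ P.J.map (etaL V W Y) := by
  simp only [etaL, P.J.map_comp, Category.assoc]
  rw [← P.L_tensor, ← P.L_exchange_assoc, ← Category.assoc, ← P.L_unit', Category.assoc]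

/-- The counit of duality is natural for morphisms of `P`. -/
theorem FreeBimod.L_L_eps {X Y : C} (f : P.J.obj X ⟶ P.J.obj Y) :
    P.L W (P.L V f) ≫ P.J.map (epsL V W Y) = P.J.map (epsL V W X) ≫ f := by
  simp only [epsL, P.J.map_comp, Category.assoc]
  rw [← P.L_unit, ← P.L_exchange_assoc, ← Category.assoc, P.L_tensor', Category.assoc]

theorem FreeBimod.R_R_eta {X Y : C} (f : P.J.obj X ⟶ P.J.obj Y) :
    P.J.map (etaR V W X) ≫ P.R W (P.R V f) = f ≫ P.J.map (etaR V W Y) := by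
  simp only [etaR, P.J.map_comp, Category.assoc]
  rw [← P.R_tensor, ← P.R_exchange_assoc, ← Category.assoc, ← P.R_unit', Category.assoc]

theorem FreeBimod.R_R_eps {X Y : C} (f : P.J.obj X ⟶ P.J.obj Y) :
    P.R V (P.R W f) ≫ P.J.map (epsR V W Y) = P.J.map (epsR V W X) ≫ f := by
  simp only [epsR, P.J.map_comp, Category.assoc]
  rw [← P.R_unit, ← P.R_exchange_assoc, ← Category.assoc, P.R_tensor', Category.assoc]

end

end Duals

/-! ### The algebra of a category of free bimodules -/

section Algebra

open VectC

variable {C : Type u} [SmallCategory C] [Preadditive C] [Linear ℂ C] [MonoidalCategory C]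
  [MonoidalPreadditive C] [MonoidalLinear ℂ C]

namespace FreeBimod

variable (P : FreeBimod C)

/-- The presheaf `U ↦ P(J U, J Y)`. -/
noncomputable def homObj (Y : C) : VectC C :=
  mk' (fun U => P.J.obj U ⟶ P.J.obj Y)
    (fun X Y => LinearMap.mk₂ ℂ (fun f a => P.J.map f ≫ a)
      (fun f f' a => by rw [P.J_add, Preadditive.add_comp])
      (fun c f a => by rw [P.J_smul, Linear.smul_comp])
      (fun f a a' => by rw [Preadditive.comp_add])
      (fun c f a => by rw [Linear.comp_smul]))
    (fun X a => by simp)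
    (fun f g a => by simp)

/-- The presheaf `U ↦ P(J U, J 1)` underlying the algebra of `P`. -/
noncomputable def algObj : VectC C := P.homObj (𝟙_ C)

/-- Elements of the algebra are morphisms `J U ⟶ J 1`. -/
def algEv (U : C) : (P.J.obj U ⟶ P.J.obj (𝟙_ C)) ≃ₗ[ℂ] P.algObj.ev U :=
  LinearEquiv.refl ℂ (P.J.obj U ⟶ P.J.obj (𝟙_ C))

theorem algEv_surj {U : C} (x : P.algObj.ev U) : ∃ a, P.algEv U a = x := ⟨x, rfl⟩

theorem res_algEv {U V : C} (f : U ⟶ V) (a : P.J.obj V ⟶ P.J.obj (𝟙_ C)) :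
    P.algObj.res f (P.algEv V a) = P.algEv U (P.J.map f ≫ a) := rfl

/-- The product of `a : J U ⟶ J 1` and `b : J V ⟶ J 1`, namely `a ⊗ V` followed by `b`. -/
def mulElt {U V : C} (a : P.J.obj U ⟶ P.J.obj (𝟙_ C)) (b : P.J.obj V ⟶ P.J.obj (𝟙_ C)) :
    P.J.obj (U ⊗ V) ⟶ P.J.obj (𝟙_ C) :=
  P.R V a ≫ P.J.map (λ_ V).hom ≫ b

theorem mulElt_nat {U U' V V' : C} (g : U ⟶ U') (h : V ⟶ V') (a : P.J.obj U' ⟶ P.J.obj (𝟙_ C))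
    (b : P.J.obj V' ⟶ P.J.obj (𝟙_ C)) :
    P.mulElt (P.J.map g ≫ a) (P.J.map h ≫ b) = P.J.map (g ⊗ₘ h) ≫ P.mulElt a b := by
  simp only [mulElt, R_comp_assoc, R_map, MonoidalCategory.tensorHom_def, P.J.map_comp,
    Category.assoc]
  rw [← R_exchange_assoc]
  congr 2
  rw [J_map_comp, J_map_comp, leftUnitor_naturality]

/-- The product as a bilinear map. -/
noncomputable def mulLin (U V : C) :
    (P.J.obj U ⟶ P.J.obj (𝟙_ C)) →ₗ[ℂ] (P.J.obj V ⟶ P.J.obj (𝟙_ C)) →ₗ[ℂ]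
      (P.J.obj (U ⊗ V) ⟶ P.J.obj (𝟙_ C)) :=
  LinearMap.mk₂ ℂ P.mulElt
    (fun a a' b => by rw [mulElt, P.R_add, Preadditive.add_comp]; rfl)
    (fun c a b => by rw [mulElt, P.R_smul, Linear.smul_comp]; rfl)
    (fun a b b' => by simp only [mulElt, Preadditive.comp_add])
    (fun c a b => by simp only [mulElt, Linear.comp_smul])

/-- The bilinear maps underlying the multiplication. -/
noncomputable def mulFam (U V : C) :
    P.algObj.ev U →ₗ[ℂ] P.algObj.ev V →ₗ[ℂ] P.algObj.ev (U ⊗ V) :=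
  ((P.mulLin U V).compl₁₂ (P.algEv U).symm.toLinearMap (P.algEv V).symm.toLinearMap).compr₂
    (P.algEv (U ⊗ V)).toLinearMap

/-- The multiplication of the algebra. -/
noncomputable def mulHom : day P.algObj P.algObj ⟶ P.algObj :=
  desc P.mulFam (fun g h a b => congrArg (P.algEv _) (P.mulElt_nat g h a b))

theorem mulHom_pureT {X U V : C} (f : X ⟶ U ⊗ V) (a : P.J.obj U ⟶ P.J.obj (𝟙_ C))
    (b : P.J.obj V ⟶ P.J.obj (𝟙_ C)) :
    app P.mulHom X (pureT P.algObj P.algObj X U V f (P.algEv U a) (P.algEv V b)) =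
      P.algEv X (P.J.map f ≫ P.mulElt a b) :=
  desc_pureT P.mulFam (fun g h a b => congrArg (P.algEv _) (P.mulElt_nat g h a b)) f _ _

/-- The unit of the algebra. -/
noncomputable def oneHom : yo (𝟙_ C) ⟶ P.algObj := yoDesc (P.algEv _ (𝟙 (P.J.obj (𝟙_ C))))

theorem oneHom_app {X : C} (k : X ⟶ 𝟙_ C) :
    app P.oneHom X k = P.algEv X (P.J.map k) := by
  refine (app_yoDesc _ _).trans ?_
  rw [res_algEv, Category.comp_id]

theorem mulElt_one_left {V : C} (k : V ⟶ 𝟙_ C) {W : C} (b : P.J.obj W ⟶ P.J.obj (𝟙_ C)) :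
    P.mulElt (P.J.map k) b = P.J.map (k ▷ W ≫ (λ_ W).hom) ≫ b := by
  rw [mulElt, R_map, J_map_comp]

theorem mulElt_one_right {V : C} (a : P.J.obj V ⟶ P.J.obj (𝟙_ C)) {W : C} (k : W ⟶ 𝟙_ C) :
    P.mulElt a (P.J.map k) = P.J.map (V ◁ k ≫ (ρ_ V).hom) ≫ a := by
  rw [mulElt, ← P.J.map_comp, ← leftUnitor_naturality, unitors_equal, P.J.map_comp,
    R_exchange_assoc, P.R_unit, J_map_comp]

/-- Associativity of the product: the right action of `V ⊗ W` is the composite of the right actions.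
-/
theorem mulElt_assoc {U V W : C} (a : P.J.obj U ⟶ P.J.obj (𝟙_ C))
    (b : P.J.obj V ⟶ P.J.obj (𝟙_ C)) (c : P.J.obj W ⟶ P.J.obj (𝟙_ C)) :
    P.mulElt (P.mulElt a b) c = P.J.map (α_ U V W).hom ≫ P.mulElt a (P.mulElt b c) := by
  simp only [mulElt, R_comp, R_map, Category.assoc]
  have e : (λ_ V).hom ▷ W = (α_ (𝟙_ C) V W).hom ≫ (λ_ (V ⊗ W)).hom := by monoidal
  rw [e, P.J.map_comp, Category.assoc, ← Category.assoc (P.R W (P.R V a)), P.R_tensor',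
    Category.assoc]

noncomputable instance algMon : MonObj P.algObj where
  one := P.oneHom
  mul := P.mulHom
  one_mul := by
    apply day_ext
    intro X U V f k b
    obtain ⟨b, rfl⟩ := P.algEv_surj b
    rw [app_comp]
    refine (congrArg (app P.mulHom X) ((app_whiskerRight_pureT P.oneHom P.algObj f k _).trans
      (congrArg (fun z => pureT _ _ X U V f z _) (P.oneHom_app k)))).trans ?_
    refine (P.mulHom_pureT f _ _).trans ?_
    refine Eq.trans ?_ (leftUnitHom_pureT f k _).symm
    have e : ∀ k : U ⟶ 𝟙_ C, P.J.map f ≫ P.mulElt (P.J.map k) b =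
        P.J.map (f ≫ k ▷ V ≫ (λ_ V).hom) ≫ b := fun k => by rw [mulElt_one_left, J_map_comp]
    exact congrArg (P.algEv X) (e k)
  mul_one := by
    apply day_ext
    intro X U V f a k
    obtain ⟨a, rfl⟩ := P.algEv_surj a
    rw [app_comp]
    refine (congrArg (app P.mulHom X) ((app_whiskerLeft_pureT P.algObj P.oneHom f _ k).trans
      (congrArg (fun z => pureT _ _ X U V f _ z) (P.oneHom_app k)))).trans ?_
    refine (P.mulHom_pureT f _ _).trans ?_
    refine Eq.trans ?_ (rightUnitHom_pureT f _ k).symm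
    have e : ∀ k : V ⟶ 𝟙_ C, P.J.map f ≫ P.mulElt a (P.J.map k) =
        P.J.map (f ≫ U ◁ k ≫ (ρ_ U).hom) ≫ a := fun k => by rw [mulElt_one_right, J_map_comp]
    exact congrArg (P.algEv X) (e k)
  mul_assoc := by
    apply day_extL
    intro X W Z U V k f a b c
    obtain ⟨a, rfl⟩ := P.algEv_surj a
    obtain ⟨b, rfl⟩ := P.algEv_surj b
    obtain ⟨c, rfl⟩ := P.algEv_surj c
    rw [app_comp, app_comp, app_comp]
    have h1 := app_whiskerRight_pureT P.mulHom P.algObj k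
      (pureT P.algObj P.algObj W U V f (P.algEv U a) (P.algEv V b)) (P.algEv Z c)
    rw [P.mulHom_pureT] at h1
    refine (congrArg (app P.mulHom X) h1).trans ?_
    rw [P.mulHom_pureT]
    have h2 := app_associator_hom_pureT k f (P.algEv U a) (P.algEv V b) (P.algEv Z c)
    refine Eq.trans ?_ (congrArg (fun z => app P.mulHom X (app (P.algObj ◁ P.mulHom) X z)) h2.symm)
    have h3 := app_whiskerLeft_pureT P.algObj P.mulHom (k ≫ f ▷ Z ≫ (α_ U V Z).hom)
      (P.algEv U a) (pureT P.algObj P.algObj (V ⊗ Z) V Z (𝟙 _) (P.algEv V b) (P.algEv Z c))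
    rw [P.mulHom_pureT] at h3
    refine Eq.trans ?_ (congrArg (fun z => app P.mulHom X z) h3.symm)
    rw [P.mulHom_pureT]
    congr 1
    have h4 := P.mulElt_nat f (𝟙 Z) (P.mulElt a b) c
    rw [P.J.map_id, Category.id_comp] at h4
    rw [h4, mulElt_assoc, J_map_comp, J_map_comp, P.J.map_id, Category.id_comp, tensorHom_id]
    simp only [Category.assoc]

end FreeBimod

end Algebra

/-! ### The half-braiding of the algebra -/

section HalfBraid

open VectC

variable {C : Type u} [SmallCategory C] [Preadditive C] [Linear ℂ C] [MonoidalCategory C]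
  [MonoidalPreadditive C] [MonoidalLinear ℂ C] [RightRigidCategory C] [LeftRigidCategory C]

namespace FreeBimod

variable (P : FreeBimod C)

/-- Transposition `P(X, V ⊗ 1) → P(V* ⊗ X, 1)`. -/
noncomputable def transL (V X : C) : (P.J.obj X ⟶ P.J.obj (V ⊗ 𝟙_ C)) →ₗ[ℂ]
    (P.J.obj (Vᘁ ⊗ X) ⟶ P.J.obj (𝟙_ C)) where
  toFun φ := P.L Vᘁ φ ≫ P.J.map (epsL V Vᘁ (𝟙_ C))
  map_add' φ ψ := by rw [P.L_add, Preadditive.add_comp]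
  map_smul' c φ := by rw [P.L_smul, Linear.smul_comp]; rfl

/-- Transposition `P(X, 1 ⊗ V) → P(X ⊗ *V, 1)`. -/
noncomputable def transR (V X : C) : (P.J.obj X ⟶ P.J.obj (𝟙_ C ⊗ V)) →ₗ[ℂ]
    (P.J.obj (X ⊗ ᘁV) ⟶ P.J.obj (𝟙_ C)) where
  toFun φ := P.R ᘁV φ ≫ P.J.map (epsR ᘁV V (𝟙_ C))
  map_add' φ ψ := by rw [P.R_add, Preadditive.add_comp]
  map_smul' c φ := by rw [P.R_smul, Linear.smul_comp]; rfl

theorem transL_def {V X : C} (φ : P.J.obj X ⟶ P.J.obj (V ⊗ 𝟙_ C)) :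
    P.transL V X φ = P.L Vᘁ φ ≫ P.J.map (epsL V Vᘁ (𝟙_ C)) := rfl

theorem transR_def {V X : C} (φ : P.J.obj X ⟶ P.J.obj (𝟙_ C ⊗ V)) :
    P.transR V X φ = P.R ᘁV φ ≫ P.J.map (epsR ᘁV V (𝟙_ C)) := rfl

/-- Transposition is undone by tensoring with `V` and composing with the unit of duality. -/
theorem eta_transL {V X : C} (φ : P.J.obj X ⟶ P.J.obj (V ⊗ 𝟙_ C)) :
    P.J.map (etaL V Vᘁ X) ≫ P.L V (P.transL V X φ) = φ := by
  rw [transL_def, P.L_comp, P.L_map, ← Category.assoc, P.L_L_eta V Vᘁ, Category.assoc,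
    ← P.J.map_comp,
    etaL_epsL, P.J.map_id, Category.comp_id]

theorem eta_transR {V X : C} (φ : P.J.obj X ⟶ P.J.obj (𝟙_ C ⊗ V)) :
    P.J.map (etaR ᘁV V X) ≫ P.R V (P.transR V X φ) = φ := by
  rw [transR_def, P.R_comp, P.R_map, ← Category.assoc, P.R_R_eta (ᘁV) V, Category.assoc,
    ← P.J.map_comp,
    etaR_epsR, P.J.map_id, Category.comp_id]

/-- The transpose of `k` followed by `V ⊗ a` is `a` precomposed with a morphism of `C`. -/
theorem transL_L {V W X : C} (k : X ⟶ V ⊗ W) (a : P.J.obj W ⟶ P.J.obj (𝟙_ C)) :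
    P.transL V X (P.J.map k ≫ P.L V a) = P.J.map (Vᘁ ◁ k ≫ epsL V Vᘁ W) ≫ a := by
  rw [transL_def, P.L_comp, P.L_map, Category.assoc, P.L_L_eps V Vᘁ, J_map_comp]

theorem transR_R {V W X : C} (k : X ⟶ W ⊗ V) (a : P.J.obj W ⟶ P.J.obj (𝟙_ C)) :
    P.transR V X (P.J.map k ≫ P.R V a) = P.J.map (k ▷ (ᘁV) ≫ epsR ᘁV V W) ≫ a := by
  rw [transR_def, P.R_comp, P.R_map, Category.assoc, P.R_R_eps (ᘁV) V, J_map_comp]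

theorem etaL_comp {V W X : C} (k : X ⟶ V ⊗ W) :
    etaL V Vᘁ X ≫ V ◁ (Vᘁ ◁ k ≫ epsL V Vᘁ W) = k := by
  rw [MonoidalCategory.whiskerLeft_comp, ← Category.assoc, ← etaL_naturality, Category.assoc,
    etaL_epsL, Category.comp_id]

theorem etaR_comp {V W X : C} (k : X ⟶ W ⊗ V) :
    etaR ᘁV V X ≫ (k ▷ (ᘁV) ≫ epsR ᘁV V W) ▷ V = k := by
  rw [comp_whiskerRight, ← Category.assoc, ← etaR_naturality, Category.assoc,
    etaR_epsR, Category.comp_id]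

/-- The element of `(F ⊗ A)(X)` given by `b ∈ F(V)` and `φ ∈ P(X, V ⊗ 1)`. Since `V` has a dual,
`(F ⊗ A)(X)` is the coend over `V` of `F(V) ⊗ P(X, V)`. -/
noncomputable def elL (F : VectC C) (V X : C) :
    F.ev V →ₗ[ℂ] (P.J.obj X ⟶ P.J.obj (V ⊗ 𝟙_ C)) →ₗ[ℂ] (day F P.algObj).ev X :=
  (pureT F P.algObj X V (Vᘁ ⊗ X) (etaL V Vᘁ X)).compl₂
    ((P.algEv _).toLinearMap.comp (P.transL V X))

/-- The element of `(A ⊗ F)(X)` given by `b ∈ F(V)` and `φ ∈ P(X, 1 ⊗ V)`. -/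
noncomputable def elR (F : VectC C) (V X : C) :
    F.ev V →ₗ[ℂ] (P.J.obj X ⟶ P.J.obj (𝟙_ C ⊗ V)) →ₗ[ℂ] (day P.algObj F).ev X :=
  ((pureT P.algObj F X (X ⊗ ᘁV) V (etaR ᘁV V X)).comp
    ((P.algEv _).toLinearMap.comp (P.transR V X))).flip

theorem elL_def {F : VectC C} {V X : C} (b : F.ev V) (φ : P.J.obj X ⟶ P.J.obj (V ⊗ 𝟙_ C)) :
    P.elL F V X b φ = pureT F P.algObj X V (Vᘁ ⊗ X) (etaL V Vᘁ X) b
      (P.algEv _ (P.transL V X φ)) := rfl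

theorem elR_def {F : VectC C} {V X : C} (b : F.ev V) (φ : P.J.obj X ⟶ P.J.obj (𝟙_ C ⊗ V)) :
    P.elR F V X b φ = pureT P.algObj F X (X ⊗ ᘁV) V (etaR ᘁV V X)
      (P.algEv _ (P.transR V X φ)) b := rfl

/-- Elementary tensors are of the form `elL`. -/
theorem pureT_eq_elL {F : VectC C} {V W X : C} (k : X ⟶ V ⊗ W) (b : F.ev V)
    (a : P.J.obj W ⟶ P.J.obj (𝟙_ C)) :
    pureT F P.algObj X V W k b (P.algEv W a) = P.elL F V X b (P.J.map k ≫ P.L V a) := by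
  rw [elL_def, transL_L, ← res_algEv, pureT_res_right, etaL_comp]

/-- Elementary tensors are of the form `elR`. -/
theorem pureT_eq_elR {F : VectC C} {V W X : C} (k : X ⟶ W ⊗ V) (b : F.ev V)
    (a : P.J.obj W ⟶ P.J.obj (𝟙_ C)) :
    pureT P.algObj F X W V k (P.algEv W a) b = P.elR F V X b (P.J.map k ≫ P.R V a) := by
  rw [elR_def, transR_R, ← res_algEv, pureT_res_left, etaR_comp]

theorem res_elL {F : VectC C} {V X Y : C} (k : Y ⟶ X) (b : F.ev V)
    (φ : P.J.obj X ⟶ P.J.obj (V ⊗ 𝟙_ C)) :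
    (day F P.algObj).res k (P.elL F V X b φ) = P.elL F V Y b (P.J.map k ≫ φ) := by
  rw [elL_def, res_pureT, pureT_eq_elL, P.J.map_comp, Category.assoc, eta_transL]

theorem res_elR {F : VectC C} {V X Y : C} (k : Y ⟶ X) (b : F.ev V)
    (φ : P.J.obj X ⟶ P.J.obj (𝟙_ C ⊗ V)) :
    (day P.algObj F).res k (P.elR F V X b φ) = P.elR F V Y b (P.J.map k ≫ φ) := by
  rw [elR_def, res_pureT, pureT_eq_elR, P.J.map_comp, Category.assoc, eta_transR]

/-- The coend relation for `elL`. -/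
theorem elL_res {F : VectC C} {V V' X : C} (h : V ⟶ V') (b : F.ev V')
    (φ : P.J.obj X ⟶ P.J.obj (V ⊗ 𝟙_ C)) :
    P.elL F V X (F.res h b) φ = P.elL F V' X b (φ ≫ P.J.map (h ▷ 𝟙_ C)) := by
  rw [elL_def, pureT_res_left, pureT_eq_elL, P.J.map_comp, Category.assoc, ← P.L_exchange,
    ← Category.assoc, eta_transL]

/-- The coend relation for `elR`. -/
theorem elR_res {F : VectC C} {V V' X : C} (h : V ⟶ V') (b : F.ev V')
    (φ : P.J.obj X ⟶ P.J.obj (𝟙_ C ⊗ V)) :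
    P.elR F V X (F.res h b) φ = P.elR F V' X b (φ ≫ P.J.map (𝟙_ C ◁ h)) := by
  rw [elR_def, pureT_res_right, pureT_eq_elR, P.J.map_comp, Category.assoc, ← P.R_exchange,
    ← Category.assoc, eta_transR]

theorem app_elL {F G : VectC C} (t : F ⟶ G) {V X : C} (b : F.ev V)
    (φ : P.J.obj X ⟶ P.J.obj (V ⊗ 𝟙_ C)) :
    app (t ▷ P.algObj) X (P.elL F V X b φ) = P.elL G V X (app t V b) φ :=
  app_whiskerRight_pureT t P.algObj _ _ _

variable (C) in
/-- The isomorphism `1 ⊗ V ≅ V ⊗ 1`. -/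
def unitSwap (V : C) : 𝟙_ C ⊗ V ≅ V ⊗ 𝟙_ C := λ_ V ≪≫ (ρ_ V).symm

theorem unitSwap_naturality {V W : C} (f : V ⟶ W) :
    𝟙_ C ◁ f ≫ (unitSwap C W).hom = (unitSwap C V).hom ≫ f ▷ 𝟙_ C := by
  simp [unitSwap]

theorem unitSwap_inv_naturality {V W : C} (f : V ⟶ W) :
    f ▷ 𝟙_ C ≫ (unitSwap C W).inv = (unitSwap C V).inv ≫ 𝟙_ C ◁ f := by
  simp [unitSwap]

/-- The bilinear maps underlying the half-braiding. -/
noncomputable def braidFam (F : VectC C) (U V : C) :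
    P.algObj.ev U →ₗ[ℂ] F.ev V →ₗ[ℂ] (day F P.algObj).ev (U ⊗ V) :=
  ((P.elL F V (U ⊗ V)).compl₂
    ({ toFun := fun a => P.R V ((P.algEv U).symm a) ≫ P.J.map (unitSwap C V).hom
       map_add' := fun a a' => by rw [map_add, P.R_add, Preadditive.add_comp]
       map_smul' := fun c a => by rw [map_smul, P.R_smul, Linear.smul_comp]; rfl } :
      P.algObj.ev U →ₗ[ℂ] (P.J.obj (U ⊗ V) ⟶ P.J.obj (V ⊗ 𝟙_ C)))).flip

theorem braidFam_apply (F : VectC C) {U V : C} (a : P.J.obj U ⟶ P.J.obj (𝟙_ C)) (b : F.ev V) :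
    P.braidFam F U V (P.algEv U a) b =
      P.elL F V (U ⊗ V) b (P.R V a ≫ P.J.map (unitSwap C V).hom) := rfl

theorem braidFam_nat (F : VectC C) {U U' V V' : C} (g : U ⟶ U') (h : V ⟶ V')
    (a : P.algObj.ev U') (b : F.ev V') :
    P.braidFam F U V (P.algObj.res g a) (F.res h b) =
      (day F P.algObj).res (g ⊗ₘ h) (P.braidFam F U' V' a b) := by
  obtain ⟨a, rfl⟩ := P.algEv_surj a
  rw [res_algEv, braidFam_apply, braidFam_apply, elL_res, res_elL, P.R_comp, P.R_map,
    Category.assoc, Category.assoc, ← P.J.map_comp, ← unitSwap_naturality, P.J.map_comp,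
    R_exchange_assoc, J_map_comp, MonoidalCategory.tensorHom_def]

/-- The half-braiding `A ⊗ F ⟶ F ⊗ A`. -/
noncomputable def braidHom (F : VectC C) : day P.algObj F ⟶ day F P.algObj :=
  desc (P.braidFam F) (P.braidFam_nat F)

theorem braidHom_pureT (F : VectC C) {X U V : C} (k : X ⟶ U ⊗ V)
    (a : P.J.obj U ⟶ P.J.obj (𝟙_ C)) (b : F.ev V) :
    app (P.braidHom F) X (pureT P.algObj F X U V k (P.algEv U a) b) =
      P.elL F V X b (P.J.map k ≫ P.R V a ≫ P.J.map (unitSwap C V).hom) := by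
  refine (desc_pureT (P.braidFam F) (P.braidFam_nat F) k _ b).trans ?_
  rw [braidFam_apply, res_elL]

theorem braidHom_elR (F : VectC C) {X V : C} (b : F.ev V)
    (φ : P.J.obj X ⟶ P.J.obj (𝟙_ C ⊗ V)) :
    app (P.braidHom F) X (P.elR F V X b φ) =
      P.elL F V X b (φ ≫ P.J.map (unitSwap C V).hom) := by
  rw [elR_def, braidHom_pureT, ← Category.assoc, eta_transR]

/-- The bilinear maps underlying the inverse of the half-braiding. -/
noncomputable def braidInvFam (F : VectC C) (V U : C) :
    F.ev V →ₗ[ℂ] P.algObj.ev U →ₗ[ℂ] (day P.algObj F).ev (V ⊗ U) :=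
  (P.elR F V (V ⊗ U)).compl₂
    ({ toFun := fun a => P.L V ((P.algEv U).symm a) ≫ P.J.map (unitSwap C V).inv
       map_add' := fun a a' => by rw [map_add, P.L_add, Preadditive.add_comp]
       map_smul' := fun c a => by rw [map_smul, P.L_smul, Linear.smul_comp]; rfl } :
      P.algObj.ev U →ₗ[ℂ] (P.J.obj (V ⊗ U) ⟶ P.J.obj (𝟙_ C ⊗ V)))

theorem braidInvFam_apply (F : VectC C) {U V : C} (b : F.ev V)
    (a : P.J.obj U ⟶ P.J.obj (𝟙_ C)) : P.braidInvFam F V U b (P.algEv U a) =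
      P.elR F V (V ⊗ U) b (P.L V a ≫ P.J.map (unitSwap C V).inv) := rfl

theorem braidInvFam_nat (F : VectC C) {V V' U U' : C} (h : V ⟶ V') (g : U ⟶ U')
    (b : F.ev V') (a : P.algObj.ev U') :
    P.braidInvFam F V U (F.res h b) (P.algObj.res g a) =
      (day P.algObj F).res (h ⊗ₘ g) (P.braidInvFam F V' U' b a) := by
  obtain ⟨a, rfl⟩ := P.algEv_surj a
  rw [res_algEv, braidInvFam_apply, braidInvFam_apply, elR_res, res_elR, P.L_comp, P.L_map,
    Category.assoc, Category.assoc, ← P.J.map_comp, ← unitSwap_inv_naturality, P.J.map_comp,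
    L_exchange_assoc, J_map_comp, MonoidalCategory.tensorHom_def']

/-- The inverse `F ⊗ A ⟶ A ⊗ F` of the half-braiding. -/
noncomputable def braidInv (F : VectC C) : day F P.algObj ⟶ day P.algObj F :=
  desc (P.braidInvFam F) (P.braidInvFam_nat F)

theorem braidInv_pureT (F : VectC C) {X U V : C} (k : X ⟶ V ⊗ U) (b : F.ev V)
    (a : P.J.obj U ⟶ P.J.obj (𝟙_ C)) :
    app (P.braidInv F) X (pureT F P.algObj X V U k b (P.algEv U a)) =
      P.elR F V X b (P.J.map k ≫ P.L V a ≫ P.J.map (unitSwap C V).inv) := by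
  refine (desc_pureT (P.braidInvFam F) (P.braidInvFam_nat F) k b _).trans ?_
  rw [braidInvFam_apply, res_elR]

theorem braidInv_elL (F : VectC C) {X V : C} (b : F.ev V)
    (φ : P.J.obj X ⟶ P.J.obj (V ⊗ 𝟙_ C)) :
    app (P.braidInv F) X (P.elL F V X b φ) =
      P.elR F V X b (φ ≫ P.J.map (unitSwap C V).inv) := by
  rw [elL_def, braidInv_pureT, ← Category.assoc, eta_transL]

/-- The half-braiding `A ⊗ F ≅ F ⊗ A`. -/
noncomputable def braidIso (F : VectC C) : P.algObj ⊗ F ≅ F ⊗ P.algObj where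
  hom := P.braidHom F
  inv := P.braidInv F
  hom_inv_id := by
    apply day_ext
    intro X U V k a b
    obtain ⟨a, rfl⟩ := P.algEv_surj a
    rw [app_comp, braidHom_pureT, braidInv_elL]
    simp only [Category.assoc, ← P.J.map_comp, Iso.hom_inv_id, P.J.map_id, Category.comp_id]
    exact (P.pureT_eq_elR k b a).symm
  inv_hom_id := by
    apply day_ext
    intro X V U k b a
    obtain ⟨a, rfl⟩ := P.algEv_surj a
    rw [app_comp, braidInv_pureT, braidHom_elR]
    simp only [Category.assoc, ← P.J.map_comp, Iso.inv_hom_id, P.J.map_id, Category.comp_id]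
    exact (P.pureT_eq_elL k b a).symm

theorem braidHom_naturality {F G : VectC C} (t : F ⟶ G) :
    P.algObj ◁ t ≫ P.braidHom G = P.braidHom F ≫ t ▷ P.algObj := by
  apply day_ext
  intro X U V k a b
  obtain ⟨a, rfl⟩ := P.algEv_surj a
  rw [app_comp, app_comp, braidHom_pureT, app_elL]
  exact (congrArg (app (P.braidHom G) X) (app_whiskerLeft_pureT P.algObj t k _ b)).trans
    (P.braidHom_pureT G k a _)

end FreeBimod

end HalfBraid

section CenterAlg

open VectC

variable {C : Type u} [SmallCategory C] [Preadditive C] [Linear ℂ C] [MonoidalCategory C]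
  [MonoidalPreadditive C] [MonoidalLinear ℂ C] [RightRigidCategory C] [LeftRigidCategory C]

namespace FreeBimod

variable (P : FreeBimod C)

/-- Transposition is compatible with the right action. -/
theorem eta_R_transL {V X Y Z : C} (k : Y ⟶ X ⊗ Z) (φ : P.J.obj X ⟶ P.J.obj (V ⊗ 𝟙_ C))
    {T : P.carrier} (h : P.J.obj (V ⊗ (𝟙_ C ⊗ Z)) ⟶ T) :
    P.J.map (k ≫ etaL V Vᘁ X ▷ Z ≫ (α_ V (Vᘁ ⊗ X) Z).hom) ≫ P.L V (P.R Z (P.transL V X φ)) ≫ h =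
      P.J.map k ≫ P.R Z φ ≫ P.J.map (α_ V (𝟙_ C) Z).hom ≫ h := by
  have e : P.J.map (α_ V (Vᘁ ⊗ X) Z).hom ≫ P.L V (P.R Z (P.transL V X φ)) ≫ h =
      P.R Z (P.L V (P.transL V X φ)) ≫ P.J.map (α_ V (𝟙_ C) Z).hom ≫ h := by
    rw [← Category.assoc, ← P.R_L, Category.assoc]
  rw [P.J.map_comp, P.J.map_comp, Category.assoc, Category.assoc, e, ← P.R_map,
    ← Category.assoc (P.R Z _), ← P.R_comp, eta_transL]

/-- Transposition is compatible with the left action. -/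
theorem eta_L_transL {V X Y Z : C} (k : Y ⟶ V ⊗ X) (φ : P.J.obj X ⟶ P.J.obj (Z ⊗ 𝟙_ C)) :
    P.J.map (k ≫ V ◁ etaL Z Zᘁ X ≫ (α_ V Z (Zᘁ ⊗ X)).inv) ≫ P.L (V ⊗ Z) (P.transL Z X φ) =
      P.J.map k ≫ P.L V φ ≫ P.J.map (α_ V Z (𝟙_ C)).inv := by
  rw [P.J.map_comp, P.J.map_comp, Category.assoc, Category.assoc, ← P.L_tensor', ← P.L_map,
    ← Category.assoc (P.L V _), ← P.L_comp, eta_transL]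

theorem pureT_elL {F G : VectC C} {U V X Z : C} (k : Z ⟶ X ⊗ U) (b : F.ev V)
    (φ : P.J.obj X ⟶ P.J.obj (V ⊗ 𝟙_ C)) (c : G.ev U) :
    app (α_ F P.algObj G).hom Z (pureT (day F P.algObj) G Z X U k (P.elL F V X b φ) c) =
      pureT F (day P.algObj G) Z V _ (k ≫ etaL V Vᘁ X ▷ U ≫ (α_ V (Vᘁ ⊗ X) U).hom) b
        (pureT P.algObj G ((Vᘁ ⊗ X) ⊗ U) (Vᘁ ⊗ X) U (𝟙 _) (P.algEv _ (P.transL V X φ)) c) := by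
  rw [elL_def]
  exact app_associator_hom_pureT k _ b _ c

theorem elL_pureT {F G : VectC C} {U V X Z : C} (k : Z ⟶ U ⊗ X) (b : F.ev V)
    (φ : P.J.obj X ⟶ P.J.obj (V ⊗ 𝟙_ C)) (c : G.ev U) :
    app (α_ G F P.algObj).inv Z (pureT G (day F P.algObj) Z U X k c (P.elL F V X b φ)) =
      pureT (day G F) P.algObj Z (U ⊗ V) (Vᘁ ⊗ X)
        (k ≫ U ◁ etaL V Vᘁ X ≫ (α_ U V (Vᘁ ⊗ X)).inv) (pureT G F (U ⊗ V) U V (𝟙 _) c b)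
        (P.algEv _ (P.transL V X φ)) := by
  rw [elL_def]
  exact app_associator_inv_pureT k _ c b _

theorem whiskerLeft_braidHom_pureT {F G : VectC C} {U V W X : C} (k : X ⟶ U ⊗ (W ⊗ V))
    (c : G.ev U) (a : P.J.obj W ⟶ P.J.obj (𝟙_ C)) (b : F.ev V) :
    app (G ◁ P.braidHom F) X (pureT G (day P.algObj F) X U (W ⊗ V) k c
      (pureT P.algObj F (W ⊗ V) W V (𝟙 _) (P.algEv W a) b)) =
      pureT G (day F P.algObj) X U (W ⊗ V) k c
        (P.elL F V (W ⊗ V) b (P.R V a ≫ P.J.map (unitSwap C V).hom)) := by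
  refine (app_whiskerLeft_pureT G (P.braidHom F) k c _).trans ?_
  rw [braidHom_pureT, P.J.map_id, Category.id_comp]

theorem whiskerRight_braidHom_pureT {F G : VectC C} {U V W X : C} (k : X ⟶ (W ⊗ V) ⊗ U)
    (c : G.ev U) (a : P.J.obj W ⟶ P.J.obj (𝟙_ C)) (b : F.ev V) :
    app (P.braidHom F ▷ G) X (pureT (day P.algObj F) G X (W ⊗ V) U k
      (pureT P.algObj F (W ⊗ V) W V (𝟙 _) (P.algEv W a) b) c) =
      pureT (day F P.algObj) G X (W ⊗ V) U k
        (P.elL F V (W ⊗ V) b (P.R V a ≫ P.J.map (unitSwap C V).hom)) c := by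
  refine (app_whiskerRight_pureT (P.braidHom F) G k _ c).trans ?_
  rw [braidHom_pureT, P.J.map_id, Category.id_comp]

/-- The hexagon identity for the half-braiding. Both sides send `a ⊗ (b ⊗ c)` to `b ⊗ c` tensored
with the same transposed morphism, because the right action of a tensor product is the composite of
the right actions. -/
theorem braidHom_tensor (F G : VectC C) :
    P.braidHom (day F G) = (α_ P.algObj F G).inv ≫ P.braidHom F ▷ G ≫ (α_ F P.algObj G).hom ≫
      F ◁ P.braidHom G ≫ (α_ F G P.algObj).inv := by
  apply day_extR
  intro X U W V Z k f a b c
  obtain ⟨a, rfl⟩ := P.algEv_surj a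
  refine Eq.trans ?_ (congrArg (fun z => app (α_ F G P.algObj).inv X (app (F ◁ P.braidHom G) X
    (app (α_ F P.algObj G).hom X (app (P.braidHom F ▷ G) X z))))
    (app_associator_inv_pureT k f (P.algEv U a) b c)).symm
  refine Eq.trans ?_ (congrArg (fun z => app (α_ F G P.algObj).inv X (app (F ◁ P.braidHom G) X
    (app (α_ F P.algObj G).hom X z))) (P.whiskerRight_braidHom_pureT _ c a b)).symm
  refine Eq.trans ?_ (congrArg (fun z => app (α_ F G P.algObj).inv X (app (F ◁ P.braidHom G) X z))
    (P.pureT_elL _ b _ c)).symm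
  refine Eq.trans ?_ (congrArg (fun z => app (α_ F G P.algObj).inv X z)
    (P.whiskerLeft_braidHom_pureT _ b _ c)).symm
  refine Eq.trans ?_ (P.elL_pureT _ c _ b).symm
  rw [braidHom_pureT, pureT_eq_elL]
  have e : pureT F G W V Z f b c = (day F G).res f (pureT F G (V ⊗ Z) V Z (𝟙 _) b c) := by
    rw [res_pureT, Category.comp_id]
  rw [e, elL_res]
  congr 1
  rw [eta_L_transL, P.L_comp, Category.assoc (P.L V _), eta_R_transL, P.R_comp, P.R_map, P.L_map,
    Category.assoc, Category.assoc (P.R Z _), P.J.map_comp _ (U ◁ f ≫ _), P.J.map_comp,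
    Category.assoc, Category.assoc,
    Category.assoc, ← Category.assoc (P.J.map (α_ U V Z).inv), ← P.R_tensor, Category.assoc,
    ← R_exchange_assoc]
  simp only [← P.J.map_comp]
  congr 3
  simp only [unitSwap, Iso.trans_hom, Iso.symm_hom]
  monoidal

/-- The unit of the algebra is a morphism in the center. -/
theorem oneHom_comm (F : VectC C) :
    P.oneHom ▷ F ≫ P.braidHom F = ((λ_ F).hom ≫ (ρ_ F).inv) ≫ F ◁ P.oneHom := by
  apply day_ext
  intro X U V k x b
  have h1 := (app_whiskerRight_pureT P.oneHom F k x b).trans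
      (congrArg (fun z => pureT _ _ X U V k z _) (P.oneHom_app x))
  refine (congrArg (app (P.braidHom F) X) h1).trans ?_
  rw [braidHom_pureT]
  refine Eq.trans ?_ (congrArg (fun z => app (F ◁ P.oneHom) X (app (ρ_ F).inv X z))
    (leftUnitHom_pureT k x b)).symm
  have h2 : app (F ◁ P.oneHom) X (app (ρ_ F).inv X (F.res (k ≫ x ▷ V ≫ (λ_ V).hom) b)) =
      pureT F P.algObj X X (𝟙_ C) (ρ_ X).inv (F.res (k ≫ x ▷ V ≫ (λ_ V).hom) b)
        (P.algEv _ (P.J.map (𝟙 (𝟙_ C)))) :=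
    (app_whiskerLeft_pureT F P.oneHom (ρ_ X).inv _ (yoElt (𝟙 (𝟙_ C)))).trans
      (congrArg (fun z => pureT _ _ X X _ _ _ z) (P.oneHom_app (𝟙 (𝟙_ C))))
  refine Eq.trans ?_ h2.symm
  rw [pureT_eq_elL, elL_res]
  congr 1
  have e : ∀ x : U ⟶ 𝟙_ C, P.J.map k ≫ P.R V (P.J.map x) ≫ P.J.map (unitSwap C V).hom =
      (P.J.map (ρ_ X).inv ≫ P.L X (P.J.map (𝟙 (𝟙_ C)))) ≫
        P.J.map ((k ≫ x ▷ V ≫ (λ_ V).hom) ▷ 𝟙_ C) := by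
    intro x
    rw [P.R_map, P.L_map]
    simp only [← P.J.map_comp]
    congr 1
    simp [unitSwap]
  exact e x

/-- The multiplication of the algebra is a morphism in the center: moving two factors past `F` one
after the other amounts to moving their product, as the right action is functorial. -/
theorem mulHom_comm (F : VectC C) :
    P.mulHom ▷ F ≫ P.braidHom F = ((α_ P.algObj P.algObj F).hom ≫ P.algObj ◁ P.braidHom F ≫
      (α_ P.algObj F P.algObj).inv ≫ P.braidHom F ▷ P.algObj ≫ (α_ F P.algObj P.algObj).hom) ≫
        F ◁ P.mulHom := by
  apply day_extL
  intro X W Z U V k f a a' b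
  obtain ⟨a, rfl⟩ := P.algEv_surj a
  obtain ⟨a', rfl⟩ := P.algEv_surj a'
  have h0 := app_whiskerRight_pureT P.mulHom F k
    (pureT P.algObj P.algObj W U V f (P.algEv U a) (P.algEv V a')) b
  rw [mulHom_pureT] at h0
  refine (congrArg (app (P.braidHom F) X) h0).trans ?_
  rw [braidHom_pureT]
  refine Eq.trans ?_ (congrArg (fun z => app (F ◁ P.mulHom) X (app (α_ F P.algObj P.algObj).hom X
    (app (P.braidHom F ▷ P.algObj) X (app (α_ P.algObj F P.algObj).inv X
    (app (P.algObj ◁ P.braidHom F) X z)))))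
    (app_associator_hom_pureT k f (P.algEv U a) (P.algEv V a') b)).symm
  refine Eq.trans ?_ (congrArg (fun z => app (F ◁ P.mulHom) X (app (α_ F P.algObj P.algObj).hom X
    (app (P.braidHom F ▷ P.algObj) X (app (α_ P.algObj F P.algObj).inv X z))))
    (P.whiskerLeft_braidHom_pureT _ (P.algEv U a) a' b)).symm
  refine Eq.trans ?_ (congrArg (fun z => app (F ◁ P.mulHom) X (app (α_ F P.algObj P.algObj).hom X
    (app (P.braidHom F ▷ P.algObj) X z))) (P.elL_pureT _ b _ (P.algEv U a))).symm
  refine Eq.trans ?_ (congrArg (fun z => app (F ◁ P.mulHom) X (app (α_ F P.algObj P.algObj).hom X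
    z)) (P.whiskerRight_braidHom_pureT _ _ a b)).symm
  refine Eq.trans ?_ (congrArg (fun z => app (F ◁ P.mulHom) X z) (P.pureT_elL _ b _ _)).symm
  refine Eq.trans ?_ (app_whiskerLeft_pureT F P.mulHom _ b _).symm
  rw [mulHom_pureT, pureT_eq_elL]
  congr 1
  simp only [mulElt, P.J.map_id, Category.id_comp]
  rw [P.L_comp Z (P.R _ _), eta_R_transL, P.R_comp (Zᘁ ⊗ _), P.R_map, P.L_comp, P.L_map]
  simp only [Category.assoc]
  have e0 : ∀ Q : C, ∀ η : V ⊗ Z ⟶ Z ⊗ Q,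
      P.J.map (k ≫ f ▷ Z ≫ (α_ U V Z).hom ≫ U ◁ η ≫ (α_ U Z Q).inv) =
        P.J.map (k ≫ f ▷ Z ≫ (α_ U V Z).hom) ≫ P.J.map (U ◁ η) ≫ P.J.map (α_ U Z Q).inv := by
    intro Q η
    simp
  rw [e0, Category.assoc, Category.assoc, ← Category.assoc (P.J.map (α_ U Z _).inv), ← P.R_tensor,
    Category.assoc, ← R_exchange_assoc]
  have e : ∀ Q : C, ∀ η : V ⊗ Z ⟶ Z ⊗ Q, 𝟙_ C ◁ η ≫ (α_ (𝟙_ C) Z Q).inv ≫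
      (unitSwap C Z).hom ▷ Q ≫ (α_ Z (𝟙_ C) Q).hom ≫ Z ◁ (λ_ Q).hom = (λ_ (V ⊗ Z)).hom ≫ η := by
    intro Q η
    simp only [unitSwap, Iso.trans_hom, Iso.symm_hom]
    monoidal
  simp only [J_map_comp]
  rw [e, P.J.map_comp _ (etaL _ _ _), Category.assoc, eta_transL, P.R_comp, P.R_comp,
    P.R_comp, P.R_map, P.R_map]
  have e2 : (λ_ V).hom ▷ Z = (α_ (𝟙_ C) V Z).hom ≫ (λ_ (V ⊗ Z)).hom := by monoidal
  simp only [Category.assoc]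
  rw [e2, P.J.map_comp (α_ (𝟙_ C) V Z).hom, Category.assoc, ← Category.assoc (P.R Z (P.R V a)),
    P.R_tensor']
  simp only [P.J.map_comp, Category.assoc]

end FreeBimod

end CenterAlg

/-! ### The functor to algebras in the center -/

section CenterFunctor

open VectC

variable {C : Type u} [SmallCategory C] [Preadditive C] [Linear ℂ C] [MonoidalCategory C]
  [MonoidalPreadditive C] [MonoidalLinear ℂ C] [RightRigidCategory C] [LeftRigidCategory C]

namespace FreeBimod

/-- The algebra of `P` with its half-braiding. -/
noncomputable def centerObj (P : FreeBimod C) : Center (VectC C) :=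
  ⟨P.algObj,
    { β := P.braidIso
      monoidal := P.braidHom_tensor
      naturality := P.braidHom_naturality }⟩

/-- The algebra of `P` as an algebra in the Drinfeld center. -/
noncomputable def centerAlg (P : FreeBimod C) : Mon (Center (VectC C)) where
  X := P.centerObj
  mon :=
    { one := ⟨P.oneHom, P.oneHom_comm⟩
      mul := ⟨P.mulHom, P.mulHom_comm⟩
      one_mul := Center.ext _ _ (MonObj.one_mul P.algObj)
      mul_one := Center.ext _ _ (MonObj.mul_one P.algObj)
      mul_assoc := Center.ext _ _ (MonObj.mul_assoc P.algObj) }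

variable {P Q S : FreeBimod C}

/-- The linear map on algebra elements given by a functor. -/
noncomputable def Hom.lin (Φ : Hom P Q) (X Y : C) :
    (P.J.obj X ⟶ P.J.obj Y) →ₗ[ℂ] (Q.J.obj X ⟶ Q.J.obj Y) where
  toFun := Φ.map
  map_add' := Φ.map_add
  map_smul' := Φ.map_smul

/-- The morphism of presheaves underlying the morphism of algebras given by a functor. -/
noncomputable def Hom.algMap (Φ : Hom P Q) : P.algObj ⟶ Q.algObj :=
  homMk (fun U => (Q.algEv U).toLinearMap.comp ((Φ.lin U (𝟙_ C)).comp (P.algEv U).symm.toLinearMap))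
    (fun {X Y} f a => by
      obtain ⟨a, rfl⟩ := P.algEv_surj a
      have h : Φ.map (P.J.map f ≫ a) = Q.J.map f ≫ Φ.map a := by simp
      exact congrArg (Q.algEv X) h)

theorem Hom.algMap_algEv (Φ : Hom P Q) {U : C} (a : P.J.obj U ⟶ P.J.obj (𝟙_ C)) :
    app Φ.algMap U (P.algEv U a) = Q.algEv U (Φ.map a) := rfl

theorem Hom.map_mulElt (Φ : Hom P Q) {U V : C} (a : P.J.obj U ⟶ P.J.obj (𝟙_ C))
    (b : P.J.obj V ⟶ P.J.obj (𝟙_ C)) :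
    Φ.map (P.mulElt a b) = Q.mulElt (Φ.map a) (Φ.map b) := by simp [mulElt]

theorem Hom.map_transL (Φ : Hom P Q) {V X : C} (φ : P.J.obj X ⟶ P.J.obj (V ⊗ 𝟙_ C)) :
    Φ.map (P.transL V X φ) = Q.transL V X (Φ.map φ) := by simp [transL_def]

theorem Hom.algMap_comm (Φ : Hom P Q) (F : VectC C) :
    Φ.algMap ▷ F ≫ Q.braidHom F = P.braidHom F ≫ F ◁ Φ.algMap := by
  apply day_ext
  intro X U V k a b
  obtain ⟨a, rfl⟩ := P.algEv_surj a
  refine (congrArg (app (Q.braidHom F) X) (app_whiskerRight_pureT Φ.algMap F k _ b)).trans ?_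
  have h := P.braidHom_pureT F k a b
  rw [elL_def] at h
  refine Eq.trans ?_ (congrArg (app (F ◁ Φ.algMap) X) h).symm
  rw [algMap_algEv, braidHom_pureT, elL_def]
  refine Eq.trans ?_ (app_whiskerLeft_pureT F Φ.algMap _ b _).symm
  rw [algMap_algEv, map_transL]
  simp

theorem Hom.one_algMap (Φ : Hom P Q) : P.oneHom ≫ Φ.algMap = Q.oneHom := by
  apply ext_app
  intro X k
  refine (congrArg (app Φ.algMap X) (P.oneHom_app k)).trans (Eq.trans ?_ (Q.oneHom_app k).symm)
  rw [algMap_algEv]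
  exact congrArg (Q.algEv X) (Φ.map_J _)

theorem Hom.mul_algMap (Φ : Hom P Q) :
    P.mulHom ≫ Φ.algMap = (Φ.algMap ⊗ₘ Φ.algMap) ≫ Q.mulHom := by
  apply day_ext
  intro X U V f a b
  obtain ⟨a, rfl⟩ := P.algEv_surj a
  obtain ⟨b, rfl⟩ := P.algEv_surj b
  refine (congrArg (app Φ.algMap X) (P.mulHom_pureT f a b)).trans ?_
  refine Eq.trans ?_ (congrArg (app Q.mulHom X)
    (app_tensorHom_pureT Φ.algMap Φ.algMap f (P.algEv U a) (P.algEv V b))).symm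
  rw [algMap_algEv, algMap_algEv, algMap_algEv, mulHom_pureT, ← map_mulElt]
  simp

/-- The morphism of algebras in the center given by a functor. -/
noncomputable def Hom.centerMap (Φ : Hom P Q) : P.centerAlg ⟶ Q.centerAlg :=
  Mon.Hom.mk' (M := P.centerAlg) (N := Q.centerAlg) ⟨Φ.algMap, Φ.algMap_comm⟩
    (Center.ext _ _ Φ.one_algMap) (Center.ext _ _ Φ.mul_algMap)

variable (C) in
/-- The functor sending a category of free bimodules to its algebra in the Drinfeld center. -/
noncomputable def toCenter : FreeBimod C ⥤ Mon (Center (VectC C)) where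
  obj := centerAlg
  map Φ := Hom.centerMap Φ
  map_id _ := Mon.Hom.ext (Center.ext _ _ rfl)
  map_comp _ _ := Mon.Hom.ext (Center.ext _ _ rfl)

/-! ### Recovering a category of free bimodules from its algebra -/

/-- Every morphism `J X ⟶ J Y` is determined by an element of the algebra. -/
theorem exists_normal (P : FreeBimod C) {X Y : C} (φ : P.J.obj X ⟶ P.J.obj Y) :
    ∃ (U : C) (k : X ⟶ U ⊗ Y) (a : P.J.obj U ⟶ P.J.obj (𝟙_ C)),
      P.J.map k ≫ P.R Y a ≫ P.J.map (λ_ Y).hom = φ :=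
  ⟨_, etaR ᘁY Y X, P.transR Y X (φ ≫ P.J.map (λ_ Y).inv), by
    rw [← Category.assoc, eta_transR, Category.assoc, ← P.J.map_comp]
    simp⟩

/-- Composition in terms of algebra elements is given by their product. -/
theorem normal_comp (P : FreeBimod C) {X Y Z U U' : C} (k : X ⟶ U ⊗ Y)
    (a : P.J.obj U ⟶ P.J.obj (𝟙_ C)) (k' : Y ⟶ U' ⊗ Z) (a' : P.J.obj U' ⟶ P.J.obj (𝟙_ C)) :
    (P.J.map k ≫ P.R Y a ≫ P.J.map (λ_ Y).hom) ≫ P.J.map k' ≫ P.R Z a' ≫ P.J.map (λ_ Z).hom =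
      P.J.map (k ≫ U ◁ k' ≫ (α_ U U' Z).inv) ≫ P.R Z (P.mulElt a a') ≫ P.J.map (λ_ Z).hom := by
  simp only [mulElt, P.R_comp, P.J.map_comp, Category.assoc, P.R_map]
  congr 1
  have e : (λ_ U').hom ▷ Z = (α_ (𝟙_ C) U' Z).hom ≫ (λ_ (U' ⊗ Z)).hom := by monoidal
  rw [e, J_map_comp, ← leftUnitor_naturality, P.J.map_comp, P.J.map_comp, Category.assoc,
    Category.assoc, R_exchange_assoc, ← Category.assoc (P.J.map (α_ U U' Z).inv), ← P.R_tensor,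
    Category.assoc, J_map_comp]
  simp

/-- The right action leaves the algebra element unchanged. -/
theorem normal_R (P : FreeBimod C) (W : C) {X Y U : C} (k : X ⟶ U ⊗ Y)
    (a : P.J.obj U ⟶ P.J.obj (𝟙_ C)) :
    P.R W (P.J.map k ≫ P.R Y a ≫ P.J.map (λ_ Y).hom) =
      P.J.map (k ▷ W ≫ (α_ U Y W).hom) ≫ P.R (Y ⊗ W) a ≫ P.J.map (λ_ (Y ⊗ W)).hom := by
  have e : (λ_ Y).hom ▷ W = (α_ (𝟙_ C) Y W).hom ≫ (λ_ (Y ⊗ W)).hom := by monoidal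
  simp only [P.R_comp, P.J.map_comp, Category.assoc, P.R_map, e]
  rw [← Category.assoc (P.R W _), P.R_tensor', Category.assoc]

/-- The left action on all morphisms is determined by the left action on algebra elements. -/
theorem normal_L (P : FreeBimod C) (W : C) {X Y U : C} (k : X ⟶ U ⊗ Y)
    (a : P.J.obj U ⟶ P.J.obj (𝟙_ C)) :
    P.L W (P.J.map k ≫ P.R Y a ≫ P.J.map (λ_ Y).hom) =
      P.J.map (W ◁ k ≫ (α_ W U Y).inv) ≫ P.R Y (P.L W a) ≫
        P.J.map ((α_ W (𝟙_ C) Y).hom ≫ W ◁ (λ_ Y).hom) := by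
  simp only [P.L_comp, P.J.map_comp, Category.assoc, P.L_map]
  rw [← Category.assoc (P.J.map (α_ W U Y).inv), ← P.L_R, Category.assoc, J_map_comp]
  simp

theorem normal_elt (P : FreeBimod C) {U : C} (a : P.J.obj U ⟶ P.J.obj (𝟙_ C)) :
    P.J.map (ρ_ U).inv ≫ P.R (𝟙_ C) a ≫ P.J.map (λ_ (𝟙_ C)).hom = a := by
  rw [unitors_equal, P.R_unit, J_map_comp]
  simp

/-- The bilinear map `(a, f) ↦ (1 ⊗ f) ∘ (a ⊗ V)`. -/
noncomputable def unfoldLin (P : FreeBimod C) (W U V : C) :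
    (P.J.obj U ⟶ P.J.obj (𝟙_ C)) →ₗ[ℂ] (V ⟶ W) →ₗ[ℂ]
      (P.J.obj (U ⊗ V) ⟶ P.J.obj (𝟙_ C ⊗ W)) :=
  LinearMap.mk₂ ℂ (fun a f => P.R V a ≫ P.J.map (𝟙_ C ◁ f))
    (fun a a' f => by rw [P.R_add, Preadditive.add_comp])
    (fun c a f => by rw [P.R_smul, Linear.smul_comp])
    (fun a f f' => by rw [MonoidalPreadditive.whiskerLeft_add, P.J_add, Preadditive.comp_add])
    (fun c a f => by rw [MonoidalLinear.whiskerLeft_smul, P.J_smul, Linear.comp_smul])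

/-- The bilinear maps underlying `unfoldHom`. -/
noncomputable def unfoldFam (P : FreeBimod C) (W U V : C) :
    P.algObj.ev U →ₗ[ℂ] (V ⟶ W) →ₗ[ℂ] (P.homObj (𝟙_ C ⊗ W)).ev (U ⊗ V) :=
  (P.unfoldLin W U V).comp (P.algEv U).symm.toLinearMap

theorem unfoldFam_nat (P : FreeBimod C) (W : C) {U U' V V' : C} (g : U ⟶ U') (h : V ⟶ V')
    (a : P.algObj.ev U') (f : V' ⟶ W) :
    P.unfoldFam W U V (P.algObj.res g a) (h ≫ f) =
      (P.homObj (𝟙_ C ⊗ W)).res (g ⊗ₘ h) (P.unfoldFam W U' V' a f) := by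
  obtain ⟨a, rfl⟩ := P.algEv_surj a
  have e : P.R V (P.J.map g ≫ a) ≫ P.J.map (𝟙_ C ◁ (h ≫ f)) =
      P.J.map (g ⊗ₘ h) ≫ P.R V' a ≫ P.J.map (𝟙_ C ◁ f) := by
    simp only [P.R_comp, P.R_map, MonoidalCategory.whiskerLeft_comp, P.J.map_comp, Category.assoc,
      MonoidalCategory.tensorHom_def]
    rw [R_exchange_assoc]
  exact e

/-- The map `(A ⊗ C(-, W))(X) ⟶ P(J X, J (1 ⊗ W))`, sending `a ⊗ f` to `a ⊗ V` followed by `f`. -/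
noncomputable def unfoldHom (P : FreeBimod C) (W : C) :
    day P.algObj (yo W) ⟶ P.homObj (𝟙_ C ⊗ W) :=
  desc (F := P.algObj) (G := yo W) (P.unfoldFam W) (P.unfoldFam_nat W)

theorem unfoldHom_elR (P : FreeBimod C) {W X : C} (φ : P.J.obj X ⟶ P.J.obj (𝟙_ C ⊗ W)) :
    app (P.unfoldHom W) X (P.elR (yo W) W X (yoElt (𝟙 W)) φ) = φ := by
  rw [elR_def]
  refine (desc_pureT (F := P.algObj) (G := yo W) (P.unfoldFam W) (P.unfoldFam_nat W) _ _ _).trans ?_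
  have e : P.J.map (etaR ᘁW W X) ≫ P.R W (P.transR W X φ) ≫ P.J.map (𝟙_ C ◁ 𝟙 W) = φ := by
    rw [MonoidalCategory.whiskerLeft_id, P.J.map_id, Category.comp_id, eta_transR]
  exact e

/-- `unfoldHom` is inverted by `φ ↦ elR 1 φ`, so that `A ⊗ C(-, W)` is represented by morphisms into
`J (1 ⊗ W)`. -/
theorem elR_unfoldHom (P : FreeBimod C) {W X : C} (z : (day P.algObj (yo W)).ev X) :
    P.elR (yo W) W X (yoElt (𝟙 W)) (app (P.unfoldHom W) X z) = z := by
  induction z using day_induction with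
  | zero =>
    exact (congrArg (P.elR (yo W) W X (yoElt (𝟙 W))) (map_zero (app (P.unfoldHom W) X))).trans
      (map_zero _)
  | add s t hs ht =>
    exact ((congrArg (P.elR (yo W) W X (yoElt (𝟙 W))) (map_add (app (P.unfoldHom W) X) s t)).trans
      (map_add _ _ _)).trans (congrArg₂ (· + ·) hs ht)
  | mk U V k a f =>
    obtain ⟨a, rfl⟩ := P.algEv_surj a
    have e : f = (yo W).res f (yoElt (𝟙 W)) := (Category.comp_id (X := V) (Y := W) f).symm
    refine Eq.trans ?_ (P.pureT_eq_elR k f a).symm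
    refine Eq.trans ?_ ((congrArg (fun z => P.elR (yo W) V X z _) e).trans (P.elR_res f _ _)).symm
    refine congrArg (P.elR (yo W) W X (yoElt (𝟙 W))) ?_
    refine (desc_pureT (F := P.algObj) (G := yo W) (P.unfoldFam W) (P.unfoldFam_nat W) k _ f).trans
      ?_
    exact (Category.assoc (P.J.map k) (P.R V a) (P.J.map (𝟙_ C ◁ f))).symm

theorem unfoldHom_injective (P : FreeBimod C) {W X : C} :
    Function.Injective (app (P.unfoldHom W) X) := fun z z' h => by
  rw [← P.elR_unfoldHom z, ← P.elR_unfoldHom z', h]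

theorem inv_comp_eq_comp_inv {D : Type*} [Category D] {X Y X' Y' : D} (e : X ≅ Y) (e' : X' ≅ Y')
    {f : X ⟶ X'} {g : Y ⟶ Y'} (h : f ≫ e'.hom = e.hom ≫ g) : e.inv ≫ f = g ≫ e'.inv := by
  rw [Iso.inv_comp_eq, ← Category.assoc, Iso.eq_comp_inv, h]

section Full

variable (Ψ : P.centerAlg ⟶ Q.centerAlg)

/-- The linear maps on algebra elements given by a morphism of algebras. -/
noncomputable def psi (U : C) :
    (P.J.obj U ⟶ P.J.obj (𝟙_ C)) →ₗ[ℂ] (Q.J.obj U ⟶ Q.J.obj (𝟙_ C)) :=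
  (Q.algEv U).symm.toLinearMap.comp ((app Ψ.hom.f U).comp (P.algEv U).toLinearMap)

theorem algEv_psi {U : C} (a : P.J.obj U ⟶ P.J.obj (𝟙_ C)) :
    app Ψ.hom.f U (P.algEv U a) = Q.algEv U (psi Ψ U a) := rfl

theorem psi_J {U V : C} (f : U ⟶ V) (a : P.J.obj V ⟶ P.J.obj (𝟙_ C)) :
    psi Ψ U (P.J.map f ≫ a) = Q.J.map f ≫ psi Ψ V a :=
  app_res Ψ.hom.f f (P.algEv V a)

theorem psi_one : psi Ψ (𝟙_ C) (𝟙 _) = 𝟙 _ := by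
  have h := congrArg (fun t => app t.f (𝟙_ C) (yoElt (𝟙 (𝟙_ C)))) Ψ.isMonHom_hom.one_hom
  have h1 : app P.oneHom (𝟙_ C) (yoElt (𝟙 (𝟙_ C))) = P.algEv (𝟙_ C) (𝟙 _) :=
    (P.oneHom_app (𝟙 (𝟙_ C))).trans (congrArg _ (P.J.map_id _))
  have h2 : app Q.oneHom (𝟙_ C) (yoElt (𝟙 (𝟙_ C))) = Q.algEv (𝟙_ C) (𝟙 _) :=
    (Q.oneHom_app (𝟙 (𝟙_ C))).trans (congrArg _ (Q.J.map_id _))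
  exact (congrArg (app Ψ.hom.f (𝟙_ C)) h1).symm.trans (h.trans h2)

theorem psi_mul {U V : C} (a : P.J.obj U ⟶ P.J.obj (𝟙_ C)) (b : P.J.obj V ⟶ P.J.obj (𝟙_ C)) :
    psi Ψ (U ⊗ V) (P.mulElt a b) = Q.mulElt (psi Ψ U a) (psi Ψ V b) := by
  have h := congrArg (fun t => app t.f (U ⊗ V)
    (pureT P.algObj P.algObj (U ⊗ V) U V (𝟙 _) (P.algEv U a) (P.algEv V b)))
    Ψ.isMonHom_hom.mul_hom
  have h1 := P.mulHom_pureT (𝟙 (U ⊗ V)) a b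
  rw [P.J.map_id, Category.id_comp] at h1
  have h2 := Q.mulHom_pureT (𝟙 (U ⊗ V)) (psi Ψ U a) (psi Ψ V b)
  rw [Q.J.map_id, Category.id_comp] at h2
  have h3 := app_tensorHom_pureT Ψ.hom.f Ψ.hom.f (𝟙 (U ⊗ V)) (P.algEv U a) (P.algEv V b)
  exact (congrArg (app Ψ.hom.f (U ⊗ V)) h1).symm.trans
    (h.trans ((congrArg (app Q.mulHom (U ⊗ V)) h3).trans h2))

/-- Compatibility with the half-braidings at `C(-, W)`, read through `unfoldHom`, says that the left
action is preserved on algebra elements. -/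
theorem psi_braid {U : C} (W : C) (a : P.J.obj U ⟶ P.J.obj (𝟙_ C)) :
    Q.J.map (etaR ᘁW W (W ⊗ U)) ≫
        Q.R W (psi Ψ _ (P.transR W (W ⊗ U) (P.L W a ≫ P.J.map (unitSwap C W).inv))) =
      Q.L W (psi Ψ U a) ≫ Q.J.map (unitSwap C W).inv := by
  have hc : Ψ.hom.f ▷ yo W ≫ Q.braidHom (yo W) = P.braidHom (yo W) ≫ yo W ◁ Ψ.hom.f :=
    Ψ.hom.comm (yo W)
  have hc' : P.braidInv (yo W) ≫ Ψ.hom.f ▷ yo W = yo W ◁ Ψ.hom.f ≫ Q.braidInv (yo W) :=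
    inv_comp_eq_comp_inv (P.braidIso (yo W)) (Q.braidIso (yo W)) hc
  have h := congrArg (fun t => app t (W ⊗ U)
    (pureT (yo W) P.algObj (W ⊗ U) W U (𝟙 _) (yoElt (𝟙 W)) (P.algEv U a))) hc'
  have h1 := P.braidInv_pureT (yo W) (𝟙 (W ⊗ U)) (yoElt (𝟙 W)) a
  rw [P.J.map_id, Category.id_comp, elR_def] at h1
  have h2 := (congrArg (app (Ψ.hom.f ▷ yo W) (W ⊗ U)) h1).trans
    (app_whiskerRight_pureT Ψ.hom.f (yo W) _ _ _)
  have h3 := (congrArg (app (Q.braidInv (yo W)) (W ⊗ U))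
    (app_whiskerLeft_pureT (yo W) Ψ.hom.f (𝟙 (W ⊗ U)) (yoElt (𝟙 W)) (P.algEv U a))).trans
    (Q.braidInv_pureT (yo W) (𝟙 (W ⊗ U)) (yoElt (𝟙 W)) (psi Ψ U a))
  rw [Q.J.map_id, Category.id_comp] at h3
  have h4 := h2.symm.trans (h.trans h3)
  have h5 := congrArg (app (Q.unfoldHom W) (W ⊗ U)) h4
  rw [unfoldHom_elR] at h5
  refine Eq.trans ?_ h5
  rw [algEv_psi]
  refine ((congrArg (app (Q.unfoldHom W) (W ⊗ U)) (Q.pureT_eq_elR _ _ _)).trans ?_).symm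
  rw [unfoldHom_elR]

/-- The extension of a morphism of algebras to all morphisms `J X ⟶ J Y`. -/
noncomputable def ext {X Y : C} (φ : P.J.obj X ⟶ P.J.obj Y) : Q.J.obj X ⟶ Q.J.obj Y :=
  Q.J.map (etaR ᘁY Y X) ≫ Q.R Y (psi Ψ _ (P.transR Y X (φ ≫ P.J.map (λ_ Y).inv))) ≫
    Q.J.map (λ_ Y).hom

/-- The extension does not depend on how a morphism is expressed through an algebra element. -/
theorem ext_normal {X Y U : C} (k : X ⟶ U ⊗ Y) (a : P.J.obj U ⟶ P.J.obj (𝟙_ C)) :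
    ext Ψ (P.J.map k ≫ P.R Y a ≫ P.J.map (λ_ Y).hom) =
      Q.J.map k ≫ Q.R Y (psi Ψ U a) ≫ Q.J.map (λ_ Y).hom := by
  have e : (P.J.map k ≫ P.R Y a ≫ P.J.map (λ_ Y).hom) ≫ P.J.map (λ_ Y).inv =
      P.J.map k ≫ P.R Y a := by
    simp only [Category.assoc, ← P.J.map_comp]
    simp
  rw [ext, e, transR_R, psi_J, ← transR_R, ← Category.assoc, eta_transR, Category.assoc]

theorem ext_elt {U : C} (a : P.J.obj U ⟶ P.J.obj (𝟙_ C)) : ext Ψ a = psi Ψ U a := by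
  have h := ext_normal Ψ (ρ_ U).inv a
  rwa [normal_elt, normal_elt] at h

theorem ext_J {X Y : C} (f : X ⟶ Y) : ext Ψ (P.J.map f) = Q.J.map f := by
  have h := ext_normal Ψ (f ≫ (λ_ Y).inv) (𝟙 _)
  rw [psi_one, R_id, R_id] at h
  simpa [← Functor.map_comp] using h

theorem ext_comp {X Y Z : C} (φ : P.J.obj X ⟶ P.J.obj Y) (χ : P.J.obj Y ⟶ P.J.obj Z) :
    ext Ψ (φ ≫ χ) = ext Ψ φ ≫ ext Ψ χ := by
  obtain ⟨U, k, a, rfl⟩ := P.exists_normal φ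
  obtain ⟨U', k', a', rfl⟩ := P.exists_normal χ
  rw [normal_comp, ext_normal, ext_normal, ext_normal, normal_comp, psi_mul]

theorem ext_R (W : C) {X Y : C} (φ : P.J.obj X ⟶ P.J.obj Y) :
    ext Ψ (P.R W φ) = Q.R W (ext Ψ φ) := by
  obtain ⟨U, k, a, rfl⟩ := P.exists_normal φ
  rw [normal_R, ext_normal, ext_normal, normal_R]

theorem ext_L_elt (W : C) {U : C} (a : P.J.obj U ⟶ P.J.obj (𝟙_ C)) :
    ext Ψ (P.L W a) = Q.L W (psi Ψ U a) := by
  have h := psi_braid Ψ W a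
  have e : ext Ψ (P.L W a ≫ P.J.map (ρ_ W).hom) = Q.L W (psi Ψ U a) ≫ Q.J.map (ρ_ W).hom := by
    have e1 : (P.L W a ≫ P.J.map (ρ_ W).hom) ≫ P.J.map (λ_ W).inv =
        P.L W a ≫ P.J.map (unitSwap C W).inv := by
      rw [Category.assoc, ← P.J.map_comp]
      rfl
    rw [ext, e1, ← Category.assoc, h, Category.assoc, ← Q.J.map_comp]
    simp [unitSwap]
  rw [ext_comp, ext_J] at e
  rwa [cancel_mono] at e

theorem ext_L (W : C) {X Y : C} (φ : P.J.obj X ⟶ P.J.obj Y) :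
    ext Ψ (P.L W φ) = Q.L W (ext Ψ φ) := by
  obtain ⟨U, k, a, rfl⟩ := P.exists_normal φ
  rw [normal_L, ext_normal, normal_L, ext_comp, ext_comp, ext_J, ext_J, ext_R, ext_L_elt]

/-- A morphism of algebras comes from a functor. -/
noncomputable def extHom : Hom P Q where
  map φ := ext Ψ φ
  map_add f g := by
    simp only [ext, Preadditive.add_comp, Preadditive.comp_add, map_add, Q.R_add]
  map_smul c f := by
    simp only [ext, Linear.smul_comp, Linear.comp_smul, map_smul, Q.R_smul]
  map_comp := ext_comp Ψ
  map_J := ext_J Ψ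
  map_R := ext_R Ψ
  map_L := ext_L Ψ

end Full

instance : (toCenter C).Full where
  map_surjective Ψ := ⟨extHom Ψ, Mon.Hom.ext (Center.ext _ _ (ext_app fun U x => by
    obtain ⟨a, rfl⟩ := algEv_surj _ x
    exact (congrArg (algEv _ U) (ext_elt Ψ a)).trans (algEv_psi Ψ a).symm))⟩

theorem Hom.eq_of_algMap {Φ Φ' : Hom P Q}
    (h : ∀ (U : C) (a : P.J.obj U ⟶ P.J.obj (𝟙_ C)), Φ.map a = Φ'.map a) : Φ = Φ' := by
  ext X Y φ
  obtain ⟨U, k, a, rfl⟩ := P.exists_normal φ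
  simp [h]

instance : (toCenter C).Faithful where
  map_injective {P Q} _ _ h := Hom.eq_of_algMap fun U a =>
    congrArg (fun t : P.centerAlg ⟶ Q.centerAlg => app t.hom.f U (P.algEv U a)) h

end FreeBimod

end CenterFunctor

/-! ### Half-braidings past a tensor product -/

section BraidPast

variable {D : Type*} [Category D] [MonoidalCategory D]

/-- The component of a half-braiding at the unit object is determined by the unitors. -/
theorem halfBraiding_unit (A : Center D) : (A.2.β (𝟙_ D)).hom ≫ (λ_ A.1).hom = (ρ_ A.1).hom := by
  have h1 := A.2.naturality (λ_ (𝟙_ D)).hom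
  rw [A.2.monoidal] at h1
  simp only [Category.assoc] at h1
  have h2 : (𝟙_ D) ◁ (A.2.β (𝟙_ D)).hom ≫ (α_ (𝟙_ D) (𝟙_ D) A.1).inv ≫ (λ_ (𝟙_ D)).hom ▷ A.1 =
      (λ_ _).hom ≫ (A.2.β (𝟙_ D)).hom := by
    rw [leftUnitor_whiskerRight, Iso.inv_hom_id_assoc, leftUnitor_naturality]
  rw [h2, ← Category.assoc, ← Category.assoc, ← Category.assoc, cancel_mono, Category.assoc,
    Category.assoc, leftUnitor_tensor_hom, Iso.hom_inv_id_assoc, ← comp_whiskerRight] at h1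
  have h3 : (ρ_ A.1).hom ▷ 𝟙_ D = ((A.2.β (𝟙_ D)).hom ≫ (λ_ A.1).hom) ▷ 𝟙_ D := by
    rw [← triangle, ← Iso.eq_inv_comp]
    exact h1
  exact (cancel_mono (ρ_ A.1).inv).1 ((cancel_epi (ρ_ _).hom).1 (by
    rw [← rightUnitor_naturality_assoc, ← rightUnitor_naturality_assoc, h3]))

theorem braidPast_naturality_left (A : Center D) {U U' : D} (g : U ⟶ U') (X : D) :
    A.1 ◁ g ▷ X ≫ (braidPast A U' X).hom = (braidPast A U X).hom ≫ g ▷ (A.1 ⊗ X) := by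
  simp only [braidPast, Iso.trans_hom, Iso.symm_hom, whiskerRightIso_hom, Category.assoc]
  rw [associator_inv_naturality_middle_assoc, ← comp_whiskerRight_assoc, A.2.naturality,
    comp_whiskerRight_assoc, associator_naturality_left]

theorem braidPast_tensor (A : Center D) (U U' X : D) :
    A.1 ◁ (α_ U U' X).hom ≫ (braidPast A U (U' ⊗ X)).hom ≫ U ◁ (braidPast A U' X).hom =
      (braidPast A (U ⊗ U') X).hom ≫ (α_ U U' (A.1 ⊗ X)).hom := by
  simp only [braidPast, Iso.trans_hom, Iso.symm_hom, whiskerRightIso_hom, Category.assoc,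
    A.2.monoidal]
  monoidal

theorem braidPast_whiskerRight (A : Center D) (U X W : D) :
    (braidPast A U X).hom ▷ W ≫ (α_ U (A.1 ⊗ X) W).hom ≫ U ◁ (α_ A.1 X W).hom =
      (α_ A.1 (U ⊗ X) W).hom ≫ A.1 ◁ (α_ U X W).hom ≫ (braidPast A U (X ⊗ W)).hom := by
  simp only [braidPast, Iso.trans_hom, Iso.symm_hom, whiskerRightIso_hom]
  monoidal

theorem braidPast_unit (A : Center D) (X : D) :
    (braidPast A (𝟙_ D) X).hom ≫ (λ_ (A.1 ⊗ X)).hom = A.1 ◁ (λ_ X).hom := by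
  simp only [braidPast, Iso.trans_hom, Iso.symm_hom, whiskerRightIso_hom, Category.assoc]
  rw [leftUnitor_tensor_hom, Iso.hom_inv_id_assoc, ← comp_whiskerRight, halfBraiding_unit,
    Iso.inv_comp_eq, triangle]

theorem braidPast_rightUnitor (A : Center D) (U : D) :
    (braidPast A U (𝟙_ D)).hom ≫ U ◁ (ρ_ A.1).hom = A.1 ◁ (ρ_ U).hom ≫ (A.2.β U).hom := by
  simp only [braidPast, Iso.trans_hom, Iso.symm_hom, whiskerRightIso_hom, Category.assoc]
  monoidal

/-- The inverse half-braiding `U ⊗ A ⟶ A ⊗ U` is `A`-linear. -/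
theorem whiskerLeft_braid_inv_freeAct (A : Mon (Center D)) (U : D) :
    A.X.1 ◁ (A.X.2.β U).inv ≫ freeAct A.X.1 U =
      (braidPast A.X U A.X.1).hom ≫ U ◁ (MonObj.mul (X := A.X.1)) ≫ (A.X.2.β U).inv := by
  have h := mul_whiskerRight_comm A U
  rw [← cancel_epi (A.X.1 ◁ (A.X.2.β U).hom), ← MonoidalCategory.whiskerLeft_comp_assoc,
    Iso.hom_inv_id, MonoidalCategory.whiskerLeft_id, Category.id_comp, freeAct,
    Iso.inv_comp_eq, ← cancel_mono (A.X.2.β U).hom, h]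
  simp only [braidPast, Iso.trans_hom, Iso.symm_hom, whiskerRightIso_hom, Category.assoc,
    Iso.inv_hom_id, Category.comp_id]

end BraidPast

/-! ### The Yoneda embedding as a monoidal functor -/

section YonedaMonoidal

open VectC

variable {C : Type u} [SmallCategory C] [Preadditive C] [Linear ℂ C] [MonoidalCategory C]
  [MonoidalPreadditive C] [MonoidalLinear ℂ C]

namespace VectC

theorem yoMap_id (U : C) : yoMap (𝟙 U) = 𝟙 (yo U) :=
  ext_app fun X k => (app_yoMap (𝟙 U) k).trans (Category.comp_id (X := X) (Y := U) k)

theorem yoMap_comp {U V W : C} (f : U ⟶ V) (g : V ⟶ W) :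
    yoMap (f ≫ g) = yoMap f ≫ yoMap g :=
  ext_app fun X k => (Category.assoc (W := X) (X := U) k f g).symm

theorem yoMap_add {U V : C} (f g : U ⟶ V) : yoMap (f + g) = yoMap f + yoMap g :=
  ext_app fun X k => Preadditive.comp_add X U V k f g

theorem yoMap_smul {U V : C} (c : ℂ) (f : U ⟶ V) : yoMap (c • f) = c • yoMap f :=
  ext_app fun X k => Linear.comp_smul X U V k c f

theorem yoTensor_naturality_left {U U' : C} (f : U ⟶ U') (V : C) :
    yoMap f ▷ yo V ≫ (yoTensor U' V).hom = (yoTensor U V).hom ≫ yoMap (f ▷ V) := by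
  apply day_ext
  intro X W W' k a b
  have h : ∀ (a : W ⟶ U) (b : W' ⟶ V), k ≫ ((a ≫ f) ⊗ₘ b) = (k ≫ (a ⊗ₘ b)) ≫ f ▷ V := by
    intro a b
    rw [Category.assoc, ← tensorHom_id, tensorHom_comp_tensorHom, Category.comp_id]
  refine (congrArg (app (yoTensorHom U' V) X) (app_whiskerRight_pureT (yoMap f) (yo V) k a b)).trans
    ((yoTensorHom_pureT k _ b).trans ((h a b).trans ?_))
  exact (congrArg (app (yoMap (f ▷ V)) X) (yoTensorHom_pureT k a b)).symm

theorem yoTensor_naturality_right (U : C) {V V' : C} (g : V ⟶ V') :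
    yo U ◁ yoMap g ≫ (yoTensor U V').hom = (yoTensor U V).hom ≫ yoMap (U ◁ g) := by
  apply day_ext
  intro X W W' k a b
  have h : ∀ (a : W ⟶ U) (b : W' ⟶ V), k ≫ (a ⊗ₘ (b ≫ g)) = (k ≫ (a ⊗ₘ b)) ≫ U ◁ g := by
    intro a b
    rw [Category.assoc, ← id_tensorHom, tensorHom_comp_tensorHom, Category.comp_id]
  refine (congrArg (app (yoTensorHom U V') X) (app_whiskerLeft_pureT (yo U) (yoMap g) k a b)).trans
    ((yoTensorHom_pureT k a _).trans ((h a b).trans ?_))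
  exact (congrArg (app (yoMap (U ◁ g)) X) (yoTensorHom_pureT k a b)).symm

theorem yoTensor_assoc (U V W : C) :
    (yoTensor U V).hom ▷ yo W ≫ (yoTensor (U ⊗ V) W).hom ≫ yoMap (α_ U V W).hom =
      (α_ (yo U) (yo V) (yo W)).hom ≫ yo U ◁ (yoTensor V W).hom ≫ (yoTensor U (V ⊗ W)).hom := by
  apply day_extL
  intro X Y Z Y₁ Y₂ k f a b c
  have h : ∀ (a : Y₁ ⟶ U) (b : Y₂ ⟶ V) (c : Z ⟶ W),
      (k ≫ ((f ≫ (a ⊗ₘ b)) ⊗ₘ c)) ≫ (α_ U V W).hom =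
        (k ≫ f ▷ Z ≫ (α_ Y₁ Y₂ Z).hom) ≫ (a ⊗ₘ (𝟙 _ ≫ (b ⊗ₘ c))) := by
    intro a b c
    simp only [Category.assoc, Category.id_comp]
    rw [← associator_naturality, ← tensorHom_id f Z, tensorHom_comp_tensorHom_assoc,
      Category.id_comp]
  have l1 := (app_whiskerRight_pureT (yoTensor U V).hom (yo W) k
    (pureT (yo U) (yo V) Y Y₁ Y₂ f a b) c).trans
    (congrArg (fun z => pureT (yo (U ⊗ V)) (yo W) X Y Z k z c) (yoTensorHom_pureT f a b))
  have l2 := (congrArg (app (yoTensorHom (U ⊗ V) W) X) l1).trans (yoTensorHom_pureT k _ c)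
  have r1 := (congrArg (app (yo U ◁ (yoTensor V W).hom) X)
    (app_associator_hom_pureT k f a b c)).trans (app_whiskerLeft_pureT (yo U) (yoTensor V W).hom
      (k ≫ f ▷ Z ≫ (α_ Y₁ Y₂ Z).hom) a (pureT (yo V) (yo W) (Y₂ ⊗ Z) Y₂ Z (𝟙 _) b c))
  have r2 := r1.trans (congrArg (fun z => pureT (yo U) (yo (V ⊗ W)) X Y₁ (Y₂ ⊗ Z)
    (k ≫ f ▷ Z ≫ (α_ Y₁ Y₂ Z).hom) a z) (yoTensorHom_pureT (𝟙 _) b c))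
  have r3 := (congrArg (app (yoTensorHom U (V ⊗ W)) X) r2).trans (yoTensorHom_pureT _ a _)
  exact (congrArg (app (yoMap (α_ U V W).hom) X) l2).trans ((h a b c).trans r3.symm)

theorem yoTensor_rightUnitor (U : C) :
    (yoTensor U (𝟙_ C)).hom ≫ yoMap (ρ_ U).hom = (ρ_ (yo U)).hom := by
  apply day_ext
  intro X W W' k a b
  have h : ∀ (a : W ⟶ U) (b : W' ⟶ 𝟙_ C), (k ≫ (a ⊗ₘ b)) ≫ (ρ_ U).hom =
      (k ≫ W ◁ b ≫ (ρ_ W).hom) ≫ a := by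
    intro a b
    simp [MonoidalCategory.tensorHom_def']
  exact (congrArg (app (yoMap (ρ_ U).hom) X) (yoTensorHom_pureT k a b)).trans
    ((h a b).trans (rightUnitHom_pureT k a b).symm)

theorem yoTensor_leftUnitor (U : C) :
    (yoTensor (𝟙_ C) U).hom ≫ yoMap (λ_ U).hom = (λ_ (yo U)).hom := by
  apply day_ext
  intro X W W' k a b
  have h : ∀ (a : W ⟶ 𝟙_ C) (b : W' ⟶ U), (k ≫ (a ⊗ₘ b)) ≫ (λ_ U).hom =
      (k ≫ a ▷ W' ≫ (λ_ W').hom) ≫ b := by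
    intro a b
    simp [MonoidalCategory.tensorHom_def]
  exact (congrArg (app (yoMap (λ_ U).hom) X) (yoTensorHom_pureT k a b)).trans
    ((h a b).trans (leftUnitHom_pureT k a b).symm)

end VectC

end YonedaMonoidal

/-! ### Free modules as a bimodule category -/

section FreeModBimod

open VectC

variable {C : Type u} [SmallCategory C] [Preadditive C] [Linear ℂ C] [MonoidalCategory C]
  [MonoidalPreadditive C] [MonoidalLinear ℂ C]

namespace FreeMod

section Right

variable (A : VectC C)

theorem reassocIso_hom (V W : C) :
    (reassocIso A V W).hom = (α_ A (yo V) (yo W)).hom ≫ A ◁ (yoTensor V W).hom := rfl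

theorem reassocIso_naturality_left {V V' : C} (g : V ⟶ V') (W : C) :
    (A ◁ yoMap g) ▷ yo W ≫ (reassocIso A V' W).hom =
      (reassocIso A V W).hom ≫ A ◁ yoMap (g ▷ W) := by
  simp only [reassocIso_hom, Category.assoc]
  rw [associator_naturality_middle_assoc, ← MonoidalCategory.whiskerLeft_comp,
    yoTensor_naturality_left, MonoidalCategory.whiskerLeft_comp]

theorem reassocIso_naturality_right (V : C) {W W' : C} (g : W ⟶ W') :
    (A ⊗ yo V) ◁ yoMap g ≫ (reassocIso A V W').hom =
      (reassocIso A V W).hom ≫ A ◁ yoMap (V ◁ g) := by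
  simp only [reassocIso_hom, Category.assoc]
  rw [associator_naturality_right_assoc, ← MonoidalCategory.whiskerLeft_comp,
    yoTensor_naturality_right, MonoidalCategory.whiskerLeft_comp]

theorem reassocIso_tensor (V W W' : C) :
    (reassocIso A V W).hom ▷ yo W' ≫ (reassocIso A (V ⊗ W) W').hom ≫
        A ◁ yoMap (α_ V W W').hom =
      (α_ (A ⊗ yo V) (yo W) (yo W')).hom ≫ (A ⊗ yo V) ◁ (yoTensor W W').hom ≫
        (reassocIso A V (W ⊗ W')).hom := by
  simp only [reassocIso_hom, Category.assoc, comp_whiskerRight]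
  rw [associator_naturality_middle_assoc, ← MonoidalCategory.whiskerLeft_comp,
    ← MonoidalCategory.whiskerLeft_comp, yoTensor_assoc]
  monoidal

theorem reassocIso_unit (V : C) :
    (reassocIso A V (𝟙_ C)).hom ≫ A ◁ yoMap (ρ_ V).hom = (ρ_ (A ⊗ yo V)).hom := by
  rw [reassocIso_hom, Category.assoc, ← MonoidalCategory.whiskerLeft_comp, yoTensor_rightUnitor,
    rightUnitor_tensor_hom]
  rfl

variable {A} [MonObj A]

@[simp] theorem map_freeMap {V W : C} (g : V ⟶ W) : map (freeMap (A := A) g) = A ◁ yoMap g := rfl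

theorem map_add {V W : FreeMod A} (f g : V ⟶ W) : map (f + g) = map f + map g := rfl

theorem map_smul {V W : FreeMod A} (c : ℂ) (f : V ⟶ W) : map (c • f) = c • map f := rfl

theorem reassocIso_map_rightWh {V W : C} (f : of A V ⟶ of A W) (Y : C) :
    (reassocIso A V Y).hom ≫ map (rightWh f Y) = map f ▷ yo Y ≫ (reassocIso A W Y).hom :=
  Iso.hom_inv_id_assoc _ _

theorem hom_ext_reassoc {V Y : C} {W : FreeMod A} {f g : of A (V ⊗ Y) ⟶ W}
    (h : (reassocIso A V Y).hom ≫ map f = (reassocIso A V Y).hom ≫ map g) : f = g :=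
  hom_ext ((cancel_epi _).1 h)

theorem rightWh_comp {U V W : C} (f : of A U ⟶ of A V) (g : of A V ⟶ of A W) (Y : C) :
    rightWh (f ≫ g) Y = rightWh f Y ≫ rightWh g Y := by
  apply hom_ext_reassoc
  rw [map_comp, reassocIso_map_rightWh, ← Category.assoc, reassocIso_map_rightWh, Category.assoc,
    reassocIso_map_rightWh, map_comp, comp_whiskerRight, Category.assoc]

theorem rightWh_add {V W : C} (f g : of A V ⟶ of A W) (Y : C) :
    rightWh (f + g) Y = rightWh f Y + rightWh g Y := by
  apply hom_ext_reassoc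
  rw [map_add, Preadditive.comp_add, reassocIso_map_rightWh, reassocIso_map_rightWh,
    reassocIso_map_rightWh, map_add, MonoidalPreadditive.add_whiskerRight, Preadditive.add_comp]

theorem rightWh_smul {V W : C} (c : ℂ) (f : of A V ⟶ of A W) (Y : C) :
    rightWh (c • f) Y = c • rightWh f Y := by
  apply hom_ext_reassoc
  rw [map_smul, Linear.comp_smul, reassocIso_map_rightWh, reassocIso_map_rightWh,
    map_smul, MonoidalLinear.smul_whiskerRight, Linear.smul_comp]

theorem rightWh_freeMap {V W : C} (g : V ⟶ W) (Y : C) :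
    rightWh (freeMap (A := A) g) Y = freeMap (g ▷ Y) := by
  apply hom_ext_reassoc
  rw [reassocIso_map_rightWh]
  exact reassocIso_naturality_left A g Y

theorem rightWh_exchange {V W : C} (f : of A V ⟶ of A W) {Y Y' : C} (g : Y ⟶ Y') :
    rightWh f Y ≫ freeMap (W ◁ g) = freeMap (V ◁ g) ≫ rightWh f Y' := by
  apply hom_ext_reassoc
  rw [map_comp, map_comp, ← Category.assoc, reassocIso_map_rightWh, Category.assoc, map_freeMap,
    map_freeMap, ← reassocIso_naturality_right, ← Category.assoc, ← Category.assoc,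
    ← reassocIso_naturality_right, Category.assoc, Category.assoc, reassocIso_map_rightWh,
    whisker_exchange_assoc]

theorem rightWh_tensor {V W : C} (f : of A V ⟶ of A W) (Y Y' : C) :
    freeMap (α_ V Y Y').hom ≫ rightWh f (Y ⊗ Y') =
      rightWh (rightWh f Y) Y' ≫ freeMap (α_ W Y Y').hom := by
  apply hom_ext_reassoc
  rw [← cancel_epi ((reassocIso A V Y).hom ▷ yo Y')]
  simp only [map_comp, map_freeMap]
  have h := reassocIso_tensor A V Y Y'
  rw [reassoc_of% h, reassocIso_map_rightWh]
  have e := reassocIso_map_rightWh (rightWh f Y) Y'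
  rw [reassoc_of% e, ← comp_whiskerRight_assoc, reassocIso_map_rightWh, comp_whiskerRight_assoc,
    reassocIso_tensor, associator_naturality_left_assoc, whisker_exchange_assoc]

theorem rightWh_unit {V W : C} (f : of A V ⟶ of A W) :
    rightWh f (𝟙_ C) ≫ freeMap (ρ_ W).hom = freeMap (ρ_ V).hom ≫ f := by
  apply hom_ext_reassoc
  rw [map_comp, map_comp, ← Category.assoc, reassocIso_map_rightWh, Category.assoc, map_freeMap,
    map_freeMap, reassocIso_unit, ← Category.assoc, reassocIso_unit]
  exact rightUnitor_naturality (map f)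

end Right

section Left

variable (A : Mon (Center (VectC C)))

theorem braidPast_centralIso (U V : C) :
    (braidPast A.X (yo U) (yo V)).hom ≫ (centralIso A U V).hom = A.X.1 ◁ (yoTensor U V).hom :=
  Iso.hom_inv_id_assoc _ _

theorem centralIso_naturality_left {U U' : C} (g : U ⟶ U') (V : C) :
    yoMap g ▷ (A.X.1 ⊗ yo V) ≫ (centralIso A U' V).hom =
      (centralIso A U V).hom ≫ A.X.1 ◁ yoMap (g ▷ V) := by
  rw [← cancel_epi (braidPast A.X (yo U) (yo V)).hom]
  have h := braidPast_naturality_left A.X (yoMap g) (yo V)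
  rw [← reassoc_of% h, braidPast_centralIso, ← Category.assoc, braidPast_centralIso,
    ← MonoidalCategory.whiskerLeft_comp, yoTensor_naturality_left,
    MonoidalCategory.whiskerLeft_comp]

theorem centralIso_naturality_right (U : C) {V V' : C} (g : V ⟶ V') :
    yo U ◁ A.X.1 ◁ yoMap g ≫ (centralIso A U V').hom =
      (centralIso A U V).hom ≫ A.X.1 ◁ yoMap (U ◁ g) := by
  rw [← cancel_epi (braidPast A.X (yo U) (yo V)).hom]
  have h := braidPast_naturality A.X (yo U) (yoMap g)
  rw [← reassoc_of% h, braidPast_centralIso, ← Category.assoc, braidPast_centralIso,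
    ← MonoidalCategory.whiskerLeft_comp, yoTensor_naturality_right,
    MonoidalCategory.whiskerLeft_comp]

theorem centralIso_tensor (U U' V : C) :
    yo U ◁ (centralIso A U' V).hom ≫ (centralIso A U (U' ⊗ V)).hom =
      (α_ (yo U) (yo U') (A.X.1 ⊗ yo V)).inv ≫ (yoTensor U U').hom ▷ (A.X.1 ⊗ yo V) ≫
        (centralIso A (U ⊗ U') V).hom ≫ A.X.1 ◁ yoMap (α_ U U' V).hom := by
  rw [Iso.eq_inv_comp, ← cancel_epi (braidPast A.X (yo U ⊗ yo U') (yo V)).hom]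
  have h1 := braidPast_tensor A.X (yo U) (yo U') (yo V)
  have h2 := braidPast_naturality_left A.X (yoTensor U U').hom (yo V)
  have h3 := braidPast_naturality A.X (yo U) (yoTensor U' V).hom
  rw [← reassoc_of% h1, ← reassoc_of% h2, ← MonoidalCategory.whiskerLeft_comp_assoc,
    braidPast_centralIso, ← reassoc_of% h3, braidPast_centralIso,
    ← Category.assoc (braidPast _ _ _).hom,
    braidPast_centralIso, ← MonoidalCategory.whiskerLeft_comp, ← MonoidalCategory.whiskerLeft_comp,
    ← MonoidalCategory.whiskerLeft_comp, ← MonoidalCategory.whiskerLeft_comp, yoTensor_assoc]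

theorem centralIso_unit (V : C) :
    (centralIso A (𝟙_ C) V).hom ≫ A.X.1 ◁ yoMap (λ_ V).hom = (λ_ (A.X.1 ⊗ yo V)).hom := by
  rw [← cancel_epi (braidPast A.X (yo (𝟙_ C)) (yo V)).hom, ← Category.assoc, braidPast_centralIso,
    ← MonoidalCategory.whiskerLeft_comp, yoTensor_leftUnitor]
  exact (braidPast_unit A.X (yo V)).symm

theorem centralIso_reassocIso (U V W : C) :
    (centralIso A U V).hom ▷ yo W ≫ (reassocIso A.X.1 (U ⊗ V) W).hom ≫
        A.X.1 ◁ yoMap (α_ U V W).hom =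
      (α_ (yo U) (A.X.1 ⊗ yo V) (yo W)).hom ≫ yo U ◁ (reassocIso A.X.1 V W).hom ≫
        (centralIso A U (V ⊗ W)).hom := by
  rw [← cancel_epi ((braidPast A.X (yo U) (yo V)).hom ▷ yo W), ← comp_whiskerRight_assoc,
    braidPast_centralIso, reassocIso_hom, reassocIso_hom, MonoidalCategory.whiskerLeft_comp]
  have h1 := braidPast_whiskerRight A.X (yo U) (yo V) (yo W)
  have h3 := braidPast_naturality A.X (yo U) (yoTensor V W).hom
  simp only [Category.assoc]
  rw [reassoc_of% h1, ← reassoc_of% h3, braidPast_centralIso, associator_naturality_middle_assoc]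
  simp only [← MonoidalCategory.whiskerLeft_comp]
  rw [yoTensor_assoc]

variable {A}

theorem centralIso_map_leftWh (U : C) {V W : C} (f : of A.X.1 V ⟶ of A.X.1 W) :
    (centralIso A U V).hom ≫ map (leftWh U f) = yo U ◁ map f ≫ (centralIso A U W).hom :=
  Iso.hom_inv_id_assoc _ _

/-- Since `U ⊗ (A ⊗ V) ≅ A ⊗ (U ⊗ V)`, module maps may be compared on `U ⊗ (A ⊗ V)`. -/
theorem hom_ext_central {U V : C} {W : FreeMod A.X.1} {f g : of A.X.1 (U ⊗ V) ⟶ W}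
    (h : (centralIso A U V).hom ≫ map f = (centralIso A U V).hom ≫ map g) : f = g :=
  hom_ext ((cancel_epi _).1 h)

theorem leftWh_comp (Y : C) {U V W : C} (f : of A.X.1 U ⟶ of A.X.1 V)
    (g : of A.X.1 V ⟶ of A.X.1 W) : leftWh Y (f ≫ g) = leftWh Y f ≫ leftWh Y g := by
  apply hom_ext_central
  rw [map_comp, centralIso_map_leftWh, ← Category.assoc, centralIso_map_leftWh, Category.assoc,
    centralIso_map_leftWh, map_comp, MonoidalCategory.whiskerLeft_comp, Category.assoc]

theorem leftWh_add (Y : C) {V W : C} (f g : of A.X.1 V ⟶ of A.X.1 W) :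
    leftWh Y (f + g) = leftWh Y f + leftWh Y g := by
  apply hom_ext_central
  rw [map_add, Preadditive.comp_add, centralIso_map_leftWh, centralIso_map_leftWh,
    centralIso_map_leftWh, map_add, MonoidalPreadditive.whiskerLeft_add, Preadditive.add_comp]

theorem leftWh_smul (Y : C) {V W : C} (c : ℂ) (f : of A.X.1 V ⟶ of A.X.1 W) :
    leftWh Y (c • f) = c • leftWh Y f := by
  apply hom_ext_central
  rw [map_smul, Linear.comp_smul, centralIso_map_leftWh, centralIso_map_leftWh,
    map_smul, MonoidalLinear.whiskerLeft_smul, Linear.smul_comp]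

theorem leftWh_freeMap (Y : C) {V W : C} (g : V ⟶ W) :
    leftWh Y (freeMap (A := A.X.1) g) = freeMap (Y ◁ g) := by
  apply hom_ext_central
  rw [centralIso_map_leftWh]
  exact centralIso_naturality_right A Y g

theorem leftWh_exchange {V W : C} (f : of A.X.1 V ⟶ of A.X.1 W) {Y Y' : C} (g : Y ⟶ Y') :
    leftWh Y f ≫ freeMap (g ▷ W) = freeMap (g ▷ V) ≫ leftWh Y' f := by
  apply hom_ext_central
  rw [map_comp, map_comp, ← Category.assoc, centralIso_map_leftWh, Category.assoc, map_freeMap,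
    map_freeMap, ← centralIso_naturality_left, ← Category.assoc (centralIso A Y V).hom,
    ← centralIso_naturality_left, Category.assoc, centralIso_map_leftWh, whisker_exchange_assoc]

theorem leftWh_tensor (Y Y' : C) {V W : C} (f : of A.X.1 V ⟶ of A.X.1 W) :
    leftWh (Y ⊗ Y') f ≫ freeMap (α_ Y Y' W).hom =
      freeMap (α_ Y Y' V).hom ≫ leftWh Y (leftWh Y' f) := by
  apply hom_ext_central
  rw [← cancel_epi ((yoTensor Y Y').hom ▷ (A.X.1 ⊗ yo V)),
    ← cancel_epi (α_ (yo Y) (yo Y') (A.X.1 ⊗ yo V)).inv]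
  simp only [map_comp, map_freeMap]
  have h := centralIso_tensor A Y Y' V
  have h' := centralIso_tensor A Y Y' W
  have e := centralIso_map_leftWh Y (leftWh Y' f)
  have e' := centralIso_map_leftWh (Y ⊗ Y') f
  rw [← reassoc_of% h, e, ← MonoidalCategory.whiskerLeft_comp_assoc, centralIso_map_leftWh,
    MonoidalCategory.whiskerLeft_comp_assoc, h', reassoc_of% e', ← whisker_exchange_assoc,
    associator_inv_naturality_right_assoc]

theorem leftWh_unit {V W : C} (f : of A.X.1 V ⟶ of A.X.1 W) :
    leftWh (𝟙_ C) f ≫ freeMap (λ_ W).hom = freeMap (λ_ V).hom ≫ f := by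
  apply hom_ext_central
  rw [map_comp, map_comp, ← Category.assoc, centralIso_map_leftWh, Category.assoc, map_freeMap,
    map_freeMap, centralIso_unit, ← Category.assoc, centralIso_unit]
  exact leftUnitor_naturality (map f)

/-- The two actions on free modules commute. -/
theorem rightWh_leftWh (Y Z : C) {V W : C} (f : of A.X.1 V ⟶ of A.X.1 W) :
    rightWh (leftWh Y f) Z ≫ freeMap (α_ Y W Z).hom =
      freeMap (α_ Y V Z).hom ≫ leftWh Y (rightWh f Z) := by
  apply hom_ext_reassoc
  rw [← cancel_epi ((centralIso A Y V).hom ▷ yo Z)]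
  simp only [map_comp, map_freeMap]
  have h := centralIso_reassocIso A Y V Z
  have h' := centralIso_reassocIso A Y W Z
  have e := centralIso_map_leftWh Y (rightWh f Z)
  have e' := reassocIso_map_rightWh (leftWh Y f) Z
  rw [reassoc_of% h, e, ← MonoidalCategory.whiskerLeft_comp_assoc, reassocIso_map_rightWh,
    MonoidalCategory.whiskerLeft_comp_assoc, reassoc_of% e', ← comp_whiskerRight_assoc,
    centralIso_map_leftWh, comp_whiskerRight_assoc, h', associator_naturality_middle_assoc]

end Left

theorem freeMap_id {A : VectC C} [MonObj A] (V : C) : freeMap (A := A) (𝟙 V) = 𝟙 (of A V) :=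
  hom_ext (by rw [map_freeMap, yoMap_id, MonoidalCategory.whiskerLeft_id]; rfl)

theorem freeMap_comp {A : VectC C} [MonObj A] {U V W : C} (f : U ⟶ V) (g : V ⟶ W) :
    freeMap (A := A) (f ≫ g) = freeMap f ≫ freeMap g :=
  hom_ext (by rw [map_comp, map_freeMap, map_freeMap, map_freeMap, yoMap_comp,
    MonoidalCategory.whiskerLeft_comp])

theorem freeMap_comp_assoc {A : VectC C} [MonObj A] {U V W : C} {X : FreeMod A} (f : U ⟶ V)
    (g : V ⟶ W) (t : of A W ⟶ X) : freeMap (A := A) (f ≫ g) ≫ t = freeMap f ≫ freeMap g ≫ t := by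
  rw [freeMap_comp, Category.assoc]

theorem freeMap_add {A : VectC C} [MonObj A] {U V : C} (f g : U ⟶ V) :
    freeMap (A := A) (f + g) = freeMap f + freeMap g :=
  hom_ext (by rw [map_add, map_freeMap, map_freeMap, map_freeMap, yoMap_add,
    MonoidalPreadditive.whiskerLeft_add])

theorem freeMap_smul {A : VectC C} [MonObj A] {U V : C} (c : ℂ) (f : U ⟶ V) :
    freeMap (A := A) (c • f) = c • freeMap f :=
  hom_ext (by rw [map_smul, map_freeMap, map_freeMap, yoMap_smul,
    MonoidalLinear.whiskerLeft_smul])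

theorem rightWh_tensor_inv {A : VectC C} [MonObj A] {V W : C} (f : of A V ⟶ of A W) (Y Y' : C) :
    rightWh f (Y ⊗ Y') ≫ freeMap (α_ W Y Y').inv =
      freeMap (α_ V Y Y').inv ≫ rightWh (rightWh f Y) Y' := by
  have h := congrArg (fun t => freeMap (α_ V Y Y').inv ≫ t ≫ freeMap (α_ W Y Y').inv)
    (rightWh_tensor f Y Y')
  simpa only [Category.assoc, ← freeMap_comp, ← freeMap_comp_assoc, Iso.inv_hom_id,
    Iso.hom_inv_id, freeMap_id, Category.id_comp, Category.comp_id] using h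

/-- The free modules over an algebra in the center of `Vect(C)`, with the two actions of `C`. -/
noncomputable def freeBimod (A : Mon (Center (VectC C))) : FreeBimod C where
  carrier := FreeMod A.X.1
  J :=
    { obj := of A.X.1
      map := freeMap
      map_id := freeMap_id
      map_comp := freeMap_comp }
  J_add := freeMap_add
  J_smul := freeMap_smul
  R W _ _ f := rightWh f W
  R_add W _ _ f g := rightWh_add f g W
  R_smul W _ _ c f := rightWh_smul c f W
  R_comp W _ _ _ f g := rightWh_comp f g W
  R_map W _ _ f := rightWh_freeMap f W
  R_exchange g _ _ f := rightWh_exchange f g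
  R_tensor W W' _ _ f := rightWh_tensor_inv f W W'
  R_unit f := rightWh_unit f
  L W _ _ f := leftWh W f
  L_add W _ _ f g := leftWh_add W f g
  L_smul W _ _ c f := leftWh_smul W c f
  L_comp W _ _ _ f g := leftWh_comp W f g
  L_map W _ _ f := leftWh_freeMap W f
  L_exchange g _ _ f := leftWh_exchange f g
  L_tensor W W' _ _ f := leftWh_tensor W W' f
  L_unit f := leftWh_unit f
  R_L W V _ _ f := rightWh_leftWh W V f

end FreeMod

end FreeModBimod

/-! ### An algebra is recovered from its free modules -/

section HatIso

open VectC

variable {C : Type u} [SmallCategory C] [Preadditive C] [Linear ℂ C] [MonoidalCategory C]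
  [MonoidalPreadditive C] [MonoidalLinear ℂ C]

namespace VectC

theorem yoDesc_app {F G : VectC C} (t : F ⟶ G) {U : C} (a : F.ev U) :
    yoDesc (app t U a) = yoDesc a ≫ t :=
  ext_app fun _ k => (app_res t k a).symm

theorem yoDesc_res {F : VectC C} {U V : C} (g : U ⟶ V) (a : F.ev V) :
    yoDesc (F.res g a) = yoMap g ≫ yoDesc a :=
  ext_app fun X k => (F.res_comp (X := X) k g a).symm

theorem yoDesc_add {F : VectC C} {U : C} (a b : F.ev U) :
    yoDesc (a + b) = yoDesc a + yoDesc b :=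
  ext_app fun X k => map_add (F.res (X := X) k) a b

theorem yoDesc_smul {F : VectC C} {U : C} (c : ℂ) (a : F.ev U) :
    yoDesc (c • a) = c • yoDesc a :=
  ext_app fun X k => map_smul (F.res (X := X) k) c a

theorem yoDesc_yoElt {U V : C} (f : U ⟶ V) : yoDesc (yoElt f) = yoMap f := rfl

theorem yoDesc_app_id {F : VectC C} {U : C} (t : yo U ⟶ F) :
    yoDesc (app t U (yoElt (𝟙 U))) = t := by
  rw [yoDesc_app, yoDesc_yoElt, yoMap_id, Category.id_comp]

theorem app_yoDesc_id {F : VectC C} {U : C} (a : F.ev U) :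
    app (yoDesc a) U (yoElt (𝟙 U)) = a := F.res_id a

/-- The morphism `C(-, X) ⟶ F ⊗ G` given by an elementary tensor. -/
theorem yoDesc_pureT {F G : VectC C} {X U V : C} (k : X ⟶ U ⊗ V) (a : F.ev U) (b : G.ev V) :
    yoDesc (F := F ⊗ G) (pureT F G X U V k a b) =
      yoMap k ≫ (yoTensor U V).inv ≫ (yoDesc a ⊗ₘ yoDesc b) := by
  have h1 : (yoTensor U V).hom ≫ yoDesc (F := F ⊗ G) (pureT F G (U ⊗ V) U V (𝟙 _) a b) =
      (yoDesc a ⊗ₘ yoDesc b) := by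
    apply day_ext
    intro Y W W' l f g
    have e : ∀ (f : W ⟶ U) (g : W' ⟶ V), pureT F G Y U V ((l ≫ (f ⊗ₘ g)) ≫ 𝟙 _) a b =
        pureT F G Y W W' l (F.res f a) (G.res g b) := by
      intro f g
      rw [pureT_rel, Category.comp_id]
    refine (congrArg (app (yoDesc (F := F ⊗ G) (pureT F G (U ⊗ V) U V (𝟙 _) a b)) Y)
      (yoTensorHom_pureT l f g)).trans ?_
    refine (app_yoDesc (F := F ⊗ G) _ _).trans ((res_pureT _ _ _ _).trans ((e f g).trans ?_))
    exact (app_tensorHom_pureT (yoDesc a) (yoDesc b) l f g).symm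
  rw [← h1, Iso.inv_hom_id_assoc]
  have h2 := yoDesc_res (F := F ⊗ G) k (pureT F G (U ⊗ V) U V (𝟙 _) a b)
  rw [← h2]
  exact congrArg _ ((congrArg (fun t => pureT F G X U V t a b) (Category.comp_id k)).symm.trans
    (res_pureT k (𝟙 _) a b).symm)

end VectC

namespace FreeMod

section

variable {A : VectC C} [MonObj A]

theorem map_hat {U : C} (a : A.ev U) :
    map (hat a) = A ◁ yoDesc a ≫ MonObj.mul ≫ (ρ_ A).inv := rfl

theorem hat_res {U V : C} (g : U ⟶ V) (a : A.ev V) : hat (A.res g a) = freeMap g ≫ hat a := by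
  apply hom_ext
  rw [map_comp, map_hat, map_hat, yoDesc_res, map_freeMap, MonoidalCategory.whiskerLeft_comp_assoc]

theorem hat_add {U : C} (a b : A.ev U) : hat (a + b) = hat a + hat b := by
  apply hom_ext
  rw [map_add, map_hat, map_hat, map_hat, yoDesc_add, MonoidalPreadditive.whiskerLeft_add,
    Preadditive.add_comp]

theorem hat_smul {U : C} (c : ℂ) (a : A.ev U) : hat (c • a) = c • hat a := by
  apply hom_ext
  rw [map_smul, map_hat, map_hat, yoDesc_smul, MonoidalLinear.whiskerLeft_smul, Linear.smul_comp]

/-- The morphism `C(-, U) ⟶ A` restricting `f : A ⊗ U ⟶ A` along the unit of `A`. -/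
noncomputable def unhatHom {U : C} (f : of A U ⟶ of A (𝟙_ C)) : yo U ⟶ A :=
  (λ_ (yo U)).inv ≫ MonObj.one ▷ yo U ≫ map f ≫ (ρ_ A).hom

theorem unhatHom_hat {U : C} (a : A.ev U) : unhatHom (hat a) = yoDesc a := by
  rw [unhatHom, map_hat]
  simp only [Category.assoc]
  have e : (ρ_ A).inv ≫ (ρ_ A).hom = 𝟙 A := Iso.inv_hom_id _
  refine (congrArg (fun t => (λ_ (yo U)).inv ≫ MonObj.one ▷ yo U ≫ A ◁ yoDesc a ≫
    MonObj.mul ≫ t) e).trans ?_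
  rw [Category.comp_id, ← whisker_exchange_assoc, MonObj.one_mul, leftUnitor_naturality,
    Iso.inv_hom_id_assoc]

theorem freeAct_unit : freeAct A (𝟙_ (VectC C)) = A ◁ (ρ_ A).hom ≫ MonObj.mul ≫ (ρ_ A).inv := by
  rw [freeAct, Iso.inv_comp_eq, ← cancel_mono (ρ_ A).hom, rightUnitor_naturality]
  simp

theorem hat_unhatHom {U : C} (f : of A U ⟶ of A (𝟙_ C)) :
    A ◁ unhatHom f ≫ MonObj.mul ≫ (ρ_ A).inv = map f := by
  have h : A ◁ map f ≫ A ◁ (ρ_ A).hom ≫ MonObj.mul ≫ (ρ_ A).inv = freeAct A (yo U) ≫ map f := by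
    rw [← freeAct_unit]
    exact map_mem f
  simp only [unhatHom, MonoidalCategory.whiskerLeft_comp, Category.assoc]
  refine (congrArg (fun t => A ◁ (λ_ (yo U)).inv ≫ A ◁ MonObj.one ▷ yo U ≫ t) h).trans ?_
  have e : A ◁ (λ_ (yo U)).inv ≫ A ◁ (MonObj.one (X := A)) ▷ yo U ≫ freeAct A (yo U) =
      𝟙 (A ⊗ yo U) := by
    rw [freeAct, associator_inv_naturality_middle_assoc, ← comp_whiskerRight, MonObj.mul_one]
    simp
  rw [reassoc_of% e]

variable (A) in
/-- Elements of `A(U)` are the same as `A`-linear maps `A ⊗ U ⟶ A`. -/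
noncomputable def hatEquiv (U : C) : A.ev U ≃ₗ[ℂ] (of A U ⟶ of A (𝟙_ C)) where
  toFun := hat
  map_add' := hat_add
  map_smul' := hat_smul
  invFun f := app (unhatHom f) U (yoElt (𝟙 U))
  left_inv a := (congrArg (fun t => app t U (yoElt (𝟙 U))) (unhatHom_hat a)).trans
    (app_yoDesc_id a)
  right_inv f := hom_ext (by rw [map_hat, yoDesc_app_id, hat_unhatHom])

theorem map_rightWh_hat {U : C} (a : A.ev U) (V : C) :
    map (rightWh (hat a) V ≫ freeMap (λ_ V).hom) =
      A ◁ (yoTensor U V).inv ≫ (α_ A (yo U) (yo V)).inv ≫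
        (A ◁ yoDesc a ≫ MonObj.mul) ▷ yo V := by
  rw [← cancel_epi (reassocIso A U V).hom]
  have h := reassocIso_map_rightWh (hat a) V
  rw [map_comp, reassoc_of% h, map_freeMap, map_hat]
  have h2 : (reassocIso A (𝟙_ C) V).hom ≫ A ◁ yoMap (λ_ V).hom =
      (ρ_ A).hom ▷ yo V := by
    rw [reassocIso_hom, Category.assoc, ← MonoidalCategory.whiskerLeft_comp, yoTensor_leftUnitor]
    exact triangle A (yo V)
  have h3 : (A ◁ yoDesc a ≫ MonObj.mul ≫ (ρ_ A).inv) ▷ yo V ≫ (ρ_ A).hom ▷ yo V =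
      (A ◁ yoDesc a ≫ MonObj.mul) ▷ yo V := by
    rw [← comp_whiskerRight, Category.assoc, Category.assoc]
    have e : (ρ_ A).inv ≫ (ρ_ A).hom = 𝟙 A := Iso.inv_hom_id _
    exact congrArg (fun t => (A ◁ yoDesc a ≫ t) ▷ yo V)
      ((congrArg (fun t => MonObj.mul ≫ t) e).trans (Category.comp_id _))
  rw [h2, h3, reassocIso_hom, Category.assoc, ← MonoidalCategory.whiskerLeft_comp_assoc,
    Iso.hom_inv_id, MonoidalCategory.whiskerLeft_id, Category.id_comp, Iso.hom_inv_id_assoc]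

/-- Multiplication of algebra elements corresponds to composition of module maps. -/
theorem hat_mul {U V : C} (a : A.ev U) (b : A.ev V) :
    hat (app (MonObj.mul (X := A)) (U ⊗ V) (pureT A A (U ⊗ V) U V (𝟙 _) a b)) =
      rightWh (hat a) V ≫ freeMap (λ_ V).hom ≫ hat b := by
  apply hom_ext
  have e1 : yoDesc (app (MonObj.mul (X := A)) (U ⊗ V) (pureT A A (U ⊗ V) U V (𝟙 _) a b)) =
      (yoTensor U V).inv ≫ (yoDesc a ⊗ₘ yoDesc b) ≫ MonObj.mul := by
    refine (yoDesc_app (F := A ⊗ A) (MonObj.mul (X := A)) _).trans ?_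
    rw [yoDesc_pureT, yoMap_id, Category.id_comp, Category.assoc]
  rw [← Category.assoc, map_comp, map_rightWh_hat, map_hat, map_hat, e1]
  simp only [MonoidalCategory.whiskerLeft_comp, Category.assoc, comp_whiskerRight]
  rw [← whisker_exchange_assoc (MonObj.mul (X := A)), MonObj.mul_assoc_assoc]
  simp [MonoidalCategory.tensorHom_def]

theorem hat_one {U : C} (k : U ⟶ 𝟙_ C) :
    hat (app (MonObj.one (X := A)) U (yoElt k)) = freeMap k := by
  apply hom_ext
  rw [map_hat, map_freeMap]
  have e : yoDesc (app (MonObj.one (X := A)) U (yoElt k)) = yoMap k ≫ MonObj.one :=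
    yoDesc_app (F := yo (𝟙_ C)) (MonObj.one (X := A)) k
  rw [e, MonoidalCategory.whiskerLeft_comp, Category.assoc]
  have e2 : A ◁ MonObj.one ≫ MonObj.mul ≫ (ρ_ A).inv = 𝟙 (A ⊗ 𝟙_ (VectC C)) := by
    rw [MonObj.mul_one_assoc, Iso.hom_inv_id]
  exact (congrArg (fun t => A ◁ yoMap k ≫ t) e2).trans (Category.comp_id _)

end

section Center

variable (A : Mon (Center (VectC C)))

/-- The isomorphism between an algebra and the algebra of its free modules, `a ↦ (x ↦ x a)`. -/
noncomputable def hatIso : A.X.1 ≅ (freeBimod A).algObj where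
  hom := homMk (fun U => ((freeBimod A).algEv U).toLinearMap.comp (hatEquiv A.X.1 U).toLinearMap)
    (fun f a => congrArg ((freeBimod A).algEv _) (hat_res f a))
  inv := homMk
    (fun U => (hatEquiv A.X.1 U).symm.toLinearMap.comp ((freeBimod A).algEv U).symm.toLinearMap)
    (fun {X Y} f a => by
      obtain ⟨a, rfl⟩ := (freeBimod A).algEv_surj a
      obtain ⟨a, rfl⟩ := (hatEquiv A.X.1 Y).surjective a
      refine (congrArg (hatEquiv A.X.1 X).symm (hat_res f a)).symm.trans ?_
      refine ((hatEquiv A.X.1 X).symm_apply_apply _).trans ?_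
      exact congrArg (A.X.1.res f) ((hatEquiv A.X.1 Y).symm_apply_apply a).symm)
  hom_inv_id := ext_app fun U a => (hatEquiv A.X.1 U).symm_apply_apply a
  inv_hom_id := ext_app fun U a => (hatEquiv A.X.1 U).apply_symm_apply a

theorem one_hatIso : MonObj.one (X := A.X.1) ≫ (hatIso A).hom = (freeBimod A).oneHom :=
  ext_app fun X k => (congrArg ((freeBimod A).algEv X) (hat_one k)).trans
    ((freeBimod A).oneHom_app k).symm

theorem mul_hatIso : MonObj.mul (X := A.X.1) ≫ (hatIso A).hom =
    ((hatIso A).hom ⊗ₘ (hatIso A).hom) ≫ (freeBimod A).mulHom := by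
  apply day_ext
  intro X U V f a b
  have h1 : pureT A.X.1 A.X.1 X U V f a b =
      (day A.X.1 A.X.1).res f (pureT A.X.1 A.X.1 (U ⊗ V) U V (𝟙 _) a b) := by
    rw [res_pureT, Category.comp_id]
  have h2 : app (MonObj.mul (X := A.X.1)) X (pureT A.X.1 A.X.1 X U V f a b) =
      A.X.1.res f (app (MonObj.mul (X := A.X.1)) (U ⊗ V)
        (pureT A.X.1 A.X.1 (U ⊗ V) U V (𝟙 _) a b)) :=
    (congrArg (app (MonObj.mul (X := A.X.1)) X) h1).trans
      (app_res (F := A.X.1 ⊗ A.X.1) (MonObj.mul (X := A.X.1)) f _)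
  have h3 : hat (app (MonObj.mul (X := A.X.1)) X (pureT A.X.1 A.X.1 X U V f a b)) =
      (freeBimod A).J.map f ≫ (freeBimod A).mulElt (hat a) (hat b) := by
    rw [h2, hat_res, hat_mul]
    rfl
  refine (congrArg ((freeBimod A).algEv X) h3).trans ?_
  refine Eq.trans ?_ (congrArg (app (freeBimod A).mulHom X)
    (app_tensorHom_pureT (hatIso A).hom (hatIso A).hom f a b)).symm
  exact ((freeBimod A).mulHom_pureT f (hat a) (hat b)).symm

theorem centralIso_rightUnitor (W : C) :
    (centralIso A W (𝟙_ C)).hom ≫ A.X.1 ◁ yoMap (ρ_ W).hom =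
      yo W ◁ (ρ_ A.X.1).hom ≫ (A.X.2.β (yo W)).inv := by
  rw [← cancel_epi (braidPast A.X (yo W) (yo (𝟙_ C))).hom, ← Category.assoc, braidPast_centralIso,
    ← MonoidalCategory.whiskerLeft_comp, yoTensor_rightUnitor, ← Category.assoc, Iso.eq_comp_inv]
  exact (braidPast_rightUnitor A.X (yo W)).symm

variable {A} [RightRigidCategory C] [LeftRigidCategory C]

theorem map_normal {X U V W : C} (k : X ⟶ U ⊗ V) (a : A.X.1.ev U) (f : V ⟶ W) :
    map ((freeMap k ≫ rightWh (hat a) V ≫ freeMap (𝟙_ C ◁ f)) ≫ freeMap (λ_ W).hom) =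
      A.X.1 ◁ yoDesc (F := A.X.1 ⊗ yo W) (pureT A.X.1 (yo W) X U V k a f) ≫
        freeAct A.X.1 (yo W) := by
  have e : (freeMap k ≫ rightWh (hat a) V ≫ freeMap (𝟙_ C ◁ f)) ≫ freeMap (λ_ W).hom =
      freeMap k ≫ (rightWh (hat a) V ≫ freeMap (λ_ V).hom) ≫ freeMap f := by
    simp only [Category.assoc, ← freeMap_comp, leftUnitor_naturality]
  rw [e, map_comp, map_comp, map_rightWh_hat, map_freeMap, map_freeMap,
    yoDesc_pureT (G := yo W) k a f, freeAct]
  have e2 : yoDesc (F := yo W) f = yoMap f := rfl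
  rw [e2]
  simp only [MonoidalCategory.whiskerLeft_comp, Category.assoc, comp_whiskerRight,
    MonoidalCategory.tensorHom_def]
  rw [associator_inv_naturality_right_assoc, whisker_exchange,
    associator_inv_naturality_middle_assoc]

/-- A tensor in `(A ⊗ C(-, W))(X)` gives a module map `A ⊗ X ⟶ A ⊗ W` in two ways: through
`unfoldHom`, and by extending it `A`-linearly. -/
theorem map_unfold {X W : C} (z : (A.X.1 ⊗ yo W).ev X) :
    map ((show of A.X.1 X ⟶ of A.X.1 (𝟙_ C ⊗ W) from
      app ((freeBimod A).unfoldHom W) X (app ((hatIso A).hom ▷ yo W) X z)) ≫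
        freeMap (λ_ W).hom) =
      A.X.1 ◁ yoDesc z ≫ freeAct A.X.1 (yo W) := by
  induction z using day_induction (F := A.X.1) (G := yo W) with
  | zero =>
    have e : yoDesc (F := A.X.1 ⊗ yo W) (0 : (day A.X.1 (yo W)).ev X) = 0 := by
      have h := yoDesc_smul (F := A.X.1 ⊗ yo W) 0 (0 : (day A.X.1 (yo W)).ev X)
      rwa [zero_smul, zero_smul] at h
    rw [map_zero, map_zero]
    refine (congrArg map (Limits.zero_comp (X := of A.X.1 X))).trans ?_
    rw [e, MonoidalPreadditive.whiskerLeft_zero, Limits.zero_comp]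
    rfl
  | add s t hs ht =>
    have e : yoDesc (F := A.X.1 ⊗ yo W) (s + t) = yoDesc (F := A.X.1 ⊗ yo W) s +
      yoDesc (F := A.X.1 ⊗ yo W) t := yoDesc_add s t
    have h : ∀ u v : yo X ⟶ A.X.1 ⊗ yo W, A.X.1 ◁ (u + v) ≫ freeAct A.X.1 (yo W) =
        A.X.1 ◁ u ≫ freeAct A.X.1 (yo W) + A.X.1 ◁ v ≫ freeAct A.X.1 (yo W) := by
      intro u v
      rw [MonoidalPreadditive.whiskerLeft_add, Preadditive.add_comp]
    have hl := (congrArg (app ((freeBimod A).unfoldHom W) X)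
      (_root_.map_add (app ((hatIso A).hom ▷ yo W) X) s t)).trans (_root_.map_add _ _ _)
    refine (congrArg (fun u : of A.X.1 X ⟶ of A.X.1 (𝟙_ C ⊗ W) => map (u ≫ freeMap (λ_ W).hom))
      hl).trans ?_
    refine (congrArg map (Preadditive.add_comp _ _ _ _ _ _)).trans ?_
    refine Eq.trans ?_ (congrArg (fun y => A.X.1 ◁ y ≫ freeAct A.X.1 (yo W)) e).symm
    exact (congrArg₂ (· + ·) hs ht).trans (h _ _).symm
  | mk U V k a f =>
    refine Eq.trans ?_ (map_normal k a f)
    have h1 := app_whiskerRight_pureT (hatIso A).hom (yo W) k a f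
    have h2 := (congrArg (app ((freeBimod A).unfoldHom W) X) h1).trans
      (desc_pureT (F := (freeBimod A).algObj) (G := yo W) ((freeBimod A).unfoldFam W)
        ((freeBimod A).unfoldFam_nat W) k ((freeBimod A).algEv U (hat a)) f)
    exact congrArg (fun t : of A.X.1 X ⟶ of A.X.1 (𝟙_ C ⊗ W) => map (t ≫ freeMap (λ_ W).hom)) h2

/-- The counterpart of `map_normal` for the left action on free modules, where the half-braiding of
the algebra appears. -/
theorem map_normal_left {X U W V : C} (k : X ⟶ W ⊗ U) (f : W ⟶ V) (a : A.X.1.ev U) :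
    map ((freeMap k ≫ leftWh W (hat a) ≫ freeMap (FreeBimod.unitSwap C W).inv ≫ freeMap (𝟙_ C ◁ f))
      ≫
        freeMap (λ_ V).hom) =
      A.X.1 ◁ (yoDesc (F := yo V ⊗ A.X.1) (pureT (yo V) A.X.1 X W U k f a) ≫
        (A.X.2.β (yo V)).inv) ≫ freeAct A.X.1 (yo V) := by
  have e : (freeMap k ≫ leftWh W (hat a) ≫ freeMap (FreeBimod.unitSwap C W).inv ≫ freeMap (𝟙_ C ◁
    f)) ≫
      freeMap (λ_ V).hom = freeMap k ≫ leftWh W (hat a) ≫ freeMap (ρ_ W).hom ≫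
        freeMap (A := A.X.1) f := by
    simp only [Category.assoc, ← freeMap_comp, leftUnitor_naturality, FreeBimod.unitSwap]
    simp
  have e2 : yoDesc (F := yo V) f = yoMap f := rfl
  have e3 := braidPast_naturality A.X (yo W) (yoDesc a)
  have e4 : (A.X.2.β (yo W)).inv ≫ A.X.1 ◁ yoMap f = yoMap f ▷ A.X.1 ≫ (A.X.2.β (yo V)).inv := by
    rw [Iso.inv_comp_eq, ← Category.assoc, Iso.eq_comp_inv]
    exact A.X.2.naturality (yoMap f)
  have e5 := braidPast_naturality_left A.X (yoMap f) A.X.1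
  have e6 := centralIso_rightUnitor A W
  have e7 := whiskerLeft_braid_inv_freeAct A (yo V)
  have e8 : map (hat a) ≫ (ρ_ A.X.1).hom = A.X.1 ◁ yoDesc a ≫ MonObj.mul := by
    have e : (ρ_ A.X.1).inv ≫ (ρ_ A.X.1).hom = 𝟙 A.X.1 := Iso.inv_hom_id _
    rw [map_hat, Category.assoc, Category.assoc]
    exact congrArg (fun t => A.X.1 ◁ yoDesc a ≫ t)
      ((congrArg (fun t => MonObj.mul ≫ t) e).trans (Category.comp_id _))
  have e9 : map (leftWh W (hat a)) ≫ A.X.1 ◁ yoMap (ρ_ W).hom = A.X.1 ◁ (yoTensor W U).inv ≫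
      (braidPast A.X (yo W) (yo U)).hom ≫ yo W ◁ (A.X.1 ◁ yoDesc a ≫ MonObj.mul) ≫
        (A.X.2.β (yo W)).inv := by
    rw [← e8, ← cancel_epi (centralIso A W U).hom]
    have h := centralIso_map_leftWh W (hat a)
    rw [reassoc_of% h, e6]
    simp only [centralIso, Iso.trans_hom, Iso.symm_hom, whiskerLeftIso_hom, Category.assoc,
      MonoidalCategory.whiskerLeft_comp]
    rw [whiskerLeft_hom_inv_assoc, Iso.inv_hom_id_assoc]
  rw [e, map_comp, map_comp, map_comp, map_freeMap, map_freeMap, map_freeMap, reassoc_of% e9,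
    e4, yoDesc_pureT (F := yo V) k f a, e2]
  simp only [MonoidalCategory.whiskerLeft_comp, Category.assoc, e7,
    MonoidalCategory.tensorHom_def']
  rw [← reassoc_of% e3, whisker_exchange_assoc (yoMap f), reassoc_of% e5]

/-- The half-braidings agree at representable presheaves: both correspond to the left action on
module maps, and `unfoldHom` is injective. -/
theorem hatIso_comm_yo (V : C) :
    (A.X.2.β (yo V)).inv ≫ (hatIso A).hom ▷ yo V =
      yo V ◁ (hatIso A).hom ≫ (freeBimod A).braidInv (yo V) := by
  apply day_ext
  intro X W U k f a
  apply (freeBimod A).unfoldHom_injective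
  have h1 := map_unfold (app (A.X.2.β (yo V)).inv X (pureT (yo V) A.X.1 X W U k f a))
  have h2 : yoDesc (app (A.X.2.β (yo V)).inv X (pureT (yo V) A.X.1 X W U k f a)) =
      yoDesc (F := yo V ⊗ A.X.1) (pureT (yo V) A.X.1 X W U k f a) ≫ (A.X.2.β (yo V)).inv :=
    yoDesc_app (F := yo V ⊗ A.X.1) _ _
  have h3 := h1.trans ((congrArg (fun y => A.X.1 ◁ y ≫ freeAct A.X.1 (yo V)) h2).trans
    (map_normal_left k f a).symm)
  have h4 := hom_ext h3
  have h5 : ∀ s t : of A.X.1 X ⟶ of A.X.1 (𝟙_ C ⊗ V), s ≫ freeMap (λ_ V).hom =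
      t ≫ freeMap (λ_ V).hom → s = t := by
    intro s t h
    have h' := congrArg (fun t => t ≫ freeMap (λ_ V).inv) h
    simpa only [Category.assoc, ← freeMap_comp, Iso.hom_inv_id, freeMap_id, Category.comp_id]
      using h'
  have h6 := h5 _ _ h4
  refine h6.trans ?_
  have r1 := (congrArg (app ((freeBimod A).braidInv (yo V)) X)
    (app_whiskerLeft_pureT (yo V) (hatIso A).hom k f a)).trans
    ((freeBimod A).braidInv_pureT (yo V) k f (hat a))
  have r2 : (freeBimod A).elR (yo V) W X f ((freeBimod A).J.map k ≫
      (freeBimod A).L W (hat a) ≫ (freeBimod A).J.map (FreeBimod.unitSwap C W).inv) =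
      (freeBimod A).elR (yo V) V X (yoElt (𝟙 V)) (((freeBimod A).J.map k ≫
      (freeBimod A).L W (hat a) ≫ (freeBimod A).J.map (FreeBimod.unitSwap C W).inv) ≫
        (freeBimod A).J.map (𝟙_ C ◁ f)) := by
    have e : f = (yo V).res f (yoElt (𝟙 V)) := (Category.comp_id (X := W) (Y := V) f).symm
    exact (congrArg (fun z => (freeBimod A).elR (yo V) W X z _) e).trans
      ((freeBimod A).elR_res f _ _)
  have r3 := (congrArg (app ((freeBimod A).unfoldHom V) X) (r1.trans r2)).trans
    ((freeBimod A).unfoldHom_elR _)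
  refine Eq.trans ?_ r3.symm
  have r4 : ∀ (s : of A.X.1 X ⟶ of A.X.1 (W ⊗ U)) (t : of A.X.1 (W ⊗ U) ⟶ of A.X.1 (W ⊗ 𝟙_ C))
      (u : of A.X.1 (W ⊗ 𝟙_ C) ⟶ of A.X.1 (𝟙_ C ⊗ W))
      (v : of A.X.1 (𝟙_ C ⊗ W) ⟶ of A.X.1 (𝟙_ C ⊗ V)),
      s ≫ t ≫ u ≫ v = (s ≫ t ≫ u) ≫ v := by
    intro s t u v
    simp only [Category.assoc]
  exact r4 _ _ _ _

/-- Half-braidings are natural, hence determined by their components at representable presheaves. -/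
theorem hatIso_comm_inv (F : VectC C) :
    (A.X.2.β F).inv ≫ (hatIso A).hom ▷ F = F ◁ (hatIso A).hom ≫ (freeBimod A).braidInv F := by
  have key : ∀ (V : C) (b : F.ev V), yoDesc b ▷ A.X.1 ≫ (A.X.2.β F).inv ≫ (hatIso A).hom ▷ F =
      yoDesc b ▷ A.X.1 ≫ F ◁ (hatIso A).hom ≫ (freeBimod A).braidInv F := by
    intro V b
    have e1 : yoDesc b ▷ A.X.1 ≫ (A.X.2.β F).inv =
        (A.X.2.β (yo V)).inv ≫ A.X.1 ◁ yoDesc b :=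
      (FreeBimod.inv_comp_eq_comp_inv (A.X.2.β (yo V)) (A.X.2.β F)
        (A.X.2.naturality (yoDesc b))).symm
    have e2 : yoDesc b ▷ (freeBimod A).algObj ≫ (freeBimod A).braidInv F =
        (freeBimod A).braidInv (yo V) ≫ (freeBimod A).algObj ◁ yoDesc b :=
      (FreeBimod.inv_comp_eq_comp_inv ((freeBimod A).braidIso (yo V)) ((freeBimod A).braidIso F)
        ((freeBimod A).braidHom_naturality (yoDesc b))).symm
    have e3 := hatIso_comm_yo (A := A) V
    rw [reassoc_of% e1, whisker_exchange, ← whisker_exchange_assoc, e2, reassoc_of% e3]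
  apply day_ext
  intro X V U k b a
  have h := congrArg (fun t => app t X (pureT (yo V) A.X.1 X V U k (yoElt (𝟙 V)) a)) (key V b)
  have h1 := (app_whiskerRight_pureT (yoDesc b) A.X.1 k (yoElt (𝟙 V)) a).trans
    (congrArg (fun z => pureT F A.X.1 X V U k z a) (app_yoDesc_id b))
  exact (congrArg (app ((A.X.2.β F).inv ≫ (hatIso A).hom ▷ F) X) h1).symm.trans (h.trans
    (congrArg (app (F ◁ (hatIso A).hom ≫ (freeBimod A).braidInv F) X) h1))

theorem hatIso_comm (F : VectC C) :
    (hatIso A).hom ▷ F ≫ (freeBimod A).braidHom F =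
      (A.X.2.β F).hom ≫ F ◁ (hatIso A).hom := by
  have h := hatIso_comm_inv (A := A) F
  rw [Iso.inv_comp_eq] at h
  have e : (freeBimod A).braidInv F ≫ (freeBimod A).braidHom F = 𝟙 _ :=
    ((freeBimod A).braidIso F).inv_hom_id
  rw [h, Category.assoc, Category.assoc, e]
  exact congrArg (fun t => (A.X.2.β F).hom ≫ t) (Category.comp_id (F ◁ (hatIso A).hom))

variable (A) in
/-- An algebra in the center is isomorphic to the algebra of its free modules. -/
noncomputable def hatCenterIso : A ≅ (freeBimod A).centerAlg :=
  haveI : IsIso (Center.Hom.f (X := A.X) (Y := (freeBimod A).centerObj)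
      ⟨(hatIso A).hom, hatIso_comm⟩) := inferInstanceAs (IsIso (hatIso A).hom)
  Mon.mkIso (N := (freeBimod A).centerAlg)
    (Center.isoMk (X := A.X) (Y := (freeBimod A).centerObj) ⟨(hatIso A).hom, hatIso_comm⟩)
    (Center.ext _ _ (one_hatIso A)) (Center.ext _ _ (mul_hatIso A))

end Center

end FreeMod

end HatIso

/-! ### Corners of C*-categories -/

section CornerTransfer

open DaggerCategory

theorem CStarAlgebra.exists_isSelfAdjoint_sq {A : Type*} [CStarAlgebra A] (g : A) :
    ∃ s : A, star s = s ∧ s * s = star g * g := by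
  let _ := CStarAlgebra.spectralOrder A
  have := CStarAlgebra.spectralOrderedRing A
  exact ⟨CFC.sqrt (star g * g), (CFC.sqrt_nonneg _).isSelfAdjoint,
    CFC.sqrt_mul_sqrt_self _ (star_mul_self_nonneg g)⟩

section

variable {M : Type*} [Category M] [Preadditive M] [Linear ℂ M] [DaggerCategory M]

theorem dag_zero {X Y : M} : dag (0 : X ⟶ Y) = 0 := by
  have h := dag_smul (0 : ℂ) (0 : X ⟶ Y)
  simpa using h

theorem cnorm_nonneg {X Y : M} (f : X ⟶ Y) : 0 ≤ cnorm f := Real.sqrt_nonneg _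

variable [IsCStarCategory M]

theorem cnorm_zero {X Y : M} : cnorm (0 : X ⟶ Y) = 0 := by
  have h := IsCStarCategory.cnorm_smul (0 : ℂ) (0 : X ⟶ Y)
  simpa using h

theorem cnorm_neg {X Y : M} (f : X ⟶ Y) : cnorm (-f) = cnorm f := by
  have h := IsCStarCategory.cnorm_smul (-1 : ℂ) f
  simpa using h

/-- In a C*-category `f f* = 0` only if `f = 0`. -/
theorem eq_zero_of_comp_dag {X Y : M} (f : X ⟶ Y) (h : f ≫ dag f = 0) : f = 0 := by
  apply IsCStarCategory.eq_zero_of_cnorm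
  have h2 := IsCStarCategory.cnorm_star f
  rw [h, cnorm_zero] at h2
  exact pow_eq_zero_iff two_ne_zero |>.1 h2.symm

/-- The endomorphisms of an object of a C*-category form a C*-algebra. -/
@[reducible]
noncomputable def endCStarAlgebra (X : M) : CStarAlgebra (End X) :=
  let n : RingNorm (End X) :=
    { toFun := fun f => cnorm (X := X) (Y := X) f
      map_zero' := cnorm_zero
      add_le' := IsCStarCategory.cnorm_add
      neg' := cnorm_neg
      mul_le' := fun f g => (IsCStarCategory.cnorm_comp g f).trans (mul_comm _ _).le
      eq_zero_of_map_eq_zero' := IsCStarCategory.eq_zero_of_cnorm }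
  letI : NormedRing (End X) := n.toNormedRing
  letI : StarRing (End X) :=
    { star := fun f => dag (X := X) (Y := X) f
      star_involutive := dag_dag
      star_mul := fun f g => dag_comp g f
      star_add := dag_add }
  { (inferInstance : NormedRing (End X)), (inferInstance : StarRing (End X)),
    (inferInstance : Algebra ℂ (End X)) with
    complete := by
      refine (Metric.complete_of_cauchySeq_tendsto fun u hu => ?_).complete
      have hd : ∀ x y : X ⟶ X, dist (α := End X) x y = cnorm (x - y) := fun x y =>
        dist_eq_norm (E := End X) x y
      obtain ⟨g, hg⟩ := IsCStarCategory.complete (X := X) (Y := X) u fun ε hε => by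
        obtain ⟨n, hn⟩ := Metric.cauchySeq_iff.1 hu ε hε
        exact ⟨n, fun m hm k hk => (hd _ _).symm.trans_lt (hn m hm k hk)⟩
      refine ⟨g, Metric.tendsto_atTop.2 fun ε hε => ?_⟩
      obtain ⟨n, hn⟩ := hg ε hε
      exact ⟨n, fun m hm => (hd _ _).trans_lt (hn m hm)⟩
    norm_mul_self_le := fun f => by
      refine le_of_eq ?_
      rw [← pow_two]
      exact (IsCStarCategory.cnorm_star (X := X) (Y := X) f).symm
    norm_smul_le := fun c f => (IsCStarCategory.cnorm_smul c f).le
    star_smul := dag_smul }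

/-- Every `g g*` has a self-adjoint square root. -/
theorem exists_dag_eq_self_sq {X : M} (g : X ⟶ X) :
    ∃ s : X ⟶ X, dag s = s ∧ s ≫ s = g ≫ dag g :=
  letI := endCStarAlgebra X
  CStarAlgebra.exists_isSelfAdjoint_sq (A := End X) g

end

variable {M N : Type*} [Category M] [Preadditive M] [Linear ℂ M] [DaggerCategory M]
  [Category N] [Preadditive N] [Linear ℂ N] [DaggerCategory N]

variable (M N) in
/-- A realization of the morphism spaces of a `*`-category as corners `p Hom(X, Y) q` in another
one: the identities are sent to projections `p`, and every morphism of the form `p f q` is hit. -/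
structure CornerEmbedding where
  /-- The map on objects. -/
  obj : N → M
  /-- The map on morphisms, which need not send identities to identities. -/
  map {X Y : N} : (X ⟶ Y) → (obj X ⟶ obj Y)
  map_add {X Y : N} (f g : X ⟶ Y) : map (f + g) = map f + map g
  map_smul {X Y : N} (c : ℂ) (f : X ⟶ Y) : map (c • f) = c • map f
  map_comp {X Y Z : N} (f : X ⟶ Y) (g : Y ⟶ Z) : map (f ≫ g) = map f ≫ map g
  map_dag {X Y : N} (f : X ⟶ Y) : map (dag f) = dag (map f)
  map_injective {X Y : N} (f g : X ⟶ Y) : map f = map g → f = g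
  exists_map {X Y : N} (f : obj X ⟶ obj Y) : ∃ g, map g = map (𝟙 X) ≫ f ≫ map (𝟙 Y)

namespace CornerEmbedding

variable (t : CornerEmbedding M N)

theorem map_id_comp {X Y : N} (f : X ⟶ Y) : t.map (𝟙 X) ≫ t.map f = t.map f := by
  rw [← t.map_comp, Category.id_comp]

theorem map_comp_id {X Y : N} (f : X ⟶ Y) : t.map f ≫ t.map (𝟙 Y) = t.map f := by
  rw [← t.map_comp, Category.comp_id]

theorem map_zero {X Y : N} : t.map (0 : X ⟶ Y) = 0 := by
  have h := t.map_smul (0 : ℂ) (0 : X ⟶ Y)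
  simpa using h

theorem map_sub {X Y : N} (f g : X ⟶ Y) : t.map (f - g) = t.map f - t.map g := by
  have h := t.map_smul (-1 : ℂ) g
  rw [sub_eq_add_neg, t.map_add, sub_eq_add_neg]
  simpa using h

theorem isUnit_iff_exists {K : Type*} [Category K] {X : K} (f : X ⟶ X) :
    IsUnit (M := End X) f ↔ ∃ g : X ⟶ X, f ≫ g = 𝟙 X ∧ g ≫ f = 𝟙 X :=
  ⟨fun ⟨u, hu⟩ => ⟨u.inv, hu ▸ u.inv_mul, hu ▸ u.mul_inv⟩,
    fun ⟨g, h1, h2⟩ => ⟨⟨f, g, h2, h1⟩, rfl⟩⟩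

/-- Away from `0` the spectrum in a corner is the spectrum in the ambient algebra: `c - x` is
inverted on the complement of the corner by `c⁻¹`. -/
theorem isUnit_map {X : N} (c : ℂ) (hc : c ≠ 0) (f : X ⟶ X) :
    IsUnit (M := End (t.obj X)) (c • 𝟙 (t.obj X) - t.map f) ↔
      IsUnit (M := End X) (c • 𝟙 X - f) := by
  rw [isUnit_iff_exists, isUnit_iff_exists]
  have hp := t.map_id_comp (𝟙 X)
  have h1 := t.map_id_comp f
  have h2 := t.map_comp_id f
  constructor
  · rintro ⟨g, hg, hg'⟩
    obtain ⟨k, hk⟩ := t.exists_map g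
    rw [Preadditive.sub_comp, Linear.smul_comp, Category.id_comp] at hg
    rw [Preadditive.comp_sub, Linear.comp_smul, Category.comp_id] at hg'
    refine ⟨k, t.map_injective _ _ ?_, t.map_injective _ _ ?_⟩
    · have h := congrArg (fun s => t.map (𝟙 X) ≫ s ≫ t.map (𝟙 X)) hg
      simp only [Preadditive.sub_comp, Preadditive.comp_sub, Linear.smul_comp, Linear.comp_smul,
        Category.id_comp, Category.assoc, hp] at h
      rw [← Category.assoc (t.map (𝟙 X)) (t.map f), h1] at h
      rw [t.map_comp, t.map_sub, t.map_smul, hk, Preadditive.sub_comp, Linear.smul_comp,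
        reassoc_of% hp, reassoc_of% h2, h]
    · have h := congrArg (fun s => t.map (𝟙 X) ≫ s ≫ t.map (𝟙 X)) hg'
      simp only [Preadditive.sub_comp, Preadditive.comp_sub, Linear.smul_comp, Linear.comp_smul,
        Category.id_comp, Category.assoc, hp, h2] at h
      rw [t.map_comp, t.map_sub, t.map_smul, hk, Preadditive.comp_sub, Linear.comp_smul]
      simp only [Category.assoc, hp, h1, h]
  · rintro ⟨k, hk, hk'⟩
    have e1 := congrArg t.map hk
    have e2 := congrArg t.map hk'
    rw [t.map_comp, t.map_sub, t.map_smul, Preadditive.sub_comp, Linear.smul_comp,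
      t.map_id_comp] at e1
    rw [t.map_comp, t.map_sub, t.map_smul, Preadditive.comp_sub, Linear.comp_smul,
      t.map_comp_id] at e2
    refine ⟨t.map k + c⁻¹ • (𝟙 _ - t.map (𝟙 X)), ?_, ?_⟩
    · simp only [Preadditive.sub_comp, Preadditive.comp_sub, Preadditive.comp_add,
        Linear.smul_comp, Linear.comp_smul, Category.id_comp, Category.comp_id, h2, smul_sub,
        smul_smul, inv_mul_cancel₀ hc, one_smul]
      rw [← e1]
      abel
    · simp only [Preadditive.sub_comp, Preadditive.comp_sub, Preadditive.add_comp,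
        Linear.smul_comp, Linear.comp_smul, Category.id_comp, Category.comp_id, h1, smul_sub,
        smul_smul, mul_inv_cancel₀ hc, one_smul, smul_add, sub_self]
      rw [← e2]
      abel

theorem spectralRadius_map {X : N} (f : X ⟶ X) :
    spectralRadius ℂ (A := End (t.obj X)) (t.map f) = spectralRadius ℂ (A := End X) f := by
  have key : ∀ c : ℂ, c ≠ 0 → (c ∈ spectrum ℂ (A := End (t.obj X)) (t.map f) ↔
      c ∈ spectrum ℂ (A := End X) f) := fun c hc => not_congr (t.isUnit_map c hc f)
  refine le_antisymm (iSup₂_le fun c hc => ?_) (iSup₂_le fun c hc => ?_)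
  -- the value `0` may be in one spectrum only, but does not contribute to the supremum
  · rcases eq_or_ne c 0 with rfl | h0
    · simp
    · exact le_iSup₂ (α := ENNReal) (f := fun (k : ℂ) (_ : k ∈ spectrum ℂ (A := End X) f) => (‖k‖₊
        : ENNReal)) c
        ((key c h0).1 hc)
  · rcases eq_or_ne c 0 with rfl | h0
    · simp
    · exact le_iSup₂ (α := ENNReal) (f := fun (k : ℂ)
        (_ : k ∈ spectrum ℂ (A := End (t.obj X)) (t.map f)) => (‖k‖₊ : ENNReal)) c ((key c h0).2 hc)

/-- Corner embeddings are isometric, since the norm is a spectral radius. -/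
theorem cnorm_map {X Y : N} (f : X ⟶ Y) : cnorm (t.map f) = cnorm f := by
  rw [cnorm, cnorm, ← t.map_dag, ← t.map_comp, spectralRadius_map]

/-- A `*`-category whose morphism spaces are corners in a C*-category is a C*-category. -/
theorem isCStarCategory (t : CornerEmbedding M N) [IsCStarCategory M] : IsCStarCategory N where
  exists_sq {X Y} f := by
    obtain ⟨g, hg⟩ := IsCStarCategory.exists_sq (t.map f)
    obtain ⟨s, hs, hs2⟩ := exists_dag_eq_self_sq g
    rw [← hg, ← t.map_dag, ← t.map_comp] at hs2
    -- `s` commutes with the corner projection since `(1 - p) s² (1 - p) = 0`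
    have h0 : (𝟙 _ - t.map (𝟙 X)) ≫ s = 0 := by
      apply eq_zero_of_comp_dag
      rw [dag_comp, hs, Category.assoc, ← Category.assoc s s, hs2]
      rw [Preadditive.sub_comp, ← Category.assoc (t.map (𝟙 X)), t.map_id_comp, Category.id_comp,
        sub_self]
    have h1 : t.map (𝟙 X) ≫ s = s := by
      rw [Preadditive.sub_comp, Category.id_comp, sub_eq_zero] at h0
      exact h0.symm
    have h2 : s ≫ t.map (𝟙 X) = s := by
      have h := congrArg dag h1
      rwa [dag_comp, hs, ← t.map_dag, dag_id] at h
    obtain ⟨k, hk⟩ := t.exists_map s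
    rw [h2, h1] at hk
    exact ⟨k, t.map_injective _ _ (by rw [t.map_comp k, t.map_dag k, hk, hs, hs2])⟩
  spectralRadius_ne_top f := by
    rw [← t.spectralRadius_map, t.map_comp, t.map_dag]
    exact IsCStarCategory.spectralRadius_ne_top _
  cnorm_add f g := by
    rw [← t.cnorm_map, ← t.cnorm_map f, ← t.cnorm_map g, t.map_add]
    exact IsCStarCategory.cnorm_add _ _
  cnorm_smul c f := by
    rw [← t.cnorm_map, ← t.cnorm_map f, t.map_smul]
    exact IsCStarCategory.cnorm_smul _ _
  eq_zero_of_cnorm f h := by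
    rw [← t.cnorm_map] at h
    exact t.map_injective _ _ ((IsCStarCategory.eq_zero_of_cnorm _ h).trans t.map_zero.symm)
  complete {X Y} f hf := by
    obtain ⟨g, hg⟩ := IsCStarCategory.complete (fun n => t.map (f n)) (fun ε hε => by
      obtain ⟨n, hn⟩ := hf ε hε
      refine ⟨n, fun m hm k hk => ?_⟩
      rw [← t.map_sub, t.cnorm_map]
      exact hn m hm k hk)
    obtain ⟨k, hk⟩ := t.exists_map g
    refine ⟨k, fun ε hε => ?_⟩
    obtain ⟨n, hn⟩ := hg ε hε
    refine ⟨n, fun m hm => lt_of_le_of_lt ?_ (hn m hm)⟩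
    -- the corner projections have norm at most `1`, so that compressing the limit keeps it a limit
    have e : t.map (f m - k) = t.map (𝟙 X) ≫ (t.map (f m) - g) ≫ t.map (𝟙 Y) := by
      rw [t.map_sub, hk, Preadditive.sub_comp, Preadditive.comp_sub, t.map_comp_id, t.map_id_comp]
    have hle : ∀ Z : N, cnorm (t.map (𝟙 Z)) ≤ 1 := by
      intro Z
      have h := IsCStarCategory.cnorm_star (t.map (𝟙 Z))
      rw [← t.map_dag, dag_id, t.map_id_comp] at h
      have h' : cnorm (t.map (𝟙 Z)) * (cnorm (t.map (𝟙 Z)) - 1) = 0 := by linarith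
      rcases mul_eq_zero.1 h' with h' | h' <;> linarith
    rw [← t.cnorm_map, e]
    refine (IsCStarCategory.cnorm_comp _ _).trans ((mul_le_of_le_one_left (cnorm_nonneg _)
      (hle X)).trans ?_)
    exact (IsCStarCategory.cnorm_comp _ _).trans (mul_le_of_le_one_right (cnorm_nonneg _) (hle Y))
  cnorm_comp f g := by
    rw [← t.cnorm_map, ← t.cnorm_map f, ← t.cnorm_map g, t.map_comp]
    exact IsCStarCategory.cnorm_comp _ _
  cnorm_star f := by
    rw [← t.cnorm_map, ← t.cnorm_map f, t.map_comp, t.map_dag]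
    exact IsCStarCategory.cnorm_star _

end CornerEmbedding

end CornerTransfer

/-! ### C*-categories of free bimodules -/

section FreeCStar

open DaggerCategory VectC

variable {C : Type u} [SmallCategory C] [Preadditive C] [Linear ℂ C] [DaggerCategory C]
  [MonoidalCategory C] [MonoidalPreadditive C] [MonoidalLinear ℂ C] [IsUnitaryTensorCategory C]

/-- A choice of right duals. -/
noncomputable instance unitaryRightRigid : RightRigidCategory C where
  rightDual U :=
    { rightDual := (IsUnitaryTensorCategory.exists_right_dual U).choose
      exact := (IsUnitaryTensorCategory.exists_right_dual U).choose_spec.some }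

/-- A choice of left duals. -/
noncomputable instance unitaryLeftRigid : LeftRigidCategory C where
  leftDual U :=
    { leftDual := (IsUnitaryTensorCategory.exists_left_dual U).choose
      exact := (IsUnitaryTensorCategory.exists_left_dual U).choose_spec.some }

variable (C) in
/-- A category of free bimodules which is a C*-category, with `*`-preserving actions. -/
structure FreeCStarBimod where
  /-- The underlying category of free bimodules. -/
  base : FreeBimod C
  [dagger : DaggerCategory base.carrier]
  [isCStar : IsCStarCategory base.carrier]
  dag_J {X Y : C} (f : X ⟶ Y) : dag (base.J.map f) = base.J.map (dag f)
  dag_R (W : C) {X Y : C} (f : base.J.obj X ⟶ base.J.obj Y) :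
    dag (base.R W f) = base.R W (dag f)
  dag_L (W : C) {X Y : C} (f : base.J.obj X ⟶ base.J.obj Y) :
    dag (base.L W f) = base.L W (dag f)

attribute [instance] FreeCStarBimod.dagger FreeCStarBimod.isCStar

namespace FreeCStarBimod

/-- Functors of categories of free bimodules that preserve the `*`-structure. -/
@[ext]
structure Hom (P Q : FreeCStarBimod C) where
  /-- The underlying functor. -/
  base : P.base ⟶ Q.base
  map_dag {X Y : C} (f : P.base.J.obj X ⟶ P.base.J.obj Y) : base.map (dag f) = dag (base.map f)

instance : Category (FreeCStarBimod C) where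
  Hom := Hom
  id P := ⟨𝟙 P.base, fun _ => rfl⟩
  comp Φ Ψ := ⟨Φ.base ≫ Ψ.base, fun f =>
    (congrArg Ψ.base.map (Φ.map_dag f)).trans (Ψ.map_dag _)⟩
  id_comp Φ := Hom.ext (Category.id_comp Φ.base)
  comp_id Φ := Hom.ext (Category.comp_id Φ.base)
  assoc Φ Ψ Θ := Hom.ext (Category.assoc Φ.base Ψ.base Θ.base)

variable (P : FreeCStarBimod C)

/-- The involution of the algebra of `P`. -/
noncomputable def starElt {U V : C} (p : ExactPairing U V)
    (a : P.base.J.obj U ⟶ P.base.J.obj (𝟙_ C)) : P.base.J.obj V ⟶ P.base.J.obj (𝟙_ C) :=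
  P.base.J.map (λ_ V).inv ≫ P.base.R V (dag a) ≫ P.base.J.map (dag (η_ U V))

theorem starElt_J_comp {U V U' V' : C} (p : ExactPairing U V) (p' : ExactPairing U' V')
    (g : U ⟶ U') (h : V ⟶ V') (w : η_ U V ≫ g ▷ V = η_ U' V' ≫ U' ◁ dag h)
    (a : P.base.J.obj U' ⟶ P.base.J.obj (𝟙_ C)) :
    P.starElt p (P.base.J.map g ≫ a) = P.base.J.map h ≫ P.starElt p' a := by
  have w' := congrArg dag w
  rw [dag_comp, dag_comp, IsUnitaryTensorCategory.dag_whiskerRight,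
    IsUnitaryTensorCategory.dag_whiskerLeft, dag_dag] at w'
  rw [starElt, starElt, dag_comp, P.dag_J, P.base.R_comp, P.base.R_map, Category.assoc,
    ← P.base.J.map_comp, w', P.base.J.map_comp, P.base.R_exchange_assoc, P.base.J_map_comp,
    ← leftUnitor_inv_naturality, ← P.base.J_map_comp]

/-- The adjoint of `a*` is obtained from `a` by bending, without adjoints. -/
theorem dag_starElt {U V : C} (p : ExactPairing U V)
    (a : P.base.J.obj U ⟶ P.base.J.obj (𝟙_ C)) :
    dag (P.starElt p a) = P.base.J.map (η_ U V) ≫ P.base.R V a ≫ P.base.J.map (λ_ V).hom := by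
  rw [starElt, dag_comp, dag_comp, P.dag_J, P.dag_J, P.dag_R, dag_dag, dag_dag,
    IsUnitaryTensorCategory.dag_leftUnitor_inv, Category.assoc]

/-- The involution is involutive by the zigzag identity. -/
theorem starElt_starElt {U V : C} (p : ExactPairing U V)
    (a : P.base.J.obj U ⟶ P.base.J.obj (𝟙_ C)) :
    P.starElt (IsUnitaryTensorCategory.dagPairing p) (P.starElt p a) = a := by
  have e : dag (@ExactPairing.coevaluation C _ _ V U (IsUnitaryTensorCategory.dagPairing p)) =
      ε_ U V := dag_dag _
  have e1 : (λ_ V).hom ▷ U = (α_ (𝟙_ C) V U).hom ≫ (λ_ (V ⊗ U)).hom := by monoidal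
  rw [starElt, dag_starElt, e]
  simp only [P.base.R_comp, P.base.R_map, e1, P.base.J.map_comp, Category.assoc]
  rw [← Category.assoc (P.base.R U _), P.base.R_tensor', Category.assoc, ← P.base.J.map_comp,
    ← leftUnitor_naturality, P.base.J.map_comp, P.base.R_exchange_assoc, unitors_equal,
    P.base.R_unit]
  simp only [P.base.J_map_comp]
  have z := ExactPairing.evaluation_coevaluation U V
  have e2 : (λ_ U).inv ≫ η_ U V ▷ U ≫ (α_ U V U).hom ≫ U ◁ ε_ U V ≫ (ρ_ U).hom = 𝟙 U := by
    rw [reassoc_of% z]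
    simp
  rw [e2, P.base.J.map_id, Category.id_comp]

/-- The involution is antimultiplicative. -/
theorem starElt_mulElt {U V U' V' : C} (p : ExactPairing U V) (p' : ExactPairing U' V')
    (a : P.base.J.obj U ⟶ P.base.J.obj (𝟙_ C)) (b : P.base.J.obj U' ⟶ P.base.J.obj (𝟙_ C)) :
    P.starElt (ExactPairing.tensor : ExactPairing (U ⊗ U') (V' ⊗ V)) (P.base.mulElt a b) =
      P.base.mulElt (P.starElt p' b) (P.starElt p a) := by
  have h1 : η_ (U ⊗ U') (V' ⊗ V) = η_ U V ≫ (ρ_ U).inv ▷ V ≫ (U ◁ η_ U' V') ▷ V ≫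
      (α_ U U' V').inv ▷ V ≫ (α_ (U ⊗ U') V' V).hom := by
    change η_ U V ⊗≫ (U ◁ η_ U' V') ▷ V ⊗≫ 𝟙 _ = _
    monoidal
  have h2 : dag (η_ (U ⊗ U') (V' ⊗ V)) = (α_ (U ⊗ U') V' V).inv ≫ (α_ U U' V').hom ▷ V ≫
      (U ◁ dag (η_ U' V')) ▷ V ≫ (ρ_ U).hom ▷ V ≫ dag (η_ U V) := by
    rw [h1]
    simp only [dag_comp, IsUnitaryTensorCategory.dag_whiskerRight,
      IsUnitaryTensorCategory.dag_whiskerLeft, IsUnitaryTensorCategory.dag_associator_hom,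
      IsUnitaryTensorCategory.dag_associator_inv, IsUnitaryTensorCategory.dag_rightUnitor_inv,
      Category.assoc]
  have h3 : ∀ x : P.base.J.obj (𝟙_ C) ⟶ P.base.J.obj U,
      P.base.R (V' ⊗ V) (P.base.R U' x) = P.base.J.map (α_ (𝟙_ C) U' (V' ⊗ V)).hom ≫
        P.base.R (U' ⊗ (V' ⊗ V)) x ≫ P.base.J.map (α_ U U' (V' ⊗ V)).inv := by
    intro x
    rw [P.base.R_tensor, P.base.J_map_comp]
    simp
  have h4 : ∀ x : P.base.J.obj (𝟙_ C) ⟶ P.base.J.obj U',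
      P.base.R V (P.base.R V' x) = P.base.J.map (α_ (𝟙_ C) V' V).hom ≫
        P.base.R (V' ⊗ V) x ≫ P.base.J.map (α_ U' V' V).inv := by
    intro x
    rw [P.base.R_tensor, P.base.J_map_comp]
    simp
  -- the evaluation of `U'` and `V'` is moved past `a`
  have h5 : (α_ U' V' V).inv ≫ dag (η_ U' V') ▷ V = (λ_ (U' ⊗ (V' ⊗ V))).inv ≫
      𝟙_ C ◁ ((α_ U' V' V).inv ≫ dag (η_ U' V') ▷ V ≫ (λ_ V).hom) := by
    rw [← leftUnitor_inv_naturality]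
    simp
  have h6 : (λ_ U').inv ▷ (V' ⊗ V) ≫ (α_ (𝟙_ C) U' (V' ⊗ V)).hom = (λ_ (U' ⊗ (V' ⊗ V))).inv := by
    monoidal
  have h7 : (λ_ V').inv ▷ V ≫ (α_ (𝟙_ C) V' V).hom = (λ_ (V' ⊗ V)).inv := by monoidal
  have h8 : (α_ U U' (V' ⊗ V)).inv ≫ dag (η_ (U ⊗ U') (V' ⊗ V)) =
      U ◁ ((α_ U' V' V).inv ≫ dag (η_ U' V') ▷ V ≫ (λ_ V).hom) ≫ dag (η_ U V) := by
    rw [h2]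
    monoidal
  have h9 : ∀ x : P.base.J.obj (𝟙_ C) ⟶ P.base.J.obj U,
      P.base.J.map ((λ_ U').inv ▷ (V' ⊗ V)) ≫ P.base.R (V' ⊗ V) (P.base.R U' x) ≫
        P.base.J.map (dag (η_ (U ⊗ U') (V' ⊗ V))) =
      P.base.J.map ((α_ U' V' V).inv ≫ dag (η_ U' V') ▷ V) ≫ P.base.R V x ≫
        P.base.J.map (dag (η_ U V)) := by
    intro x
    rw [h5, h3, Category.assoc, Category.assoc, P.base.J_map_comp, h6, ← P.base.J.map_comp, h8,
      P.base.J.map_comp, ← P.base.J_map_comp, P.base.R_exchange_assoc]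
  rw [FreeBimod.mulElt, FreeBimod.mulElt, starElt, starElt, starElt, dag_comp, dag_comp, P.dag_J,
    P.dag_R, IsUnitaryTensorCategory.dag_leftUnitor_hom, P.base.R_comp, P.base.R_comp,
    P.base.R_map, Category.assoc, Category.assoc, h9, P.base.R_comp, P.base.R_comp, P.base.R_map,
    P.base.R_map, h4]
  simp only [Category.assoc, P.base.J_map_comp, h7, Iso.hom_inv_id,
    Category.comp_id]

/-- The algebra of `P` with its involution. -/
noncomputable def starAlg : StarAlgStructure P.base.algObj where
  star p a := P.base.algEv _ (P.starElt p ((P.base.algEv _).symm a))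
  star_add p a b := by
    rw [map_add, starElt, dag_add, P.base.R_add, Preadditive.add_comp, Preadditive.comp_add,
      map_add]
    rfl
  star_smul p c a := by
    rw [map_smul, starElt, dag_smul, P.base.R_smul, Linear.smul_comp, Linear.comp_smul, map_smul]
    rfl
  star_res p p' g h w a := congrArg (P.base.algEv _) (P.starElt_J_comp p p' g h w a)
  star_star p a := congrArg (P.base.algEv _) (P.starElt_starElt p a)
  star_mul p p' a b := by
    have e : ∀ {U V : C} (a : P.base.J.obj U ⟶ P.base.J.obj (𝟙_ C))
        (b : P.base.J.obj V ⟶ P.base.J.obj (𝟙_ C)),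
        algMul P.base.algObj (P.base.algEv U a) (P.base.algEv V b) =
          P.base.algEv (U ⊗ V) (P.base.mulElt a b) := fun a b =>
      (P.base.mulHom_pureT (𝟙 _) a b).trans
        (congrArg (P.base.algEv _) (by rw [P.base.J.map_id, Category.id_comp]))
    obtain ⟨a, rfl⟩ := P.base.algEv_surj a
    obtain ⟨b, rfl⟩ := P.base.algEv_surj b
    exact (congrArg (fun z => P.base.algEv _ (P.starElt ExactPairing.tensor
      ((P.base.algEv _).symm z))) (e a b)).trans
      ((congrArg (P.base.algEv _) (P.starElt_mulElt p p' a b)).trans (e _ _).symm)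
  star_one := by
    have e : algOne P.base.algObj = P.base.algEv (𝟙_ C) (𝟙 _) :=
      (P.base.oneHom_app (𝟙 (𝟙_ C))).trans (congrArg _ (P.base.J.map_id _))
    have h : P.starElt (exactPairingUnit : ExactPairing (𝟙_ C) (𝟙_ C)) (𝟙 _) = 𝟙 _ := by
      have e1 : dag (@ExactPairing.coevaluation C _ _ (𝟙_ C) (𝟙_ C) exactPairingUnit) =
          (ρ_ (𝟙_ C)).hom := IsUnitaryTensorCategory.dag_rightUnitor_inv _
      rw [starElt, e1, dag_id, P.base.R_id, Category.id_comp, ← P.base.J.map_comp,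
        ← unitors_equal, Iso.inv_hom_id, P.base.J.map_id]
    rw [e]
    exact congrArg (P.base.algEv _) h

/-- The category of free bimodules `P` is isomorphic to the free modules over its algebra. -/
noncomputable def freeIso (P : FreeBimod C) : P ≅ FreeMod.freeBimod P.centerAlg :=
  (FreeBimod.toCenter C).preimageIso (FreeMod.hatCenterIso P.centerAlg)

theorem freeIso_map (P : FreeBimod C) {U : C} (a : P.J.obj U ⟶ P.J.obj (𝟙_ C)) :
    (freeIso P).hom.map a = FreeMod.hat (A := P.algObj) (P.algEv U a) := by
  have h := (FreeBimod.toCenter C).map_preimage (FreeMod.hatCenterIso P.centerAlg).hom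
  exact congrArg (fun t : P.centerAlg ⟶ (FreeMod.freeBimod P.centerAlg).centerAlg =>
    app t.hom.f U (P.algEv U a)) h

section Transport

variable {Q : FreeBimod C} (e : P.base ≅ Q)

theorem iso_inv_hom {X Y : C} (f : P.base.J.obj X ⟶ P.base.J.obj Y) :
    e.inv.map (e.hom.map f) = f :=
  congrArg (fun t : P.base ⟶ P.base => t.map f) e.hom_inv_id

theorem iso_hom_inv {X Y : C} (f : Q.J.obj X ⟶ Q.J.obj Y) : e.hom.map (e.inv.map f) = f :=
  congrArg (fun t : Q ⟶ Q => t.map f) e.inv_hom_id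

/-- The `*`-structure transported along an isomorphism. -/
def transDag {X Y : C} (f : Q.J.obj X ⟶ Q.J.obj Y) : Q.J.obj Y ⟶ Q.J.obj X :=
  e.hom.map (dag (e.inv.map f))

theorem transDag_transDag {X Y : C} (f : Q.J.obj X ⟶ Q.J.obj Y) :
    P.transDag e (P.transDag e f) = f := by
  rw [transDag, transDag, iso_inv_hom, dag_dag, iso_hom_inv]

theorem transDag_comp {X Y Z : C} (f : Q.J.obj X ⟶ Q.J.obj Y) (g : Q.J.obj Y ⟶ Q.J.obj Z) :
    P.transDag e (f ≫ g) = P.transDag e g ≫ P.transDag e f := by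
  rw [transDag, e.inv.map_comp, dag_comp, e.hom.map_comp, transDag, transDag]

theorem transDag_add {X Y : C} (f g : Q.J.obj X ⟶ Q.J.obj Y) :
    P.transDag e (f + g) = P.transDag e f + P.transDag e g := by
  rw [transDag, e.inv.map_add, dag_add, e.hom.map_add, transDag, transDag]

theorem transDag_smul {X Y : C} (c : ℂ) (f : Q.J.obj X ⟶ Q.J.obj Y) :
    P.transDag e (c • f) = conj c • P.transDag e f := by
  rw [transDag, e.inv.map_smul, dag_smul, e.hom.map_smul, transDag]

theorem transDag_R (W : C) {X Y : C} (f : Q.J.obj X ⟶ Q.J.obj Y) :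
    P.transDag e (Q.R W f) = Q.R W (P.transDag e f) := by
  rw [transDag, e.inv.map_R, P.dag_R, e.hom.map_R, transDag]

theorem transDag_L (W : C) {X Y : C} (f : Q.J.obj X ⟶ Q.J.obj Y) :
    P.transDag e (Q.L W f) = Q.L W (P.transDag e f) := by
  rw [transDag, e.inv.map_L, P.dag_L, e.hom.map_L, transDag]

theorem transDag_J {X Y : C} (f : X ⟶ Y) :
    P.transDag e (Q.J.map f) = Q.J.map (dag f) := by
  rw [transDag, e.inv.map_J, P.dag_J, e.hom.map_J]

/-- An isomorphism sends the involution of `P` to the one defined by the transported `*`-structure.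
-/
theorem hom_starElt {U V : C} (p : ExactPairing U V)
    (a : P.base.J.obj U ⟶ P.base.J.obj (𝟙_ C)) :
    e.hom.map (P.starElt p a) = Q.J.map (λ_ V).inv ≫ Q.R V (P.transDag e (e.hom.map a)) ≫
      Q.J.map (dag (η_ U V)) := by
  rw [transDag, iso_inv_hom, starElt, e.hom.map_comp, e.hom.map_comp, e.hom.map_J, e.hom.map_J,
    e.hom.map_R]

theorem inv_injective {X Y : C} {f g : Q.J.obj X ⟶ Q.J.obj Y} (h : e.inv.map f = e.inv.map g) :
    f = g := by
  rw [← P.iso_hom_inv e f, h, iso_hom_inv]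

end Transport

/-- The `*`-structure on the free modules over the algebra of `P`. -/
@[reducible]
noncomputable def freeModDagger : DaggerCategory (FreeMod P.base.algObj) where
  dag f := P.transDag (freeIso P.base) f
  dag_dag f := P.transDag_transDag (freeIso P.base) f
  dag_comp f g := P.transDag_comp (freeIso P.base) f g
  dag_add f g := P.transDag_add (freeIso P.base) f g
  dag_smul c f := P.transDag_smul (freeIso P.base) c f

/-- The free modules over the algebra of `P` are the objects `J X` of `P`. -/
noncomputable def freeModEmbedding :
    letI := P.freeModDagger
    CornerEmbedding P.base.carrier (FreeMod P.base.algObj) :=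
  letI := P.freeModDagger
  { obj := fun X => P.base.J.obj X.gen
    map := fun {X Y} f => (freeIso P.base).inv.map (X := X.gen) (Y := Y.gen) f
    map_add := fun f g => (freeIso P.base).inv.map_add f g
    map_smul := fun c f => (freeIso P.base).inv.map_smul c f
    map_comp := fun f g => (freeIso P.base).inv.map_comp f g
    map_dag := fun f => P.iso_inv_hom (freeIso P.base) _
    map_injective := fun f g h => P.inv_injective (freeIso P.base) h
    exists_map := fun {X Y} f => ⟨(freeIso P.base).hom.map f, by
      have h1 := (freeIso P.base).inv.map_id X.gen
      have h2 := (freeIso P.base).inv.map_id Y.gen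
      refine (P.iso_inv_hom (freeIso P.base) f).trans ?_
      refine Eq.trans ?_ (congrArg₂ (fun s t => s ≫ f ≫ t) h1 h2).symm
      rw [Category.id_comp, Category.comp_id]⟩ }

/-- The Yetter-Drinfeld C*-algebra of `P`. -/
noncomputable def toYDObj : YetterDrinfeldAlgebra C where
  alg := P.base.centerAlg
  star := P.starAlg
  isCStar := by
    have h1 : @IsCorrespondingDagger C _ _ _ _ _ _ _ _ P.base.algObj _ P.starAlg
        P.freeModDagger :=
      @IsCorrespondingDagger.mk C _ _ _ _ _ _ _ _ P.base.algObj _ P.starAlg P.freeModDagger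
        (fun f Y => P.transDag_R (freeIso P.base) Y f)
        (fun g => P.transDag_J (freeIso P.base) g)
        (fun {U V} p a => by
          obtain ⟨a, rfl⟩ := P.base.algEv_surj a
          have h := P.hom_starElt (freeIso P.base) p a
          rw [freeIso_map, freeIso_map] at h
          exact h)
    have h2 : @IsCStarCategory (FreeMod P.base.algObj) _ _ _ P.freeModDagger :=
      letI := P.freeModDagger
      P.freeModEmbedding.isCStarCategory
    exact ⟨P.freeModDagger, h1, h2, fun U V W f => P.transDag_L (freeIso P.base) U f⟩

variable {P}

theorem Hom.map_starElt {Q : FreeCStarBimod C} (Φ : P ⟶ Q) {U V : C} (p : ExactPairing U V)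
    (a : P.base.J.obj U ⟶ P.base.J.obj (𝟙_ C)) :
    Φ.base.map (P.starElt p a) = Q.starElt p (Φ.base.map a) := by
  rw [starElt, Φ.base.map_comp, Φ.base.map_comp, Φ.base.map_J, Φ.base.map_J, Φ.base.map_R,
    Φ.map_dag, starElt]

variable (C) in
/-- The functor from C*-categories of free bimodules to Yetter-Drinfeld C*-algebras. -/
noncomputable def toYD : FreeCStarBimod C ⥤ YetterDrinfeldAlgebra C where
  obj := toYDObj
  map Φ := ⟨FreeBimod.Hom.centerMap Φ.base, fun p a => congrArg (FreeBimod.algEv _ _)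
    (Hom.map_starElt Φ p a)⟩
  map_id _ := YetterDrinfeldAlgebra.Hom.ext ((FreeBimod.toCenter C).map_id _)
  map_comp _ _ := YetterDrinfeldAlgebra.Hom.ext ((FreeBimod.toCenter C).map_comp _ _)

instance : (toYD C).Faithful where
  map_injective h := Hom.ext ((FreeBimod.toCenter C).map_injective
    (congrArg YetterDrinfeldAlgebra.Hom.hom h))

/-- Adjoints of algebra elements are expressed through the involution. -/
theorem dag_eq_starElt {U : C} (a : P.base.J.obj U ⟶ P.base.J.obj (𝟙_ C)) :
    ∃ (V : C) (p : ExactPairing U V), dag a = P.base.J.map (dag (ε_ U V)) ≫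
      P.base.R U (P.starElt p a) ≫ P.base.J.map (λ_ U).hom := by
  refine ⟨Uᘁ, inferInstance, ?_⟩
  exact (congrArg dag (P.starElt_starElt inferInstance a)).symm.trans
    (P.dag_starElt (IsUnitaryTensorCategory.dagPairing inferInstance) _)

instance : (toYD C).Full where
  map_surjective {P Q} Ψ := by
    obtain ⟨Φ, hΦ⟩ := (FreeBimod.toCenter C).map_surjective Ψ.hom
    have hstar : ∀ {U V : C} (p : ExactPairing U V) (a : P.base.J.obj U ⟶ P.base.J.obj (𝟙_ C)),
        Φ.map (P.starElt p a) = Q.starElt p (Φ.map a) := by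
      intro U V p a
      have h := Ψ.map_star p (P.base.algEv U a)
      rw [← hΦ] at h
      exact h
    have helt : ∀ {U : C} (a : P.base.J.obj U ⟶ P.base.J.obj (𝟙_ C)),
        Φ.map (dag a) = dag (Φ.map a) := by
      intro U a
      obtain ⟨V, p, h⟩ := dag_eq_starElt a
      have h2 : dag (Φ.map a) = Q.base.J.map (dag (ε_ U V)) ≫
          Q.base.R U (Q.starElt p (Φ.map a)) ≫ Q.base.J.map (λ_ U).hom := by
        refine (congrArg dag (Q.starElt_starElt p _)).symm.trans
          (Q.dag_starElt (IsUnitaryTensorCategory.dagPairing p) _)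
      rw [h, h2, Φ.map_comp, Φ.map_comp, Φ.map_J, Φ.map_J, Φ.map_R, hstar]
    -- adjoints of all morphisms reduce to adjoints of algebra elements
    refine ⟨⟨Φ, fun {X Y} f => ?_⟩, YetterDrinfeldAlgebra.Hom.ext hΦ⟩
    obtain ⟨U, k, a, rfl⟩ := P.base.exists_normal f
    simp only [dag_comp, P.dag_J, P.dag_R, Q.dag_J, Q.dag_R, FreeBimod.Hom.map_comp,
      FreeBimod.Hom.map_J, FreeBimod.Hom.map_R, helt]

/-- The free modules over a Yetter-Drinfeld C*-algebra, with the corresponding `*`-structure. -/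
noncomputable def ofYD (A : YetterDrinfeldAlgebra C) : FreeCStarBimod C :=
  { base := FreeMod.freeBimod A.alg
    dagger := A.isCStar.choose
    isCStar := A.isCStar.choose_spec.2.1
    dag_J := fun f =>
      let _ := A.isCStar.choose
      A.isCStar.choose_spec.1.dag_freeMap f
    dag_R := fun W _ _ f =>
      let _ := A.isCStar.choose
      A.isCStar.choose_spec.1.dag_rightWh f W
    dag_L := fun W _ _ f => A.isCStar.choose_spec.2.2 W f }

/-- The involution of the algebra of free modules is the given one. -/
theorem ofYD_hat_star (A : YetterDrinfeldAlgebra C) {U V : C} (p : ExactPairing U V)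
    (a : A.alg.X.1.ev U) :
    FreeMod.hat (A.star.star p a) = (ofYD A).starElt p (FreeMod.hat a) :=
  let _ := A.isCStar.choose
  A.isCStar.choose_spec.1.hat_star p a

/-- A Yetter-Drinfeld C*-algebra is recovered from its free modules. -/
noncomputable def toYDIso (A : YetterDrinfeldAlgebra C) : (toYD C).obj (ofYD A) ≅ A where
  hom := ⟨(FreeMod.hatCenterIso A.alg).inv, fun {U V} p a => by
    have hi : ∀ {U : C} (b : A.alg.X.1.ev U), app (FreeMod.hatCenterIso A.alg).inv.hom.f U
        (app (FreeMod.hatCenterIso A.alg).hom.hom.f U b) = b := fun {U} b =>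
      congrArg (fun t : A.alg ⟶ A.alg => app t.hom.f U b) (FreeMod.hatCenterIso A.alg).hom_inv_id
    have hs : ∀ {U : C} (b : ((toYD C).obj (ofYD A)).alg.X.1.ev U),
        app (FreeMod.hatCenterIso A.alg).hom.hom.f U
          (app (FreeMod.hatCenterIso A.alg).inv.hom.f U b) = b := fun {U} b =>
      congrArg (fun t : (FreeMod.freeBimod A.alg).centerAlg ⟶ _ => app t.hom.f U b)
        (FreeMod.hatCenterIso A.alg).inv_hom_id
    have h : app (FreeMod.hatCenterIso A.alg).hom.hom.f V (A.star.star p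
          (app (FreeMod.hatCenterIso A.alg).inv.hom.f U a)) =
        ((toYD C).obj (ofYD A)).star.star p (app (FreeMod.hatCenterIso A.alg).hom.hom.f U
          (app (FreeMod.hatCenterIso A.alg).inv.hom.f U a)) :=
      congrArg ((FreeMod.freeBimod A.alg).algEv _) (ofYD_hat_star A p _)
    rw [hs] at h
    exact (congrArg _ h).symm.trans (hi _)⟩
  inv := ⟨(FreeMod.hatCenterIso A.alg).hom, fun p a =>
    congrArg ((FreeMod.freeBimod A.alg).algEv _) (ofYD_hat_star A p a)⟩
  hom_inv_id := YetterDrinfeldAlgebra.Hom.ext (FreeMod.hatCenterIso A.alg).inv_hom_id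
  inv_hom_id := YetterDrinfeldAlgebra.Hom.ext (FreeMod.hatCenterIso A.alg).hom_inv_id

instance : (toYD C).EssSurj where
  mem_essImage A := ⟨ofYD A, ⟨toYDIso A⟩⟩

instance : (toYD C).IsEquivalence where

end FreeCStarBimod

end FreeCStar

/-! ### Free bimodules in a centrally cyclic bimodule category -/

section CyclicBimodules

open DaggerCategory BimoduleCategory
open scoped MonoidalLeftAction MonoidalRightAction

variable {C : Type u} [SmallCategory C] [Preadditive C] [Linear ℂ C] [DaggerCategory C]
  [MonoidalCategory C] [MonoidalPreadditive C] [MonoidalLinear ℂ C] [IsUnitaryTensorCategory C]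

namespace CentrallyCyclicBimodule

section Actions

variable {M : Type u} [SmallCategory M] [MonoidalLeftAction C M] [MonoidalRightAction C M]

theorem rightAssoc_naturality {X Y : M} (f : X ⟶ Y) (U V : C) :
    f ⊵ᵣ (U ⊗ V) ≫ (αᵣ Y U V).hom = (αᵣ X U V).hom ≫ (f ⊵ᵣ U) ⊵ᵣ V := by
  simp

theorem rightAssoc_naturality_middle (X : M) {U U' : C} (f : U ⟶ U') (V : C) :
    X ⊴ᵣ (f ▷ V) ≫ (αᵣ X U' V).hom = (αᵣ X U V).hom ≫ (X ⊴ᵣ f) ⊵ᵣ V := by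
  simp

theorem rightAssoc_naturality_right (X : M) (U : C) {V V' : C} (f : V ⟶ V') :
    X ⊴ᵣ (U ◁ f) ≫ (αᵣ X U V').hom = (αᵣ X U V).hom ≫ (X ⊙ᵣ U) ⊴ᵣ f := by
  simp

theorem leftAssoc_naturality (U V : C) {X Y : M} (f : X ⟶ Y) :
    (U ⊗ V) ⊴ₗ f ≫ (αₗ U V Y).hom = (αₗ U V X).hom ≫ U ⊴ₗ V ⊴ₗ f := by
  simp

end Actions

variable (S : CentrallyCyclicBimodule C)

/-- The isomorphism `m ◁ (W ⊗ X) ≅ W ▷ (m ◁ X)`. -/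
def leftIso (W X : C) : S.pt ⊙ᵣ (W ⊗ X) ≅ W ⊙ₗ (S.pt ⊙ᵣ X) where
  hom := (αᵣ S.pt W X).hom ≫ (S.central W).hom ⊵ᵣ X ≫ (mid W S.pt X).hom
  inv := (mid W S.pt X).inv ≫ (S.central W).inv ⊵ᵣ X ≫ (αᵣ S.pt W X).inv

theorem leftIso_hom (W X : C) : (S.leftIso W X).hom =
    (αᵣ S.pt W X).hom ≫ (S.central W).hom ⊵ᵣ X ≫ (mid W S.pt X).hom := rfl

theorem leftIso_unitary (W X : C) : IsUnitary (S.leftIso W X).hom := by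
  refine (IsCStarBimodule.rightAssoc_unitary _ _ _).comp (IsUnitary.comp ⟨?_, ?_⟩
    (IsCStarBimodule.mid_unitary _ _ _))
  · rw [IsCStarBimodule.dag_right (C := C), ← MonoidalRightAction.comp_actionHomLeft,
      (S.central_unitary W).1, MonoidalRightAction.id_actionHomLeft]
  · rw [IsCStarBimodule.dag_right (C := C), ← MonoidalRightAction.comp_actionHomLeft,
      (S.central_unitary W).2, MonoidalRightAction.id_actionHomLeft]

theorem leftIso_naturality_left {W W' : C} (g : W ⟶ W') (X : C) :
    S.pt ⊴ᵣ (g ▷ X) ≫ (S.leftIso W' X).hom = (S.leftIso W X).hom ≫ g ⊵ₗ (S.pt ⊙ᵣ X) := by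
  simp only [leftIso_hom, Category.assoc]
  rw [← mid_naturality_left, reassoc_of% (rightAssoc_naturality_middle (M := S.carrier)),
    ← MonoidalRightAction.comp_actionHomLeft_assoc, central_naturality,
    MonoidalRightAction.comp_actionHomLeft_assoc]

theorem leftIso_naturality_right (W : C) {X Y : C} (f : X ⟶ Y) :
    S.pt ⊴ᵣ (W ◁ f) ≫ (S.leftIso W Y).hom = (S.leftIso W X).hom ≫ W ⊴ₗ (S.pt ⊴ᵣ f) := by
  simp only [leftIso_hom, Category.assoc]
  rw [← mid_naturality_right, reassoc_of% (rightAssoc_naturality_right (M := S.carrier)),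
    MonoidalRightAction.action_exchange_assoc]

theorem leftIso_tensor (W W' X : C) :
    (S.leftIso (W ⊗ W') X).hom ≫ (αₗ W W' (S.pt ⊙ᵣ X)).hom =
      S.pt ⊴ᵣ (α_ W W' X).hom ≫ (S.leftIso W (W' ⊗ X)).hom ≫ W ⊴ₗ (S.leftIso W' X).hom := by
  have h1 := mid_tensor_right W S.pt W' X
  have h2 := MonoidalRightAction.actionHom_associator W W' X S.pt
  simp only [leftIso_hom, Category.assoc, MonoidalLeftAction.actionHomRight_comp]
  rw [← mid_tensor_left, reassoc_of% h1,
    reassoc_of% (rightAssoc_naturality (S.central W).hom W' X), reassoc_of% h2, central_tensor]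
  simp only [MonoidalRightAction.comp_actionHomLeft, Category.assoc]
  rw [MonoidalRightAction.inv_hom_actionHomLeft_assoc, reassoc_of% (@mid_naturality_middle)]

theorem leftIso_rightAssoc (W X V : C) :
    S.pt ⊴ᵣ (α_ W X V).hom ≫ (S.leftIso W (X ⊗ V)).hom ≫ W ⊴ₗ (αᵣ S.pt X V).hom =
      (αᵣ S.pt (W ⊗ X) V).hom ≫ (S.leftIso W X).hom ⊵ᵣ V ≫ (mid W (S.pt ⊙ᵣ X) V).hom := by
  have h2 := MonoidalRightAction.actionHom_associator W X V S.pt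
  simp only [leftIso_hom, Category.assoc, MonoidalRightAction.comp_actionHomLeft]
  rw [mid_tensor_right, reassoc_of% (rightAssoc_naturality (S.central W).hom X V),
    reassoc_of% h2]

theorem leftIso_unit (X : C) :
    (S.leftIso (𝟙_ C) X).hom ≫ (λₗ (S.pt ⊙ᵣ X)).hom = S.pt ⊴ᵣ (λ_ X).hom := by
  simp only [leftIso_hom, Category.assoc]
  rw [mid_unit_left, central_unit, MonoidalRightAction.comp_actionHomLeft, Category.assoc,
    MonoidalRightAction.inv_hom_actionHomLeft, Category.comp_id,
    MonoidalRightAction.actionHom_leftUnitor]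

/-- The free bimodules `m ◁ U`. -/
def freeBimod : FreeBimod C where
  carrier := S.carrier
  J :=
    { obj := fun U => S.pt ⊙ᵣ U
      map := fun f => S.pt ⊴ᵣ f }
  J_add f g := IsCStarBimodule.right_add _ f g
  J_smul c f := IsCStarBimodule.right_smul _ c f
  R W {X Y} f := (αᵣ S.pt X W).hom ≫ f ⊵ᵣ W ≫ (αᵣ S.pt Y W).inv
  R_add W _ _ f g := by
    rw [IsCStarBimodule.add_right, Preadditive.add_comp, Preadditive.comp_add]
  R_smul W _ _ c f := by
    rw [IsCStarBimodule.smul_right, Linear.smul_comp, Linear.comp_smul]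
  R_comp W _ _ _ f g := by simp
  R_map W _ _ f := by simp
  R_exchange {W W'} g {X Y} f := by
    simp only [Category.assoc]
    rw [MonoidalRightAction.whiskerRight_actionHomLeft, Iso.inv_hom_id_assoc,
      ← MonoidalRightAction.action_exchange_assoc,
      MonoidalRightAction.whiskerRight_actionHomLeft, Category.assoc, Category.assoc,
      Iso.inv_hom_id_assoc]
  R_tensor W W' {X Y} f := by
    have h1 := MonoidalRightAction.actionHom_associator X W W' S.pt
    have h2 := MonoidalRightAction.actionHom_associator Y W W' S.pt
    have h3 : (αᵣ S.pt Y (W ⊗ W')).inv ≫ S.pt ⊴ᵣ (α_ Y W W').inv ≫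
        (αᵣ S.pt (Y ⊗ W) W').hom ≫ (αᵣ S.pt Y W).hom ⊵ᵣ W' = (αᵣ (S.pt ⊙ᵣ Y) W W').hom := by
      rw [← h2, MonoidalRightAction.actionHomRight_inv_hom_assoc, Iso.inv_hom_id_assoc]
    rw [← cancel_mono ((αᵣ S.pt (Y ⊗ W) W').hom ≫ (αᵣ S.pt Y W).hom ⊵ᵣ W'),
      ← cancel_epi (S.pt ⊴ᵣ (α_ X W W').hom)]
    simp only [Category.assoc, MonoidalRightAction.actionHomRight_hom_inv_assoc,
      Iso.inv_hom_id_assoc, MonoidalRightAction.comp_actionHomLeft, h3]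
    rw [MonoidalRightAction.inv_hom_actionHomLeft, Category.comp_id, rightAssoc_naturality,
      reassoc_of% h1]
  R_unit {X Y} f := by simp
  L W {X Y} f := (S.leftIso W X).hom ≫ W ⊴ₗ f ≫ (S.leftIso W Y).inv
  L_add W _ _ f g := by
    rw [IsCStarBimodule.left_add, Preadditive.add_comp, Preadditive.comp_add]
  L_smul W _ _ c f := by
    rw [IsCStarBimodule.left_smul, Linear.smul_comp, Linear.comp_smul]
  L_comp W _ _ _ f g := by simp
  L_map W _ _ f := by
    rw [← Category.assoc, Iso.comp_inv_eq, leftIso_naturality_right]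
  L_exchange {W W'} g {X Y} f := by
    rw [← cancel_mono (S.leftIso W' Y).hom]
    simp only [Category.assoc, Iso.inv_hom_id, Category.comp_id]
    rw [leftIso_naturality_left, reassoc_of% (@leftIso_naturality_left), Iso.inv_hom_id_assoc,
      MonoidalLeftAction.action_exchange]
  L_tensor W W' {X Y} f := by
    rw [← cancel_mono ((S.leftIso W (W' ⊗ Y)).hom ≫ W ⊴ₗ (S.leftIso W' Y).hom)]
    simp only [Category.assoc, MonoidalLeftAction.actionHomRight_comp, Iso.inv_hom_id_assoc,
      MonoidalLeftAction.actionHomRight_inv_hom, Category.comp_id]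
    rw [← leftIso_tensor, Iso.inv_hom_id_assoc, leftAssoc_naturality, reassoc_of% leftIso_tensor]
  L_unit {X Y} f := by
    simp only [Category.assoc, ← leftIso_unit, Iso.inv_hom_id_assoc]
    rw [MonoidalLeftAction.actionUnitIso_hom_naturality]
  R_L W V {X Y} f := by
    rw [← cancel_mono ((S.leftIso W (Y ⊗ V)).hom ≫ W ⊴ₗ (αᵣ S.pt Y V).hom)]
    simp only [Category.assoc, MonoidalLeftAction.actionHomRight_comp, Iso.inv_hom_id_assoc,
      MonoidalLeftAction.actionHomRight_inv_hom, Category.comp_id]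
    rw [leftIso_rightAssoc, Iso.inv_hom_id_assoc, reassoc_of% leftIso_rightAssoc]
    simp only [MonoidalRightAction.comp_actionHomLeft, Category.assoc]
    rw [MonoidalRightAction.inv_hom_actionHomLeft_assoc, mid_naturality_middle]

theorem dag_conj {M : Type*} [Category M] [Preadditive M] [Linear ℂ M] [DaggerCategory M]
    {X X' Y Y' : M} {e : X ≅ X'} {e' : Y ≅ Y'} (h : IsUnitary e.hom) (h' : IsUnitary e'.hom)
    (f : X' ⟶ Y') : dag (e.hom ≫ f ≫ e'.inv) = e'.hom ≫ dag f ≫ e.inv := by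
  rw [dag_comp, dag_comp, h.dag_eq_inv, ← h'.dag_eq_inv, dag_dag, Category.assoc]

theorem dag_rightConj (W : C) {X Y : C} (f : S.pt ⊙ᵣ X ⟶ S.pt ⊙ᵣ Y) :
    dag ((αᵣ S.pt X W).hom ≫ f ⊵ᵣ W ≫ (αᵣ S.pt Y W).inv) =
      (αᵣ S.pt Y W).hom ≫ dag f ⊵ᵣ W ≫ (αᵣ S.pt X W).inv := by
  rw [dag_conj (IsCStarBimodule.rightAssoc_unitary _ _ _)
    (IsCStarBimodule.rightAssoc_unitary _ _ _), IsCStarBimodule.dag_right]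

theorem dag_leftConj (W : C) {X Y : C} (f : S.pt ⊙ᵣ X ⟶ S.pt ⊙ᵣ Y) :
    dag ((S.leftIso W X).hom ≫ W ⊴ₗ f ≫ (S.leftIso W Y).inv) =
      (S.leftIso W Y).hom ≫ W ⊴ₗ dag f ≫ (S.leftIso W X).inv := by
  rw [dag_conj (S.leftIso_unitary _ _) (S.leftIso_unitary _ _), IsCStarBimodule.left_dag]

/-- The C*-category of the free bimodules `m ◁ U`. -/
def freeCStarBimod : FreeCStarBimod C where
  base := S.freeBimod
  dagger := S.dagger
  isCStar := S.isCStar.toIsCStarCategory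
  dag_J f := IsCStarBimodule.right_dag S.pt f
  dag_R W _ _ f := S.dag_rightConj W f
  dag_L W _ _ f := S.dag_leftConj W f

namespace PointedFunctor

variable {S} {T : CentrallyCyclicBimodule C} (P : PointedFunctor S T)

/-- The unitary `m' ◁ U ≅ F(m ◁ U)`. -/
def ptIso (U : C) : T.pt ⊙ᵣ U ⟶ P.F.obj (S.pt ⊙ᵣ U) := P.u.inv ⊵ᵣ U ≫ P.r S.pt U

theorem ptIso_unitary (U : C) : IsUnitary (P.ptIso U) := by
  have h := P.u_unitary.inv
  refine IsUnitary.comp ⟨?_, ?_⟩ (P.r_unitary _ _)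
  · rw [IsCStarBimodule.dag_right (C := C), ← MonoidalRightAction.comp_actionHomLeft, h.1,
      MonoidalRightAction.id_actionHomLeft]
  · rw [IsCStarBimodule.dag_right (C := C), ← MonoidalRightAction.comp_actionHomLeft, h.2,
      MonoidalRightAction.id_actionHomLeft]

theorem ptIso_naturality {U V : C} (f : U ⟶ V) :
    T.pt ⊴ᵣ f ≫ P.ptIso V = P.ptIso U ≫ P.F.map (S.pt ⊴ᵣ f) := by
  rw [ptIso, ptIso, Category.assoc, ← r_naturality_right,
    MonoidalRightAction.action_exchange_assoc]

theorem ptIso_tensor (U V : C) : P.ptIso (U ⊗ V) ≫ P.F.map (αᵣ S.pt U V).hom =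
    (αᵣ T.pt U V).hom ≫ P.ptIso U ⊵ᵣ V ≫ P.r (S.pt ⊙ᵣ U) V := by
  rw [ptIso, ptIso, Category.assoc, r_assoc, MonoidalRightAction.comp_actionHomLeft,
    Category.assoc, reassoc_of% (rightAssoc_naturality P.u.inv U V)]

theorem ptIso_central (U : C) : P.ptIso U ≫ P.F.map (S.central U).hom =
    (T.central U).hom ≫ U ⊴ₗ P.u.inv ≫ P.l U S.pt := by
  rw [ptIso, Category.assoc, ← u_central, MonoidalRightAction.inv_hom_actionHomLeft_assoc]

theorem ptIso_leftIso (W X : C) : P.ptIso (W ⊗ X) ≫ P.F.map (S.leftIso W X).hom =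
    (T.leftIso W X).hom ≫ W ⊴ₗ P.ptIso X ≫ P.l W (S.pt ⊙ᵣ X) := by
  rw [leftIso_hom, leftIso_hom, P.F.map_comp, P.F.map_comp, reassoc_of% (P.ptIso_tensor W X),
    ← reassoc_of% (P.r_naturality_left (S.central W).hom X),
    ← MonoidalRightAction.comp_actionHomLeft_assoc, ptIso_central]
  simp only [MonoidalRightAction.comp_actionHomLeft, Category.assoc, P.l_r]
  rw [reassoc_of% (@mid_naturality_middle), ptIso, MonoidalLeftAction.actionHomRight_comp,
    Category.assoc]

/-- The action of a functor on morphisms between free bimodules. -/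
def freeMap {X Y : C} (f : S.pt ⊙ᵣ X ⟶ S.pt ⊙ᵣ Y) : T.pt ⊙ᵣ X ⟶ T.pt ⊙ᵣ Y :=
  P.ptIso X ≫ P.F.map f ≫ dag (P.ptIso Y)

theorem freeMap_ptIso {X Y : C} (f : S.pt ⊙ᵣ X ⟶ S.pt ⊙ᵣ Y) :
    P.freeMap f ≫ P.ptIso Y = P.ptIso X ≫ P.F.map f := by
  rw [freeMap, Category.assoc, Category.assoc, (P.ptIso_unitary Y).2, Category.comp_id]

theorem eq_freeMap {X Y : C} {f : S.pt ⊙ᵣ X ⟶ S.pt ⊙ᵣ Y} {g : T.pt ⊙ᵣ X ⟶ T.pt ⊙ᵣ Y}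
    (h : g ≫ P.ptIso Y = P.ptIso X ≫ P.F.map f) : P.freeMap f = g := by
  rw [freeMap, ← reassoc_of% h, (P.ptIso_unitary Y).1, Category.comp_id]

theorem freeMap_comp {X Y Z : C} (f : S.pt ⊙ᵣ X ⟶ S.pt ⊙ᵣ Y) (g : S.pt ⊙ᵣ Y ⟶ S.pt ⊙ᵣ Z) :
    P.freeMap (f ≫ g) = P.freeMap f ≫ P.freeMap g := by
  apply P.eq_freeMap
  rw [Category.assoc, freeMap_ptIso, reassoc_of% (P.freeMap_ptIso f), P.F.map_comp]

theorem freeMap_add {X Y : C} (f g : S.pt ⊙ᵣ X ⟶ S.pt ⊙ᵣ Y) :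
    P.freeMap (f + g) = P.freeMap f + P.freeMap g := by
  simp only [freeMap, P.map_add, Preadditive.add_comp, Preadditive.comp_add]

theorem freeMap_smul {X Y : C} (c : ℂ) (f : S.pt ⊙ᵣ X ⟶ S.pt ⊙ᵣ Y) :
    P.freeMap (c • f) = c • P.freeMap f := by
  simp only [freeMap, P.map_smul, Linear.smul_comp, Linear.comp_smul]

theorem freeMap_dag {X Y : C} (f : S.pt ⊙ᵣ X ⟶ S.pt ⊙ᵣ Y) :
    P.freeMap (dag f) = dag (P.freeMap f) := by
  rw [freeMap, freeMap, dag_comp, dag_comp, dag_dag, P.map_dag, Category.assoc]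

theorem freeMap_id {X Y : C} (f : S.pt ⊙ᵣ X ⟶ S.pt ⊙ᵣ Y) :
    (PointedFunctor.id S).freeMap f = f := by
  apply eq_freeMap
  simp [ptIso, PointedFunctor.id]

theorem freeMap_comp_functor {R : CentrallyCyclicBimodule C} (Q : PointedFunctor T R) {X Y : C}
    (f : S.pt ⊙ᵣ X ⟶ S.pt ⊙ᵣ Y) : (P.comp Q).freeMap f = Q.freeMap (P.freeMap f) := by
  have h : ∀ U, (P.comp Q).ptIso U = Q.ptIso U ≫ Q.F.map (P.ptIso U) := fun U => by
    simp only [PointedFunctor.ptIso, PointedFunctor.comp, Iso.trans_inv, Functor.mapIso_inv,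
      MonoidalRightAction.comp_actionHomLeft, Q.F.map_comp, Category.assoc]
    rw [reassoc_of% (@PointedFunctor.r_naturality_left)]
  have h' : Q.freeMap (P.freeMap f) ≫ Q.ptIso Y ≫ Q.F.map (P.ptIso Y) =
      (Q.ptIso X ≫ Q.F.map (P.ptIso X)) ≫ Q.F.map (P.F.map f) := by
    rw [reassoc_of% (Q.freeMap_ptIso (P.freeMap f)), Category.assoc, ← Q.F.map_comp,
      freeMap_ptIso, Q.F.map_comp]
  apply eq_freeMap
  rw [h, h]
  exact h'

/-- The action on morphisms between free bimodules commutes with the right action. -/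
theorem freeMap_R (W : C) {X Y : C} (f : S.pt ⊙ᵣ X ⟶ S.pt ⊙ᵣ Y) :
    P.freeMap ((αᵣ S.pt X W).hom ≫ f ⊵ᵣ W ≫ (αᵣ S.pt Y W).inv) =
      (αᵣ T.pt X W).hom ≫ P.freeMap f ⊵ᵣ W ≫ (αᵣ T.pt Y W).inv := by
  apply P.eq_freeMap
  rw [← cancel_mono (P.F.map (αᵣ S.pt Y W).hom)]
  simp only [Category.assoc, ← P.F.map_comp, Iso.inv_hom_id, Category.comp_id]
  rw [ptIso_tensor, Iso.inv_hom_id_assoc, ← MonoidalRightAction.comp_actionHomLeft_assoc,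
    freeMap_ptIso, P.F.map_comp, reassoc_of% (P.ptIso_tensor X W), ← r_naturality_left,
    MonoidalRightAction.comp_actionHomLeft_assoc]

/-- The action on morphisms between free bimodules commutes with the left action. -/
theorem freeMap_L (W : C) {X Y : C} (f : S.pt ⊙ᵣ X ⟶ S.pt ⊙ᵣ Y) :
    P.freeMap ((S.leftIso W X).hom ≫ W ⊴ₗ f ≫ (S.leftIso W Y).inv) =
      (T.leftIso W X).hom ≫ W ⊴ₗ P.freeMap f ≫ (T.leftIso W Y).inv := by
  apply P.eq_freeMap
  rw [← cancel_mono (P.F.map (S.leftIso W Y).hom)]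
  simp only [Category.assoc, ← P.F.map_comp, Iso.inv_hom_id, Category.comp_id]
  rw [ptIso_leftIso, Iso.inv_hom_id_assoc, ← MonoidalLeftAction.actionHomRight_comp_assoc,
    freeMap_ptIso, P.F.map_comp, reassoc_of% (P.ptIso_leftIso W X), ← l_naturality_right,
    MonoidalLeftAction.actionHomRight_comp_assoc]

/-- The functor between the categories of free bimodules. -/
def freeHom : S.freeCStarBimod ⟶ T.freeCStarBimod where
  base :=
    { map := fun f => P.freeMap f
      map_add := fun f g => P.freeMap_add f g
      map_smul := fun c f => P.freeMap_smul c f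
      map_comp := fun f g => P.freeMap_comp f g
      map_J := fun f => P.eq_freeMap (P.ptIso_naturality f)
      map_R := fun W _ _ f => P.freeMap_R W f
      map_L := fun W _ _ f => P.freeMap_L W f }
  map_dag f := P.freeMap_dag f

/-- Equivalent functors act in the same way on morphisms between free bimodules. -/
theorem Equivalent.freeMap_eq {P Q : PointedFunctor S T} (h : Equivalent P Q) {X Y : C}
    (f : S.pt ⊙ᵣ X ⟶ S.pt ⊙ᵣ Y) : P.freeMap f = Q.freeMap f := by
  obtain ⟨η, h1, h2, h3, h4⟩ := h
  have h5 : P.u.inv ≫ η.hom.app S.pt = Q.u.inv := by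
    rw [Iso.inv_comp_eq, ← h4, Category.assoc, Iso.hom_inv_id, Category.comp_id]
  have h6 : ∀ U, P.ptIso U ≫ η.hom.app (S.pt ⊙ᵣ U) = Q.ptIso U := fun U => by
    rw [ptIso, ptIso, Category.assoc, h3, ← MonoidalRightAction.comp_actionHomLeft_assoc, h5]
  refine (Q.eq_freeMap ?_).symm
  rw [← h6, ← h6, reassoc_of% (P.freeMap_ptIso f), Category.assoc, η.hom.naturality]

end PointedFunctor

variable (C) in
/-- The functor of free bimodules `m ◁ U`. -/
def toFree : CentrallyCyclicBimodule C ⥤ FreeCStarBimod C where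
  obj := freeCStarBimod
  map := Quotient.lift PointedFunctor.freeHom fun P Q h => by
    apply FreeCStarBimod.Hom.ext
    apply FreeBimod.Hom.ext
    funext X Y f
    exact h.freeMap_eq f
  map_id S := by
    apply FreeCStarBimod.Hom.ext
    apply FreeBimod.Hom.ext
    funext X Y f
    exact PointedFunctor.freeMap_id f
  map_comp {S T R} f g := by
    induction f using Quotient.inductionOn with
    | _ P =>
      induction g using Quotient.inductionOn with
      | _ Q =>
        apply FreeCStarBimod.Hom.ext
        apply FreeBimod.Hom.ext
        funext X Y f
        exact P.freeMap_comp_functor Q f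

end CentrallyCyclicBimodule

end CyclicBimodules

/-! ### Functors of cyclic bimodule categories from functors of free bimodules -/

section Frames

open DaggerCategory BimoduleCategory
open scoped MonoidalLeftAction MonoidalRightAction

variable {C : Type u} [SmallCategory C] [Preadditive C] [Linear ℂ C] [DaggerCategory C]
  [MonoidalCategory C] [MonoidalPreadditive C] [MonoidalLinear ℂ C] [IsUnitaryTensorCategory C]

namespace CentrallyCyclicBimodule

theorem dag_inv_of_unitary {M : Type*} [Category M] [Preadditive M] [Linear ℂ M]
    [DaggerCategory M] {X Y : M} {e : X ≅ Y} (h : IsUnitary e.hom) : dag e.inv = e.hom := by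
  rw [← h.dag_eq_inv, dag_dag]

section Coordinates

variable (S : CentrallyCyclicBimodule C)

/-- The coordinates `X ◁ W ⟶ m ◁ (U ⊗ W)` induced by `v : X ⟶ m ◁ U`. -/
def rightCoord {X : S.carrier} {U : C} (v : X ⟶ S.pt ⊙ᵣ U) (W : C) :
    X ⊙ᵣ W ⟶ S.pt ⊙ᵣ (U ⊗ W) := v ⊵ᵣ W ≫ (αᵣ S.pt U W).inv

/-- The coordinates `W ▷ X ⟶ m ◁ (W ⊗ U)` induced by `v : X ⟶ m ◁ U`. -/
def leftCoord (W : C) {X : S.carrier} {U : C} (v : X ⟶ S.pt ⊙ᵣ U) :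
    W ⊙ₗ X ⟶ S.pt ⊙ᵣ (W ⊗ U) := W ⊴ₗ v ≫ (S.leftIso W U).inv

/-- The coordinates `m ⟶ m ◁ 1`. -/
def ptCoord : S.pt ⟶ S.pt ⊙ᵣ (𝟙_ C) := (ρᵣ S.pt).inv

variable {S}
variable {X Y : S.carrier} {U U' : C}

theorem rightCoord_isometry {v : X ⟶ S.pt ⊙ᵣ U} (h : IsIsometry v) (W : C) :
    IsIsometry (S.rightCoord v W) := by
  rw [IsIsometry, rightCoord, dag_comp,
    dag_inv_of_unitary (IsCStarBimodule.rightAssoc_unitary S.pt U W), Category.assoc,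
    Iso.inv_hom_id_assoc, IsCStarBimodule.dag_right,
    ← MonoidalRightAction.comp_actionHomLeft, h, MonoidalRightAction.id_actionHomLeft]

theorem dag_rightCoord_comp (v : X ⟶ S.pt ⊙ᵣ U) (W : C) :
    dag (S.rightCoord v W) ≫ S.rightCoord v W =
      (αᵣ S.pt U W).hom ≫ (dag v ≫ v) ⊵ᵣ W ≫ (αᵣ S.pt U W).inv := by
  rw [rightCoord, dag_comp,
    dag_inv_of_unitary (IsCStarBimodule.rightAssoc_unitary S.pt U W), Category.assoc,
    IsCStarBimodule.dag_right,
    MonoidalRightAction.comp_actionHomLeft_assoc]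

theorem leftCoord_isometry (W : C) {v : X ⟶ S.pt ⊙ᵣ U} (h : IsIsometry v) :
    IsIsometry (S.leftCoord W v) := by
  rw [IsIsometry, leftCoord, dag_comp,
    dag_inv_of_unitary (S.leftIso_unitary W U), Category.assoc, Iso.inv_hom_id_assoc,
    IsCStarBimodule.left_dag,
    ← MonoidalLeftAction.actionHomRight_comp, h, MonoidalLeftAction.actionHomRight_id]

theorem dag_leftCoord_comp (W : C) (v : X ⟶ S.pt ⊙ᵣ U) :
    dag (S.leftCoord W v) ≫ S.leftCoord W v =
      (S.leftIso W U).hom ≫ W ⊴ₗ (dag v ≫ v) ≫ (S.leftIso W U).inv := by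
  rw [leftCoord, dag_comp,
    dag_inv_of_unitary (S.leftIso_unitary W U), Category.assoc, IsCStarBimodule.left_dag,
    MonoidalLeftAction.actionHomRight_comp_assoc]

theorem rightCoord_comp {f : X ⟶ Y} {v : X ⟶ S.pt ⊙ᵣ U} {v' : Y ⟶ S.pt ⊙ᵣ U'}
    {k : S.pt ⊙ᵣ U ⟶ S.pt ⊙ᵣ U'} (h : f ≫ v' = v ≫ k) (W : C) :
    f ⊵ᵣ W ≫ S.rightCoord v' W =
      S.rightCoord v W ≫ (αᵣ S.pt U W).hom ≫ k ⊵ᵣ W ≫ (αᵣ S.pt U' W).inv := by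
  rw [rightCoord, rightCoord, ← MonoidalRightAction.comp_actionHomLeft_assoc, h, Category.assoc,
    Iso.inv_hom_id_assoc, MonoidalRightAction.comp_actionHomLeft_assoc]

theorem leftCoord_comp {f : X ⟶ Y} {v : X ⟶ S.pt ⊙ᵣ U} {v' : Y ⟶ S.pt ⊙ᵣ U'}
    {k : S.pt ⊙ᵣ U ⟶ S.pt ⊙ᵣ U'} (h : f ≫ v' = v ≫ k) (W : C) :
    W ⊴ₗ f ≫ S.leftCoord W v' =
      S.leftCoord W v ≫ (S.leftIso W U).hom ≫ W ⊴ₗ k ≫ (S.leftIso W U').inv := by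
  rw [leftCoord, leftCoord, ← MonoidalLeftAction.actionHomRight_comp_assoc, h, Category.assoc,
    Iso.inv_hom_id_assoc, MonoidalLeftAction.actionHomRight_comp_assoc]

variable (v : X ⟶ S.pt ⊙ᵣ U)

theorem rightCoord_naturality {W W' : C} (g : W ⟶ W') :
    X ⊴ᵣ g ≫ S.rightCoord v W' = S.rightCoord v W ≫ S.pt ⊴ᵣ (U ◁ g) := by
  rw [rightCoord, rightCoord, MonoidalRightAction.action_exchange_assoc, Category.assoc,
    MonoidalRightAction.whiskerRight_actionHomLeft, Iso.inv_hom_id_assoc]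

theorem rightCoord_assoc (W W' : C) :
    (αᵣ X W W').hom ≫ S.rightCoord (S.rightCoord v W) W' =
      S.rightCoord v (W ⊗ W') ≫ S.pt ⊴ᵣ (α_ U W W').inv := by
  have h := MonoidalRightAction.actionHom_associator U W W' S.pt
  have h3 : (αᵣ S.pt U (W ⊗ W')).inv ≫ S.pt ⊴ᵣ (α_ U W W').inv ≫
      (αᵣ S.pt (U ⊗ W) W').hom ≫ (αᵣ S.pt U W).hom ⊵ᵣ W' = (αᵣ (S.pt ⊙ᵣ U) W W').hom := by
    rw [← h, MonoidalRightAction.actionHomRight_inv_hom_assoc, Iso.inv_hom_id_assoc]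
  rw [← cancel_mono ((αᵣ S.pt (U ⊗ W) W').hom ≫ (αᵣ S.pt U W).hom ⊵ᵣ W')]
  simp only [rightCoord, Category.assoc, MonoidalRightAction.comp_actionHomLeft, h3,
    Iso.inv_hom_id_assoc]
  rw [MonoidalRightAction.inv_hom_actionHomLeft, Category.comp_id, rightAssoc_naturality]

theorem rightCoord_unit : (ρᵣ[C] X).hom ≫ v = S.rightCoord v (𝟙_ C) ≫ S.pt ⊴ᵣ (ρ_ U).hom := by
  rw [rightCoord, Category.assoc, MonoidalRightAction.actionHom_rightUnitor,
    Iso.inv_hom_id_assoc, MonoidalRightAction.actionUnitIso_hom_naturality]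

theorem leftCoord_naturality {W W' : C} (g : W ⟶ W') :
    g ⊵ₗ X ≫ S.leftCoord W' v = S.leftCoord W v ≫ S.pt ⊴ᵣ (g ▷ U) := by
  rw [← cancel_mono (S.leftIso W' U).hom]
  simp only [leftCoord, Category.assoc, Iso.inv_hom_id, Category.comp_id]
  rw [leftIso_naturality_left, Iso.inv_hom_id_assoc, MonoidalLeftAction.action_exchange]

theorem leftCoord_assoc (W W' : C) :
    (αₗ W W' X).hom ≫ S.leftCoord W (S.leftCoord W' v) =
      S.leftCoord (W ⊗ W') v ≫ S.pt ⊴ᵣ (α_ W W' U).hom := by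
  rw [← cancel_mono ((S.leftIso W (W' ⊗ U)).hom ≫ W ⊴ₗ (S.leftIso W' U).hom)]
  simp only [leftCoord, Category.assoc, MonoidalLeftAction.actionHomRight_comp,
    Iso.inv_hom_id_assoc, MonoidalLeftAction.actionHomRight_inv_hom, Category.comp_id]
  rw [← leftIso_tensor, Iso.inv_hom_id_assoc, leftAssoc_naturality]

theorem leftCoord_unit : (λₗ[C] X).hom ≫ v = S.leftCoord (𝟙_ C) v ≫ S.pt ⊴ᵣ (λ_ U).hom := by
  rw [leftCoord, Category.assoc, ← leftIso_unit, Iso.inv_hom_id_assoc,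
    MonoidalLeftAction.actionUnitIso_hom_naturality]

theorem leftCoord_rightCoord (W W' : C) :
    (mid W X W').hom ≫ S.leftCoord W (S.rightCoord v W') =
      S.rightCoord (S.leftCoord W v) W' ≫ S.pt ⊴ᵣ (α_ W U W').hom := by
  rw [← cancel_mono ((S.leftIso W (U ⊗ W')).hom ≫ W ⊴ₗ (αᵣ S.pt U W').hom)]
  simp only [leftCoord, rightCoord, Category.assoc, MonoidalLeftAction.actionHomRight_comp,
    Iso.inv_hom_id_assoc, MonoidalLeftAction.actionHomRight_inv_hom, Category.comp_id,
    MonoidalRightAction.comp_actionHomLeft]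
  rw [leftIso_rightAssoc, Iso.inv_hom_id_assoc, MonoidalRightAction.inv_hom_actionHomLeft_assoc,
    mid_naturality_middle]

variable (S) in
theorem rightCoord_ptCoord (W : C) : S.rightCoord S.ptCoord W = S.pt ⊴ᵣ (λ_ W).inv := by
  rw [← cancel_mono (S.pt ⊴ᵣ (λ_ W).hom), MonoidalRightAction.actionHomRight_inv_hom,
    MonoidalRightAction.actionHom_leftUnitor, rightCoord, Category.assoc, Iso.inv_hom_id_assoc,
    ptCoord, MonoidalRightAction.inv_hom_actionHomLeft]

variable (S) in
theorem central_leftCoord (W : C) :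
    (S.central W).hom ≫ S.leftCoord W S.ptCoord = S.pt ⊴ᵣ (ρ_ W).inv := by
  have h : (S.leftIso W (𝟙_ C)).hom ≫ W ⊴ₗ (ρᵣ S.pt).hom =
      S.pt ⊴ᵣ (ρ_ W).hom ≫ (S.central W).hom := by
    rw [leftIso_hom, Category.assoc, Category.assoc, mid_unit_right,
      MonoidalRightAction.actionHom_rightUnitor, Category.assoc,
      MonoidalRightAction.actionUnitIso_hom_naturality]
  rw [← cancel_mono ((S.leftIso W (𝟙_ C)).hom ≫ W ⊴ₗ (ρᵣ S.pt).hom)]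
  simp only [leftCoord, ptCoord, Category.assoc, Iso.inv_hom_id_assoc,
    MonoidalLeftAction.actionHomRight_inv_hom, Category.comp_id]
  rw [h, MonoidalRightAction.actionHomRight_inv_hom_assoc]

variable (S) in
theorem ptCoord_unitary : IsUnitary S.ptCoord :=
  (IsCStarBimodule.rightUnit_unitary (C := C) S.pt).inv

end Coordinates

variable {S T : CentrallyCyclicBimodule C} (Φ : S.freeCStarBimod ⟶ T.freeCStarBimod)

/-- The action on morphisms of a functor of free bimodules. -/
def onFree {X Y : C} (f : S.pt ⊙ᵣ X ⟶ S.pt ⊙ᵣ Y) : T.pt ⊙ᵣ X ⟶ T.pt ⊙ᵣ Y := Φ.base.map f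

theorem onFree_comp {X Y Z : C} (f : S.pt ⊙ᵣ X ⟶ S.pt ⊙ᵣ Y) (g : S.pt ⊙ᵣ Y ⟶ S.pt ⊙ᵣ Z) :
    onFree Φ (f ≫ g) = onFree Φ f ≫ onFree Φ g := Φ.base.map_comp f g

theorem onFree_id (X : C) : onFree Φ (𝟙 (S.pt ⊙ᵣ X)) = 𝟙 (T.pt ⊙ᵣ X) := Φ.base.map_id X

theorem onFree_add {X Y : C} (f g : S.pt ⊙ᵣ X ⟶ S.pt ⊙ᵣ Y) :
    onFree Φ (f + g) = onFree Φ f + onFree Φ g := Φ.base.map_add f g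

theorem onFree_smul {X Y : C} (c : ℂ) (f : S.pt ⊙ᵣ X ⟶ S.pt ⊙ᵣ Y) :
    onFree Φ (c • f) = c • onFree Φ f := Φ.base.map_smul c f

theorem onFree_dag {X Y : C} (f : S.pt ⊙ᵣ X ⟶ S.pt ⊙ᵣ Y) :
    onFree Φ (dag f) = dag (onFree Φ f) := Φ.map_dag f

theorem onFree_pt {X Y : C} (f : X ⟶ Y) : onFree Φ (S.pt ⊴ᵣ f) = T.pt ⊴ᵣ f := Φ.base.map_J f

theorem onFree_R (W : C) {X Y : C} (f : S.pt ⊙ᵣ X ⟶ S.pt ⊙ᵣ Y) :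
    onFree Φ ((αᵣ S.pt X W).hom ≫ f ⊵ᵣ W ≫ (αᵣ S.pt Y W).inv) =
      (αᵣ T.pt X W).hom ≫ onFree Φ f ⊵ᵣ W ≫ (αᵣ T.pt Y W).inv := Φ.base.map_R W f

theorem onFree_L (W : C) {X Y : C} (f : S.pt ⊙ᵣ X ⟶ S.pt ⊙ᵣ Y) :
    onFree Φ ((S.leftIso W X).hom ≫ W ⊴ₗ f ≫ (S.leftIso W Y).inv) =
      (T.leftIso W X).hom ≫ W ⊴ₗ onFree Φ f ≫ (T.leftIso W Y).inv := Φ.base.map_L W f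

/-- Objects `X` and `Y` embedded in `m ◁ U` and `m' ◁ U` as the ranges of a projection and of its
image under `Φ`. -/
structure Frame (X : S.carrier) (Y : T.carrier) where
  /-- The ambient free bimodule. -/
  U : C
  /-- The embedding of `X`. -/
  v : X ⟶ S.pt ⊙ᵣ U
  /-- The embedding of `Y`. -/
  w : Y ⟶ T.pt ⊙ᵣ U
  v_isometry : IsIsometry v
  w_isometry : IsIsometry w
  dag_w_w : dag w ≫ w = onFree Φ (dag v ≫ v)

/-- The projection of `m ◁ U` onto `X` is sent by `Φ` to a projection of `m' ◁ U`, which splits. -/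
theorem exists_frame (X : S.carrier) : ∃ Y : T.carrier, Nonempty (Frame Φ X Y) := by
  obtain ⟨U, v, hv⟩ := S.cyclic X
  obtain ⟨Y, w, hw, hp⟩ := IsKaroubiAdditive.exists_split (onFree Φ (dag v ≫ v))
    (by rw [← onFree_comp, Category.assoc, reassoc_of% hv])
    (by rw [← onFree_dag, dag_comp, dag_dag])
  exact ⟨Y, ⟨⟨U, v, w, hv, hw, hp⟩⟩⟩

namespace Frame

variable {Φ} {X X' X'' : S.carrier} {Y Y' Y'' : T.carrier} (a : Frame Φ X Y) (b : Frame Φ X' Y')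
  (c : Frame Φ X'' Y'')

/-- The morphism corresponding to `f`. -/
def tr (f : X ⟶ X') : Y ⟶ Y' := a.w ≫ onFree Φ (dag a.v ≫ f ≫ b.v) ≫ dag b.w

theorem w_proj {Z : T.carrier} (h : T.pt ⊙ᵣ a.U ⟶ Z) :
    a.w ≫ onFree Φ (dag a.v ≫ a.v) ≫ h = a.w ≫ h := by
  have h1 : a.w ≫ dag a.w = 𝟙 Y := a.w_isometry
  rw [← a.dag_w_w, Category.assoc, reassoc_of% h1]

theorem v_dag {Z : S.carrier} (h : X ⟶ Z) : a.v ≫ dag a.v ≫ h = h := by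
  have h1 : a.v ≫ dag a.v = 𝟙 X := a.v_isometry
  rw [reassoc_of% h1]

/-- Corresponding morphisms are determined by their values in coordinates. -/
theorem eq_tr {f : X ⟶ X'} {t : Y ⟶ Y'} (k : S.pt ⊙ᵣ a.U ⟶ S.pt ⊙ᵣ b.U)
    (hv : f ≫ b.v = a.v ≫ k) (hw : t ≫ b.w = a.w ≫ onFree Φ k) : t = tr a b f := by
  have h1 : b.w ≫ dag b.w = 𝟙 Y' := b.w_isometry
  rw [tr, hv, ← Category.assoc (dag a.v), onFree_comp, Category.assoc, w_proj,
    ← Category.assoc, ← hw, Category.assoc, h1, Category.comp_id]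

theorem tr_w (f : X ⟶ X') : tr a b f ≫ b.w = a.w ≫ onFree Φ (dag a.v ≫ f ≫ b.v) := by
  rw [tr, Category.assoc, Category.assoc, b.dag_w_w, ← onFree_comp]
  simp only [Category.assoc, b.v_dag]

theorem tr_v (f : X ⟶ X') : f ≫ b.v = a.v ≫ dag a.v ≫ f ≫ b.v := (a.v_dag _).symm

theorem tr_comp (f : X ⟶ X') (g : X' ⟶ X'') : tr a b f ≫ tr b c g = tr a c (f ≫ g) := by
  refine eq_tr a c ((dag a.v ≫ f ≫ b.v) ≫ (dag b.v ≫ g ≫ c.v)) ?_ ?_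
  · simp only [Category.assoc, a.v_dag, b.v_dag]
  · rw [Category.assoc, tr_w, ← Category.assoc, tr_w, Category.assoc, onFree_comp]

theorem tr_id : tr a a (𝟙 X) = 𝟙 Y :=
  (eq_tr a a (𝟙 _) (by rw [Category.id_comp, Category.comp_id])
    (by rw [onFree_id, Category.id_comp, Category.comp_id])).symm

theorem tr_dag (f : X ⟶ X') : dag (tr a b f) = tr b a (dag f) := by
  simp only [tr, dag_comp, dag_dag, ← onFree_dag, Category.assoc]

theorem tr_add (f g : X ⟶ X') : tr a b (f + g) = tr a b f + tr a b g := by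
  simp only [tr, Preadditive.add_comp, Preadditive.comp_add, onFree_add]

theorem tr_smul (z : ℂ) (f : X ⟶ X') : tr a b (z • f) = z • tr a b f := by
  simp only [tr, Linear.smul_comp, Linear.comp_smul, onFree_smul]

theorem tr_unitary {f : X ⟶ X'} (h : IsUnitary f) : IsUnitary (tr a b f) :=
  ⟨by rw [tr_dag, tr_comp, h.1, tr_id], by rw [tr_dag, tr_comp, h.2, tr_id]⟩

/-- The frame of `X ◁ W`. -/
def right (W : C) : Frame Φ (X ⊙ᵣ W) (Y ⊙ᵣ W) where
  U := a.U ⊗ W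
  v := S.rightCoord a.v W
  w := T.rightCoord a.w W
  v_isometry := rightCoord_isometry a.v_isometry W
  w_isometry := rightCoord_isometry a.w_isometry W
  dag_w_w := by rw [dag_rightCoord_comp, dag_rightCoord_comp, a.dag_w_w, onFree_R]

/-- The frame of `W ▷ X`. -/
def left (W : C) : Frame Φ (W ⊙ₗ X) (W ⊙ₗ Y) where
  U := W ⊗ a.U
  v := S.leftCoord W a.v
  w := T.leftCoord W a.w
  v_isometry := leftCoord_isometry W a.v_isometry
  w_isometry := leftCoord_isometry W a.w_isometry
  dag_w_w := by rw [dag_leftCoord_comp, dag_leftCoord_comp, a.dag_w_w, onFree_L]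

variable (Φ) in
/-- The frame of the distinguished objects. -/
def pt : Frame Φ S.pt T.pt where
  U := 𝟙_ C
  v := S.ptCoord
  w := T.ptCoord
  v_isometry := S.ptCoord_unitary.1
  w_isometry := T.ptCoord_unitary.1
  dag_w_w := by rw [S.ptCoord_unitary.2, T.ptCoord_unitary.2, onFree_id]

variable (Φ) in
/-- The frame of the free bimodules. -/
def free (U : C) : Frame Φ (S.pt ⊙ᵣ U) (T.pt ⊙ᵣ U) where
  U := U
  v := 𝟙 _
  w := 𝟙 _
  v_isometry := (IsUnitary.id _).1
  w_isometry := (IsUnitary.id _).1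
  dag_w_w := by rw [(IsUnitary.id _).2, (IsUnitary.id _).2, onFree_id]

theorem tr_right (f : X ⟶ X') (W : C) : tr a b f ⊵ᵣ W = tr (a.right W) (b.right W) (f ⊵ᵣ W) :=
  eq_tr _ _ _ (rightCoord_comp (tr_v a b f) W)
    ((rightCoord_comp (tr_w a b f) W).trans
      (congrArg (T.rightCoord a.w W ≫ ·) (onFree_R Φ W _).symm))

theorem tr_left (W : C) (f : X ⟶ X') : W ⊴ₗ tr a b f = tr (a.left W) (b.left W) (W ⊴ₗ f) :=
  eq_tr _ _ _ (leftCoord_comp (tr_v a b f) W)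
    ((leftCoord_comp (tr_w a b f) W).trans
      (congrArg (T.leftCoord W a.w ≫ ·) (onFree_L Φ W _).symm))

/-- Corresponding morphisms given in coordinates by a morphism of `C`. -/
theorem eq_tr_pt {f : X ⟶ X'} {t : Y ⟶ Y'} (k : a.U ⟶ b.U)
    (hv : f ≫ b.v = a.v ≫ S.pt ⊴ᵣ k) (hw : t ≫ b.w = a.w ≫ T.pt ⊴ᵣ k) : t = tr a b f :=
  eq_tr a b _ hv (by rw [onFree_pt]; exact hw)

theorem right_hom {W W' : C} (g : W ⟶ W') :
    Y ⊴ᵣ g = tr (a.right W) (a.right W') (X ⊴ᵣ g) :=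
  eq_tr_pt _ _ _ (rightCoord_naturality a.v g) (rightCoord_naturality a.w g)

theorem left_hom {W W' : C} (g : W ⟶ W') :
    g ⊵ₗ Y = tr (a.left W) (a.left W') (g ⊵ₗ X) :=
  eq_tr_pt _ _ _ (leftCoord_naturality a.v g) (leftCoord_naturality a.w g)

theorem rightAssoc (W W' : C) :
    (αᵣ Y W W').hom = tr (a.right (W ⊗ W')) ((a.right W).right W') (αᵣ X W W').hom :=
  eq_tr_pt _ _ _ (rightCoord_assoc a.v W W') (rightCoord_assoc a.w W W')

theorem leftAssoc (W W' : C) :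
    (αₗ W W' Y).hom = tr (a.left (W ⊗ W')) ((a.left W').left W) (αₗ W W' X).hom :=
  eq_tr_pt _ _ _ (leftCoord_assoc a.v W W') (leftCoord_assoc a.w W W')

theorem rightUnit : (ρᵣ[C] Y).hom = tr (a.right (𝟙_ C)) a (ρᵣ[C] X).hom :=
  eq_tr_pt _ _ _ (rightCoord_unit a.v) (rightCoord_unit a.w)

theorem leftUnit : (λₗ[C] Y).hom = tr (a.left (𝟙_ C)) a (λₗ[C] X).hom :=
  eq_tr_pt _ _ _ (leftCoord_unit a.v) (leftCoord_unit a.w)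

theorem middle (W W' : C) :
    (mid W Y W').hom = tr ((a.left W).right W') ((a.right W').left W) (mid W X W').hom :=
  eq_tr_pt _ _ _ (leftCoord_rightCoord a.v W W') (leftCoord_rightCoord a.w W W')

theorem central_aux (S : CentrallyCyclicBimodule C) (W : C) :
    (S.central W).hom ≫ S.leftCoord W S.ptCoord =
      S.rightCoord S.ptCoord W ≫ S.pt ⊴ᵣ ((λ_ W).hom ≫ (ρ_ W).inv) := by
  rw [central_leftCoord, rightCoord_ptCoord, ← MonoidalRightAction.actionHomRight_comp,
    Iso.inv_hom_id_assoc]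

variable (Φ) in
theorem central (W : C) :
    (T.central W).hom = tr ((pt Φ).right W) ((pt Φ).left W) (S.central W).hom :=
  eq_tr_pt _ _ _ (central_aux S W) (central_aux T W)

variable (Φ) in
theorem tr_free {U V : C} (f : S.pt ⊙ᵣ U ⟶ S.pt ⊙ᵣ V) : onFree Φ f = tr (free Φ U) (free Φ V) f :=
  eq_tr _ _ f ((Category.comp_id _).trans (Category.id_comp _).symm)
    ((Category.comp_id _).trans (Category.id_comp _).symm)

theorem free_aux (S : CentrallyCyclicBimodule C) (U : C) :
    𝟙 (S.pt ⊙ᵣ U) ≫ 𝟙 (S.pt ⊙ᵣ U) = S.rightCoord S.ptCoord U ≫ S.pt ⊴ᵣ (λ_ U).hom := by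
  rw [rightCoord_ptCoord, MonoidalRightAction.actionHomRight_inv_hom, Category.comp_id]

variable (Φ) in
theorem pt_right_free (U : C) : 𝟙 _ = tr ((pt Φ).right U) (free Φ U) (𝟙 (S.pt ⊙ᵣ U)) :=
  eq_tr_pt _ _ (λ_ U).hom (free_aux S U) (free_aux T U)

end Frame

section Extension

/-- The object corresponding to `X`. -/
noncomputable def extObj (X : S.carrier) : T.carrier := (exists_frame Φ X).choose

/-- The chosen frame. -/
noncomputable def extFrame (X : S.carrier) : Frame Φ X (extObj Φ X) :=
  (exists_frame Φ X).choose_spec.some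

/-- The functor of cyclic bimodule categories extending a functor of free bimodules. -/
noncomputable def extension : PointedFunctor S T where
  F :=
    { obj := extObj Φ
      map := fun {X Y} f => (extFrame Φ X).tr (extFrame Φ Y) f
      map_id := fun X => (extFrame Φ X).tr_id
      map_comp := fun {X Y Z} f g =>
        ((extFrame Φ X).tr_comp (extFrame Φ Y) (extFrame Φ Z) f g).symm }
  map_add f g := Frame.tr_add _ _ f g
  map_smul c f := Frame.tr_smul _ _ c f
  map_dag f := (Frame.tr_dag _ _ f).symm
  l U X := ((extFrame Φ X).left U).tr (extFrame Φ (U ⊙ₗ X)) (𝟙 _)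
  l_unitary U X := Frame.tr_unitary _ _ (IsUnitary.id _)
  l_naturality_left f X := by
    dsimp only
    rw [(extFrame Φ X).left_hom, Frame.tr_comp, Frame.tr_comp, Category.comp_id, Category.id_comp]
  l_naturality_right U X Y f := by
    dsimp only
    rw [Frame.tr_left, Frame.tr_comp, Frame.tr_comp, Category.comp_id, Category.id_comp]
  l_assoc U V X := by
    dsimp only
    rw [(extFrame Φ X).leftAssoc, Frame.tr_left, Frame.tr_comp, Frame.tr_comp, Frame.tr_comp,
      MonoidalLeftAction.actionHomRight_id, Category.comp_id, Category.comp_id, Category.id_comp]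
  l_unit X := by
    dsimp only
    rw [(extFrame Φ X).leftUnit, Frame.tr_comp, Category.id_comp]
  r X U := ((extFrame Φ X).right U).tr (extFrame Φ (X ⊙ᵣ U)) (𝟙 _)
  r_unitary X U := Frame.tr_unitary _ _ (IsUnitary.id _)
  r_naturality_left f U := by
    dsimp only
    rw [Frame.tr_right, Frame.tr_comp, Frame.tr_comp, Category.comp_id, Category.id_comp]
  r_naturality_right X U V f := by
    dsimp only
    rw [(extFrame Φ X).right_hom, Frame.tr_comp, Frame.tr_comp, Category.comp_id, Category.id_comp]
  r_assoc X U V := by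
    dsimp only
    rw [(extFrame Φ X).rightAssoc, Frame.tr_right, Frame.tr_comp, Frame.tr_comp, Frame.tr_comp,
      MonoidalRightAction.id_actionHomLeft, Category.comp_id, Category.comp_id, Category.id_comp]
  r_unit X := by
    dsimp only
    rw [(extFrame Φ X).rightUnit, Frame.tr_comp, Category.id_comp]
  l_r U X V := by
    dsimp only
    rw [(extFrame Φ X).middle, Frame.tr_left, Frame.tr_right, Frame.tr_comp, Frame.tr_comp,
      Frame.tr_comp, Frame.tr_comp, MonoidalLeftAction.actionHomRight_id,
      MonoidalRightAction.id_actionHomLeft, Category.comp_id, Category.comp_id, Category.id_comp,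
      Category.id_comp]
  u :=
    { hom := (extFrame Φ S.pt).tr (Frame.pt Φ) (𝟙 _)
      inv := (Frame.pt Φ).tr (extFrame Φ S.pt) (𝟙 _)
      hom_inv_id := by rw [Frame.tr_comp, Category.comp_id, Frame.tr_id]
      inv_hom_id := by rw [Frame.tr_comp, Category.comp_id, Frame.tr_id] }
  u_unitary := Frame.tr_unitary _ _ (IsUnitary.id _)
  u_central U := by
    dsimp only
    rw [Frame.central, Frame.tr_left, Frame.tr_right, Frame.tr_comp, Frame.tr_comp,
      Frame.tr_comp, Frame.tr_comp, MonoidalLeftAction.actionHomRight_id,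
      MonoidalRightAction.id_actionHomLeft, Category.comp_id, Category.comp_id, Category.id_comp]

/-- The extension restricts to the given functor of free bimodules. -/
theorem freeMap_extension {X Y : C} (f : S.pt ⊙ᵣ X ⟶ S.pt ⊙ᵣ Y) :
    (extension Φ).freeMap f = onFree Φ f := by
  have h : ∀ U, (extension Φ).ptIso U =
      ((Frame.free Φ U).tr (extFrame Φ (S.pt ⊙ᵣ U)) (𝟙 _)) := fun U => by
    change ((Frame.pt Φ).tr (extFrame Φ S.pt) (𝟙 _)) ⊵ᵣ U ≫
      ((extFrame Φ S.pt).right U).tr (extFrame Φ (S.pt ⊙ᵣ U)) (𝟙 _) = _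
    rw [Frame.tr_right, Frame.tr_comp, MonoidalRightAction.id_actionHomLeft, Category.comp_id]
    have h1 := Frame.tr_comp ((Frame.pt Φ).right U) (Frame.free Φ U)
      (extFrame Φ (S.pt ⊙ᵣ U)) (𝟙 _) (𝟙 _)
    rw [← Frame.pt_right_free, Category.id_comp, Category.id_comp] at h1
    exact h1.symm
  refine PointedFunctor.eq_freeMap _ ?_
  rw [h, h]
  change _ ≫ _ = _ ≫ (extFrame Φ _).tr (extFrame Φ _) f
  rw [Frame.tr_free, Frame.tr_comp, Frame.tr_comp, Category.comp_id, Category.id_comp]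

end Extension

namespace PointedFunctor

variable (P : PointedFunctor S T)

theorem freeMap_dag_v {X : S.carrier} {U U' : C} (v : X ⟶ S.pt ⊙ᵣ U)
    (k : S.pt ⊙ᵣ U ⟶ S.pt ⊙ᵣ U') :
    (P.F.map v ≫ dag (P.ptIso U)) ≫ P.freeMap k = P.F.map (v ≫ k) ≫ dag (P.ptIso U') := by
  rw [freeMap, Category.assoc, reassoc_of% (P.ptIso_unitary U).2, P.F.map_comp, Category.assoc]

theorem rightCoord_map {X : S.carrier} {U : C} (v : X ⟶ S.pt ⊙ᵣ U) (W : C) :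
    P.r X W ≫ P.F.map (S.rightCoord v W) ≫ dag (P.ptIso (U ⊗ W)) =
      T.rightCoord (P.F.map v ≫ dag (P.ptIso U)) W := by
  have h : dag (P.ptIso U) ⊵ᵣ W ≫ (αᵣ T.pt U W).inv =
      P.r (S.pt ⊙ᵣ U) W ≫ P.F.map (αᵣ S.pt U W).inv ≫ dag (P.ptIso (U ⊗ W)) := by
    have h1 : (αᵣ T.pt U W).inv ≫ P.ptIso (U ⊗ W) ≫ P.F.map (αᵣ S.pt U W).hom =
        P.ptIso U ⊵ᵣ W ≫ P.r (S.pt ⊙ᵣ U) W := by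
      rw [ptIso_tensor, Iso.inv_hom_id_assoc]
    have h2 : P.r (S.pt ⊙ᵣ U) W = dag (P.ptIso U) ⊵ᵣ W ≫ (αᵣ T.pt U W).inv ≫
        P.ptIso (U ⊗ W) ≫ P.F.map (αᵣ S.pt U W).hom := by
      rw [h1, ← MonoidalRightAction.comp_actionHomLeft_assoc, (P.ptIso_unitary U).2,
        MonoidalRightAction.id_actionHomLeft, Category.id_comp]
    rw [h2]
    simp only [Category.assoc]
    rw [← P.F.map_comp_assoc, Iso.hom_inv_id, P.F.map_id, Category.id_comp,
      (P.ptIso_unitary _).1, Category.comp_id]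
  rw [rightCoord, rightCoord, MonoidalRightAction.comp_actionHomLeft, Category.assoc, h,
    reassoc_of% (P.r_naturality_left v W), P.F.map_comp, Category.assoc]

theorem leftCoord_map (W : C) {X : S.carrier} {U : C} (v : X ⟶ S.pt ⊙ᵣ U) :
    P.l W X ≫ P.F.map (S.leftCoord W v) ≫ dag (P.ptIso (W ⊗ U)) =
      T.leftCoord W (P.F.map v ≫ dag (P.ptIso U)) := by
  have h : W ⊴ₗ dag (P.ptIso U) ≫ (T.leftIso W U).inv =
      P.l W (S.pt ⊙ᵣ U) ≫ P.F.map (S.leftIso W U).inv ≫ dag (P.ptIso (W ⊗ U)) := by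
    have h1 : (T.leftIso W U).inv ≫ P.ptIso (W ⊗ U) ≫ P.F.map (S.leftIso W U).hom =
        W ⊴ₗ P.ptIso U ≫ P.l W (S.pt ⊙ᵣ U) := by
      rw [ptIso_leftIso, Iso.inv_hom_id_assoc]
    have h2 : P.l W (S.pt ⊙ᵣ U) = W ⊴ₗ dag (P.ptIso U) ≫ (T.leftIso W U).inv ≫
        P.ptIso (W ⊗ U) ≫ P.F.map (S.leftIso W U).hom := by
      rw [h1, ← MonoidalLeftAction.actionHomRight_comp_assoc, (P.ptIso_unitary U).2,
        MonoidalLeftAction.actionHomRight_id, Category.id_comp]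
    rw [h2]
    simp only [Category.assoc]
    rw [← P.F.map_comp_assoc, Iso.hom_inv_id, P.F.map_id, Category.id_comp,
      (P.ptIso_unitary _).1, Category.comp_id]
  rw [leftCoord, leftCoord, MonoidalLeftAction.actionHomRight_comp, Category.assoc, h,
    reassoc_of% (P.l_naturality_right W v), P.F.map_comp, Category.assoc]

theorem ptCoord_map :
    P.u.inv ≫ P.F.map S.ptCoord ≫ dag (P.ptIso (𝟙_ C)) = T.ptCoord := by
  have h : T.ptCoord ≫ P.ptIso (𝟙_ C) = P.u.inv ≫ P.F.map S.ptCoord := by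
    rw [ptIso, ptCoord, ptCoord, MonoidalRightAction.actionUnitIso_inv_naturality_assoc]
    congr 1
    rw [Iso.inv_comp_eq, ← P.r_unit, Category.assoc, ← P.F.map_comp, Iso.hom_inv_id, P.F.map_id,
      Category.comp_id]
  rw [← reassoc_of% h, (P.ptIso_unitary _).1, Category.comp_id]

variable {Φ} {P} (hP : P.freeHom = Φ)

/-- The frames given by a functor of bimodule categories. -/
noncomputable def frame (X : S.carrier) : Frame Φ X (P.F.obj X) where
  U := (S.cyclic X).choose
  v := (S.cyclic X).choose_spec.choose
  w := P.F.map (S.cyclic X).choose_spec.choose ≫ dag (P.ptIso _)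
  v_isometry := (S.cyclic X).choose_spec.choose_spec
  w_isometry := by
    have h : _ ≫ dag _ = 𝟙 X := (S.cyclic X).choose_spec.choose_spec
    rw [IsIsometry, dag_comp, dag_dag, Category.assoc, reassoc_of% (P.ptIso_unitary _).2,
      ← P.map_dag, ← P.F.map_comp, h, P.F.map_id]
  dag_w_w := by
    subst hP
    change _ = P.freeMap _
    rw [dag_comp, dag_dag, Category.assoc, freeMap, P.F.map_comp, P.map_dag, Category.assoc]

/-- A morphism `s : Z ⟶ F(X)` that is compatible with the coordinates identifies `F(f)` with the
morphism corresponding to `f`. The structure morphisms of a functor of bimodule categories are of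
this kind. -/
theorem comp_map_eq_tr {X Y : S.carrier} {Z : T.carrier} (a : Frame Φ X Z) (s : Z ⟶ P.F.obj X)
    (h : s ≫ P.F.map a.v ≫ dag (P.ptIso a.U) = a.w) (f : X ⟶ Y) :
    s ≫ P.F.map f = a.tr (frame hP Y) f := by
  refine Frame.eq_tr _ _ (dag a.v ≫ f ≫ (frame hP Y).v) (Frame.tr_v _ _ _) ?_
  subst hP
  change _ = _ ≫ P.freeMap _
  rw [← h, Category.assoc, Category.assoc]
  refine congrArg (s ≫ ·) (Eq.trans ?_ (P.freeMap_dag_v _ _).symm)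
  rw [Frame.v_dag, P.F.map_comp, Category.assoc]
  rfl

theorem map_eq_tr {X Y : S.carrier} (f : X ⟶ Y) :
    P.F.map f = (frame hP X).tr (frame hP Y) f :=
  (Category.id_comp _).symm.trans
    (comp_map_eq_tr hP (frame hP X) (𝟙 _) (Category.id_comp _) f)

theorem r_eq_tr (X : S.carrier) (W : C) :
    P.r X W = ((frame hP X).right W).tr (frame hP (X ⊙ᵣ W)) (𝟙 _) := by
  rw [← comp_map_eq_tr hP ((frame hP X).right W) (P.r X W) (P.rightCoord_map _ W), P.F.map_id,
    Category.comp_id]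

theorem l_eq_tr (W : C) (X : S.carrier) :
    P.l W X = ((frame hP X).left W).tr (frame hP (W ⊙ₗ X)) (𝟙 _) := by
  rw [← comp_map_eq_tr hP ((frame hP X).left W) (P.l W X) (P.leftCoord_map W _), P.F.map_id,
    Category.comp_id]

theorem u_inv_eq_tr : P.u.inv = (Frame.pt Φ).tr (frame hP S.pt) (𝟙 _) := by
  rw [← comp_map_eq_tr hP (Frame.pt Φ) P.u.inv P.ptCoord_map, P.F.map_id, Category.comp_id]

/-- Functors of cyclic bimodule categories are determined by their restrictions to free
bimodules. -/
theorem equivalent_of_freeHom_eq (hP : P.freeHom = Φ) {Q : PointedFunctor S T}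
    (hQ : Q.freeHom = Φ) : Equivalent P Q := by
  refine ⟨NatIso.ofComponents (fun X =>
    { hom := (frame hP X).tr (frame hQ X) (𝟙 X)
      inv := (frame hQ X).tr (frame hP X) (𝟙 X)
      hom_inv_id := by rw [Frame.tr_comp, Category.comp_id, Frame.tr_id]
      inv_hom_id := by rw [Frame.tr_comp, Category.comp_id, Frame.tr_id] })
    (fun {X Y} f => ?_), fun X => ?_, fun U X => ?_, fun X U => ?_, ?_⟩
  · dsimp only
    rw [map_eq_tr hP, map_eq_tr hQ, Frame.tr_comp, Frame.tr_comp, Category.comp_id,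
      Category.id_comp]
  · exact Frame.tr_unitary _ _ (IsUnitary.id _)
  · dsimp only [NatIso.ofComponents_hom_app]
    rw [l_eq_tr hP, l_eq_tr hQ, Frame.tr_left, Frame.tr_comp, Frame.tr_comp,
      MonoidalLeftAction.actionHomRight_id]
  · dsimp only [NatIso.ofComponents_hom_app]
    rw [r_eq_tr hP, r_eq_tr hQ, Frame.tr_right, Frame.tr_comp, Frame.tr_comp,
      MonoidalRightAction.id_actionHomLeft]
  · dsimp only [NatIso.ofComponents_hom_app]
    rw [← cancel_epi P.u.inv, Iso.inv_hom_id, u_inv_eq_tr hP, ← Category.assoc, Frame.tr_comp,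
      Category.comp_id, ← u_inv_eq_tr hQ, Iso.inv_hom_id]

end PointedFunctor

instance : (toFree C).Faithful where
  map_injective {S T f g} h := by
    induction f using Quotient.inductionOn with
    | _ P =>
      induction g using Quotient.inductionOn with
      | _ Q =>
        exact Quotient.sound (PointedFunctor.equivalent_of_freeHom_eq (Φ := Q.freeHom) h rfl)

instance : (toFree C).Full where
  map_surjective {S T} Φ := ⟨Quotient.mk _ (extension (S := S) (T := T) Φ), by
    apply FreeCStarBimod.Hom.ext
    apply FreeBimod.Hom.ext
    funext X Y f
    exact freeMap_extension (S := S) (T := T) Φ f⟩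

end CentrallyCyclicBimodule

end Frames

/-! ### The Karoubi completion of a C*-category of free bimodules -/

section Karoubi

open DaggerCategory BimoduleCategory

variable {C : Type u} [SmallCategory C] [Preadditive C] [Linear ℂ C] [DaggerCategory C]
  [MonoidalCategory C] [MonoidalPreadditive C] [MonoidalLinear ℂ C] [IsUnitaryTensorCategory C]

/-- A subobject of a free bimodule `J X`, the range of a projection `p`. -/
structure SubFree (P : FreeCStarBimod C) where
  /-- The object generating the free bimodule. -/
  X : C
  /-- The projection. -/
  p : P.base.J.obj X ⟶ P.base.J.obj X
  p_comp_p : p ≫ p = p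
  dag_p : dag p = p

variable {P : FreeCStarBimod C}

/-- The morphisms between the ranges of two projections. -/
def subHom (A B : SubFree P) : Submodule ℂ (P.base.J.obj A.X ⟶ P.base.J.obj B.X) where
  carrier := {f | A.p ≫ f = f ∧ f ≫ B.p = f}
  add_mem' {f g} hf hg := by
    simp only [Set.mem_ofPred_eq] at hf hg ⊢
    rw [Preadditive.comp_add, Preadditive.add_comp, hf.1, hf.2, hg.1, hg.2]
    exact ⟨rfl, rfl⟩
  zero_mem' := by simp
  smul_mem' c f hf := by
    simp only [Set.mem_ofPred_eq] at hf ⊢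
    rw [Linear.comp_smul, Linear.smul_comp, hf.1, hf.2]
    exact ⟨rfl, rfl⟩

theorem mem_subHom {A B : SubFree P} {f : P.base.J.obj A.X ⟶ P.base.J.obj B.X} :
    f ∈ subHom A B ↔ A.p ≫ f = f ∧ f ≫ B.p = f := Iff.rfl

namespace SubFree

instance : SmallCategory (SubFree P) where
  Hom A B := subHom A B
  id A := ⟨A.p, A.p_comp_p, A.p_comp_p⟩
  comp f g := ⟨f.1 ≫ g.1, by
    have hf := mem_subHom.mp f.2
    have hg := mem_subHom.mp g.2
    rw [mem_subHom, ← Category.assoc, hf.1, Category.assoc, hg.2]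
    exact ⟨rfl, rfl⟩⟩
  id_comp f := Subtype.ext (mem_subHom.mp f.2).1
  comp_id f := Subtype.ext (mem_subHom.mp f.2).2
  assoc f g h := Subtype.ext (Category.assoc ..)

/-- The underlying morphism of free bimodules. -/
def val {A B : SubFree P} (f : A ⟶ B) : P.base.J.obj A.X ⟶ P.base.J.obj B.X := f.1

@[simp] theorem p_val {A B : SubFree P} (f : A ⟶ B) : A.p ≫ val f = val f := (mem_subHom.mp f.2).1

@[simp] theorem val_p {A B : SubFree P} (f : A ⟶ B) : val f ≫ B.p = val f := (mem_subHom.mp f.2).2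

theorem p_val_assoc {A B : SubFree P} (f : A ⟶ B) {Z : P.base.carrier} (h : P.base.J.obj B.X ⟶ Z) :
    A.p ≫ val f ≫ h = val f ≫ h := by rw [← Category.assoc, p_val]

theorem val_p_assoc {A B : SubFree P} (f : A ⟶ B) {Z : P.base.carrier} (h : P.base.J.obj B.X ⟶ Z) :
    val f ≫ B.p ≫ h = val f ≫ h := by rw [← Category.assoc, val_p]

/-- A morphism from its underlying morphism of free bimodules. -/
def mk' {A B : SubFree P} (f : P.base.J.obj A.X ⟶ P.base.J.obj B.X) (h : A.p ≫ f = f)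
    (h' : f ≫ B.p = f) : A ⟶ B := ⟨f, h, h'⟩

@[simp] theorem val_mk' {A B : SubFree P} (f : P.base.J.obj A.X ⟶ P.base.J.obj B.X)
    (h : A.p ≫ f = f) (h' : f ≫ B.p = f) : val (mk' f h h') = f := rfl

theorem hom_ext {A B : SubFree P} {f g : A ⟶ B} (h : val f = val g) : f = g := Subtype.ext h

@[simp] theorem val_id (A : SubFree P) : val (𝟙 A) = A.p := rfl

@[simp] theorem val_comp {A B D : SubFree P} (f : A ⟶ B) (g : B ⟶ D) :
    val (f ≫ g) = val f ≫ val g := rfl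

instance : Preadditive (SubFree P) where
  homGroup A B := inferInstanceAs (AddCommGroup (subHom A B))
  add_comp _ _ _ _ _ _ := hom_ext (Preadditive.add_comp ..)
  comp_add _ _ _ _ _ _ := hom_ext (Preadditive.comp_add ..)

instance : Linear ℂ (SubFree P) where
  homModule A B := inferInstanceAs (Module ℂ (subHom A B))
  smul_comp _ _ _ _ _ _ := hom_ext (Linear.smul_comp ..)
  comp_smul _ _ _ _ _ _ := hom_ext (Linear.comp_smul ..)

@[simp] theorem val_add {A B : SubFree P} (f g : A ⟶ B) : val (f + g) = val f + val g := rfl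

@[simp] theorem val_smul {A B : SubFree P} (c : ℂ) (f : A ⟶ B) : val (c • f) = c • val f := rfl

instance : DaggerCategory (SubFree P) where
  dag {A B} f := mk' (dag (val f))
    (by have h := congrArg dag (val_p f); rwa [dag_comp, B.dag_p] at h)
    (by have h := congrArg dag (p_val f); rwa [dag_comp, A.dag_p] at h)
  dag_dag f := hom_ext (dag_dag (val f))
  dag_comp f g := hom_ext (dag_comp (val f) (val g))
  dag_add f g := hom_ext (dag_add (val f) (val g))
  dag_smul c f := hom_ext (dag_smul c (val f))

@[simp] theorem val_dag {A B : SubFree P} (f : A ⟶ B) : val (dag f) = dag (val f) := rfl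

/-- The subobjects of free bimodules as corners in the category of free bimodules. -/
def embedding : CornerEmbedding P.base.carrier (SubFree P) where
  obj A := P.base.J.obj A.X
  map f := val f
  map_add _ _ := rfl
  map_smul _ _ := rfl
  map_comp _ _ := rfl
  map_dag _ := rfl
  map_injective _ _ h := hom_ext h
  exists_map {A B} f := ⟨mk' (A.p ≫ f ≫ B.p)
    (by rw [← Category.assoc, A.p_comp_p])
    (by rw [Category.assoc, Category.assoc, B.p_comp_p]), rfl⟩

instance : IsCStarCategory (SubFree P) := embedding.isCStarCategory

instance : IsKaroubiAdditive (SubFree P) where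
  exists_zero := ⟨⟨𝟙_ C, 0, by simp, dag_zero⟩, rfl⟩
  exists_sum A B := by
    obtain ⟨S, i, j, hi, hj, hij, -⟩ := IsKaroubiAdditive.exists_sum A.X B.X
    have e1 : P.base.J.map i ≫ P.base.J.map (dag i) = 𝟙 _ := by
      rw [← P.base.J.map_comp, hi, P.base.J.map_id]
    have e2 : P.base.J.map j ≫ P.base.J.map (dag j) = 𝟙 _ := by
      rw [← P.base.J.map_comp, hj, P.base.J.map_id]
    have e3 : P.base.J.map i ≫ P.base.J.map (dag j) = 0 := by
      have h := P.base.J_smul (0 : ℂ) (0 : A.X ⟶ B.X)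
      rw [zero_smul, zero_smul] at h
      rw [← P.base.J.map_comp, hij, h]
    have e4 : P.base.J.map j ≫ P.base.J.map (dag i) = 0 := by
      have h := congrArg dag e3
      rwa [dag_comp, P.dag_J, P.dag_J, dag_dag, dag_zero] at h
    -- the projection `p ⊕ q` on the direct sum
    let q : P.base.J.obj S ⟶ P.base.J.obj S :=
      P.base.J.map (dag i) ≫ A.p ≫ P.base.J.map i + P.base.J.map (dag j) ≫ B.p ≫ P.base.J.map j
    have hiq : P.base.J.map i ≫ q = A.p ≫ P.base.J.map i := by
      simp only [q, Preadditive.comp_add]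
      rw [reassoc_of% e1, reassoc_of% e3, Limits.zero_comp, add_zero]
    have hjq : P.base.J.map j ≫ q = B.p ≫ P.base.J.map j := by
      simp only [q, Preadditive.comp_add]
      rw [reassoc_of% e2, reassoc_of% e4, Limits.zero_comp, zero_add]
    let T : SubFree P := ⟨S, q, by
      conv_lhs => simp only [q, Preadditive.add_comp, Category.assoc]
      change P.base.J.map (dag i) ≫ A.p ≫ P.base.J.map i ≫ q +
        P.base.J.map (dag j) ≫ B.p ≫ P.base.J.map j ≫ q = q
      rw [hiq, hjq, ← Category.assoc A.p, ← Category.assoc B.p, A.p_comp_p, B.p_comp_p], by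
      simp only [q, dag_add, dag_comp, P.dag_J, dag_dag, A.dag_p, B.dag_p, Category.assoc]⟩
    refine ⟨T, mk' (A.p ≫ P.base.J.map i) (by rw [← Category.assoc, A.p_comp_p])
      (by
        change (A.p ≫ P.base.J.map i) ≫ q = _
        rw [Category.assoc, hiq, ← Category.assoc, A.p_comp_p]),
      mk' (B.p ≫ P.base.J.map j) (by rw [← Category.assoc, B.p_comp_p])
      (by
        change (B.p ≫ P.base.J.map j) ≫ q = _
        rw [Category.assoc, hjq, ← Category.assoc, B.p_comp_p]), hom_ext ?_, hom_ext ?_,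
      hom_ext ?_, hom_ext ?_⟩
    · simp only [val_comp, val_dag, val_mk', dag_comp, P.dag_J, A.dag_p, Category.assoc, val_id]
      rw [reassoc_of% e1, A.p_comp_p]
    · simp only [val_comp, val_dag, val_mk', dag_comp, P.dag_J, B.dag_p, Category.assoc, val_id]
      rw [reassoc_of% e2, B.p_comp_p]
    · simp only [val_comp, val_dag, val_mk', dag_comp, P.dag_J, B.dag_p, Category.assoc]
      rw [reassoc_of% e3, Limits.zero_comp, Limits.comp_zero]
      rfl
    · simp only [val_comp, val_dag, val_mk', val_add, dag_comp, P.dag_J, A.dag_p, B.dag_p,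
        Category.assoc, val_id]
      rw [← Category.assoc A.p, ← Category.assoc B.p, A.p_comp_p, B.p_comp_p]
  exists_split {A} e he hd := by
    have h1 : val e ≫ val e = val e := congrArg val he
    have h2 : dag (val e) = val e := congrArg val hd
    let B : SubFree P := ⟨A.X, val e, h1, h2⟩
    refine ⟨B, mk' (A := B) (B := A) (val (A := A) (B := A) e) h1 (val_p e), hom_ext ?_, hom_ext ?_⟩
    · exact (congrArg (val (A := A) e ≫ ·) h2).trans h1
    · exact (congrArg (· ≫ val (A := A) e) h2).trans h1

/-- The morphism given by a morphism `g` of `C` intertwining the projections. -/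
def ofC {A B : SubFree P} (g : A.X ⟶ B.X) (h : A.p ≫ P.base.J.map g = P.base.J.map g ≫ B.p) :
    A ⟶ B :=
  mk' (A.p ≫ P.base.J.map g) (by rw [← Category.assoc, A.p_comp_p])
    (by rw [Category.assoc, ← h, ← Category.assoc, A.p_comp_p])

theorem val_ofC {A B : SubFree P} (g : A.X ⟶ B.X)
    (h : A.p ≫ P.base.J.map g = P.base.J.map g ≫ B.p) : val (ofC g h) = A.p ≫ P.base.J.map g := rfl

theorem ofC_congr {A B : SubFree P} {g g' : A.X ⟶ B.X}
    {h : A.p ≫ P.base.J.map g = P.base.J.map g ≫ B.p}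
    {h' : A.p ≫ P.base.J.map g' = P.base.J.map g' ≫ B.p} (e : g = g') : ofC g h = ofC g' h' := by
  subst e
  rfl

theorem intertwines_comp {A B D : SubFree P} {g : A.X ⟶ B.X} {g' : B.X ⟶ D.X}
    (h : A.p ≫ P.base.J.map g = P.base.J.map g ≫ B.p)
    (h' : B.p ≫ P.base.J.map g' = P.base.J.map g' ≫ D.p) :
    A.p ≫ P.base.J.map (g ≫ g') = P.base.J.map (g ≫ g') ≫ D.p := by
  rw [P.base.J.map_comp, ← Category.assoc, h, Category.assoc, h', Category.assoc]

theorem ofC_comp {A B D : SubFree P} (g : A.X ⟶ B.X) (g' : B.X ⟶ D.X)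
    (h : A.p ≫ P.base.J.map g = P.base.J.map g ≫ B.p)
    (h' : B.p ≫ P.base.J.map g' = P.base.J.map g' ≫ D.p) :
    ofC g h ≫ ofC g' h' = ofC (g ≫ g') (intertwines_comp h h') := by
  apply hom_ext
  rw [val_comp, val_ofC, val_ofC, val_ofC, P.base.J.map_comp, Category.assoc, ← reassoc_of% h,
    ← Category.assoc, A.p_comp_p]

theorem ofC_id {A : SubFree P} (g : A.X ⟶ A.X)
    (h : A.p ≫ P.base.J.map g = P.base.J.map g ≫ A.p) (e : g = 𝟙 _) : ofC g h = 𝟙 A := by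
  subst e
  apply hom_ext
  rw [val_ofC, P.base.J.map_id, Category.comp_id, val_id]

theorem intertwines_dag {A B : SubFree P} {g : A.X ⟶ B.X}
    (h : A.p ≫ P.base.J.map g = P.base.J.map g ≫ B.p) :
    B.p ≫ P.base.J.map (dag g) = P.base.J.map (dag g) ≫ A.p := by
  have h' := congrArg dag h
  rw [dag_comp, dag_comp, P.dag_J, A.dag_p, B.dag_p] at h'
  exact h'.symm

theorem dag_ofC {A B : SubFree P} (g : A.X ⟶ B.X)
    (h : A.p ≫ P.base.J.map g = P.base.J.map g ≫ B.p) :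
    dag (ofC g h) = ofC (dag g) (intertwines_dag h) := by
  apply hom_ext
  rw [val_dag, val_ofC, val_ofC, dag_comp, P.dag_J, A.dag_p, intertwines_dag h]

theorem intertwines_inv {A B : SubFree P} {g : A.X ≅ B.X}
    (h : A.p ≫ P.base.J.map g.hom = P.base.J.map g.hom ≫ B.p) :
    B.p ≫ P.base.J.map g.inv = P.base.J.map g.inv ≫ A.p := by
  rw [← cancel_epi (P.base.J.map g.hom), ← reassoc_of% h, ← P.base.J.map_comp, Iso.hom_inv_id,
    P.base.J.map_id, Category.comp_id, P.base.J_map_comp, Iso.hom_inv_id, P.base.J.map_id,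
    Category.id_comp]

/-- The isomorphism given by an isomorphism of `C` intertwining the projections. -/
@[simps]
def ofIso {A B : SubFree P} (g : A.X ≅ B.X)
    (h : A.p ≫ P.base.J.map g.hom = P.base.J.map g.hom ≫ B.p) : A ≅ B where
  hom := ofC g.hom h
  inv := ofC g.inv (intertwines_inv h)
  hom_inv_id := by rw [ofC_comp, ofC_id _ _ g.hom_inv_id]
  inv_hom_id := by rw [ofC_comp, ofC_id _ _ g.inv_hom_id]

theorem ofC_unitary {A B : SubFree P} {g : A.X ⟶ B.X}
    (h : A.p ≫ P.base.J.map g = P.base.J.map g ≫ B.p) (hg : IsUnitary g) :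
    IsUnitary (ofC g h) :=
  ⟨by rw [dag_ofC, ofC_comp, ofC_id _ _ hg.1], by rw [dag_ofC, ofC_comp, ofC_id _ _ hg.2]⟩

theorem ofC_naturality {A B A' B' : SubFree P} {f : A ⟶ B} {f' : A' ⟶ B'} {g : A.X ⟶ A'.X}
    {g' : B.X ⟶ B'.X} (h : A.p ≫ P.base.J.map g = P.base.J.map g ≫ A'.p)
    (h' : B.p ≫ P.base.J.map g' = P.base.J.map g' ≫ B'.p)
    (w : val f ≫ P.base.J.map g' = P.base.J.map g ≫ val f') : f ≫ ofC g' h' = ofC g h ≫ f' := by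
  apply hom_ext
  rw [val_comp, val_comp, val_ofC, val_ofC, val_p_assoc, Category.assoc, ← w, p_val_assoc]

/-! ### The two actions on the Karoubi completion -/

/-- The object `U ⊗ A`. -/
abbrev lobj (U : C) (A : SubFree P) : SubFree P where
  X := U ⊗ A.X
  p := P.base.L U A.p
  p_comp_p := by rw [← P.base.L_comp, A.p_comp_p]
  dag_p := by rw [P.dag_L, A.dag_p]

/-- The object `A ⊗ U`. -/
abbrev robj (A : SubFree P) (U : C) : SubFree P where
  X := A.X ⊗ U
  p := P.base.R U A.p
  p_comp_p := by rw [← P.base.R_comp, A.p_comp_p]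
  dag_p := by rw [P.dag_R, A.dag_p]

/-- The morphism `U ⊗ f`. -/
def lmap (U : C) {A B : SubFree P} (f : A ⟶ B) : lobj U A ⟶ lobj U B :=
  mk' (P.base.L U (val f))
    ((P.base.L_comp U A.p (val f)).symm.trans (congrArg (P.base.L U) (p_val f)))
    ((P.base.L_comp U (val f) B.p).symm.trans (congrArg (P.base.L U) (val_p f)))

/-- The morphism `f ⊗ U`. -/
def rmap {A B : SubFree P} (f : A ⟶ B) (U : C) : robj A U ⟶ robj B U :=
  mk' (P.base.R U (val f))
    ((P.base.R_comp U A.p (val f)).symm.trans (congrArg (P.base.R U) (p_val f)))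
    ((P.base.R_comp U (val f) B.p).symm.trans (congrArg (P.base.R U) (val_p f)))

theorem val_lmap (U : C) {A B : SubFree P} (f : A ⟶ B) : val (lmap U f) = P.base.L U (val f) := rfl

theorem val_rmap {A B : SubFree P} (f : A ⟶ B) (U : C) : val (rmap f U) = P.base.R U (val f) := rfl

theorem lmap_id (U : C) (A : SubFree P) : lmap U (𝟙 A) = 𝟙 (lobj U A) := rfl

theorem rmap_id (A : SubFree P) (U : C) : rmap (𝟙 A) U = 𝟙 (robj A U) := rfl

theorem lmap_comp (U : C) {A B D : SubFree P} (f : A ⟶ B) (g : B ⟶ D) :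
    lmap U (f ≫ g) = lmap U f ≫ lmap U g := hom_ext (P.base.L_comp U _ _)

theorem rmap_comp {A B D : SubFree P} (f : A ⟶ B) (g : B ⟶ D) (U : C) :
    rmap (f ≫ g) U = rmap f U ≫ rmap g U := hom_ext (P.base.R_comp U _ _)

theorem intertwines_whiskerLeft (U : C) {A B : SubFree P} {g : A.X ⟶ B.X}
    (h : A.p ≫ P.base.J.map g = P.base.J.map g ≫ B.p) :
    P.base.L U A.p ≫ P.base.J.map (U ◁ g) = P.base.J.map (U ◁ g) ≫ P.base.L U B.p := by
  rw [← P.base.L_map, ← P.base.L_comp, h, P.base.L_comp]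

theorem intertwines_whiskerRight (U : C) {A B : SubFree P} {g : A.X ⟶ B.X}
    (h : A.p ≫ P.base.J.map g = P.base.J.map g ≫ B.p) :
    P.base.R U A.p ≫ P.base.J.map (g ▷ U) = P.base.J.map (g ▷ U) ≫ P.base.R U B.p := by
  rw [← P.base.R_map, ← P.base.R_comp, h, P.base.R_comp]

theorem lmap_ofC (U : C) {A B : SubFree P} (g : A.X ⟶ B.X)
    (h : A.p ≫ P.base.J.map g = P.base.J.map g ≫ B.p) :
    lmap U (ofC g h) = ofC (U ◁ g) (intertwines_whiskerLeft U h) :=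
  hom_ext ((P.base.L_comp U A.p (P.base.J.map g)).trans
    (congrArg (P.base.L U A.p ≫ ·) (P.base.L_map U g)))

theorem rmap_ofC {A B : SubFree P} (g : A.X ⟶ B.X)
    (h : A.p ≫ P.base.J.map g = P.base.J.map g ≫ B.p) (U : C) :
    rmap (ofC g h) U = ofC (g ▷ U) (intertwines_whiskerRight U h) :=
  hom_ext ((P.base.R_comp U A.p (P.base.J.map g)).trans
    (congrArg (P.base.R U A.p ≫ ·) (P.base.R_map U g)))

/-- The morphism `g ⊗ A`. -/
def lhom {U V : C} (g : U ⟶ V) (A : SubFree P) : lobj U A ⟶ lobj V A :=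
  ofC (g ▷ A.X) (P.base.L_exchange g A.p)

/-- The morphism `A ⊗ g`. -/
def rhom (A : SubFree P) {U V : C} (g : U ⟶ V) : robj A U ⟶ robj A V :=
  ofC (A.X ◁ g) (P.base.R_exchange g A.p)

theorem lmap_lhom {U V : C} (g : U ⟶ V) {A B : SubFree P} (f : A ⟶ B) :
    lmap U f ≫ lhom g B = lhom g A ≫ lmap V f :=
  ofC_naturality (P.base.L_exchange g _) (P.base.L_exchange g _) (P.base.L_exchange g (val f))

theorem rmap_rhom {U V : C} (g : U ⟶ V) {A B : SubFree P} (f : A ⟶ B) :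
    rmap f U ≫ rhom B g = rhom A g ≫ rmap f V :=
  ofC_naturality (P.base.R_exchange g _) (P.base.R_exchange g _) (P.base.R_exchange g (val f))

/-- The associativity isomorphism of the left action. -/
def lassoc (U V : C) (A : SubFree P) : lobj (U ⊗ V) A ≅ lobj U (lobj V A) :=
  ofIso (α_ U V A.X) (P.base.L_tensor U V A.p)

/-- The unit isomorphism of the left action. -/
def lunit (A : SubFree P) : lobj (𝟙_ C) A ≅ A := ofIso (λ_ A.X) (P.base.L_unit A.p)

/-- The associativity isomorphism of the right action. -/
def rassoc (A : SubFree P) (U V : C) : robj A (U ⊗ V) ≅ robj (robj A U) V :=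
  ofIso (α_ A.X U V).symm (P.base.R_tensor U V A.p)

/-- The unit isomorphism of the right action. -/
def runit (A : SubFree P) : robj A (𝟙_ C) ≅ A := ofIso (ρ_ A.X) (P.base.R_unit A.p)

/-- The middle associativity isomorphism. -/
def middle (U : C) (A : SubFree P) (V : C) : robj (lobj U A) V ≅ lobj U (robj A V) :=
  ofIso (α_ U A.X V) (P.base.R_L U V A.p)

theorem lassoc_naturality (U V : C) {A B : SubFree P} (f : A ⟶ B) :
    lmap (U ⊗ V) f ≫ (lassoc U V B).hom = (lassoc U V A).hom ≫ lmap U (lmap V f) :=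
  ofC_naturality (P.base.L_tensor U V _) (P.base.L_tensor U V _)
    (P.base.L_tensor U V (val f))

theorem lunit_naturality {A B : SubFree P} (f : A ⟶ B) :
    lmap (𝟙_ C) f ≫ (lunit B).hom = (lunit A).hom ≫ f :=
  ofC_naturality (P.base.L_unit _) (P.base.L_unit _) (P.base.L_unit (val f))

theorem rassoc_naturality {A B : SubFree P} (f : A ⟶ B) (U V : C) :
    rmap f (U ⊗ V) ≫ (rassoc B U V).hom = (rassoc A U V).hom ≫ rmap (rmap f U) V :=
  ofC_naturality (P.base.R_tensor U V _) (P.base.R_tensor U V _)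
    (P.base.R_tensor U V (val f))

theorem runit_naturality {A B : SubFree P} (f : A ⟶ B) :
    rmap f (𝟙_ C) ≫ (runit B).hom = (runit A).hom ≫ f :=
  ofC_naturality (P.base.R_unit _) (P.base.R_unit _) (P.base.R_unit (val f))

theorem middle_naturality (U : C) {A B : SubFree P} (f : A ⟶ B) (V : C) :
    rmap (lmap U f) V ≫ (middle U B V).hom = (middle U A V).hom ≫ lmap U (rmap f V) :=
  ofC_naturality (P.base.R_L U V _) (P.base.R_L U V _)
    (P.base.R_L U V (val f))

instance : MonoidalLeftAction C (SubFree P) where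
  actionObj := lobj
  actionHomLeft := lhom
  actionHomRight U _ _ f := lmap U f
  actionAssocIso := lassoc
  actionUnitIso := lunit
  actionHom_def _ _ := rfl
  actionHomRight_id U A := lmap_id U A
  id_actionHomLeft U A := ofC_id _ _ (id_whiskerRight _ _)
  actionHom_comp {U V W A B D} f f' g g' := by
    have h : lhom (f ≫ f') A = lhom f A ≫ lhom f' A := by
      rw [lhom, lhom, lhom, ofC_comp]
      exact ofC_congr (comp_whiskerRight _ _ _)
    rw [h, lmap_comp, Category.assoc, Category.assoc, reassoc_of% (lmap_lhom f' g)]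
  actionAssocIso_hom_naturality {U U' V V' A B} f g h := by
    have e : lhom (f ⊗ₘ g) A ≫ (lassoc U' V' A).hom =
        (lassoc U V A).hom ≫ lhom f (lobj V A) ≫ lmap U' (lhom g A) := by
      simp only [lhom, lassoc, ofIso_hom, ofC_comp, lmap_ofC]
      exact ofC_congr (by simp [MonoidalCategory.tensorHom_def])
    rw [Category.assoc, lassoc_naturality, reassoc_of% e, lmap_comp]
  actionUnitIso_hom_naturality f := (lunit_naturality f).symm
  whiskerLeft_actionHomLeft U V W f A := by
    simp only [lhom, lassoc, ofIso_hom, ofIso_inv, ofC_comp, lmap_ofC]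
    exact ofC_congr (by simp)
  whiskerRight_actionHomLeft W f A := by
    simp only [lhom, lassoc, ofIso_hom, ofIso_inv, ofC_comp]
    exact ofC_congr (by simp)
  associator_actionHom U V W A := by
    simp only [lhom, lassoc, ofIso_hom, ofC_comp, lmap_ofC]
    exact ofC_congr (by simp)
  leftUnitor_actionHom U A := by
    simp only [lhom, lassoc, lunit, ofIso_hom, ofC_comp]
    exact ofC_congr (by simp)
  rightUnitor_actionHom U A := by
    simp only [lhom, lassoc, lunit, ofIso_hom, ofC_comp, lmap_ofC]
    exact ofC_congr (by simp)

instance : MonoidalRightAction C (SubFree P) where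
  actionObj := robj
  actionHomRight A _ _ g := rhom A g
  actionHomLeft f U := rmap f U
  actionAssocIso := rassoc
  actionUnitIso := runit
  actionHom_def _ _ := rfl
  actionHomRight_id U A := ofC_id _ _ (MonoidalCategory.whiskerLeft_id _ _)
  id_actionHomLeft U A := rmap_id A U
  actionHom_comp {U V W A B D} g g' f f' := by
    have h : rhom D (f ≫ f') = rhom D f ≫ rhom D f' := by
      rw [rhom, rhom, rhom, ofC_comp]
      exact ofC_congr (MonoidalCategory.whiskerLeft_comp _ _ _)
    rw [h, rmap_comp, Category.assoc, Category.assoc, ← reassoc_of% (rmap_rhom f g')]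
  actionAssocIso_hom_naturality {A B U U' V V'} f g h := by
    have e : rhom B (g ⊗ₘ h) ≫ (rassoc B U' V').hom =
        (rassoc B U V).hom ≫ rmap (rhom B g) V ≫ rhom (robj B U') h := by
      simp only [rhom, rassoc, ofIso_hom, ofC_comp, rmap_ofC]
      exact ofC_congr (by simp [MonoidalCategory.tensorHom_def])
    rw [Category.assoc, e, reassoc_of% (rassoc_naturality f U V), rmap_comp, Category.assoc]
  actionUnitIso_hom_naturality f := (runit_naturality f).symm
  actionHomRight_whiskerRight f U A := by
    simp only [rhom, rassoc, ofIso_hom, ofIso_inv, ofC_comp, rmap_ofC]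
    exact ofC_congr (by simp)
  whiskerRight_actionHomLeft U V W f A := by
    simp only [rhom, rassoc, ofIso_hom, ofIso_inv, ofC_comp]
    exact ofC_congr (by simp)
  actionHom_associator U V W A := by
    simp only [rhom, rassoc, ofIso_hom, ofC_comp, rmap_ofC]
    exact ofC_congr (by simp)
  actionHom_leftUnitor U A := by
    simp only [rhom, rassoc, runit, ofIso_hom, ofC_comp, rmap_ofC]
    exact ofC_congr (by simp)
  actionHom_rightUnitor U A := by
    simp only [rhom, rassoc, runit, ofIso_hom, ofC_comp]
    exact ofC_congr (by simp)

end SubFree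

end Karoubi

/-! ### The cyclic bimodule category of a C*-category of free bimodules -/

section KaroubiBimodule

open DaggerCategory BimoduleCategory
open scoped MonoidalLeftAction MonoidalRightAction

variable {C : Type u} [SmallCategory C] [Preadditive C] [Linear ℂ C] [DaggerCategory C]
  [MonoidalCategory C] [MonoidalPreadditive C] [MonoidalLinear ℂ C] [IsUnitaryTensorCategory C]

variable {P : FreeCStarBimod C}

namespace SubFree

instance : BimoduleCategory C (SubFree P) where
  mid := middle
  mid_naturality_left f A V := by
    change rmap (lhom f A) V ≫ (middle _ A V).hom = (middle _ A V).hom ≫ lhom f (robj A V)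
    simp only [lhom, middle, ofIso_hom, rmap_ofC, ofC_comp]
    exact ofC_congr (by simp)
  mid_naturality_middle U _ _ f V := middle_naturality U f V
  mid_naturality_right U A V V' f := by
    change rhom (lobj U A) f ≫ (middle U A V').hom = (middle U A V).hom ≫ lmap U (rhom A f)
    simp only [rhom, middle, ofIso_hom, lmap_ofC, ofC_comp]
    exact ofC_congr (by simp)
  mid_tensor_left U U' A V := by
    change rmap (lassoc U U' A).hom V ≫ (middle U (lobj U' A) V).hom ≫
      lmap U (middle U' A V).hom = (middle (U ⊗ U') A V).hom ≫ (lassoc U U' (robj A V)).hom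
    simp only [lassoc, middle, ofIso_hom, lmap_ofC, rmap_ofC, ofC_comp]
    exact ofC_congr (by simp)
  mid_tensor_right U A V V' := by
    change (middle U A (V ⊗ V')).hom ≫ lmap U (rassoc A V V').hom =
      (rassoc (lobj U A) V V').hom ≫ rmap (middle U A V).hom V' ≫ (middle U (robj A V) V').hom
    simp only [rassoc, middle, ofIso_hom, lmap_ofC, rmap_ofC, ofC_comp]
    exact ofC_congr (by simp)
  mid_unit_left A V := by
    change (middle (𝟙_ C) A V).hom ≫ (lunit (robj A V)).hom = rmap (lunit A).hom V
    simp only [lunit, middle, ofIso_hom, rmap_ofC, ofC_comp]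
    exact ofC_congr (by simp)
  mid_unit_right U A := by
    change (middle U A (𝟙_ C)).hom ≫ lmap U (runit A).hom = (runit (lobj U A)).hom
    simp only [runit, middle, ofIso_hom, lmap_ofC, ofC_comp]
    exact ofC_congr (by simp)

theorem lhom_add {U V : C} (f g : U ⟶ V) (A : SubFree P) :
    lhom (f + g) A = lhom f A + lhom g A := by
  apply hom_ext
  rw [val_add]
  simp only [lhom, val_ofC]
  rw [MonoidalPreadditive.add_whiskerRight, P.base.J_add, Preadditive.comp_add]

theorem lhom_smul {U V : C} (c : ℂ) (f : U ⟶ V) (A : SubFree P) :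
    lhom (c • f) A = c • lhom f A := by
  apply hom_ext
  rw [val_smul]
  simp only [lhom, val_ofC]
  rw [MonoidalLinear.smul_whiskerRight, P.base.J_smul, Linear.comp_smul]

theorem rhom_add (A : SubFree P) {U V : C} (f g : U ⟶ V) :
    rhom A (f + g) = rhom A f + rhom A g := by
  apply hom_ext
  rw [val_add]
  simp only [rhom, val_ofC]
  rw [MonoidalPreadditive.whiskerLeft_add, P.base.J_add, Preadditive.comp_add]

theorem rhom_smul (A : SubFree P) {U V : C} (c : ℂ) (f : U ⟶ V) :
    rhom A (c • f) = c • rhom A f := by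
  apply hom_ext
  rw [val_smul]
  simp only [rhom, val_ofC]
  rw [MonoidalLinear.whiskerLeft_smul, P.base.J_smul, Linear.comp_smul]

theorem dag_lhom {U V : C} (f : U ⟶ V) (A : SubFree P) : dag (lhom f A) = lhom (dag f) A := by
  rw [lhom, dag_ofC, lhom]
  exact ofC_congr (IsUnitaryTensorCategory.dag_whiskerRight f A.X)

theorem dag_rhom (A : SubFree P) {U V : C} (f : U ⟶ V) : dag (rhom A f) = rhom A (dag f) := by
  rw [rhom, dag_ofC, rhom]
  exact ofC_congr (IsUnitaryTensorCategory.dag_whiskerLeft A.X f)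

instance : IsCStarBimodule C (SubFree P) where
  add_left := lhom_add
  smul_left := lhom_smul
  left_add U _ _ f g := hom_ext (P.base.L_add U (val f) (val g))
  left_smul U _ _ c f := hom_ext (P.base.L_smul U c (val f))
  right_add := rhom_add
  right_smul := rhom_smul
  add_right f g U := hom_ext (P.base.R_add U (val f) (val g))
  smul_right c f U := hom_ext (P.base.R_smul U c (val f))
  dag_left f A := dag_lhom f A
  left_dag U _ _ f := hom_ext (P.dag_L U (val f))
  right_dag A _ _ f := dag_rhom A f
  dag_right f U := hom_ext (P.dag_R U (val f))
  leftAssoc_unitary U V A := ofC_unitary (P.base.L_tensor U V A.p)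
    (IsUnitaryTensorCategory.associator_unitary U V A.X)
  leftUnit_unitary A := ofC_unitary (P.base.L_unit A.p)
    (IsUnitaryTensorCategory.leftUnitor_unitary A.X)
  rightAssoc_unitary A U V := ofC_unitary (P.base.R_tensor U V A.p)
    (IsUnitaryTensorCategory.associator_unitary A.X U V).inv
  rightUnit_unitary A := ofC_unitary (P.base.R_unit A.p)
    (IsUnitaryTensorCategory.rightUnitor_unitary A.X)
  mid_unitary U A V := ofC_unitary (P.base.R_L U V A.p)
    (IsUnitaryTensorCategory.associator_unitary U A.X V)

variable (P) in
/-- The distinguished object `J 1`. -/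
abbrev one : SubFree P where
  X := 𝟙_ C
  p := 𝟙 _
  p_comp_p := Category.comp_id _
  dag_p := dag_id _

theorem robj_one_p (U : C) : (robj (one P) U).p = 𝟙 _ := P.base.R_id U _

theorem lobj_robj_one_p (W X : C) : (lobj W (robj (one P) X)).p = 𝟙 _ :=
  (congrArg (P.base.L W) (robj_one_p X)).trans (P.base.L_id W _)

variable (P) in
theorem intertwines_one {U : C} {Y : C} (g : 𝟙_ C ⊗ U ⟶ Y ⊗ 𝟙_ C) :
    P.base.R U (𝟙 (P.base.J.obj (𝟙_ C))) ≫ P.base.J.map g =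
      P.base.J.map g ≫ P.base.L Y (𝟙 (P.base.J.obj (𝟙_ C))) := by
  rw [P.base.R_id, P.base.L_id, Category.id_comp, Category.comp_id]

variable (P) in
/-- The isomorphism `J 1 ⊗ U ≅ U ⊗ J 1`. -/
def braid (U : C) : robj (one P) U ≅ lobj U (one P) :=
  ofIso (λ_ U ≪≫ (ρ_ U).symm) (intertwines_one P _)

variable (P) in
/-- The cyclic bimodule category of a C*-category of free bimodules. -/
def cyclicBimodule : CentrallyCyclicBimodule C where
  carrier := SubFree P
  pt := one P
  cyclic A := by
    have h : P.base.J.map (λ_ A.X).inv ≫ P.base.J.map (λ_ A.X).hom = 𝟙 _ := by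
      rw [← P.base.J.map_comp, Iso.inv_hom_id, P.base.J.map_id]
    refine ⟨A.X, mk' (B := robj (one P) A.X) (A.p ≫ P.base.J.map (λ_ A.X).inv)
      (by rw [← Category.assoc, A.p_comp_p]) (by rw [robj_one_p, Category.comp_id]),
      hom_ext ?_⟩
    change (A.p ≫ P.base.J.map (λ_ A.X).inv) ≫ dag (A.p ≫ P.base.J.map (λ_ A.X).inv) = A.p
    rw [dag_comp, P.dag_J, A.dag_p, IsUnitaryTensorCategory.dag_leftUnitor_inv, Category.assoc,
      reassoc_of% h, A.p_comp_p]
  central := braid P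
  central_unitary U := ofC_unitary (intertwines_one P _)
    ((IsUnitaryTensorCategory.leftUnitor_unitary U).comp
    (IsUnitaryTensorCategory.rightUnitor_unitary U).inv)
  central_naturality {U V} f := by
    change rhom (one P) f ≫ (braid P V).hom = (braid P U).hom ≫ lhom f (one P)
    simp only [rhom, lhom, braid, ofIso_hom, ofC_comp]
    exact ofC_congr (by simp)
  central_tensor U V := by
    change (braid P (U ⊗ V)).hom = (rassoc (one P) U V).hom ≫ rmap (braid P U).hom V ≫
      (middle U (one P) V).hom ≫ lmap U (braid P V).hom ≫ (lassoc U V (one P)).inv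
    simp only [braid, rassoc, middle, lassoc, ofIso_hom, ofIso_inv, rmap_ofC, lmap_ofC, ofC_comp]
    exact ofC_congr (by simp)
  central_unit := by
    change (braid P (𝟙_ C)).hom = (runit (one P)).hom ≫ (lunit (one P)).inv
    simp only [braid, runit, lunit, ofIso_hom, ofIso_inv, ofC_comp]
    exact ofC_congr (by simp [unitors_equal, unitors_inv_equal])

/-- The morphism of free bimodules `J X ⟶ J Y` given by `J 1 ⊗ X ⟶ J 1 ⊗ Y`. -/
def unpoint {X Y : C} (f : robj (one P) X ⟶ robj (one P) Y) : P.base.J.obj X ⟶ P.base.J.obj Y :=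
  P.base.J.map (λ_ X).inv ≫ val f ≫ P.base.J.map (λ_ Y).hom

/-- The morphism `J 1 ⊗ X ⟶ J 1 ⊗ Y` given by a morphism of free bimodules `J X ⟶ J Y`. -/
def point {X Y : C} (g : P.base.J.obj X ⟶ P.base.J.obj Y) : robj (one P) X ⟶ robj (one P) Y :=
  mk' (P.base.J.map (λ_ X).hom ≫ g ≫ P.base.J.map (λ_ Y).inv)
    (by rw [robj_one_p, Category.id_comp]) (by rw [robj_one_p, Category.comp_id])

theorem unpoint_point {X Y : C} (g : P.base.J.obj X ⟶ P.base.J.obj Y) : unpoint (point g) = g := by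
  rw [unpoint, point, val_mk']
  simp only [Category.assoc, P.base.J_map_comp, ← P.base.J.map_comp, Iso.inv_hom_id,
    P.base.J.map_id, Category.id_comp, Category.comp_id]

theorem point_unpoint {X Y : C} (f : robj (one P) X ⟶ robj (one P) Y) : point (unpoint f) = f := by
  apply hom_ext
  rw [unpoint, point, val_mk']
  simp only [Category.assoc, P.base.J_map_comp, ← P.base.J.map_comp, Iso.hom_inv_id,
    P.base.J.map_id, Category.id_comp, Category.comp_id]

theorem unpoint_add {X Y : C} (f g : robj (one P) X ⟶ robj (one P) Y) :
    unpoint (f + g) = unpoint f + unpoint g := by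
  simp only [unpoint, val_add, Preadditive.add_comp, Preadditive.comp_add]

theorem unpoint_smul {X Y : C} (c : ℂ) (f : robj (one P) X ⟶ robj (one P) Y) :
    unpoint (c • f) = c • unpoint f := by
  simp only [unpoint, val_smul, Linear.smul_comp, Linear.comp_smul]

theorem unpoint_comp {X Y Z : C} (f : robj (one P) X ⟶ robj (one P) Y)
    (g : robj (one P) Y ⟶ robj (one P) Z) : unpoint (f ≫ g) = unpoint f ≫ unpoint g := by
  simp only [unpoint, val_comp, Category.assoc, P.base.J_map_comp, Iso.hom_inv_id,
    P.base.J.map_id, Category.id_comp]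

theorem unpoint_rhom {X Y : C} (g : X ⟶ Y) : unpoint (rhom (one P) g) = P.base.J.map g := by
  simp only [unpoint, rhom, val_ofC, P.base.R_id, Category.id_comp, ← P.base.J.map_comp]
  simp

theorem unpoint_dag {X Y : C} (f : robj (one P) X ⟶ robj (one P) Y) :
    unpoint (dag f) = dag (unpoint f) := by
  simp only [unpoint, val_dag, dag_comp, P.dag_J, IsUnitaryTensorCategory.dag_leftUnitor_inv,
    IsUnitaryTensorCategory.dag_leftUnitor_hom, Category.assoc]

theorem unpoint_R (W : C) {X Y : C} (f : robj (one P) X ⟶ robj (one P) Y) :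
    unpoint ((rassoc (one P) X W).hom ≫ rmap f W ≫ (rassoc (one P) Y W).inv) =
      P.base.R W (unpoint f) := by
  simp only [unpoint, val_comp, rassoc, ofIso_hom, ofIso_inv, val_ofC, val_rmap, P.base.R_id,
    Category.id_comp, P.base.R_comp, P.base.R_map, Category.assoc, P.base.J_map_comp,
    ← P.base.J.map_comp]
  simp

variable (P) in
/-- The isomorphism `J 1 ⊗ (W ⊗ X) ≅ W ⊗ (J 1 ⊗ X)`. -/
def oneIso (W X : C) : robj (one P) (W ⊗ X) ≅ lobj W (robj (one P) X) :=
  ofIso (λ_ (W ⊗ X) ≪≫ whiskerLeftIso W (λ_ X).symm)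
    (by rw [robj_one_p, lobj_robj_one_p, Category.id_comp, Category.comp_id])

theorem leftIso_cyclicBimodule (W X : C) : (cyclicBimodule P).leftIso W X = oneIso P W X := by
  apply Iso.ext
  change (rassoc (one P) W X).hom ≫ rmap (braid P W).hom X ≫ (middle W (one P) X).hom = _
  simp only [braid, rassoc, middle, oneIso, ofIso_hom, rmap_ofC, ofC_comp]
  exact ofC_congr (by simp)

theorem unpoint_oneIso (W : C) {X Y : C} (f : robj (one P) X ⟶ robj (one P) Y) :
    unpoint ((oneIso P W X).hom ≫ lmap W f ≫ (oneIso P W Y).inv) = P.base.L W (unpoint f) := by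
  simp only [unpoint, oneIso, ofIso_hom, ofIso_inv, val_comp, val_ofC, val_lmap, P.base.R_id,
    P.base.L_id, Category.id_comp, P.base.L_comp, P.base.L_map, Category.assoc,
    P.base.J_map_comp, ← P.base.J.map_comp]
  simp

theorem unpoint_L (W : C) {X Y : C} (f : robj (one P) X ⟶ robj (one P) Y) :
    unpoint (((cyclicBimodule P).leftIso W X).hom ≫ lmap W f ≫
      ((cyclicBimodule P).leftIso W Y).inv) = P.base.L W (unpoint f) :=
  (congrArg₂ (fun i j => unpoint (Iso.hom i ≫ lmap W f ≫ Iso.inv j))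
    (leftIso_cyclicBimodule W X) (leftIso_cyclicBimodule W Y)).trans (unpoint_oneIso W f)

end SubFree

namespace FreeCStarBimod

/-- A functor of C*-categories of free bimodules which is bijective on morphisms is an
isomorphism. -/
def isoOfInverse {P Q : FreeCStarBimod C} (Φ : P ⟶ Q)
    (e : ∀ {X Y : C}, (Q.base.J.obj X ⟶ Q.base.J.obj Y) → (P.base.J.obj X ⟶ P.base.J.obj Y))
    (h : ∀ {X Y : C} (f : Q.base.J.obj X ⟶ Q.base.J.obj Y), Φ.base.map (e f) = f)
    (h' : ∀ {X Y : C} (f : P.base.J.obj X ⟶ P.base.J.obj Y), e (Φ.base.map f) = f) : P ≅ Q where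
  hom := Φ
  inv :=
    { base :=
        { map := e
          map_add := fun f g => by
            rw [← h' (e f + e g), Φ.base.map_add, h, h]
          map_smul := fun c f => by rw [← h' (c • e f), Φ.base.map_smul, h]
          map_comp := fun f g => by rw [← h' (e f ≫ e g), Φ.base.map_comp, h, h]
          map_J := fun f => by rw [← Φ.base.map_J, h']
          map_R := fun W _ _ f => by rw [← h' (P.base.R W (e f)), Φ.base.map_R, h]
          map_L := fun W _ _ f => by rw [← h' (P.base.L W (e f)), Φ.base.map_L, h] }
      map_dag := fun f => by
        change e (dag f) = dag (e f)
        rw [← h' (dag (e f)), Φ.map_dag, h] }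
  hom_inv_id := by
    apply Hom.ext
    apply FreeBimod.Hom.ext
    funext X Y f
    exact h' f
  inv_hom_id := by
    apply Hom.ext
    apply FreeBimod.Hom.ext
    funext X Y f
    exact h f

/-- A C*-category of free bimodules is recovered from its cyclic bimodule category. -/
def toFreeIso (P : FreeCStarBimod C) :
    (SubFree.cyclicBimodule P).freeCStarBimod ≅ P :=
  isoOfInverse
    { base :=
        { map := fun f => SubFree.unpoint f
          map_add := fun f g => SubFree.unpoint_add f g
          map_smul := fun c f => SubFree.unpoint_smul c f
          map_comp := fun f g => SubFree.unpoint_comp f g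
          map_J := fun f => SubFree.unpoint_rhom f
          map_R := fun W _ _ f => SubFree.unpoint_R W f
          map_L := fun W _ _ f => SubFree.unpoint_L W f }
      map_dag := fun f => SubFree.unpoint_dag f }
    (fun g => SubFree.point g) (fun g => SubFree.unpoint_point g)
    (fun f => SubFree.point_unpoint f)

end FreeCStarBimod

namespace CentrallyCyclicBimodule

instance : (toFree C).EssSurj where
  mem_essImage P := ⟨SubFree.cyclicBimodule P, ⟨FreeCStarBimod.toFreeIso P⟩⟩

instance : (toFree C).IsEquivalence where

end CentrallyCyclicBimodule

end KaroubiBimodule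

theorem mainTheorem11 (C : Type u) [SmallCategory C] [Preadditive C] [Linear ℂ C]
    [DaggerCategory C] [MonoidalCategory C] [MonoidalPreadditive C] [MonoidalLinear ℂ C]
    [IsUnitaryTensorCategory C] :
    Nonempty (CentrallyCyclicBimodule C ≌ YetterDrinfeldAlgebra C) :=
  ⟨(CentrallyCyclicBimodule.toFree C).asEquivalence.trans (FreeCStarBimod.toYD C).asEquivalence⟩
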